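/- Let $A$ be a finite-dimensional $\mathbb Z/2$-graded real associative algebra (a unit is not required) with an odd differential $d$ ($d^2=0$, $d(ab)=d(a)b+(-1)^a a\,d(b)$) and a graded-symmetric, even, nondegenerate inner product with $\langle a,bc\rangle=\langle ab,c\rangle$ and $\langle da,b\rangle=-(-1)^a\langle a,db\rangle$ (a differential graded Frobenius algebra). Let $s$ (odd) and $\pi$ (even) be an abstract Hodge decomposition: $ds+sd=\mathrm{id}-\pi$, $s^2=0$, $\pi^2=\pi$, $d\pi=\pi d=0$, $\pi s=s\pi=0$, $\langle sa,b\rangle=(-1)^a\langle a,sb\rangle$, $\langle \pi a,b\rangle=\langle a,\pi b\rangle$. Put $\Delta=ds+sd$, $K_t=(e^{-t\Delta}\otimes\mathrm{id})[\langle-,-\rangle^{-1}]\in A^{\otimes2}$ and $\alpha=K_t+(s\otimes\mathrm{id})[K_t]\,dt$. **Graphs.** A stable ribbon graph $\gamma$ is a connected graph given by a finite set of half-edges with a partition into pairs (edges) and a partition into vertices, each vertex $v$ being decorated by a homeomorphism type of connected compact oriented surfaces $S_v$ with nonempty boundary, in which the half-edges at $v$ are embedded as disjoint intervals; that is, by a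 genus $\lambda_v$, a partition of the half-edges at $v$ into cyclically ordered boundary circles, and a number of further boundary circles, $\nu_v\ge1$ circles in all. Stability $2(2\lambda_v+\nu_v-1)+|v|-2>0$ is required. (The graph with one vertex and no half-edges is allowed.) Edges are black, or white (infinite length). $\gamma$ has type $(g,n)$ if the surface obtained by gluing strips along all edges to the $S_v$ has genus $g$ and $n$ boundary circles. It is an ordinary ribbon graph if all $S_v$ are disks and all edges are black. $\gamma/e$ is obtained by gluing a strip along the ends of $e$ and deleting $e$; $e\backslash\gamma$ by making $e$ white. **Orbi-cellular forms.** An orbi-cellular form on $\mathcal L_{g,n}$ assigns to every stable ribbon graph $\gamma$ of type $(g,n)$ with black edges a smooth form $\omega_\gamma$ on $\mathbb R_{\ge0}^{E(\gamma)}$, invariant under isomorphisms, with $i_{\gamma,e}^*\omega_\gamma=\omega_{\gamma/e}$ for every edge or loop $e$, where $i_{\gamma,e}$ is the zero-section. On $\mathcal L^\infty_{g,n}$ it assigns to every $\gamma$ of type $(g,n)$ with black and white edges a smooth form on $[0,\infty]^{E_{\mathrm{Black}}(\gamma)}$ (with $[0,\infty]\cong[0,1]$ via $x\mapsto\frac1{1-x}-1$),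 invariant under isomorphisms, with $i_{\gamma,e}^*\omega_\gamma=\omega_{\gamma/e}$ and $i_{e,\gamma}^*\omega_\gamma=\omega_{e\backslash\gamma}$ for every black $e$, where $i_{e,\gamma}$ is the $\infty$-section. On $[\mathcal M_{g,n}\times\mathbb R_+^n]/\mathbb S_n$ it assigns to every ordinary ribbon graph $\gamma$ of type $(g,n)$ a smooth form on the set of $\ell\in\mathbb R_{\ge0}^{E(\gamma)}$ whose edges of length zero form a forest, invariant under isomorphisms, with $i_{\gamma,e}^*\omega_\gamma=\omega_{\gamma/e}$ for every edge $e$ that is not a loop. It is closed if all $d\omega_\gamma=0$. **Theorem.** 1. There is exactly one open topological field theory with values in $A$ which assigns $\langle ab,c\rangle$ to the disk with three boundary intervals. Here such a theory assigns to every stable surface (as above) with boundary intervals labelled by a finite set $I$ an even $d$-closed tensor in $(A^*)^{\otimes I}$, naturally in $I$ (with Koszul signs), so that gluing two intervals of one surface or of two surfaces corresponds to contraction with $\langle-,-\rangle^{-1}$. To the disk with $m$ intervals in cyclic order it assigns $t_m(a_1,\dots,a_m)=\langle a_1\cdots a_{m-1},a_m\rangle$. Denote by $t_v$ the tensor it assigns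 to $S_v$. 2. $\lim_{t\to\infty}e^{-t\Delta}=\pi$, so that $\lim_{t\to\infty}K_t=(\pi\otimes\mathrm{id})[\langle-,-\rangle^{-1}]$. 3. For all $g,n$: - (Costello's form.) The forms $\omega_\gamma$ obtained by applying $\bigotimes_v t_{|v|}$ to the product over the edges of copies of $\alpha$ define a closed orbi-cellular form on $[\mathcal M_{g,n}\times\mathbb R_+^n]/\mathbb S_n$. - It extends to the closed orbi-cellular form $\omega$ on $\mathcal L_{g,n}$ for which $\omega_\gamma$ is obtained by applying $\bigotimes_v t_v$ to the product over the edges of copies of $\alpha$. - $\omega$ extends further to a closed orbi-cellular form on $\mathcal L^\infty_{g,n}$; on the points with finite lengths on black edges its value on a graph with black and white edges is obtained by applying $\bigotimes_v t_v$ to the product of $\alpha$ for every black edge and $(\pi\otimes\mathrm{id})[\langle-,-\rangle^{-1}]$ for every white edge. None of these forms depends on the choices in its construction (the orders of the vertices, of the half-edges at each vertex and of the edges, and the order of the two ends of each edge; for ordinary ribbon graphs and $t_{|v|}$, the order at a vertex is one compatible with the cyclic order). -/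

import Mathlib

open scoped ContDiff Classical
open Equiv

noncomputable section

/-- The number of cycles of a permutation, fixed points included. -/
def numCycles {I : Type} (σ : Perm I) : ℕ :=
  Nat.card (Quotient (Perm.SameCycle.setoid σ))

theorem numCycles_congr {I J : Type} (e : I ≃ J) (σ : Perm I) (τ : Perm J)
    (h : ∀ x, e (σ x) = τ (e x)) : numCycles σ = numCycles τ := by
  have hτ : τ = (e.symm.trans σ).trans e := by
    ext y; simp [h]
  have key : ∀ x y, σ.SameCycle x y ↔ τ.SameCycle (e x) (e y) := by
    intro x y
    have hz : ∀ n : ℕ, ∀ x, (τ ^ n) (e x) = e ((σ ^ n) x) := by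
      intro n
      induction n with
      | zero => intro x; simp
      | succ n ih => intro x; rw [pow_succ, pow_succ, Perm.mul_apply, Perm.mul_apply, ← h, ih]
    have hz' : ∀ n : ℤ, ∀ x, (τ ^ n) (e x) = e ((σ ^ n) x) := by
      intro n
      obtain ⟨n, rfl | rfl⟩ := n.eq_nat_or_neg
      · intro x; simpa using hz n x
      · intro x
        rw [zpow_neg, zpow_neg, Perm.inv_eq_iff_eq, zpow_natCast, zpow_natCast, hz]
        simp
    constructor
    · rintro ⟨n, hn⟩; exact ⟨n, by rw [hz', hn]⟩
    · rintro ⟨n, hn⟩; exact ⟨n, e.injective (by rw [← hz', hn])⟩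
  exact Nat.card_congr (Quotient.congr e key)

theorem sameCycle_of_step {I : Type} (σ : Perm I) (r : Setoid I) (h : ∀ x, r (σ x) x)
    {x y : I} (hxy : σ.SameCycle x y) : r x y := by
  have hz : ∀ n : ℕ, ∀ x, r ((σ ^ n) x) x := by
    intro n
    induction n with
    | zero => intro x; exact r.refl x
    | succ n ih => intro x; rw [pow_succ, Perm.mul_apply]; exact r.trans (ih _) (h x)
  obtain ⟨n, rfl⟩ := hxy
  obtain ⟨n, rfl | rfl⟩ := n.eq_nat_or_neg
  · exact r.symm (by simpa using hz n x)
  · have := hz n ((σ ^ (-(n : ℤ))) x)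
    rw [← zpow_natCast, ← Perm.mul_apply, ← zpow_add] at this
    simpa using this

theorem pow_mul_swap {I : Type} (σ : Perm I) {a b : I} (k : ℕ)
    (hk : ∀ i, 0 < i → i < k → (σ ^ i) b ≠ a ∧ (σ ^ i) b ≠ b) :
    ∀ i, 0 < i → i ≤ k → ((σ * swap a b) ^ i) a = (σ ^ i) b := by
  intro i
  induction i with
  | zero => intro h; omega
  | succ i ih =>
    intro _ hi
    rcases Nat.eq_zero_or_pos i with rfl | h0
    · simp
    · rw [pow_succ', Perm.mul_apply, ih h0 (by omega), pow_succ', Perm.mul_apply, Perm.mul_apply,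
        swap_apply_of_ne_of_ne (hk i h0 (by omega)).1 (hk i h0 (by omega)).2]

theorem sameCycle_mul_swap {I : Type} [Finite I] (σ : Perm I) {a b : I}
    (h : ¬ σ.SameCycle a b) : (σ * swap a b).SameCycle a b := by
  have hex : ∃ k, 0 < k ∧ (σ ^ k) b = b :=
    ⟨orderOf σ, orderOf_pos σ, by simp [pow_orderOf_eq_one]⟩
  have hk := Nat.find_spec hex
  have hmin := fun i (hi : i < Nat.find hex) => Nat.find_min hex hi
  refine ⟨(Nat.find hex : ℤ), ?_⟩
  rw [zpow_natCast, pow_mul_swap σ (Nat.find hex) _ _ hk.1 le_rfl, hk.2]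
  intro i h0 hi
  refine ⟨fun hc => h ?_, fun hc => hmin i hi ⟨h0, hc⟩⟩
  exact Perm.SameCycle.symm ⟨i, by simpa using hc⟩

theorem not_sameCycle_mul_swap {I : Type} [Finite I] (σ : Perm I) {a b : I} (hne : a ≠ b)
    (h : σ.SameCycle a b) : ¬ (σ * swap a b).SameCycle a b := by
  have hex : ∃ k : ℕ, (σ ^ k) b = a := by
    obtain ⟨n, -, hn⟩ := h.symm.exists_pow_eq'
    exact ⟨n, hn⟩
  set k := Nat.find hex with hkdef
  have hk : (σ ^ k) b = a := Nat.find_spec hex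
  have hmin := fun i (hi : i < k) => Nat.find_min hex hi
  have hk0 : 0 < k := by
    rcases Nat.eq_zero_or_pos k with h0 | h0
    · rw [h0] at hk; exact absurd hk.symm hne
    · exact h0
  have hb : ∀ i, 0 < i → i ≤ k → (σ ^ i) b ≠ b := by
    intro i h0 hi hc
    refine hmin (k - i) (by omega) ?_
    have : k = (k - i) + i := by omega
    rw [this, pow_add, Perm.mul_apply, hc] at hk
    exact hk
  have hp := pow_mul_swap σ (a := a) (b := b) k
    (fun i h0 hi => ⟨hmin i hi, hb i h0 hi.le⟩)
  have hper : ((σ * swap a b) ^ k) a = a := by rw [hp k hk0 le_rfl, hk]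
  intro hs
  obtain ⟨n, -, hn⟩ := hs.exists_pow_eq'
  have hmod : ((σ * swap a b) ^ (n % k)) a = b := by
    have h3 : ((σ * swap a b) ^ (n % k + k * (n / k))) a = b := by
      rw [Nat.mod_add_div]; exact hn
    rwa [pow_add, Perm.mul_apply, pow_mul, Perm.pow_apply_eq_self_of_apply_eq_self hper] at h3
  rcases Nat.eq_zero_or_pos (n % k) with h0 | h0
  · rw [h0] at hmod; exact hne hmod
  · have hlt := Nat.mod_lt n hk0
    rw [hp _ h0 hlt.le] at hmod
    exact hb _ h0 hlt.le hmod

theorem numCycles_mul_swap_of_not {I : Type} [Finite I] (σ : Perm I) {a b : I}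
    (h : ¬ σ.SameCycle a b) : numCycles (σ * swap a b) + 1 = numCycles σ := by
  set ρ := σ * swap a b with hρ
  have hab : ρ.SameCycle a b := sameCycle_mul_swap σ h
  have h1 : ∀ x y, σ.SameCycle x y → ρ.SameCycle x y := by
    intro x y hxy
    refine sameCycle_of_step σ (Perm.SameCycle.setoid ρ) ?_ hxy
    intro x
    show ρ.SameCycle (σ x) x
    by_cases hxa : x = a
    · subst hxa
      have : σ x = ρ b := by simp [hρ]
      rw [this]
      exact (Perm.sameCycle_apply_left.2 (Perm.SameCycle.refl ρ b)).trans hab.symm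
    · by_cases hxb : x = b
      · subst hxb
        have : σ x = ρ a := by simp [hρ]
        rw [this]
        exact (Perm.sameCycle_apply_left.2 (Perm.SameCycle.refl ρ a)).trans hab
      · have : σ x = ρ x := by simp [hρ, swap_apply_of_ne_of_ne hxa hxb]
        rw [this]
        exact Perm.sameCycle_apply_left.2 (Perm.SameCycle.refl ρ x)
  let U : I → Prop := fun x => σ.SameCycle a x ∨ σ.SameCycle b x
  have hU : ∀ x y, σ.SameCycle x y → U x → U y := by
    rintro x y hxy (hx | hx)
    · exact Or.inl (hx.trans hxy)
    · exact Or.inr (hx.trans hxy)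
  let r : Setoid I :=
    { r := fun x y => σ.SameCycle x y ∨ (U x ∧ U y)
      iseqv :=
        { refl := fun x => Or.inl (Perm.SameCycle.refl σ x)
          symm := by
            rintro x y (hxy | hxy)
            · exact Or.inl hxy.symm
            · exact Or.inr hxy.symm
          trans := by
            rintro x y z (hxy | hxy) (hyz | hyz)
            · exact Or.inl (hxy.trans hyz)
            · exact Or.inr ⟨hU _ _ hxy.symm hyz.1, hyz.2⟩
            · exact Or.inr ⟨hxy.1, hU _ _ hyz hxy.2⟩
            · exact Or.inr ⟨hxy.1, hyz.2⟩ } }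
  have h2 : ∀ x y, ρ.SameCycle x y → σ.SameCycle x y ∨ (U x ∧ U y) := by
    intro x y hxy
    refine sameCycle_of_step ρ r ?_ hxy
    intro x
    show σ.SameCycle (ρ x) x ∨ (U (ρ x) ∧ U x)
    by_cases hxa : x = a
    · subst hxa
      refine Or.inr ⟨Or.inr ?_, Or.inl (Perm.SameCycle.refl _ _)⟩
      simpa [hρ, Perm.sameCycle_apply_right] using Perm.SameCycle.refl _ _
    · by_cases hxb : x = b
      · subst hxb
        refine Or.inr ⟨Or.inl ?_, Or.inr (Perm.SameCycle.refl _ _)⟩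
        have : ρ x = σ a := by simp [hρ]
        rw [this, Perm.sameCycle_apply_right]
      · left
        simpa [hρ, swap_apply_of_ne_of_ne hxa hxb, Perm.sameCycle_apply_left] using
          Perm.SameCycle.refl _ _
  let Q := Quotient (Perm.SameCycle.setoid σ)
  let qb : Q := Quotient.mk (Perm.SameCycle.setoid σ) b
  let f : {q : Q // q ≠ qb} → Quotient (Perm.SameCycle.setoid ρ) :=
    fun q => Quotient.map' (s₁ := Perm.SameCycle.setoid σ) (s₂ := Perm.SameCycle.setoid ρ) id
      (fun x y hxy => h1 x y hxy) q.1
  have hf : Function.Bijective f := by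
    constructor
    · rintro ⟨q, hq⟩ ⟨q', hq'⟩ hqq
      induction q using Quotient.inductionOn with | _ x =>
      induction q' using Quotient.inductionOn with | _ y =>
      have hxy : ρ.SameCycle x y := Quotient.exact hqq
      apply Subtype.ext
      apply Quotient.sound
      show σ.SameCycle x y
      have nx : ¬ σ.SameCycle b x := fun hc => hq (Quotient.sound (hc.symm))
      have ny : ¬ σ.SameCycle b y := fun hc => hq' (Quotient.sound (hc.symm))
      rcases h2 x y hxy with hh | ⟨hx, hy⟩
      · exact hh
      · rcases hx with hx | hx
        · rcases hy with hy | hy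
          · exact hx.symm.trans hy
          · exact absurd hy ny
        · exact absurd hx nx
    · intro q
      induction q using Quotient.inductionOn with | _ y =>
      by_cases hy : σ.SameCycle b y
      · refine ⟨⟨Quotient.mk _ a, fun hc => h (Quotient.exact hc)⟩, ?_⟩
        apply Quotient.sound
        exact hab.trans (h1 _ _ hy)
      · exact ⟨⟨Quotient.mk _ y, fun hc => hy (Perm.SameCycle.symm (Quotient.exact hc))⟩, rfl⟩
  have hc : numCycles ρ = Nat.card {q : Q // q ≠ qb} := (Nat.card_congr (Equiv.ofBijective f hf)).symm
  have hc2 : numCycles σ = Nat.card (Option {q : Q // q ≠ qb}) :=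
    (Nat.card_congr (Equiv.optionSubtypeNe qb)).symm
  rw [hc, hc2, Finite.card_option]

theorem numCycles_mul_swap_of_same {I : Type} [Finite I] (σ : Perm I) {a b : I} (hne : a ≠ b)
    (h : σ.SameCycle a b) : numCycles (σ * swap a b) = numCycles σ + 1 := by
  have := numCycles_mul_swap_of_not (σ * swap a b) (not_sameCycle_mul_swap σ hne h)
  rw [mul_assoc, swap_mul_self, mul_one] at this
  exact this.symm

/-- Splitting a point off its cycle. -/
theorem numCycles_split {I : Type} [Finite I] (ρ : Perm I) (a : I) :
    numCycles (swap a (ρ a) * ρ) + (if ρ a = a then 1 else 0) = numCycles ρ + 1 := by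
  by_cases h : ρ a = a
  · simp [h]
    congr 1
  · have e : swap a (ρ a) * ρ = ρ * swap (ρ⁻¹ a) a := by
      rw [Equiv.swap_mul_eq_mul_swap]; simp
    rw [e, numCycles_mul_swap_of_same]
    · simp [h]
    · intro hc
      apply h
      rw [Perm.inv_eq_iff_eq] at hc
      exact hc.symm
    · exact ⟨1, by simp⟩

/-- Removing a fixed point. -/
theorem numCycles_sub {I : Type} [Finite I] (ρ : Perm I) (p : I → Prop)
    (hp : ∀ x, p (ρ x) ↔ p x) (hfix : ∀ x, ¬ p x → ρ x = x) :
    numCycles (ρ.subtypePerm hp) + Nat.card {x // ¬ p x} = numCycles ρ := by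
  have hsame : ∀ x y, ¬ p x → ρ.SameCycle x y → x = y := by
    rintro x y hx ⟨n, rfl⟩
    exact (Perm.zpow_apply_eq_self_of_apply_eq_self (hfix x hx) n).symm
  let f : Quotient (Perm.SameCycle.setoid (ρ.subtypePerm hp)) ⊕ {x // ¬ p x} →
      Quotient (Perm.SameCycle.setoid ρ) :=
    Sum.elim (Quotient.map' Subtype.val (fun x y hxy => Perm.sameCycle_subtypePerm.1 hxy))
      (fun x => Quotient.mk _ x.1)
  have hf : Function.Bijective f := by
    constructor
    · rintro (q | x) (q' | x') h
      · induction q using Quotient.inductionOn with | _ x =>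
        induction q' using Quotient.inductionOn with | _ y =>
        congr 1
        exact Quotient.sound (Perm.sameCycle_subtypePerm.2 (Quotient.exact h))
      · induction q using Quotient.inductionOn with | _ y =>
        have := hsame _ _ x'.2 (Perm.SameCycle.symm (Quotient.exact h))
        exact absurd (this ▸ y.2) x'.2
      · induction q' using Quotient.inductionOn with | _ y =>
        have := hsame _ _ x.2 (Quotient.exact h)
        exact absurd (this ▸ y.2) x.2
      · congr 1
        exact Subtype.ext (hsame _ _ x.2 (Quotient.exact h))
    · intro q
      induction q using Quotient.inductionOn with | _ y =>
      by_cases hy : p y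
      · exact ⟨Sum.inl (Quotient.mk _ ⟨y, hy⟩), rfl⟩
      · exact ⟨Sum.inr ⟨y, hy⟩, rfl⟩
  rw [numCycles, numCycles, ← Nat.card_congr (Equiv.ofBijective f hf), Nat.card_sum]

theorem numCycles_sumCongr {I J : Type} [Finite I] [Finite J] (σ : Perm I) (τ : Perm J) :
    numCycles (Perm.sumCongr σ τ) = numCycles σ + numCycles τ := by
  have hpow : ∀ n : ℤ, (Perm.sumCongr σ τ) ^ n = Perm.sumCongr (σ ^ n) (τ ^ n) := fun n =>
    ((Perm.sumCongrHom I J).map_zpow (σ, τ) n).symm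
  have hl : ∀ x y, (Perm.sumCongr σ τ).SameCycle (Sum.inl x) (Sum.inl y) ↔ σ.SameCycle x y := by
    intro x y
    exact exists_congr fun n => by rw [hpow]; simp
  have hr : ∀ x y, (Perm.sumCongr σ τ).SameCycle (Sum.inr x) (Sum.inr y) ↔ τ.SameCycle x y := by
    intro x y
    exact exists_congr fun n => by rw [hpow]; simp
  have hlr : ∀ x y, ¬ (Perm.sumCongr σ τ).SameCycle (Sum.inl x) (Sum.inr y) := by
    rintro x y ⟨n, hn⟩
    rw [hpow] at hn
    simp at hn
  let f : Quotient (Perm.SameCycle.setoid σ) ⊕ Quotient (Perm.SameCycle.setoid τ) →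
      Quotient (Perm.SameCycle.setoid (Perm.sumCongr σ τ)) :=
    Sum.elim (Quotient.map' Sum.inl (fun x y hxy => (hl x y).2 hxy))
      (Quotient.map' Sum.inr (fun x y hxy => (hr x y).2 hxy))
  have hf : Function.Bijective f := by
    constructor
    · rintro (q | q) (q' | q') h <;>
      induction q using Quotient.inductionOn with | _ x =>
      induction q' using Quotient.inductionOn with | _ y =>
      first
        | exact congrArg _ (Quotient.sound ((hl x y).1 (Quotient.exact h)))
        | exact congrArg _ (Quotient.sound ((hr x y).1 (Quotient.exact h)))
        | exact absurd (Quotient.exact h) (hlr x y)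
        | exact absurd (Perm.SameCycle.symm (Quotient.exact h)) (hlr y x)
    · intro q
      induction q using Quotient.inductionOn with | _ y =>
      rcases y with y | y
      · exact ⟨Sum.inl (Quotient.mk _ y), rfl⟩
      · exact ⟨Sum.inr (Quotient.mk _ y), rfl⟩
  rw [numCycles, numCycles, numCycles, ← Nat.card_congr (Equiv.ofBijective f hf), Nat.card_sum]

theorem gluePerm_aux {I : Type} (σ : Perm I) (h h' x : I) :
    let ρ := σ * swap h h'
    let ρ₁ := swap h (ρ h) * ρ
    let ρ₂ := swap h' (ρ₁ h') * ρ₁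
    (ρ₂ x ≠ h ∧ ρ₂ x ≠ h') ↔ (x ≠ h ∧ x ≠ h') := by
  intro ρ ρ₁ ρ₂
  have e1 : ρ₁ h = h := by simp [ρ₁]
  have e2 : ρ₂ h' = h' := by simp [ρ₂]
  have e3 : ρ₂ h = h := by
    by_cases hh : h = h'
    · rw [hh]; exact e2
    · have : ρ₁ h' ≠ h := fun hc => hh (ρ₁.injective (e1.trans hc.symm))
      simp only [ρ₂, Perm.mul_apply, e1]
      exact swap_apply_of_ne_of_ne hh this.symm
  have f : ∀ y, ρ₂ y = y → (ρ₂ x ≠ y ↔ x ≠ y) := fun y hy => by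
    rw [not_iff_not]
    exact ⟨fun hx => ρ₂.injective (hx.trans hy.symm), fun hx => hx ▸ hy⟩
  rw [f h e3, f h' e2]

/-- The boundary permutation after a strip is glued along the intervals `h` and `h'`:  `σ` records,
for every interval in the boundary, the interval that follows it on the same boundary circle; a
boundary walk that reaches `h` continues, along the side of the strip, with the successor of `h'`,
and vice versa. So one takes `σ * swap h h'` and removes `h` and `h'` from their cycles. -/
def gluePerm {I : Type} (σ : Perm I) (h h' : I) : Perm {x // x ≠ h ∧ x ≠ h'} :=
  let ρ := σ * swap h h'
  let ρ₁ := swap h (ρ h) * ρ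
  let ρ₂ := swap h' (ρ₁ h') * ρ₁
  ρ₂.subtypePerm (p := fun x => x ≠ h ∧ x ≠ h') (gluePerm_aux σ h h')

/-- The number of boundary circles without intervals that arise when a strip is glued along the
intervals `h ≠ h'`, that is the number of cycles of `σ * swap h h'` contained in `{h, h'}`. -/
def glueFree {I : Type} (σ : Perm I) (h h' : I) : ℕ :=
  (if σ h = h ∧ σ h' = h' then 1 else 0) + (if σ h' = h then 1 else 0) + (if σ h = h' then 1 else 0)

theorem gluePerm_val {I : Type} (σ : Perm I) {h h' : I} (hne : h ≠ h')
    (x : {x // x ≠ h ∧ x ≠ h'}) :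
    (gluePerm σ h h' x : I) =
      if σ x = h then (if σ h' = h' then σ h else σ h')
      else if σ x = h' then (if σ h = h then σ h' else σ h) else σ x := by
  obtain ⟨x, hx, hx'⟩ := x
  have i1 : σ x ≠ σ h := fun hc => hx (σ.injective hc)
  have i2 : σ x ≠ σ h' := fun hc => hx' (σ.injective hc)
  have i3 : σ h ≠ σ h' := fun hc => hne (σ.injective hc)
  simp only [gluePerm, Perm.subtypePerm_apply, Perm.mul_apply, swap_apply_left, swap_apply_right,
    swap_apply_of_ne_of_ne hx hx']
  simp only [swap_apply_def]
  split_ifs <;> grind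

theorem numCycles_glue {I : Type} [Finite I] (σ : Perm I) {h h' : I} (hne : h ≠ h') :
    numCycles (gluePerm σ h h') + glueFree σ h h' = numCycles (σ * swap h h') := by
  set ρ := σ * swap h h' with hρ
  set ρ₁ := swap h (ρ h) * ρ with hρ₁
  have s1 := numCycles_split ρ h
  have s2 := numCycles_split ρ₁ h'
  have e1 : ρ₁ h = h := by simp [ρ₁]
  have e2 : (swap h' (ρ₁ h') * ρ₁) h' = h' := by simp
  have e3 : (swap h' (ρ₁ h') * ρ₁) h = h := by
    have : ρ₁ h' ≠ h := fun hc => hne (ρ₁.injective (e1.trans hc.symm))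
    rw [Perm.mul_apply, e1]
    exact swap_apply_of_ne_of_ne hne this.symm
  have hcard : Nat.card {x : I // ¬ (x ≠ h ∧ x ≠ h')} = 2 := by
    have : {x : I | ¬ (x ≠ h ∧ x ≠ h')} = {h, h'} := by
      ext x; simp; tauto
    have h2 := Set.ncard_pair hne
    rw [← this] at h2
    exact h2
  have s3 := numCycles_sub (swap h' (ρ₁ h') * ρ₁) (fun x => x ≠ h ∧ x ≠ h')
    (gluePerm_aux σ h h') (by
      intro x hx
      have : x = h ∨ x = h' := by tauto
      rcases this with rfl | rfl
      · exact e3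
      · exact e2)
  rw [hcard] at s3
  have s4 : numCycles (gluePerm σ h h') + 2 = numCycles (swap h' (ρ₁ h') * ρ₁) := s3
  have s5 : glueFree σ h h' = (if ρ h = h then 1 else 0) + (if ρ₁ h' = h' then 1 else 0) := by
    have a1 : ρ h = σ h' := by simp [ρ]
    have a2 : ρ h' = σ h := by simp [ρ]
    have i3 : σ h ≠ σ h' := fun hc => hne (σ.injective hc)
    have a3 : ρ₁ h' = swap h (σ h') (σ h) := by rw [hρ₁, Perm.mul_apply, a1, a2]
    rw [glueFree, a3, a1, swap_apply_def]
    split_ifs <;> grind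
  rw [← hρ₁] at s1
  split_ifs at s1 s2 s5 <;> omega

theorem numCycles_pos {I : Type} [Finite I] (σ : Perm I) (x : I) : 0 < numCycles σ :=
  haveI : Nonempty (Quotient (Perm.SameCycle.setoid σ)) := ⟨Quotient.mk _ x⟩
  Nat.card_pos

theorem card_glue {I : Type} [Finite I] {h h' : I} (hne : h ≠ h') :
    Nat.card {x : I // x ≠ h ∧ x ≠ h'} + 2 = Nat.card I := by
  have h1 : {x : I | x ≠ h ∧ x ≠ h'}ᶜ = {h, h'} := by ext x; simp; tauto
  have h2 := Set.ncard_add_ncard_compl {x : I | x ≠ h ∧ x ≠ h'}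
  rw [h1, Set.ncard_pair hne] at h2
  exact h2

/-- A connected compact oriented surface of genus `γ` whose boundary consists of the circles that
are the cycles of `σ` (the intervals embedded in the boundary, in their cyclic order) and of `b`
further circles without intervals has nonempty boundary and is stable: `2 * g + n - 2 > 0`, where
`n` is the number of intervals and `g = 2 * γ + ν - 1`, with `ν` the number of all boundary
circles. -/
def IsStableSurface {I : Type} (σ : Perm I) (γ b : ℕ) : Prop :=
  0 < numCycles σ + b ∧ 4 < 4 * γ + 2 * (numCycles σ + b) + Nat.card I

theorem IsStableSurface.congr {I J : Type} {σ : Perm I} {γ b : ℕ} (hs : IsStableSurface σ γ b)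
    (e : J ≃ I) (τ : Perm J) (h : ∀ x, e (τ x) = σ (e x)) : IsStableSurface τ γ b := by
  unfold IsStableSurface
  rw [numCycles_congr e τ σ h, Nat.card_congr e]
  exact hs

theorem IsStableSurface.congr' {I J : Type} {σ : Perm I} {γ b : ℕ} (hs : IsStableSurface σ γ b)
    (e : I ≃ J) (τ : Perm J) (h : ∀ x, e (σ x) = τ (e x)) : IsStableSurface τ γ b := by
  unfold IsStableSurface
  rw [← numCycles_congr e σ τ h, ← Nat.card_congr e]
  exact hs

theorem IsStableSurface.selfGlue {I : Type} [Finite I] {σ : Perm I} {γ b : ℕ}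
    (hs : IsStableSurface σ γ b) {h h' : I} (hne : h ≠ h') :
    IsStableSurface (gluePerm σ h h') (if σ.SameCycle h h' then γ else γ + 1)
      (b + glueFree σ h h') := by
  obtain ⟨h1, h2⟩ := hs
  have h3 := numCycles_glue σ hne
  have h4 := card_glue hne
  have h5 := numCycles_pos (σ * swap h h') h
  by_cases hc : σ.SameCycle h h'
  · have h6 := numCycles_mul_swap_of_same σ hne hc
    rw [if_pos hc]
    constructor <;> omega
  · have h6 := numCycles_mul_swap_of_not σ hc
    rw [if_neg hc]
    constructor <;> omega

theorem IsStableSurface.join {I J : Type} [Finite I] [Finite J] {σ : Perm I} {τ : Perm J}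
    {γ γ' b b' : ℕ} (hs : IsStableSurface σ γ b) (hs' : IsStableSurface τ γ' b') (h : I) (h' : J) :
    IsStableSurface (gluePerm (Perm.sumCongr σ τ) (Sum.inl h) (Sum.inr h')) (γ + γ')
      (b + b' + glueFree (Perm.sumCongr σ τ) (Sum.inl h) (Sum.inr h')) := by
  obtain ⟨h1, h2⟩ := hs
  obtain ⟨h1', h2'⟩ := hs'
  have hne : (Sum.inl h : I ⊕ J) ≠ Sum.inr h' := Sum.inl_ne_inr
  have hc : ¬ (Perm.sumCongr σ τ).SameCycle (Sum.inl h) (Sum.inr h') := by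
    rintro ⟨n, hn⟩
    have hpow : (Perm.sumCongr σ τ) ^ n = Perm.sumCongr (σ ^ n) (τ ^ n) :=
      ((Perm.sumCongrHom I J).map_zpow (σ, τ) n).symm
    rw [hpow] at hn
    simp at hn
  have h3 := numCycles_glue (Perm.sumCongr σ τ) hne
  have h4 := card_glue hne
  have h5 := numCycles_pos (Perm.sumCongr σ τ * swap (Sum.inl h) (Sum.inr h')) (Sum.inl h)
  have h6 := numCycles_mul_swap_of_not _ hc
  have h7 := numCycles_sumCongr σ τ
  rw [Nat.card_sum] at h4
  constructor <;> omega

/-- A homeomorphism type of connected compact oriented surfaces with nonempty boundary and with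
disjoint oriented intervals, labelled by `I`, embedded in the boundary. By the classification of
surfaces it is given by the genus, the partition of the intervals into boundary circles together
with their cyclic order on each circle (the permutation `cyc` sends an interval to the next one on
its boundary circle), and the number `free` of boundary circles without intervals. -/
@[ext] structure Surface (I : Type) where
  cyc : Perm I
  genus : ℕ
  free : ℕ
  stable : IsStableSurface cyc genus free

namespace Surface

/-- The surface is a disk. -/
def IsDisk {I : Type} (S : Surface I) : Prop :=
  S.genus = 0 ∧ S.free = 0 ∧ numCycles S.cyc = 1

/-- The effect of relabelling the intervals. -/
def relabel {I J : Type} (S : Surface I) (e : I ≃ J) : Surface J where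
  cyc := e.permCongr S.cyc
  genus := S.genus
  free := S.free
  stable := S.stable.congr e.symm _ (fun x => by simp)

/-- Gluing two intervals `h ≠ h'` of the same surface. If they lie on the same boundary circle,
this circle is cut into two and the genus is unchanged; otherwise two circles become one and the
genus increases by one. -/
def selfGlue {I : Type} [Finite I] (S : Surface I) (h h' : I) (hne : h ≠ h') :
    Surface {x // x ≠ h ∧ x ≠ h'} where
  cyc := gluePerm S.cyc h h'
  genus := if S.cyc.SameCycle h h' then S.genus else S.genus + 1
  free := S.free + glueFree S.cyc h h'
  stable := S.stable.selfGlue hne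

/-- Gluing the interval `h` of one surface to the interval `h'` of another. -/
def join {I J : Type} [Finite I] [Finite J] (S : Surface I) (T : Surface J) (h : I) (h' : J) :
    Surface {x : I ⊕ J // x ≠ Sum.inl h ∧ x ≠ Sum.inr h'} where
  cyc := gluePerm (Perm.sumCongr S.cyc T.cyc) (Sum.inl h) (Sum.inr h')
  genus := S.genus + T.genus
  free := S.free + T.free + glueFree (Perm.sumCongr S.cyc T.cyc) (Sum.inl h) (Sum.inr h')
  stable := S.stable.join T.stable h h'

end Surface

/-- A stable ribbon graph whose edges are coloured black or white. `H`, `E`, `V` are the sets of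
half-edges, edges and vertices; `edge` and `vert` are the two partitions of the half-edges, and
`flip` exchanges the two half-edges of every edge. The surface at a vertex `v` is given by its genus
`genus v`, by the restriction of `cyc` to the half-edges at `v` and by the number `free v` of its
boundary circles that carry no half-edge. (A vertex without half-edges occurs only in a graph
without edges.) -/
structure StableRibbonGraph where
  H : Type
  E : Type
  V : Type
  [fintypeH : Fintype H]
  [fintypeE : Fintype E]
  [fintypeV : Fintype V]
  edge : H → E
  vert : H → V
  flip : Perm H
  flip_ne : ∀ h, flip h ≠ h
  edge_surjective : Function.Surjective edge
  edge_eq_iff : ∀ h h', edge h = edge h' ↔ h' = h ∨ h' = flip h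
  cyc : Perm H
  vert_cyc : ∀ h, vert (cyc h) = vert h
  genus : V → ℕ
  free : V → ℕ
  white : Set E
  stable : ∀ v, IsStableSurface
    (cyc.subtypePerm (p := fun h => vert h = v) (fun h => by rw [vert_cyc])) (genus v) (free v)
  nonempty : Nonempty V
  connected : ∀ v w, Relation.ReflTransGen (fun a b => ∃ h, vert h = a ∧ vert (flip h) = b) v w

namespace StableRibbonGraph

attribute [instance] StableRibbonGraph.fintypeH StableRibbonGraph.fintypeE
  StableRibbonGraph.fintypeV

theorem edge_flip (γ : StableRibbonGraph) (h : γ.H) : γ.edge (γ.flip h) = γ.edge h :=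
  ((γ.edge_eq_iff h (γ.flip h)).2 (Or.inr rfl)).symm

theorem flip_flip (γ : StableRibbonGraph) (h : γ.H) : γ.flip (γ.flip h) = h := by
  rcases (γ.edge_eq_iff (γ.flip h) h).1 (γ.edge_flip h) with h1 | h1
  · exact absurd h1.symm (γ.flip_ne h)
  · exact h1.symm

theorem edge_ne_iff (γ : StableRibbonGraph) (h x : γ.H) :
    γ.edge x ≠ γ.edge h ↔ x ≠ h ∧ x ≠ γ.flip h := by
  rw [← not_or, not_iff_not, eq_comm, γ.edge_eq_iff]

/-- The surface that decorates the vertex `v`. -/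
def surface (γ : StableRibbonGraph) (v : γ.V) : Surface {h : γ.H // γ.vert h = v} where
  cyc := γ.cyc.subtypePerm (p := fun h => γ.vert h = v) (fun h => by rw [γ.vert_cyc])
  genus := γ.genus v
  free := γ.free v
  stable := γ.stable v

/-- The edge of the half-edge `h` joins a vertex to itself. -/
def IsLoop (γ : StableRibbonGraph) (h : γ.H) : Prop := γ.vert h = γ.vert (γ.flip h)

theorem glue_stable_away (γ : StableRibbonGraph) (h : γ.H) (w : γ.V) (h1 : w ≠ γ.vert h)
    (h2 : w ≠ γ.vert (γ.flip h)) (P : {x // x ≠ h ∧ x ≠ γ.flip h} → Prop)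
    (hP : ∀ x, P x ↔ γ.vert x = w) (hg : ∀ x, P (gluePerm γ.cyc h (γ.flip h) x) ↔ P x) :
    IsStableSurface ((gluePerm γ.cyc h (γ.flip h)).subtypePerm hg) (γ.genus w) (γ.free w) := by
  refine (γ.stable w).congr
    { toFun := fun x => ⟨x.1.1, (hP _).1 x.2⟩
      invFun := fun x => ⟨⟨x.1, fun hc => h1 (by rw [← x.2, hc]), fun hc => h2 (by rw [← x.2, hc])⟩,
        (hP _).2 x.2⟩
      left_inv := fun x => rfl
      right_inv := fun x => rfl } _ ?_
  rintro ⟨x, hx⟩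
  apply Subtype.ext
  have hw := (hP _).1 hx
  have a1 : γ.cyc x ≠ h := fun hc => h1 (by rw [← hw, ← γ.vert_cyc, hc])
  have a2 : γ.cyc x ≠ γ.flip h := fun hc => h2 (by rw [← hw, ← γ.vert_cyc, hc])
  simp [gluePerm_val _ (γ.flip_ne h).symm, a1, a2]

theorem glue_stable_loop (γ : StableRibbonGraph) (h : γ.H) (hl : γ.IsLoop h)
    (P : {x // x ≠ h ∧ x ≠ γ.flip h} → Prop)
    (hP : ∀ x, P x ↔ γ.vert x = γ.vert h)
    (hg : ∀ x, P (gluePerm γ.cyc h (γ.flip h) x) ↔ P x) :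
    IsStableSurface ((gluePerm γ.cyc h (γ.flip h)).subtypePerm hg)
      (if γ.cyc.SameCycle h (γ.flip h) then γ.genus (γ.vert h) else γ.genus (γ.vert h) + 1)
      (γ.free (γ.vert h) + glueFree γ.cyc h (γ.flip h)) := by
  have hne := (γ.flip_ne h).symm
  set a : {x // γ.vert x = γ.vert h} := ⟨h, rfl⟩ with ha
  set b : {x // γ.vert x = γ.vert h} := ⟨γ.flip h, hl.symm⟩ with hb
  have hab : a ≠ b := fun hc => hne (congrArg Subtype.val hc)
  have hs : IsStableSurface (gluePerm (γ.surface (γ.vert h)).cyc a b)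
      (if (γ.surface (γ.vert h)).cyc.SameCycle a b then γ.genus (γ.vert h)
        else γ.genus (γ.vert h) + 1)
      (γ.free (γ.vert h) + glueFree (γ.surface (γ.vert h)).cyc a b) := by
    convert (γ.stable (γ.vert h)).selfGlue hab <;> rfl
  have e1 : ((γ.surface (γ.vert h)).cyc.SameCycle a b) = γ.cyc.SameCycle h (γ.flip h) :=
    propext (Perm.sameCycle_subtypePerm (h := fun x => by rw [γ.vert_cyc]))
  have e2 : glueFree (γ.surface (γ.vert h)).cyc a b = glueFree γ.cyc h (γ.flip h) := by
    simp [glueFree, surface, a, b, Subtype.ext_iff]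
  have e3 : (if γ.cyc.SameCycle h (γ.flip h) then γ.genus (γ.vert h) else γ.genus (γ.vert h) + 1) =
      if (γ.surface (γ.vert h)).cyc.SameCycle a b then γ.genus (γ.vert h)
        else γ.genus (γ.vert h) + 1 := if_congr (Iff.of_eq e1.symm) rfl rfl
  rw [← e2, e3]
  let e : {x // P x} ≃ {x : {x // γ.vert x = γ.vert h} // x ≠ a ∧ x ≠ b} :=
    { toFun := fun x => ⟨⟨x.1.1, (hP _).1 x.2⟩,
        fun hc => x.1.2.1 (congrArg Subtype.val hc), fun hc => x.1.2.2 (congrArg Subtype.val hc)⟩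
      invFun := fun x => ⟨⟨x.1.1, fun hc => x.2.1 (Subtype.ext hc),
        fun hc => x.2.2 (Subtype.ext hc)⟩, (hP _).2 x.1.2⟩
      left_inv := fun x => rfl
      right_inv := fun x => rfl }
  refine hs.congr e _ ?_
  rintro ⟨x, hx⟩
  apply Subtype.ext
  apply Subtype.ext
  rw [gluePerm_val _ hab]
  simp only [e, surface, Equiv.coe_fn_mk, Perm.subtypePerm_apply, gluePerm_val _ hne, Subtype.ext_iff, a, b]
  split_ifs <;> rfl

theorem glue_stable_join (γ : StableRibbonGraph) (h : γ.H) (hl : ¬ γ.IsLoop h)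
    (P : {x // x ≠ h ∧ x ≠ γ.flip h} → Prop)
    (hP : ∀ x, P x ↔ γ.vert x = γ.vert h ∨ γ.vert x = γ.vert (γ.flip h))
    (hg : ∀ x, P (gluePerm γ.cyc h (γ.flip h) x) ↔ P x) :
    IsStableSurface ((gluePerm γ.cyc h (γ.flip h)).subtypePerm hg)
      (γ.genus (γ.vert h) + γ.genus (γ.vert (γ.flip h)))
      (γ.free (γ.vert h) + γ.free (γ.vert (γ.flip h)) + glueFree γ.cyc h (γ.flip h)) := by
  have hne := (γ.flip_ne h).symm
  set a : {x // γ.vert x = γ.vert h} := ⟨h, rfl⟩ with ha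
  set b : {x // γ.vert x = γ.vert (γ.flip h)} := ⟨γ.flip h, rfl⟩ with hb
  have hs := (γ.stable (γ.vert h)).join (γ.stable (γ.vert (γ.flip h))) a b
  have e2 : glueFree (Perm.sumCongr (γ.surface (γ.vert h)).cyc (γ.surface (γ.vert (γ.flip h))).cyc)
      (Sum.inl a) (Sum.inr b) = glueFree γ.cyc h (γ.flip h) := by
    have a1 : γ.cyc h ≠ γ.flip h := fun hc => hl (by rw [IsLoop, ← hc, γ.vert_cyc])
    have a2 : γ.cyc (γ.flip h) ≠ h := fun hc => hl (by
      have := γ.vert_cyc (γ.flip h); rw [hc] at this; exact this)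
    simp [glueFree, surface, a, b, Subtype.ext_iff, a1, a2]
  rw [← e2]
  have hout : ∀ x, γ.vert x = γ.vert h → γ.vert x ≠ γ.vert (γ.flip h) := fun x h1 h2 =>
    hl (h1.symm.trans h2)
  let f : {x : {x // γ.vert x = γ.vert h} ⊕ {x // γ.vert x = γ.vert (γ.flip h)} //
      x ≠ Sum.inl a ∧ x ≠ Sum.inr b} → {x // P x} := fun x =>
    ⟨⟨Sum.elim Subtype.val Subtype.val x.1, by
      rcases x with ⟨x | x, hx, hx'⟩
      · exact ⟨fun hc => hx (congrArg Sum.inl (Subtype.ext hc)),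
          fun hc => hout x.1 x.2 (by rw [show x.1 = γ.flip h from hc])⟩
      · exact ⟨fun hc => hout h rfl (by rw [← x.2, show x.1 = h from hc]),
          fun hc => hx' (congrArg Sum.inr (Subtype.ext hc))⟩⟩, by
      rcases x with ⟨x | x, hx, hx'⟩
      · exact (hP _).2 (Or.inl x.2)
      · exact (hP _).2 (Or.inr x.2)⟩
  have hf : Function.Bijective f := by
    constructor
    · rintro ⟨x | x, hx, hx'⟩ ⟨y | y, hy, hy'⟩ hxy
      all_goals
        have h3 := congrArg Subtype.val (congrArg Subtype.val hxy)
        simp only [f, Sum.elim_inl, Sum.elim_inr] at h3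
      · exact Subtype.ext (congrArg Sum.inl (Subtype.ext h3))
      · exact absurd y.2 (hout _ (h3 ▸ x.2))
      · exact absurd x.2 (hout _ (h3 ▸ y.2))
      · exact Subtype.ext (congrArg Sum.inr (Subtype.ext h3))
    · rintro ⟨⟨x, hx⟩, hx'⟩
      rcases (hP _).1 hx' with h3 | h3
      · exact ⟨⟨Sum.inl ⟨x, h3⟩, fun hc => hx.1 (congrArg Subtype.val (Sum.inl_injective hc)),
          Sum.inl_ne_inr⟩, rfl⟩
      · exact ⟨⟨Sum.inr ⟨x, h3⟩, Sum.inr_ne_inl,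
          fun hc => hx.2 (congrArg Subtype.val (Sum.inr_injective hc))⟩, rfl⟩
  refine hs.congr' (Equiv.ofBijective f hf) _ ?_
  intro x
  apply Subtype.ext
  apply Subtype.ext
  show Sum.elim Subtype.val Subtype.val (gluePerm _ (Sum.inl a) (Sum.inr b) x).1 =
    (gluePerm γ.cyc h (γ.flip h) (f x).1).1
  rw [gluePerm_val _ Sum.inl_ne_inr, gluePerm_val _ hne]
  rcases x with ⟨x | x, hx, hx'⟩
  · have b1 : γ.cyc x.1 ≠ γ.flip h := fun hc => hout _ x.2 (by rw [← hc, γ.vert_cyc])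
    simp only [f, a, b, Perm.sumCongr_apply, Sum.map_inl, Sum.map_inr, Sum.elim_inl, Sum.inl.injEq,
      Sum.inr.injEq, reduceCtorEq, if_false, Subtype.ext_iff, Perm.subtypePerm_apply, b1]
    split_ifs <;> simp
  · have b1 : γ.cyc x.1 ≠ h := fun hc => hout h rfl (by
      have := γ.vert_cyc x.1; rw [hc] at this; exact this.trans x.2)
    simp only [f, a, b, Perm.sumCongr_apply, Sum.map_inl, Sum.map_inr, Sum.elim_inr, Sum.inl.injEq,
      Sum.inr.injEq, reduceCtorEq, if_false, Subtype.ext_iff, Perm.subtypePerm_apply, b1]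
    split_ifs <;> simp [*]

/-- The vertex of `γ/e` that results from a vertex of `γ`: if the edge `e` of `h` is not a loop, its
two ends are identified. -/
def contractVert (γ : StableRibbonGraph) (h : γ.H) (w : γ.V) :
    {w // w = γ.vert h ∨ w ≠ γ.vert (γ.flip h)} :=
  if hw : w = γ.vert (γ.flip h) then ⟨γ.vert h, Or.inl rfl⟩ else ⟨w, Or.inr hw⟩

theorem contractVert_eq_iff (γ : StableRibbonGraph) (h : γ.H) (w : γ.V)
    (v : {w // w = γ.vert h ∨ w ≠ γ.vert (γ.flip h)}) :
    γ.contractVert h w = v ↔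
      (if w = γ.vert (γ.flip h) then γ.vert h else w) = v.1 := by
  rw [Subtype.ext_iff, contractVert]
  split_ifs <;> rfl

theorem vert_gluePerm (γ : StableRibbonGraph) (h : γ.H) (x : {x // x ≠ h ∧ x ≠ γ.flip h}) :
    γ.contractVert h (γ.vert (gluePerm γ.cyc h (γ.flip h) x)) =
      γ.contractVert h (γ.vert x) := by
  have h1 : γ.contractVert h (γ.vert h) = γ.contractVert h (γ.vert (γ.flip h)) := by
    rw [contractVert_eq_iff, contractVert, dif_pos rfl]
    simp
  rw [gluePerm_val _ (γ.flip_ne h).symm]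
  have hx := γ.vert_cyc x.1
  split_ifs with a1 a2 a3 a4
  · rw [a1] at hx; rw [γ.vert_cyc]; exact congrArg _ hx
  · rw [a1] at hx; rw [γ.vert_cyc, ← h1]; exact congrArg _ hx
  · rw [a3] at hx; rw [γ.vert_cyc]; exact congrArg _ hx
  · rw [a3] at hx; rw [γ.vert_cyc, h1]; exact congrArg _ hx
  · rw [hx]

/-- The graph `γ/e`, where `e` is the edge of the half-edge `h`: the edge is removed and a strip is
glued to the surface(s) along the two half-edges of `e`. -/
def contract (γ : StableRibbonGraph) (h : γ.H) : StableRibbonGraph where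
  H := {x // x ≠ h ∧ x ≠ γ.flip h}
  E := {e // e ≠ γ.edge h}
  V := {w // w = γ.vert h ∨ w ≠ γ.vert (γ.flip h)}
  edge x := ⟨γ.edge x, (γ.edge_ne_iff h x).2 x.2⟩
  vert x := γ.contractVert h (γ.vert x)
  flip := γ.flip.subtypePerm (p := fun x => x ≠ h ∧ x ≠ γ.flip h) (fun x => by
    rw [← γ.edge_ne_iff, ← γ.edge_ne_iff, γ.edge_flip])
  flip_ne x hc := γ.flip_ne x (congrArg Subtype.val hc)
  edge_surjective := by
    rintro ⟨e, he⟩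
    obtain ⟨x, rfl⟩ := γ.edge_surjective e
    exact ⟨⟨x, (γ.edge_ne_iff h x).1 he⟩, rfl⟩
  edge_eq_iff x y := by
    simp only [Subtype.ext_iff, Perm.subtypePerm_apply]
    exact γ.edge_eq_iff x y
  cyc := gluePerm γ.cyc h (γ.flip h)
  vert_cyc := γ.vert_gluePerm h
  genus v :=
    if v.1 = γ.vert h then
      if γ.IsLoop h then
        if γ.cyc.SameCycle h (γ.flip h) then γ.genus (γ.vert h) else γ.genus (γ.vert h) + 1
      else γ.genus (γ.vert h) + γ.genus (γ.vert (γ.flip h))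
    else γ.genus v
  free v :=
    if v.1 = γ.vert h then
      if γ.IsLoop h then γ.free (γ.vert h) + glueFree γ.cyc h (γ.flip h)
      else γ.free (γ.vert h) + γ.free (γ.vert (γ.flip h)) + glueFree γ.cyc h (γ.flip h)
    else γ.free v
  white := {e | e.1 ∈ γ.white}
  stable := by
    rintro ⟨v, hv⟩
    by_cases h1 : v = γ.vert h
    · subst h1
      by_cases hl : γ.IsLoop h
      · simp only [if_true, if_pos hl]
        refine γ.glue_stable_loop h hl _ ?_ _
        intro x
        rw [contractVert_eq_iff]
        split_ifs with hx
        · simp only [true_iff]; rw [hx]; exact hl.symm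
        · rfl
      · simp only [if_true, if_neg hl]
        refine γ.glue_stable_join h hl _ ?_ _
        intro x
        rw [contractVert_eq_iff]
        split_ifs with hx <;> simp [hx]
    · simp only [if_neg h1]
      refine γ.glue_stable_away h v h1 (hv.resolve_left h1) _ ?_ _
      intro x
      rw [contractVert_eq_iff]
      split_ifs with hx
      · have : γ.vert x ≠ v := by rw [hx]; exact (hv.resolve_left h1).symm
        simp [this, Ne.symm h1]
      · rfl
  nonempty := ⟨γ.contractVert h (γ.vert h)⟩
  connected v w := by
    have key : ∀ a b, Relation.ReflTransGen
        (fun a b => ∃ x, γ.vert x = a ∧ γ.vert (γ.flip x) = b) a b →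
        Relation.ReflTransGen (fun a b => ∃ x : {x // x ≠ h ∧ x ≠ γ.flip h},
          γ.contractVert h (γ.vert x) = a ∧ γ.contractVert h (γ.vert (γ.flip x)) = b)
          (γ.contractVert h a) (γ.contractVert h b) := by
      intro a b hab
      induction hab with
      | refl => exact Relation.ReflTransGen.refl
      | tail _ hbc ih =>
        obtain ⟨x, rfl, rfl⟩ := hbc
        have h1 : γ.contractVert h (γ.vert h) = γ.contractVert h (γ.vert (γ.flip h)) := by
          rw [contractVert_eq_iff, contractVert, dif_pos rfl]
          simp
        by_cases hx : x ≠ h ∧ x ≠ γ.flip h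
        · exact ih.tail ⟨⟨x, hx⟩, rfl, rfl⟩
        · have : x = h ∨ x = γ.flip h := by tauto
          rcases this with rfl | rfl
          · rwa [← h1]
          · rwa [γ.flip_flip, h1]
    have hs : ∀ v : {w // w = γ.vert h ∨ w ≠ γ.vert (γ.flip h)}, ∃ a, γ.contractVert h a = v := by
      intro v
      refine ⟨v.1, ?_⟩
      rw [contractVert_eq_iff]
      rcases v with ⟨v, hv⟩
      split_ifs with hc
      · rcases hv with hv | hv
        · exact hv.symm
        · exact absurd hc hv
      · rfl
    obtain ⟨a, rfl⟩ := hs v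
    obtain ⟨b, rfl⟩ := hs w
    exact key a b (γ.connected a b)

/-- The graph in which the edge `e` is made white. -/
def whiten (γ : StableRibbonGraph) (e : γ.E) : StableRibbonGraph :=
  { γ with white := insert e γ.white }

end StableRibbonGraph

namespace StableRibbonGraph

/-- The number of boundary circles of the surface obtained from the vertex surfaces by gluing in a
strip for every edge; these circles are the marked points. -/
def numBoundary (γ : StableRibbonGraph) : ℕ :=
  numCycles (γ.cyc * γ.flip) + ∑ v, γ.free v

/-- The surface obtained from the vertex surfaces by gluing in a strip for every edge has genus `g`
and `n` boundary circles; its Euler characteristic `2 - 2 * g - n` is the sum of those of the vertex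
surfaces minus the number of edges. These graphs index the cells of the moduli spaces of type
`(g, n)`. -/
def IsOfType (γ : StableRibbonGraph) (g n : ℕ) : Prop :=
  γ.numBoundary = n ∧
    (2 - 2 * g - n : ℤ) =
      (∑ v, (2 - 2 * γ.genus v - (numCycles (γ.surface v).cyc + γ.free v) : ℤ)) - Fintype.card γ.E

/-- An isomorphism of stable ribbon graphs. By the classification of surfaces, the existence of
homeomorphisms between the surfaces of corresponding vertices which preserve the orientation and the
embedded half-edges means that `genus`, `free` and `cyc` are preserved. -/
structure Iso (γ γ' : StableRibbonGraph) where
  onH : γ.H ≃ γ'.H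
  onE : γ.E ≃ γ'.E
  onV : γ.V ≃ γ'.V
  edge_eq : ∀ h, γ'.edge (onH h) = onE (γ.edge h)
  vert_eq : ∀ h, γ'.vert (onH h) = onV (γ.vert h)
  cyc_eq : ∀ h, γ'.cyc (onH h) = onH (γ.cyc h)
  genus_eq : ∀ v, γ'.genus (onV v) = γ.genus v
  free_eq : ∀ v, γ'.free (onV v) = γ.free v
  white_iff : ∀ e, onE e ∈ γ'.white ↔ e ∈ γ.white

def AllBlack (γ : StableRibbonGraph) : Prop := γ.white = ∅

/-- Ordinary ribbon graphs: every vertex surface is a disk, and all edges have finite length. -/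
def IsRibbon (γ : StableRibbonGraph) : Prop := γ.AllBlack ∧ ∀ v, (γ.surface v).IsDisk

def BlackEdge (γ : StableRibbonGraph) : Type := {e : γ.E // e ∉ γ.white}

instance (γ : StableRibbonGraph) : Fintype γ.BlackEdge :=
  inferInstanceAs (Fintype {e : γ.E // e ∉ γ.white})

/-- The affine space of real-valued functions on the black edges. -/
abbrev EdgeSpace (γ : StableRibbonGraph) : Type := γ.BlackEdge → ℝ

/-- Differential forms of all degrees on (subsets of) the space of functions on the black edges. -/
abbrev Form (γ : StableRibbonGraph) : Type :=
  ∀ k : ℕ, γ.EdgeSpace → γ.EdgeSpace [⋀^Fin k]→L[ℝ] ℝ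

/-- The zero-section of `γ` along the edge of `h`. -/
def zeroSection (γ : StableRibbonGraph) (h : γ.H) (l : (γ.contract h).EdgeSpace) : γ.EdgeSpace :=
  fun e => if he : e.1 = γ.edge h then 0 else l ⟨⟨e.1, he⟩, e.2⟩

/-- The `∞`-section of `γ` along the edge `e`, in the coordinate on `[0, ∞]` in which `∞` is `1`. -/
def inftySection (γ : StableRibbonGraph) (e : γ.E) (l : (γ.whiten e).EdgeSpace) : γ.EdgeSpace :=
  fun e' => if he : e'.1 = e then 1 else l ⟨e'.1, fun hc => by
    rcases hc with hc | hc
    · exact he hc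
    · exact e'.2 hc⟩

/-- The map between spaces of functions on black edges induced by an isomorphism. -/
def Iso.pull {γ γ' : StableRibbonGraph} (f : Iso γ γ') (l : γ'.EdgeSpace) : γ.EdgeSpace :=
  fun e => l ⟨f.onE e.1, fun hc => e.2 ((f.white_iff e.1).1 hc)⟩

end StableRibbonGraph

open StableRibbonGraph

/-- The pull-back of a differential form. -/
def pullbackForm {V W : Type} [NormedAddCommGroup V] [NormedSpace ℝ V] [NormedAddCommGroup W]
    [NormedSpace ℝ W] {k : ℕ} (f : W → V) (η : V → V [⋀^Fin k]→L[ℝ] ℝ) (x : W) :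
    W [⋀^Fin k]→L[ℝ] ℝ :=
  (η (f x)).compContinuousLinearMap (fderiv ℝ f x)

/-- An assignment of a differential form to every stable ribbon graph. -/
abbrev FormFamily := ∀ γ : StableRibbonGraph, γ.Form

/-- The common conditions on an orbi-cellular form on a space whose cells are indexed by the graphs
that satisfy `cell`, where `dom γ` is the part of the space of edge functions that parametrizes the
closure, within the space, of the cell of `γ`, and `shrink γ h` says that the edge of `h` may be
contracted. Only the values of the forms on the sets `dom γ` matter. -/
structure IsOrbiCellular (cell : StableRibbonGraph → Prop)
    (dom : ∀ γ : StableRibbonGraph, Set γ.EdgeSpace) (shrink : ∀ γ : StableRibbonGraph, γ.H → Prop)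
    (η : FormFamily) : Prop where
  smooth : ∀ γ, cell γ → ∀ k, ContDiffOn ℝ ∞ (η γ k) (dom γ)
  invariant : ∀ γ γ', cell γ → ∀ f : Iso γ γ', ∀ k, ∀ l ∈ dom γ',
    pullbackForm f.pull (η γ k) l = η γ' k l
  contract : ∀ γ, cell γ → ∀ h, γ.edge h ∉ γ.white → shrink γ h →
    ∀ k, ∀ l ∈ dom (γ.contract h),
      pullbackForm (γ.zeroSection h) (η γ k) l = η (γ.contract h) k l

/-- The exterior derivative vanishes. -/
def IsClosedOn (cell : StableRibbonGraph → Prop)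
    (dom : ∀ γ : StableRibbonGraph, Set γ.EdgeSpace) (η : FormFamily) : Prop :=
  ∀ γ, cell γ → ∀ k, ∀ l ∈ dom γ, extDerivWithin (η γ k) (dom γ) l = 0

namespace StableRibbonGraph

/-- Metrics with nonnegative lengths on a ribbon graph for which the edges of length zero form a
forest, i.e. every edge of length zero is a bridge of the subgraph of edges of length zero. These
are the metrics obtained by repeatedly shrinking edges that are not loops. -/
def openDom (γ : StableRibbonGraph) : Set γ.EdgeSpace :=
  {l | (∀ e, 0 ≤ l e) ∧ ∀ h (hb : γ.edge h ∉ γ.white), l ⟨γ.edge h, hb⟩ = 0 →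
    ¬ Relation.ReflTransGen (fun a b => ∃ x, x ≠ h ∧ x ≠ γ.flip h ∧
        (∃ hx : γ.edge x ∉ γ.white, l ⟨γ.edge x, hx⟩ = 0) ∧ γ.vert x = a ∧ γ.vert (γ.flip x) = b)
      (γ.vert h) (γ.vert (γ.flip h))}

/-- Metrics with nonnegative lengths. -/
def halfDom (γ : StableRibbonGraph) : Set γ.EdgeSpace := {l | ∀ e, 0 ≤ l e}

/-- The cube `[0, ∞]` to the power of the black edges, in the coordinate `x` with values in `[0, 1]`
for which the length is `1 / (1 - x) - 1`. -/
def cube (γ : StableRibbonGraph) : Set γ.EdgeSpace := {x | ∀ e, 0 ≤ x e ∧ x e ≤ 1}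

/-- The points of the cube at which all lengths are finite. -/
def finiteCube (γ : StableRibbonGraph) : Set γ.EdgeSpace := {x | ∀ e, 0 ≤ x e ∧ x e < 1}

/-- The lengths at a point of the cube. -/
def lengths (γ : StableRibbonGraph) (x : γ.EdgeSpace) : γ.EdgeSpace := fun e => 1 / (1 - x e) - 1

end StableRibbonGraph

/-- Orbi-cellular forms on the decorated moduli space `[M_{g,n} × ℝ₊ⁿ] / S_n`. -/
def IsOrbiCellularM (g n : ℕ) : FormFamily → Prop :=
  IsOrbiCellular (fun γ => γ.IsRibbon ∧ γ.IsOfType g n) openDom (fun γ h => ¬ γ.IsLoop h)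

def IsClosedM (g n : ℕ) : FormFamily → Prop :=
  IsClosedOn (fun γ => γ.IsRibbon ∧ γ.IsOfType g n) openDom

/-- Orbi-cellular forms on `L_{g,n}`. -/
def IsOrbiCellularL (g n : ℕ) : FormFamily → Prop :=
  IsOrbiCellular (fun γ => γ.AllBlack ∧ γ.IsOfType g n) halfDom (fun _ _ => True)

def IsClosedL (g n : ℕ) : FormFamily → Prop :=
  IsClosedOn (fun γ => γ.AllBlack ∧ γ.IsOfType g n) halfDom

/-- Orbi-cellular forms on `L^∞_{g,n}`, written in the coordinates on the cubes. -/
def IsOrbiCellularLInfty (g n : ℕ) (η : FormFamily) : Prop :=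
  IsOrbiCellular (fun γ => γ.IsOfType g n) cube (fun _ _ => True) η ∧
    ∀ γ, γ.IsOfType g n → ∀ e, e ∉ γ.white → ∀ k, ∀ x ∈ (γ.whiten e).cube,
      pullbackForm (γ.inftySection e) (η γ k) x = η (γ.whiten e) k x

def IsClosedLInfty (g n : ℕ) : FormFamily → Prop :=
  IsClosedOn (fun γ => γ.IsOfType g n) cube

/-- The form `ηL` on `L_{g,n}` extends the form `ηM` on the decorated moduli space. -/
def ExtendsM (g n : ℕ) (ηL ηM : FormFamily) : Prop :=
  ∀ γ, γ.IsRibbon → γ.IsOfType g n → ∀ k, ∀ l ∈ γ.openDom, ηL γ k l = ηM γ k l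

/-- The form `ηI` on `L^∞_{g,n}` extends the form `ηL` on `L_{g,n}`. -/
def ExtendsL (g n : ℕ) (ηI ηL : FormFamily) : Prop :=
  ∀ γ, γ.AllBlack → γ.IsOfType g n → ∀ k, ∀ x ∈ γ.finiteCube,
    ηI γ k x = pullbackForm γ.lengths (ηL γ k) x

/-! Algebra -/

section Algebra

/-- The structure of a finite-dimensional differential graded Frobenius algebra, possibly without
unit, on a `ℤ/2`-graded associative algebra `A`: a differential and a (graded) symmetric even
nondegenerate invariant inner product compatible with it. -/
structure DGFrobenius {A : Type*} [NonUnitalRing A] [Module ℝ A]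
    (𝒜 : ZMod 2 → Submodule ℝ A) where
  d : A →ₗ[ℝ] A
  d_mem : ∀ i, ∀ a ∈ 𝒜 i, d a ∈ 𝒜 (i + 1)
  d_d : ∀ a, d (d a) = 0
  d_mul : ∀ i, ∀ a ∈ 𝒜 i, ∀ b, d (a * b) = d a * b + (-1 : ℝ) ^ i.val • (a * d b)
  form : LinearMap.BilinForm ℝ A
  form_nondegenerate : form.Nondegenerate
  form_symm : ∀ i j, ∀ a ∈ 𝒜 i, ∀ b ∈ 𝒜 j, form a b = (-1 : ℝ) ^ (i.val * j.val) * form b a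
  form_even : ∀ i j, i ≠ j → ∀ a ∈ 𝒜 i, ∀ b ∈ 𝒜 j, form a b = 0
  form_mul : ∀ a b c, form a (b * c) = form (a * b) c
  form_d : ∀ i, ∀ a ∈ 𝒜 i, ∀ b, form (d a) b = -(-1 : ℝ) ^ i.val * form a (d b)

/-- An abstract Hodge decomposition. -/
structure HodgeDecomposition {A : Type*} [NonUnitalRing A] [Module ℝ A]
    {𝒜 : ZMod 2 → Submodule ℝ A} (F : DGFrobenius 𝒜) where
  s : A →ₗ[ℝ] A
  π : A →ₗ[ℝ] A
  s_mem : ∀ i, ∀ a ∈ 𝒜 i, s a ∈ 𝒜 (i + 1)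
  π_mem : ∀ i, ∀ a ∈ 𝒜 i, π a ∈ 𝒜 i
  homotopy : ∀ a, F.d (s a) + s (F.d a) = a - π a
  s_s : ∀ a, s (s a) = 0
  π_π : ∀ a, π (π a) = π a
  d_π : ∀ a, F.d (π a) = 0
  π_d : ∀ a, π (F.d a) = 0
  π_s : ∀ a, π (s a) = 0
  s_π : ∀ a, s (π a) = 0
  form_s : ∀ i, ∀ a ∈ 𝒜 i, ∀ b, F.form (s a) b = (-1 : ℝ) ^ i.val * F.form a (s b)
  form_π : ∀ a b, F.form (π a) b = F.form a (π b)

/-- An enumeration of the elements of a finite set. -/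
structure Enumeration (I : Type) where
  list : List I
  nodup : list.Nodup
  complete : ∀ i, i ∈ list

/-- The Koszul sign of reordering a tensor product of elements of parities `p i`, `i : I`, from the
order `L` to the order `L'`. -/
def koszulSign {I : Type} [Fintype I] (p : I → ZMod 2) (L L' : List I) : ℝ :=
  ∏ i, ∏ j, if L.idxOf i < L.idxOf j ∧ L'.idxOf j < L'.idxOf i ∧ p i = 1 ∧ p j = 1 then -1 else 1

/-- The sign of moving an odd operator past the factors that precede the factor `i`. -/
def prefixSign {I : Type} [Fintype I] (p : I → ZMod 2) (L : List I) (i : I) : ℝ :=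
  ∏ j, if L.idxOf j < L.idxOf i ∧ p j = 1 then -1 else 1

variable {A : Type*} [NonUnitalRing A] [Module ℝ A] [FiniteDimensional ℝ A]
  {𝒜 : ZMod 2 → Submodule ℝ A}

namespace DGFrobenius

/-- The inverse inner product is the tensor `∑ i, basis i ⊗ dual i`, where `form (dual i) (basis j)`
is `1` for `i = j` and `0` otherwise. It does not depend on the basis and is characterized by
`∑ i, form a (basis i) * form (dual i) b = form a b`. -/
def basis (_F : DGFrobenius 𝒜) : Module.Basis (Fin (Module.finrank ℝ A)) ℝ A :=
  Module.finBasis ℝ A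

def dual (F : DGFrobenius 𝒜) : Module.Basis (Fin (Module.finrank ℝ A)) ℝ A :=
  LinearMap.BilinForm.dualBasis F.form F.form_nondegenerate F.basis

/-- `⟨a₁ ⋯ a_{n-1}, a_n⟩` for a list `a₁, …, a_n` with `n ≥ 2`. -/
def cyclicProduct (F : DGFrobenius 𝒜) : List A → ℝ
  | a :: b :: c :: l => cyclicProduct F ((a * b) :: c :: l)
  | [a, b] => F.form a b
  | _ => 0
termination_by l => l.length

end DGFrobenius

/-- Open topological field theories with values in `A`, i.e. morphisms of modular operads from the
modular operad of surfaces with intervals in the boundary to the endomorphism modular operad of `A`.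
To a surface with intervals labelled by `I` such a theory assigns a tensor in `(A*)^{⊗ I}`; this
tensor is given as a multilinear form `val S L` for every order `L` of the tensor factors, the forms
for different orders being related by the Koszul sign. The tensors are even, they are cycles, and
they are compatible with gluing, where gluing of tensors is contraction with the inverse inner
product. -/
@[ext] structure OpenTFT (F : DGFrobenius 𝒜) where
  val : ∀ {I : Type}, Surface I → Enumeration I → MultilinearMap ℝ (fun _ : I => A) ℝ
  val_relabel : ∀ {I J : Type} [Fintype I] [Fintype J] (e : I ≃ J) (S : Surface I)
    (L : Enumeration I) (L' : Enumeration J), L'.list = L.list.map e →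
    ∀ a : J → A, val (S.relabel e) L' a = val S L (fun i => a (e i))
  val_reorder : ∀ {I : Type} [Fintype I] (S : Surface I) (L L' : Enumeration I) (p : I → ZMod 2)
    (a : I → A), (∀ i, a i ∈ 𝒜 (p i)) →
    val S L' a = koszulSign p L.list L'.list * val S L a
  val_even : ∀ {I : Type} [Fintype I] (S : Surface I) (L : Enumeration I) (p : I → ZMod 2)
    (a : I → A), (∀ i, a i ∈ 𝒜 (p i)) → ∑ i, p i ≠ 0 → val S L a = 0
  val_d : ∀ {I : Type} [Fintype I] (S : Surface I) (L : Enumeration I) (p : I → ZMod 2)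
    (a : I → A), (∀ i, a i ∈ 𝒜 (p i)) →
    ∑ i, prefixSign p L.list i * val S L (Function.update a i (F.d (a i))) = 0
  val_selfGlue : ∀ {I : Type} [Fintype I] (S : Surface I) (h h' : I) (hne : h ≠ h')
    (L : Enumeration {x // x ≠ h ∧ x ≠ h'}) (L' : Enumeration I),
    L'.list = h :: h' :: L.list.map Subtype.val → ∀ a : {x // x ≠ h ∧ x ≠ h'} → A,
    val (S.selfGlue h h' hne) L a =
      ∑ j, val S L' (fun x =>
        if hx : x ≠ h ∧ x ≠ h' then a ⟨x, hx⟩ else if x = h then F.basis j else F.dual j)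
  val_join : ∀ {I J : Type} [Fintype I] [Fintype J] (S : Surface I) (T : Surface J) (h : I) (h' : J)
    (l : List I) (l' : List J) (L : Enumeration I) (L' : Enumeration J)
    (K : Enumeration {x : I ⊕ J // x ≠ Sum.inl h ∧ x ≠ Sum.inr h'}),
    L.list = l ++ [h] → L'.list = h' :: l' →
    K.list.map Subtype.val = l.map Sum.inl ++ l'.map Sum.inr →
    ∀ a : {x : I ⊕ J // x ≠ Sum.inl h ∧ x ≠ Sum.inr h'} → A,
    val (S.join T h h') K a =
      ∑ j, val S L (fun x =>
          if hx : x = h then F.basis j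
          else a ⟨Sum.inl x, fun hc => hx (Sum.inl_injective hc), Sum.inl_ne_inr⟩) *
        val T L' (fun x =>
          if hx : x = h' then F.dual j
          else a ⟨Sum.inr x, Sum.inr_ne_inl, fun hc => hx (Sum.inr_injective hc)⟩)

/-- The theory assigns to every disk with intervals `1, …, n`, in this cyclic order, the map
`a₁ ⊗ ⋯ ⊗ a_n ↦ ⟨a₁ ⋯ a_{n-1}, a_n⟩`. -/
def OpenTFT.DiskValues {F : DGFrobenius 𝒜} (t : OpenTFT F) : Prop :=
  ∀ {I : Type} [Fintype I] (S : Surface I) (L : Enumeration I), S.IsDisk → L.list.formPerm = S.cyc →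
    ∀ a, t.val S L a = F.cyclicProduct (L.list.map a)

/-- The theory assigns to the disk with three intervals the structure map `⟨a b, c⟩` of the
Frobenius algebra. -/
def OpenTFT.IsDeterminedBy {F : DGFrobenius 𝒜} (t : OpenTFT F) : Prop :=
  ∀ (S : Surface (Fin 3)) (L : Enumeration (Fin 3)), S.IsDisk → S.cyc = finRotate 3 →
    L.list = [0, 1, 2] → ∀ a, t.val S L a = F.form (a 0 * a 1) (a 2)

namespace HodgeDecomposition

def laplacian {F : DGFrobenius 𝒜} (D : HodgeDecomposition F) : A →ₗ[ℝ] A :=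
  F.d ∘ₗ D.s + D.s ∘ₗ F.d

/-- The operator `exp (-t Δ)`. -/
def heat {F : DGFrobenius 𝒜} (D : HodgeDecomposition F) (t : ℝ) : A →ₗ[ℝ] A :=
  Matrix.toLin F.basis F.basis
    (NormedSpace.exp (-t • LinearMap.toMatrix F.basis F.basis D.laplacian))

end HodgeDecomposition

/-- The choices that enter the construction of the form of a graph: orders of the vertices, of the
half-edges at each vertex and of the edges, and a first half-edge on every edge. -/
structure StableRibbonGraph.Choices (γ : StableRibbonGraph) where
  verts : Enumeration γ.V
  legs : ∀ v, Enumeration {h : γ.H // γ.vert h = v}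
  edges : Enumeration γ.E
  fst : γ.E → γ.H
  edge_fst : ∀ e, γ.edge (fst e) = e

namespace StableRibbonGraph.Choices

variable {γ : StableRibbonGraph} (c : γ.Choices)

/-- The half-edges, vertex by vertex. -/
def vertexOrder : List γ.H := c.verts.list.flatMap fun v => (c.legs v).list.map Subtype.val

/-- The half-edges, edge by edge. -/
def edgeOrder : List γ.H := c.edges.list.flatMap fun e => [c.fst e, γ.flip (c.fst e)]

/-- The tensor product over the vertices of multilinear maps `t v`, applied to the product of the
elements `a h` taken in the order `edgeOrder`: the elements are decomposed into their homogeneous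
parts and brought into the order `vertexOrder`. -/
def tensor [DirectSum.Decomposition 𝒜] (t : ∀ v, ({h : γ.H // γ.vert h = v} → A) → ℝ)
    (a : γ.H → A) : ℝ :=
  ∑ p : γ.H → ZMod 2, koszulSign p c.edgeOrder c.vertexOrder *
    ∏ v, t v fun h => (DirectSum.decompose 𝒜 (a h.1) (p h.1) : A)

/-- The form of degree `k` obtained by applying the tensor product over the vertices of maps `t v`
to the product over the edges, in the chosen order, of `α = K_t + (s ⊗ id) K_t dt` for the black
edges and of the limit `(π ⊗ id) K_0` for the white edges, where
`K_t = (exp (-t Δ) ⊗ id) (∑ i, basis i ⊗ dual i)`.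
The `k`-form is the sum over the increasing sequences `f` of `k` black edges on which the term with
`dt` is taken; the sign comes from moving the `k` factors `dt` past the `k` odd tensors. -/
def form [DirectSum.Decomposition 𝒜] {F : DGFrobenius 𝒜} (D : HodgeDecomposition F)
    (t : ∀ v, ({h : γ.H // γ.vert h = v} → A) → ℝ) : γ.Form := fun k l =>
  ∑ f : Fin k → γ.BlackEdge,
    if ∀ i j, i < j → c.edges.list.idxOf (f i).1 < c.edges.list.idxOf (f j).1 then
      ((-1 : ℝ) ^ (k * (k - 1) / 2) *
        ∑ m : γ.E → Fin (Module.finrank ℝ A), c.tensor (𝒜 := 𝒜) t fun h =>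
          if h = c.fst (γ.edge h) then
            if hw : γ.edge h ∈ γ.white then D.π (F.basis (m (γ.edge h)))
            else if ∃ i, (f i).1 = γ.edge h then
              D.s (D.heat (l ⟨γ.edge h, hw⟩) (F.basis (m (γ.edge h))))
            else D.heat (l ⟨γ.edge h, hw⟩) (F.basis (m (γ.edge h)))
          else F.dual (m (γ.edge h))) •
      ContinuousMultilinearMap.alternatization
        ((ContinuousMultilinearMap.mkPiAlgebra ℝ (Fin k) ℝ).compContinuousLinearMap
          fun i => ContinuousLinearMap.proj (R := ℝ) (φ := fun _ : γ.BlackEdge => ℝ) (f i))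
    else 0

/-- At every vertex the chosen order of the half-edges is compatible with their cyclic order. -/
def IsCyclic : Prop := ∀ v, (c.legs v).list.formPerm = (γ.surface v).cyc

end StableRibbonGraph.Choices

end Algebra

end

set_option linter.unusedSectionVars false

/-! The field theory. Adjoin to `A` a unit and an element ω annihilated by `A`, with the new product
of `a` and `b` in `A` equal to `ab + ⟨a, b⟩ ω`. Invariance of the inner product is what makes this
associative, and `⟨a₁ ⋯ aₘ₋₁, aₘ⟩` becomes the trace of `a₁ ⋯ aₘ`, where the trace reads off the
coefficient of ω. Write the inverse inner product as `∑ b_j ⊗ b^j` and put `C(x) = ∑ ± b_j x b^j`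
(`casimir`) and `H = ∑ b_j C(b^j)` (`handle`). The surface of genus `g` whose boundary circles carry
the words `w₀, …, w_r` is assigned `trace (w₀ C(w₁) ⋯ C(w_r) H^g)`, up to the Koszul sign; a circle
without intervals carries the empty word, which is why a unit is needed.

The basic identity is that a letter slides through the inverse inner product: `∑ y b_j ⊗ b^j = ∑ b_j
⊗ b^j y` (`slide_left`, `slide_right`). It implies that `C(x)` is graded central and invariant under
rotation of the word `x`, that `H` is central, and that `w₀` may be exchanged with the other words.
Hence the tensor depends on the surface only (`surfaceTrace_cycles`). Gluing turns `b_j v b^j v'`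
into `C(v) v'` when the two intervals lie on one circle, and `b_j v C(b^j v')` into `± v' v H` when
they lie on two circles of one surface. For two surfaces it is the formula `∑ trace (x b_j) trace
(b^j y) = trace (x y)`, valid since stability forces `x` and `y` to have no unit component.
Conversely every stable surface can be cut into disks with three intervals, without leaving the
stable range; this gives uniqueness (`agree_of_isDeterminedBy`).

The forms. The operator `Δ = 1 - π` is idempotent, so `exp (-tΔ) = π + exp (-t) (1 - π)` and `s exp
(-tΔ) = exp (-t) s`. The limit is then clear, and the form of a graph is a sum of values `coef` of
the vertex tensors on edge operators of these two kinds. Four facts about `coef` carry the theorem.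
Vertex tensors are even and edge tensors are symmetric, so a change of choices only permutes the odd
factors, which is compensated by the permutation of the `dt` (`Choices.coef_eq`, `valueForm_eq`). At
length zero the edge operator is the identity, and the gluing axioms contract the edge
(`exists_contract`). At infinite length it is `π`, the operator of a white edge. Finally, closedness
of the vertex tensors gives a Stokes relation: the signed sum over the edges of the values with one
operator replaced by its graded commutator with `d` is zero (`stokes`). As `[d, exp (-l) s] = exp
(-l) (1 - π)` is minus the derivative of `π + exp (-l) (1 - π)`, the forms are closed.

In the coordinate `x` on the cube, `exp (-l)` is `e * exp (-1 / (1 - x))`. It extends smoothly, and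
flatly, by zero to `x = 1`, so that the form extends over infinite lengths. -/

noncomputable section

/-! ### Koszul signs -/

/-- The sign of exchanging two elements of parities `a` and `b`. -/
def swapSign (a b : ZMod 2) : ℝ := if a = 1 ∧ b = 1 then -1 else 1

theorem zmod_two_cases (a : ZMod 2) : a = 0 ∨ a = 1 := by
  revert a; decide

theorem swapSign_add_left (a b c : ZMod 2) :
    swapSign (a + b) c = swapSign a c * swapSign b c := by
  rcases zmod_two_cases a with rfl | rfl <;> rcases zmod_two_cases b with rfl | rfl <;>
    rcases zmod_two_cases c with rfl | rfl <;>
    simp [swapSign, show (1 : ZMod 2) + 1 = 0 from rfl]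

theorem swapSign_comm (a b : ZMod 2) : swapSign a b = swapSign b a := by
  simp only [swapSign, and_comm]

theorem swapSign_add_right (a b c : ZMod 2) :
    swapSign a (b + c) = swapSign a b * swapSign a c := by
  rw [swapSign_comm, swapSign_add_left, swapSign_comm b, swapSign_comm c]

@[simp] theorem swapSign_zero_left (a : ZMod 2) : swapSign 0 a = 1 := by simp [swapSign]

@[simp] theorem swapSign_zero_right (a : ZMod 2) : swapSign a 0 = 1 := by simp [swapSign]

@[simp] theorem swapSign_mul_self (a b : ZMod 2) : swapSign a b * swapSign a b = 1 := by
  unfold swapSign; split_ifs <;> norm_num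

theorem neg_one_pow_val (a : ZMod 2) : (-1 : ℝ) ^ a.val = swapSign 1 a := by
  rcases zmod_two_cases a with rfl | rfl <;>
    simp [swapSign, show ZMod.val (1 : ZMod 2) = 1 from rfl]

theorem neg_one_pow_val_mul (a b : ZMod 2) : (-1 : ℝ) ^ (a.val * b.val) = swapSign a b := by
  rcases zmod_two_cases a with rfl | rfl <;> rcases zmod_two_cases b with rfl | rfl <;>
    simp [swapSign, show ZMod.val (1 : ZMod 2) = 1 from rfl]

section Koszul

variable {I : Type}

/-- The parity of a product of elements of parities `p i`. -/
def wordParity (p : I → ZMod 2) (L : List I) : ZMod 2 := (L.map p).sum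

@[simp] theorem wordParity_nil (p : I → ZMod 2) : wordParity p [] = 0 := rfl

@[simp] theorem wordParity_cons (p : I → ZMod 2) (x : I) (L : List I) :
    wordParity p (x :: L) = p x + wordParity p L := by simp [wordParity]

@[simp] theorem wordParity_append (p : I → ZMod 2) (L L' : List I) :
    wordParity p (L ++ L') = wordParity p L + wordParity p L' := by simp [wordParity]

variable [Fintype I]

theorem koszulSign_self (p : I → ZMod 2) (L : List I) : koszulSign p L L = 1 := by
  refine Finset.prod_eq_one fun i _ => Finset.prod_eq_one fun j _ => if_neg ?_
  rintro ⟨h1, h2, -⟩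
  omega

/-- An element that is not on the lists has their length as its index and therefore never takes part
in an inversion. -/
theorem koszulSign_congr {p q : I → ZMod 2} {L L' : List I} (hL : L.Perm L')
    (h : ∀ i ∈ L, p i = q i) : koszulSign p L L' = koszulSign q L L' := by
  refine Finset.prod_congr rfl fun i _ => Finset.prod_congr rfl fun j _ => ?_
  by_cases hi : i ∈ L
  · by_cases hj : j ∈ L
    · rw [h i hi, h j hj]
    · have : L'.idxOf i ≤ L'.length := List.idxOf_le_length
      have h2 := List.idxOf_eq_length (fun hc => hj (hL.mem_iff.2 hc))
      rw [if_neg (by omega), if_neg (by omega)]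
  · have : L.idxOf j ≤ L.length := List.idxOf_le_length
    have h2 := List.idxOf_eq_length hi
    rw [if_neg (by omega), if_neg (by omega)]

theorem koszulSign_comm (p : I → ZMod 2) (L L' : List I) :
    koszulSign p L L' = koszulSign p L' L := by
  unfold koszulSign
  rw [Finset.prod_comm]
  refine Finset.prod_congr rfl fun i _ => Finset.prod_congr rfl fun j _ => ?_
  refine if_congr ?_ rfl rfl
  tauto

theorem koszulSign_mul_self (p : I → ZMod 2) (L L' : List I) :
    koszulSign p L L' * koszulSign p L L' = 1 := by
  simp only [koszulSign, ← Finset.prod_mul_distrib]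
  refine Finset.prod_eq_one fun i _ => Finset.prod_eq_one fun j _ => ?_
  split_ifs <;> norm_num

theorem koszulSign_cons (p : I → ZMod 2) {L L' : List I} (hL : L.Perm L') {x : I} (hx : x ∉ L) :
    koszulSign p (x :: L) (x :: L') = koszulSign p L L' := by
  have hx' : x ∉ L' := fun h => hx (hL.mem_iff.2 h)
  have e1 := List.idxOf_eq_length hx
  have e2 := List.idxOf_eq_length hx'
  refine Finset.prod_congr rfl fun i _ => Finset.prod_congr rfl fun j _ => ?_
  refine if_congr ?_ rfl rfl
  by_cases hi : i = x
  · subst hi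
    have : L.idxOf j ≤ L.length := List.idxOf_le_length
    rw [List.idxOf_cons_self, List.idxOf_cons_self]
    constructor <;> intro h <;> omega
  · by_cases hj : j = x
    · subst hj
      have : L'.idxOf i ≤ L'.length := List.idxOf_le_length
      rw [List.idxOf_cons_self, List.idxOf_cons_self]
      constructor <;> intro h <;> omega
    · rw [List.idxOf_cons_ne _ (Ne.symm hi), List.idxOf_cons_ne _ (Ne.symm hj),
        List.idxOf_cons_ne _ (Ne.symm hi), List.idxOf_cons_ne _ (Ne.symm hj)]
      simp only [Nat.succ_lt_succ_iff]

theorem koszulSign_swap (p : I → ZMod 2) (L : List I) {x y : I} (hxy : x ≠ y) :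
    koszulSign p (x :: y :: L) (y :: x :: L) = swapSign (p x) (p y) := by
  have key : ∀ i j, ((x :: y :: L).idxOf i < (x :: y :: L).idxOf j ∧
      (y :: x :: L).idxOf j < (y :: x :: L).idxOf i ∧ p i = 1 ∧ p j = 1) ↔
      (i = x ∧ j = y ∧ p x = 1 ∧ p y = 1) := by
    intro i j
    have f : ∀ k, k ≠ x → k ≠ y → (x :: y :: L).idxOf k = L.idxOf k + 2 ∧
        (y :: x :: L).idxOf k = L.idxOf k + 2 := by
      intro k h1 h2
      rw [List.idxOf_cons_ne _ h1.symm, List.idxOf_cons_ne _ h2.symm,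
        List.idxOf_cons_ne _ h2.symm, List.idxOf_cons_ne _ h1.symm]
      exact ⟨rfl, rfl⟩
    have a1 : (x :: y :: L).idxOf x = 0 := List.idxOf_cons_self
    have a2 : (y :: x :: L).idxOf y = 0 := List.idxOf_cons_self
    have a3 : (x :: y :: L).idxOf y = 1 := by
      rw [List.idxOf_cons_ne _ hxy, List.idxOf_cons_self]
    have a4 : (y :: x :: L).idxOf x = 1 := by
      rw [List.idxOf_cons_ne _ hxy.symm, List.idxOf_cons_self]
    constructor
    · rintro ⟨h1, h2, h3, h4⟩
      by_cases hi : i = x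
      · subst hi
        by_cases hj : j = y
        · subst hj; exact ⟨rfl, rfl, h3, h4⟩
        · by_cases hj' : j = i
          · subst hj'; omega
          · have := f j hj' hj; omega
      · by_cases hi' : i = y
        · subst hi'; omega
        · have := f i hi hi'
          by_cases hj : j = x
          · subst hj; omega
          · by_cases hj' : j = y
            · subst hj'; omega
            · have := f j hj hj'; omega
    · rintro ⟨rfl, rfl, h3, h4⟩
      exact ⟨by omega, by omega, h3, h4⟩
  unfold koszulSign
  simp only [key]
  rw [Finset.prod_eq_single x, Finset.prod_eq_single y]
  · simp [swapSign]
  · intro j _ hj; simp [hj]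
  · simp
  · intro i _ hi; simp [hi]
  · simp

/-- Each unordered pair of distinct entries contributes exactly one factor for either order, and `G`
is symmetric. In the proof the pairs on which the two orders agree match directly, the others after
transposition. -/
theorem prod_pairs_eq (G : I → I → ℝ) (hG : ∀ i j, G i j = G j i) {L L' : List I}
    (hL : L.Perm L') :
    (∏ i, ∏ j, if L.idxOf i < L.idxOf j ∧ j ∈ L then G i j else 1) =
      ∏ i, ∏ j, if L'.idxOf i < L'.idxOf j ∧ j ∈ L' then G i j else 1 := by
  let a := fun i j => if L.idxOf i < L.idxOf j ∧ j ∈ L then G i j else 1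
  let b := fun i j => if L'.idxOf i < L'.idxOf j ∧ j ∈ L' then G i j else 1
  have ha : ∀ i j, a i j = (if L.idxOf i < L.idxOf j ∧ L'.idxOf i < L'.idxOf j ∧ j ∈ L then G i j
      else 1) * (if L.idxOf i < L.idxOf j ∧ L'.idxOf j < L'.idxOf i ∧ j ∈ L then G i j else 1) := by
    intro i j
    by_cases hij : i = j
    · subst hij; simp [a]
    · by_cases hj : j ∈ L
      · have : L'.idxOf i ≠ L'.idxOf j := fun h =>
          hij (((List.idxOf_inj (hL.mem_iff.1 hj)).1 h.symm).symm)
        rcases lt_or_gt_of_ne this with h | h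
        · simp [a, h, h.asymm]
        · simp [a, h, h.asymm]
      · simp [a, hj]
  have hb : ∀ i j, b i j = (if L.idxOf i < L.idxOf j ∧ L'.idxOf i < L'.idxOf j ∧ j ∈ L then G i j
      else 1) * (if L.idxOf j < L.idxOf i ∧ L'.idxOf i < L'.idxOf j ∧ i ∈ L then G j i else 1) := by
    intro i j
    simp only [b, ← hL.mem_iff]
    by_cases hij : i = j
    · subst hij; simp
    · have hlt : ∀ k l : I, k ∈ L → L'.idxOf l < L'.idxOf k → l ∈ L := fun k l hk h => by
        by_contra hl
        have h1 := List.idxOf_eq_length (fun hc => hl (hL.mem_iff.2 hc))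
        have h2 : L'.idxOf k ≤ L'.length := List.idxOf_le_length
        omega
      by_cases hj : j ∈ L
      · have : L.idxOf i ≠ L.idxOf j := fun h => hij (((List.idxOf_inj hj).1 h.symm).symm)
        by_cases hij' : L'.idxOf i < L'.idxOf j
        · have hi := hlt _ _ hj hij'
          rcases lt_or_gt_of_ne this with h | h
          · simp [h, h.asymm, hj, hij']
          · simp [h, h.asymm, hi, hj, hij', hG i j]
        · simp [hij']
      · have h2 : L.idxOf i ≤ L.length := List.idxOf_le_length
        have h1 := List.idxOf_eq_length hj
        simp only [hj, and_false, if_false, one_mul]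
        rw [if_neg]
        rintro ⟨h3, -⟩
        omega
  have hc : (∏ i, ∏ j, if L.idxOf j < L.idxOf i ∧ L'.idxOf i < L'.idxOf j ∧ i ∈ L
      then G j i else 1) = ∏ i, ∏ j, if L.idxOf i < L.idxOf j ∧ L'.idxOf j < L'.idxOf i ∧ j ∈ L
      then G i j else 1 := Finset.prod_comm
  show ∏ i, ∏ j, a i j = ∏ i, ∏ j, b i j
  simp only [ha, hb, Finset.prod_mul_distrib]
  rw [hc]

/-- A pair is inverted from `L` to `L''` exactly if it is inverted in one but not both of the two
steps. The two signs are products over pairs listed in different orders; `G` symmetrizes the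
inversion condition of the second step so that `prod_pairs_eq` brings both to the order `L`. -/
theorem koszulSign_trans (p : I → ZMod 2) {L L' L'' : List I} (h1 : L.Perm L') (h2 : L'.Perm L'') :
    koszulSign p L L' * koszulSign p L' L'' = koszulSign p L L'' := by
  let G := fun i j => if (L'.idxOf i < L'.idxOf j ∧ L''.idxOf j < L''.idxOf i ∨
    L'.idxOf j < L'.idxOf i ∧ L''.idxOf i < L''.idxOf j) ∧ p i = 1 ∧ p j = 1 then (-1 : ℝ) else 1
  have hmem : ∀ {K K' : List I}, K.Perm K' → ∀ i j, K'.idxOf j < K'.idxOf i → j ∈ K := by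
    intro K K' h i j hij
    by_contra hl
    have h1 := List.idxOf_eq_length (fun hc => hl (h.mem_iff.2 hc))
    have h2 : K'.idxOf i ≤ K'.length := List.idxOf_le_length
    omega
  have e1 : koszulSign p L' L'' =
      ∏ i, ∏ j, if L'.idxOf i < L'.idxOf j ∧ j ∈ L' then G i j else 1 := by
    refine Finset.prod_congr rfl fun i _ => Finset.prod_congr rfl fun j _ => ?_
    by_cases h : L'.idxOf i < L'.idxOf j
    · by_cases hj : j ∈ L'
      · simp [G, h, h.asymm, hj]
      · have := fun h' => hj (hmem h2 i j h')
        rw [if_neg (fun hc => this hc.2.1), if_neg (fun hc => hj hc.2)]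
    · simp [h]
  rw [e1, ← prod_pairs_eq G (fun i j => by
    simp only [G]; exact if_congr (by tauto) rfl rfl) h1]
  simp only [koszulSign, ← Finset.prod_mul_distrib]
  refine Finset.prod_congr rfl fun i _ => Finset.prod_congr rfl fun j _ => ?_
  by_cases h : L.idxOf i < L.idxOf j
  · by_cases hp : p i = 1 ∧ p j = 1
    · have hi : i ∈ L := hmem (List.Perm.refl L) j i h
      by_cases hj : j ∈ L
      · have hij : i ≠ j := fun h' => by subst h'; omega
        have n1 : L'.idxOf i ≠ L'.idxOf j := fun h =>
          hij (((List.idxOf_inj (h1.mem_iff.1 hj)).1 h.symm).symm)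
        have n2 : L''.idxOf i ≠ L''.idxOf j := fun h =>
          hij (((List.idxOf_inj (h2.mem_iff.1 (h1.mem_iff.1 hj))).1 h.symm).symm)
        rcases lt_or_gt_of_ne n1 with h3 | h3 <;> rcases lt_or_gt_of_ne n2 with h4 | h4 <;>
          simp [G, h, hj, hp, h3, h4, h3.asymm, h4.asymm]
      · have a1 := fun h' => hj (hmem h1 i j h')
        have a2 := fun h' => hj (hmem (h1.trans h2) i j h')
        rw [if_neg (fun hc => a1 hc.2.1), if_neg (fun hc => hj hc.2),
          if_neg (fun hc => a2 hc.2.1), mul_one]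
    · simp only [hp, and_false, if_false, G, ite_self, mul_one]
  · simp [h]

/-- Multiplicativity of the sign in `koszulSign_trans` allows induction on the generation of
permutations by adjacent swaps. Most later statements on signs and reorderings are obtained by this
induction. -/
theorem koszulSign_append (p : I → ZMod 2) {L L' : List I} (hL : L.Perm L') {K : List I}
    (hn : (L ++ K).Nodup) : koszulSign p (L ++ K) (L' ++ K) = koszulSign p L L' := by
  induction hL with
  | nil => exact (koszulSign_self _ _).trans (koszulSign_self _ _).symm
  | cons x h ih =>
    have h1 := List.nodup_cons.1 hn
    rw [List.cons_append, List.cons_append, koszulSign_cons p (h.append_right K) h1.1,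
      koszulSign_cons p h (fun hc => h1.1 (List.mem_append_left _ hc)), ih h1.2]
  | swap x y l =>
    have h1 : y ≠ x := fun hc => (List.nodup_cons.1 hn).1 (by simp [hc])
    simp only [List.cons_append]
    rw [koszulSign_swap _ _ h1, koszulSign_swap _ _ h1]
  | trans h1 h2 ih1 ih2 =>
    rw [← koszulSign_trans p (h1.append_right K) (h2.append_right K), ih1 hn,
      ih2 ((h1.append_right K).nodup_iff.1 hn), koszulSign_trans p h1 h2]

theorem koszulSign_append_left (p : I → ZMod 2) {L L' : List I} (hL : L.Perm L') {K : List I}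
    (hn : (K ++ L).Nodup) : koszulSign p (K ++ L) (K ++ L') = koszulSign p L L' := by
  induction K with
  | nil => rfl
  | cons x K ih =>
    have h1 := List.nodup_cons.1 hn
    rw [List.cons_append, List.cons_append, koszulSign_cons p (hL.append_left K) h1.1, ih h1.2]

theorem koszulSign_append_append (p : I → ZMod 2) {L L' K K' : List I} (hL : L.Perm L')
    (hK : K.Perm K') (hn : (L ++ K).Nodup) :
    koszulSign p (L ++ K) (L' ++ K') = koszulSign p L L' * koszulSign p K K' := by
  rw [← koszulSign_trans p (hL.append_right K) (hK.append_left L'), koszulSign_append p hL hn,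
    koszulSign_append_left p hK ((hL.append_right K).nodup_iff.1 hn)]

theorem koszulSign_move (p : I → ZMod 2) (x : I) (L K : List I) (hn : (x :: L ++ K).Nodup) :
    koszulSign p (x :: L ++ K) (L ++ x :: K) = swapSign (p x) (wordParity p L) := by
  induction L with
  | nil => simp [koszulSign_self]
  | cons y L ih =>
    have hn' : (y :: (x :: L ++ K)).Nodup := (List.Perm.swap y x (L ++ K)).nodup_iff.1 hn
    have h1 := List.nodup_cons.1 hn'
    have hxy : x ≠ y := fun hc => h1.1 (by simp [hc])
    have hp : (x :: L ++ K).Perm (L ++ x :: K) := List.perm_middle.symm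
    rw [List.cons_append, List.cons_append, List.cons_append,
      ← koszulSign_trans p (L' := y :: x :: (L ++ K)) (List.Perm.swap y x (L ++ K)) (hp.cons y),
      wordParity_cons, swapSign_add_right, ← ih h1.2, ← koszulSign_cons p hp h1.1]
    congr 1
    exact koszulSign_swap p _ hxy

/-- The letters of `X` are carried across `Y` one by one, and `swapSign` is bimultiplicative. -/
theorem koszulSign_swap_blocks (p : I → ZMod 2) (X Y K : List I) (hn : (X ++ Y ++ K).Nodup) :
    koszulSign p (X ++ Y ++ K) (Y ++ X ++ K) = swapSign (wordParity p X) (wordParity p Y) := by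
  induction X with
  | nil => simp [koszulSign_self]
  | cons x X ih =>
    have h1 := List.nodup_cons.1 hn
    have e1 : (x :: X ++ Y ++ K).Perm (x :: (Y ++ X ++ K)) :=
      (List.perm_append_comm.append_right K).cons x
    have e2 : (x :: (Y ++ X ++ K)).Perm (Y ++ x :: X ++ K) := by
      simpa using (List.perm_middle (a := x) (l₁ := Y) (l₂ := X ++ K)).symm
    rw [← koszulSign_trans p e1 e2, wordParity_cons, swapSign_add_left, mul_comm]
    congr 1
    · have := koszulSign_move p x Y (X ++ K) (by simpa using e1.nodup_iff.1 hn)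
      simpa using this
    · rw [← ih h1.2]
      exact koszulSign_cons p (List.perm_append_comm.append_right K) h1.1

theorem koszulSign_map {J : Type} [Fintype J] (e : I → J) (he : Function.Injective e)
    (p : J → ZMod 2) {L L' : List I} (hL : L.Perm L') (hn : L.Nodup) :
    koszulSign p (L.map e) (L'.map e) = koszulSign (fun i => p (e i)) L L' := by
  induction hL with
  | nil => exact (koszulSign_self _ _).trans (koszulSign_self _ _).symm
  | cons x h ih =>
    have h1 := List.nodup_cons.1 hn
    rw [List.map_cons, List.map_cons, koszulSign_cons _ (h.map e), koszulSign_cons _ h h1.1,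
      ih h1.2]
    rw [List.mem_map_of_injective he]
    exact h1.1
  | swap x y l =>
    have h1 : y ≠ x := fun hc => (List.nodup_cons.1 hn).1 (by simp [hc])
    simp only [List.map_cons]
    rw [koszulSign_swap _ _ h1, koszulSign_swap _ _ (fun hc => h1 (he hc))]
  | trans h1 h2 ih1 ih2 =>
    rw [← koszulSign_trans p (h1.map e) (h2.map e), ih1 hn, ih2 (h1.nodup_iff.1 hn),
      koszulSign_trans _ h1 h2]

theorem prefixSign_cons (p : I → ZMod 2) {x : I} {L : List I} (hx : x ∉ L) (i : I) :
    prefixSign p (x :: L) i = if i = x then 1 else swapSign 1 (p x) * prefixSign p L i := by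
  split_ifs with h
  · subst h
    refine Finset.prod_eq_one fun j _ => if_neg ?_
    rw [List.idxOf_cons_self]
    omega
  · unfold prefixSign
    have e : swapSign 1 (p x) = ∏ j : I, if j = x then swapSign 1 (p x) else 1 := by simp
    rw [e, ← Finset.prod_mul_distrib]
    refine Finset.prod_congr rfl fun j _ => ?_
    rw [List.idxOf_cons_ne _ (Ne.symm h)]
    by_cases hj : j = x
    · subst hj
      have h1 := List.idxOf_eq_length hx
      have h2 : L.idxOf i ≤ L.length := List.idxOf_le_length
      rw [List.idxOf_cons_self, if_pos rfl, if_neg (c := L.idxOf j < L.idxOf i ∧ p j = 1) (by omega)]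
      simp [swapSign]
    · rw [List.idxOf_cons_ne _ (Ne.symm hj), if_neg hj]
      simp

theorem prefixSign_append_of_mem (p : I → ZMod 2) {L K : List I} {i : I}
    (hi : i ∈ L) : prefixSign p (L ++ K) i = prefixSign p L i := by
  refine Finset.prod_congr rfl fun j _ => if_congr ?_ rfl rfl
  rw [List.idxOf_append_of_mem hi]
  by_cases hj : j ∈ L
  · rw [List.idxOf_append_of_mem hj]
  · rw [List.idxOf_append_of_notMem hj, List.idxOf_eq_length hj]
    have : L.idxOf i < L.length := List.idxOf_lt_length_iff.2 hi
    constructor <;> intro h <;> omega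

theorem prefixSign_append_of_not_mem (p : I → ZMod 2) {L K : List I} (hn : (L ++ K).Nodup) {i : I}
    (hi : i ∉ L) :
    prefixSign p (L ++ K) i = swapSign 1 (wordParity p L) * prefixSign p K i := by
  induction L with
  | nil => simp
  | cons x L ih =>
    have h1 := List.nodup_cons.1 hn
    rw [List.cons_append, prefixSign_cons p (L := L ++ K) h1.1, if_neg (fun hc => hi (by simp [hc])),
      ih h1.2 (fun hc => hi (List.mem_cons_of_mem _ hc)), wordParity_cons, swapSign_add_right,
      mul_assoc]

/-- Moving an odd operator through a reordering. -/
theorem prefixSign_mul_koszulSign (p : I → ZMod 2) {L L' : List I} (hL : L.Perm L') (hn : L.Nodup)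
    (i : I) : prefixSign p L i * koszulSign (Function.update p i (p i + 1)) L L' =
      koszulSign p L L' * prefixSign p L' i := by
  induction hL with
  | nil => simp [koszulSign_self]
  | cons x h ih =>
    have h1 := List.nodup_cons.1 hn
    have h2 : ∀ q, koszulSign q (x :: _) (x :: _) = koszulSign q _ _ :=
      fun q => koszulSign_cons q h h1.1
    rw [h2, h2, prefixSign_cons p h1.1, prefixSign_cons p (fun hc => h1.1 (h.mem_iff.2 hc))]
    split_ifs with hi
    · subst hi
      rw [one_mul, mul_one]
      refine koszulSign_congr h fun j hj => ?_
      rw [Function.update_of_ne (fun hc => h1.1 (by rwa [← hc]))]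
    · rw [mul_assoc, ih h1.2]; ring
  -- Changing the parity of one swapped entry multiplies the swap sign by the sign of an odd
  -- operator passing the other entry. This is the difference between the two prefix signs.
  | swap x y l =>
    have h1 := List.nodup_cons.1 hn
    have h2 := List.nodup_cons.1 h1.2
    have hxy : y ≠ x := fun hc => h1.1 (by simp [hc])
    have h3 : y ∉ l := fun hc => h1.1 (by simp [hc])
    rw [koszulSign_swap _ _ hxy, koszulSign_swap _ _ hxy, prefixSign_cons p h1.1,
      prefixSign_cons p h2.1, prefixSign_cons p (x := x) (by simp [h2.1, hxy.symm]),
      prefixSign_cons p h3]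
    by_cases hy : i = y
    · subst hy
      simp [hxy, hxy.symm, swapSign_add_left, mul_comm]
    · by_cases hx : i = x
      · subst hx
        simp [hxy, hxy.symm, swapSign_add_right, swapSign_comm (p y) 1, mul_comm]
        rw [mul_comm (swapSign (p y) (p i)), ← mul_assoc, swapSign_mul_self, one_mul]
      · simp only [hx, hy, if_false, Function.update_of_ne (Ne.symm hx),
          Function.update_of_ne (Ne.symm hy)]
        ring
  | trans h1 h2 ih1 ih2 =>
    rw [← koszulSign_trans _ h1 h2, ← koszulSign_trans _ h1 h2, ← mul_assoc, ih1 hn, mul_assoc,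
      ih2 (h1.nodup_iff.1 hn), mul_assoc]

end Koszul

end

noncomputable section

/-! ### The parity automorphism and the inverse inner product -/

section Parity

variable {A : Type*} [NonUnitalRing A] [Module ℝ A] (𝒜 : ZMod 2 → Submodule ℝ A)
  [DirectSum.Decomposition 𝒜]

/-- The projection to the component of degree `i`. -/
def hproj (i : ZMod 2) : A →ₗ[ℝ] A :=
  (𝒜 i).subtype ∘ₗ DirectSum.component ℝ (ZMod 2) (fun i => 𝒜 i) i ∘ₗ
    (DirectSum.decomposeLinearEquiv 𝒜).toLinearMap

theorem hproj_apply (i : ZMod 2) (a : A) :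
    hproj 𝒜 i a = (DirectSum.decompose 𝒜 a i : A) := rfl

theorem hproj_mem (i : ZMod 2) (a : A) : hproj 𝒜 i a ∈ 𝒜 i := (DirectSum.decompose 𝒜 a i).2

theorem hproj_of_mem {i : ZMod 2} {a : A} (ha : a ∈ 𝒜 i) (j : ZMod 2) :
    hproj 𝒜 j a = if i = j then a else 0 := by
  rw [hproj_apply]
  split_ifs with h
  · subst h; exact DirectSum.decompose_of_mem_same 𝒜 ha
  · exact DirectSum.decompose_of_mem_ne 𝒜 ha h

theorem sum_hproj (a : A) : ∑ i, hproj 𝒜 i a = a := by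
  conv_rhs => rw [← DirectSum.sum_support_decompose 𝒜 a]
  symm
  refine Finset.sum_subset (Finset.subset_univ _) fun i _ hi => ?_
  simpa using hi

theorem LinearMap.ext_homogeneous {M : Type*} [AddCommMonoid M] [Module ℝ M] {f g : A →ₗ[ℝ] M}
    (h : ∀ i, ∀ a ∈ 𝒜 i, f a = g a) : f = g := by
  ext a
  rw [← sum_hproj 𝒜 a, map_sum, map_sum]
  exact Finset.sum_congr rfl fun i _ => h i _ (hproj_mem 𝒜 i a)

theorem LinearMap.congr_homogeneous {M : Type*} [AddCommMonoid M] [Module ℝ M] (f g : A →ₗ[ℝ] M)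
    (h : ∀ i, ∀ a ∈ 𝒜 i, f a = g a) (a : A) : f a = g a := by
  rw [LinearMap.ext_homogeneous 𝒜 h]

/-- The operator that multiplies elements of degree `i` by `(-1) ^ (q * i)`. -/
def signOp (q : ZMod 2) : A →ₗ[ℝ] A := ∑ i, swapSign q i • hproj 𝒜 i

theorem signOp_of_mem (q : ZMod 2) {i : ZMod 2} {a : A} (ha : a ∈ 𝒜 i) :
    signOp 𝒜 q a = swapSign q i • a := by
  simp [signOp, hproj_of_mem 𝒜 ha]

theorem signOp_signOp (q r : ZMod 2) (a : A) :
    signOp 𝒜 q (signOp 𝒜 r a) = signOp 𝒜 (q + r) a := by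
  refine LinearMap.congr_homogeneous 𝒜 (signOp 𝒜 q ∘ₗ signOp 𝒜 r) _ ?_ a
  intro i a ha
  simp [signOp_of_mem 𝒜 _ ha, swapSign_add_left, smul_smul, mul_comm]

@[simp] theorem signOp_zero (a : A) : signOp 𝒜 0 a = a := by
  conv_rhs => rw [← sum_hproj 𝒜 a]
  simp [signOp]

theorem signOp_mul [IsScalarTower ℝ A A] [SMulCommClass ℝ A A] [SetLike.GradedMul 𝒜]
    (q : ZMod 2) (a b : A) : signOp 𝒜 q (a * b) = signOp 𝒜 q a * signOp 𝒜 q b := by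
  have := LinearMap.congr_homogeneous 𝒜 ((LinearMap.mul ℝ A).compr₂ (signOp 𝒜 q))
    ((LinearMap.mul ℝ A).compl₁₂ (signOp 𝒜 q) (signOp 𝒜 q)) ?_ a
  · exact LinearMap.congr_fun this b
  · intro i a ha
    apply LinearMap.ext_homogeneous 𝒜
    intro j b hb
    simp [signOp_of_mem 𝒜 _ ha, signOp_of_mem 𝒜 _ hb,
      signOp_of_mem 𝒜 _ (SetLike.mul_mem_graded ha hb), swapSign_add_right, smul_smul, mul_comm]

end Parity

namespace DGFrobenius

variable {A : Type*} [NonUnitalRing A] [Module ℝ A] {𝒜 : ZMod 2 → Submodule ℝ A}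
  [DirectSum.Decomposition 𝒜] (F : DGFrobenius 𝒜)

/-- The inner product is nonzero only for arguments of equal parity, so the sign of the exchange
depends on the parity of either one of them. This makes graded symmetry a linear identity, free of
degrees; evenness is used in the same way for `signOp` and `hproj` below. -/
theorem form_comm (a b : A) : F.form a b = F.form b (signOp 𝒜 1 a) := by
  have := LinearMap.congr_homogeneous 𝒜 F.form (LinearMap.flip F.form ∘ₗ signOp 𝒜 1) ?_ a
  · exact LinearMap.congr_fun this b
  · intro i a ha
    apply LinearMap.ext_homogeneous 𝒜
    intro j b hb
    simp only [LinearMap.comp_apply, signOp_of_mem 𝒜 _ ha, map_smul, LinearMap.smul_apply,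
      LinearMap.flip_apply]
    by_cases hij : i = j
    · subst hij
      rw [F.form_symm i i a ha b hb, neg_one_pow_val_mul]
      rcases zmod_two_cases i with rfl | rfl <;> simp
    · rw [F.form_even i j hij a ha b hb, F.form_even j i (Ne.symm hij) b hb a ha, smul_zero]

theorem form_signOp (q : ZMod 2) (a b : A) : F.form a (signOp 𝒜 q b) = F.form (signOp 𝒜 q a) b := by
  have := LinearMap.congr_homogeneous 𝒜 (F.form.compl₂ (signOp 𝒜 q))
    (F.form ∘ₗ signOp 𝒜 q) ?_ a
  · exact LinearMap.congr_fun this b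
  · intro i a ha
    apply LinearMap.ext_homogeneous 𝒜
    intro j b hb
    simp only [LinearMap.comp_apply, LinearMap.compl₂_apply, signOp_of_mem 𝒜 _ ha,
      signOp_of_mem 𝒜 _ hb, map_smul, LinearMap.smul_apply]
    by_cases hij : i = j
    · rw [hij]
    · rw [F.form_even i j hij a ha b hb, smul_zero, smul_zero]

theorem form_hproj (q : ZMod 2) (a b : A) : F.form a (hproj 𝒜 q b) = F.form (hproj 𝒜 q a) b := by
  have := LinearMap.congr_homogeneous 𝒜 (F.form.compl₂ (hproj 𝒜 q))
    (F.form ∘ₗ hproj 𝒜 q) ?_ a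
  · exact LinearMap.congr_fun this b
  · intro i a ha
    apply LinearMap.ext_homogeneous 𝒜
    intro j b hb
    simp only [LinearMap.comp_apply, LinearMap.compl₂_apply, hproj_of_mem 𝒜 ha,
      hproj_of_mem 𝒜 hb]
    by_cases hij : i = j
    · subst hij; split_ifs <;> simp
    · have := F.form_even i j hij a ha b hb
      split_ifs <;> simp [this]

/-- The adjoint of `d`, with its degree-dependent sign put into `signOp`, as needed for
`contract_adjoint`. -/
theorem form_d_right (a b : A) : F.form a (F.d b) = F.form (-F.d (signOp 𝒜 1 a)) b := by
  refine LinearMap.congr_fun (LinearMap.congr_homogeneous 𝒜 (F.form.compl₂ F.d)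
    (F.form ∘ₗ (-(F.d ∘ₗ signOp 𝒜 1))) ?_ a) b
  intro i a ha
  ext b
  simp only [LinearMap.compl₂_apply, LinearMap.comp_apply, LinearMap.neg_apply,
    signOp_of_mem 𝒜 _ ha, map_neg, map_smul, LinearMap.smul_apply, F.form_d i a ha b,
    neg_one_pow_val, smul_eq_mul]
  have := swapSign_mul_self 1 i
  linear_combination -(F.form a (F.d b)) * this

theorem d_signOp (q : ZMod 2) (a : A) :
    F.d (signOp 𝒜 q a) = swapSign q 1 • signOp 𝒜 q (F.d a) := by
  refine LinearMap.congr_homogeneous 𝒜 (F.d ∘ₗ signOp 𝒜 q) (swapSign q 1 • (signOp 𝒜 q ∘ₗ F.d)) ?_ a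
  intro i a ha
  simp only [LinearMap.comp_apply, LinearMap.smul_apply, signOp_of_mem 𝒜 _ ha,
    signOp_of_mem 𝒜 _ (F.d_mem i a ha), map_smul, swapSign_add_right, smul_smul]
  congr 1
  rw [mul_comm (swapSign q i), ← mul_assoc, swapSign_mul_self, one_mul]

variable [FiniteDimensional ℝ A]

theorem form_dual_basis (i j) : F.form (F.dual i) (F.basis j) = if j = i then 1 else 0 :=
  LinearMap.BilinForm.apply_dualBasis_left _ _ _ _

theorem sum_form_basis (a : A) : ∑ j, F.form a (F.basis j) • F.dual j = a := by
  conv_rhs => rw [← F.dual.sum_repr a]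
  refine Finset.sum_congr rfl fun j _ => ?_
  rw [dual, LinearMap.BilinForm.dualBasis_repr_apply]

theorem sum_form_dual (a : A) : ∑ j, F.form (F.dual j) a • F.basis j = a := by
  conv_rhs => rw [← F.basis.sum_repr a]
  refine Finset.sum_congr rfl fun j _ => ?_
  have h : F.form (F.dual j) (∑ i, F.basis.repr a i • F.basis i) = F.basis.repr a j := by
    simp only [map_sum, map_smul, smul_eq_mul, form_dual_basis, mul_ite, mul_one, mul_zero,
      Finset.sum_ite_eq', Finset.mem_univ, if_true]
  rw [Module.Basis.sum_repr] at h
  rw [h]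

/-- Adjoint operators may be moved from one slot of the inverse inner product to the other. -/
theorem contract_adjoint {M : Type*} [AddCommGroup M] [Module ℝ M] (B : A →ₗ[ℝ] A →ₗ[ℝ] M)
    {T T' : A →ₗ[ℝ] A} (h : ∀ a b, F.form a (T b) = F.form (T' a) b) :
    ∑ j, B (T (F.basis j)) (F.dual j) = ∑ j, B (F.basis j) (T' (F.dual j)) := by
  have e1 : ∀ j, B (T (F.basis j)) (F.dual j) =
      ∑ k, F.form (F.dual k) (T (F.basis j)) • B (F.basis k) (F.dual j) := by
    intro j
    conv_lhs => rw [← F.sum_form_dual (T (F.basis j))]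
    simp
  have e2 : ∀ k, B (F.basis k) (T' (F.dual k)) =
      ∑ j, F.form (T' (F.dual k)) (F.basis j) • B (F.basis k) (F.dual j) := by
    intro k
    conv_lhs => rw [← F.sum_form_basis (T' (F.dual k))]
    simp
  simp only [e1, e2]
  rw [Finset.sum_comm]
  simp only [h]

/-- The inverse inner product is graded symmetric. Expanded in `dual ⊗ dual`, its coefficients are
the values of the inner product on the basis, and `form_comm` transposes this matrix. -/
theorem contract_symm {M : Type*} [AddCommGroup M] [Module ℝ M] (B : A →ₗ[ℝ] A →ₗ[ℝ] M) :
    ∑ j, B (F.basis j) (F.dual j) = ∑ j, B (F.dual j) (signOp 𝒜 1 (F.basis j)) := by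
  have e1 : ∀ j, B (F.basis j) (F.dual j) =
      ∑ k, F.form (F.basis j) (F.basis k) • B (F.dual k) (F.dual j) := by
    intro j
    conv_lhs => rw [← F.sum_form_basis (F.basis j)]
    simp
  have e2 : ∀ k, B (F.dual k) (signOp 𝒜 1 (F.basis k)) =
      ∑ j, F.form (signOp 𝒜 1 (F.basis k)) (F.basis j) • B (F.dual k) (F.dual j) := by
    intro k
    conv_lhs => rw [← F.sum_form_basis (signOp 𝒜 1 (F.basis k))]
    simp
  simp only [e1, e2]
  rw [Finset.sum_comm]
  simp only [← F.form_signOp, ← F.form_comm]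

/-- The inverse inner product is even: the projections are self-adjoint, so both can be moved to the
second factor, where their product is zero. -/
theorem contract_hproj {M : Type*} [AddCommGroup M] [Module ℝ M] (B : A →ₗ[ℝ] A →ₗ[ℝ] M)
    {q r : ZMod 2} (h : q ≠ r) :
    ∑ j, B (hproj 𝒜 q (F.basis j)) (hproj 𝒜 r (F.dual j)) = 0 := by
  have := F.contract_adjoint (B.compl₂ (hproj 𝒜 r)) (F.form_hproj q)
  simp only [LinearMap.compl₂_apply] at this
  rw [this]
  refine Finset.sum_eq_zero fun j _ => ?_
  rw [hproj_of_mem 𝒜 (hproj_mem 𝒜 q _), if_neg h, map_zero]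

end DGFrobenius

/-! ### Extension to a unital Frobenius algebra -/

/-- The elements `r + a + s ω` of the unital extension of a Frobenius algebra `A` by a unit and by an
element `ω` dual to it, which is annihilated by `A`. -/
@[ext] structure DGFrobenius.Ext {A : Type*} [NonUnitalRing A] [Module ℝ A]
    {𝒜 : ZMod 2 → Submodule ℝ A} (F : DGFrobenius 𝒜) where
  unit : ℝ
  el : A
  top : ℝ

namespace DGFrobenius.Ext

variable {A : Type*} [NonUnitalRing A] [Module ℝ A] {𝒜 : ZMod 2 → Submodule ℝ A}
  {F : DGFrobenius 𝒜}

/-- The components of an element of the extension. -/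
def equivProd (F : DGFrobenius 𝒜) : F.Ext ≃ ℝ × A × ℝ where
  toFun x := (x.unit, x.el, x.top)
  invFun x := ⟨x.1, x.2.1, x.2.2⟩
  left_inv _ := rfl
  right_inv _ := rfl

instance : AddCommGroup F.Ext := (equivProd F).addCommGroup

instance : Module ℝ F.Ext := (equivProd F).module ℝ

@[simp] theorem unit_add (x y : F.Ext) : (x + y).unit = x.unit + y.unit := rfl
@[simp] theorem el_add (x y : F.Ext) : (x + y).el = x.el + y.el := rfl
@[simp] theorem top_add (x y : F.Ext) : (x + y).top = x.top + y.top := rfl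
@[simp] theorem unit_zero : (0 : F.Ext).unit = 0 := rfl
@[simp] theorem el_zero : (0 : F.Ext).el = 0 := rfl
@[simp] theorem top_zero : (0 : F.Ext).top = 0 := rfl
@[simp] theorem unit_neg (x : F.Ext) : (-x).unit = -x.unit := rfl
@[simp] theorem el_neg (x : F.Ext) : (-x).el = -x.el := rfl
@[simp] theorem top_neg (x : F.Ext) : (-x).top = -x.top := rfl
@[simp] theorem unit_smul (r : ℝ) (x : F.Ext) : (r • x).unit = r * x.unit := rfl
@[simp] theorem el_smul (r : ℝ) (x : F.Ext) : (r • x).el = r • x.el := rfl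
@[simp] theorem top_smul (r : ℝ) (x : F.Ext) : (r • x).top = r * x.top := rfl

/-- The inner product is the ω-component of the product. Associativity in this component is
invariance of the inner product, and ω is annihilated by `A` so that longer products are not
disturbed. -/
instance : Mul F.Ext where
  mul x y := ⟨x.unit * y.unit, x.unit • y.el + y.unit • x.el + x.el * y.el,
    x.unit * y.top + y.unit * x.top + F.form x.el y.el⟩

instance : One F.Ext := ⟨⟨1, 0, 0⟩⟩

@[simp] theorem unit_mul (x y : F.Ext) : (x * y).unit = x.unit * y.unit := rfl
@[simp] theorem el_mul (x y : F.Ext) :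
    (x * y).el = x.unit • y.el + y.unit • x.el + x.el * y.el := rfl
@[simp] theorem top_mul (x y : F.Ext) :
    (x * y).top = x.unit * y.top + y.unit * x.top + F.form x.el y.el := rfl
@[simp] theorem unit_one : (1 : F.Ext).unit = 1 := rfl
@[simp] theorem el_one : (1 : F.Ext).el = 0 := rfl
@[simp] theorem top_one : (1 : F.Ext).top = 0 := rfl

variable [IsScalarTower ℝ A A] [SMulCommClass ℝ A A]

instance : Ring F.Ext :=
  { (inferInstance : AddCommGroup F.Ext) with
    mul := (· * ·)
    one := 1
    left_distrib := fun x y z => by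
      ext
      · simp [mul_add]
      · simp only [el_mul, el_add, unit_add, mul_add]; module
      · simp only [top_mul, top_add, unit_add, el_add, map_add]; ring
    right_distrib := fun x y z => by
      ext
      · simp [add_mul]
      · simp only [el_mul, el_add, unit_add, add_mul]; module
      · simp only [top_mul, top_add, unit_add, el_add, map_add, LinearMap.add_apply]; ring
    zero_mul := fun x => by ext <;> simp
    mul_zero := fun x => by ext <;> simp
    mul_assoc := fun x y z => by
      ext
      · simp [mul_assoc]
      · simp only [el_mul, unit_mul, mul_add, add_mul, smul_mul_assoc, mul_smul_comm, mul_assoc]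
        module
      · simp only [top_mul, el_mul, unit_mul, map_add, LinearMap.add_apply, map_smul,
          LinearMap.smul_apply, smul_eq_mul, F.form_mul]
        ring
    one_mul := fun x => by ext <;> simp
    mul_one := fun x => by ext <;> simp }

instance : Algebra ℝ F.Ext := Algebra.ofModule
  (fun r x y => by
    ext
    · simp [mul_assoc]
    · simp only [el_mul, el_smul, unit_smul, smul_mul_assoc]; module
    · simp only [top_mul, top_smul, unit_smul, el_smul, map_smul, LinearMap.smul_apply, smul_eq_mul]
      ring)
  (fun r x y => by
    ext
    · simp [mul_left_comm]
    · simp only [el_mul, el_smul, unit_smul, mul_smul_comm]; module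
    · simp only [top_mul, top_smul, unit_smul, el_smul, map_smul, smul_eq_mul]
      ring)

/-- The inclusion of `A`. -/
def incl (F : DGFrobenius 𝒜) : A →ₗ[ℝ] F.Ext where
  toFun a := ⟨0, a, 0⟩
  map_add' a b := by ext <;> simp
  map_smul' a b := by ext <;> simp

/-- The trace. -/
def trace (F : DGFrobenius 𝒜) : F.Ext →ₗ[ℝ] ℝ where
  toFun x := x.top
  map_add' _ _ := rfl
  map_smul' _ _ := rfl

/-- The element dual to the unit. -/
def omega (F : DGFrobenius 𝒜) : F.Ext := ⟨0, 0, 1⟩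

end DGFrobenius.Ext

end

/-! ### Central elements, the operator `casimir` and the element `handle`. -/

noncomputable section

theorem zmod_two_add_of_ne {q r : ZMod 2} (h : q ≠ r) : q + r = 1 := by
  revert q r; decide

namespace DGFrobenius.Ext

variable {A : Type*} [NonUnitalRing A] [Module ℝ A] [IsScalarTower ℝ A A] [SMulCommClass ℝ A A]
  {𝒜 : ZMod 2 → Submodule ℝ A} {F : DGFrobenius 𝒜}

@[simp] theorem unit_incl (a : A) : (incl F a).unit = 0 := rfl
@[simp] theorem el_incl (a : A) : (incl F a).el = a := rfl
@[simp] theorem top_incl (a : A) : (incl F a).top = 0 := rfl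
@[simp] theorem unit_omega : (omega F).unit = 0 := rfl
@[simp] theorem el_omega : (omega F).el = 0 := rfl
@[simp] theorem top_omega : (omega F).top = 1 := rfl
theorem trace_apply (x : F.Ext) : trace F x = x.top := rfl

theorem incl_mul_incl (a b : A) :
    incl F a * incl F b = incl F (a * b) + F.form a b • omega F := by
  ext <;> simp

theorem omega_mul_incl (a : A) : omega F * incl F a = 0 := by ext <;> simp

theorem incl_mul_omega (a : A) : incl F a * omega F = 0 := by ext <;> simp

theorem omega_mul_mul_incl (x : F.Ext) (a : A) : omega F * x * incl F a = 0 := by ext <;> simp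

theorem trace_incl_mul_incl (a b : A) : trace F (incl F a * incl F b) = F.form a b := by
  simp [trace_apply]

/-- Any ω produced before the last multiplication is killed by the next letter, so only the final
inner product reaches the trace. -/
theorem cyclicProduct_eq (a b : A) (l : List A) :
    F.cyclicProduct (a :: b :: l) = trace F ((a :: b :: l).map (incl F)).prod := by
  induction l generalizing a b with
  | nil => simp [cyclicProduct, trace_incl_mul_incl]
  | cons c l ih =>
    rw [cyclicProduct, ih]
    simp only [List.map_cons, List.prod_cons]
    rw [← mul_assoc (incl F a), incl_mul_incl, add_mul, smul_mul_assoc, ← mul_assoc (omega F),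
      omega_mul_incl, zero_mul, smul_zero, add_zero]

variable [DirectSum.Decomposition 𝒜]

/-- The sign operator on the extension, whose new elements are even. -/
def grade (F : DGFrobenius 𝒜) (q : ZMod 2) : F.Ext →ₗ[ℝ] F.Ext where
  toFun x := ⟨x.unit, signOp 𝒜 q x.el, x.top⟩
  map_add' x y := by ext <;> simp
  map_smul' r x := by ext <;> simp

@[simp] theorem unit_grade (q : ZMod 2) (x : F.Ext) : (grade F q x).unit = x.unit := rfl
@[simp] theorem el_grade (q : ZMod 2) (x : F.Ext) : (grade F q x).el = signOp 𝒜 q x.el := rfl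
@[simp] theorem top_grade (q : ZMod 2) (x : F.Ext) : (grade F q x).top = x.top := rfl

@[simp] theorem grade_zero (x : F.Ext) : grade F 0 x = x := by ext <;> simp

theorem grade_incl (q : ZMod 2) (a : A) : grade F q (incl F a) = incl F (signOp 𝒜 q a) := by
  ext <;> simp

/-- `x` has degree `q`. -/
def IsHomog (q : ZMod 2) (x : F.Ext) : Prop := grade F 1 x = swapSign 1 q • x

theorem IsHomog.grade_eq {q : ZMod 2} {x : F.Ext} (hx : IsHomog q x) (r : ZMod 2) :
    grade F r x = swapSign r q • x := by
  rcases zmod_two_cases r with rfl | rfl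
  · simp
  · exact hx

theorem isHomog_incl {q : ZMod 2} {a : A} (ha : a ∈ 𝒜 q) : IsHomog q (incl F a) := by
  rw [IsHomog, grade_incl, signOp_of_mem 𝒜 _ ha, map_smul]

theorem trace_comm (x y : F.Ext) : trace F (x * y) = trace F (y * grade F 1 x) := by
  simp only [trace_apply, top_mul, unit_grade, el_grade, top_grade, F.form_comm x.el]
  ring

/-- The element ω is even, so an odd element has no ω-component. -/
theorem IsHomog.trace_eq_zero {x : F.Ext} (hx : IsHomog 1 x) : trace F x = 0 := by
  have h := congrArg top hx
  simp only [top_grade, top_smul, swapSign] at h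
  norm_num at h
  rw [trace_apply]
  linarith

variable [SetLike.GradedMul 𝒜]

theorem grade_mul (q : ZMod 2) (x y : F.Ext) : grade F q (x * y) = grade F q x * grade F q y := by
  ext
  · simp
  · simp [signOp_mul]
  · simp only [top_grade, top_mul, unit_grade, el_grade, F.form_signOp, signOp_signOp]
    rw [CharTwo.add_self_eq_zero, signOp_zero]

theorem isHomog_one : IsHomog 0 (1 : F.Ext) := by ext <;> simp

theorem IsHomog.mul {q r : ZMod 2} {x y : F.Ext} (hx : IsHomog q x) (hy : IsHomog r y) :
    IsHomog (q + r) (x * y) := by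
  rw [IsHomog, grade_mul, hx.grade_eq, hy.grade_eq, smul_mul_smul_comm, swapSign_add_right]

/-- For different parities both traces are traces of odd elements and vanish; for equal parities the
sign in `Ext.trace_comm` is the Koszul sign. -/
theorem IsHomog.trace_comm {q r : ZMod 2} {x y : F.Ext} (hx : IsHomog q x) (hy : IsHomog r y) :
    trace F (x * y) = swapSign q r * trace F (y * x) := by
  rw [Ext.trace_comm, hx.grade_eq, mul_smul_comm, map_smul, smul_eq_mul]
  by_cases h : q = r
  · subst h
    rcases zmod_two_cases q with rfl | rfl <;> simp
  · have h1 : IsHomog 1 (y * x) := by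
      have := hy.mul hx
      have e : r + q = 1 := zmod_two_add_of_ne (Ne.symm h)
      rwa [e] at this
    rw [h1.trace_eq_zero, mul_zero, mul_zero]

/-- Products of homogeneous elements of `A`. -/
inductive IsWord (F : DGFrobenius 𝒜) : ZMod 2 → F.Ext → Prop
  | one : IsWord F 0 1
  | cons {i j : ZMod 2} {a : A} {x : F.Ext} (ha : a ∈ 𝒜 i) (hx : IsWord F j x) :
      IsWord F (i + j) (incl F a * x)

theorem IsWord.isHomog {i : ZMod 2} {x : F.Ext} (hx : IsWord F i x) : IsHomog i x := by
  induction hx with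
  | one => exact isHomog_one
  | cons ha _ ih => exact (isHomog_incl ha).mul ih

/-- `z`, of degree `q`, commutes with the elements of `A` in the graded sense. -/
structure IsCentral (q : ZMod 2) (z : F.Ext) : Prop where
  isHomog : IsHomog q z
  comm : ∀ a, incl F a * z = z * incl F (signOp 𝒜 q a)

theorem isCentral_one : IsCentral 0 (1 : F.Ext) := ⟨isHomog_one, fun a => by simp⟩

theorem IsCentral.mul {q r : ZMod 2} {x y : F.Ext} (hx : IsCentral q x) (hy : IsCentral r y) :
    IsCentral (q + r) (x * y) :=
  ⟨hx.isHomog.mul hy.isHomog, fun a => by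
    rw [← mul_assoc, hx.comm, mul_assoc, hy.comm, signOp_signOp, add_comm, mul_assoc]⟩

theorem IsCentral.pow {x : F.Ext} (hx : IsCentral 0 x) (n : ℕ) : IsCentral 0 (x ^ n) := by
  induction n with
  | zero => rw [pow_zero]; exact isCentral_one
  | succ n ih => rw [pow_succ]; simpa using ih.mul hx

theorem IsCentral.word_mul {q i : ZMod 2} {z x : F.Ext} (hz : IsCentral q z) (hx : IsWord F i x) :
    x * z = swapSign i q • (z * x) := by
  induction hx with
  | one => simp
  | @cons i j a x ha hx ih =>
    rw [mul_assoc, ih, mul_smul_comm, ← mul_assoc, hz.comm, signOp_of_mem 𝒜 _ ha, map_smul,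
      mul_smul_comm, smul_mul_assoc, smul_smul, swapSign_add_left, swapSign_comm q i, mul_comm,
      mul_assoc z]

variable [FiniteDimensional ℝ A]

/-- The bilinear map `a, b ↦ a x b`. -/
def sandwich (x : F.Ext) : F.Ext →ₗ[ℝ] F.Ext →ₗ[ℝ] F.Ext :=
  LinearMap.mul ℝ F.Ext ∘ₗ LinearMap.mulRight ℝ x

@[simp] theorem sandwich_apply (x u v : F.Ext) : sandwich x u v = u * x * v := rfl

/-- In `A` itself the letter slides because right multiplication by `y` is adjoint to left
multiplication. In the extension the products also create ω-terms, which add up to `ω ⊗ y` on the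
left and to `y ⊗ ω` on the right; the hypothesis `h` says that `f` does not distinguish them. -/
theorem slide_left {M : Type*} [AddCommGroup M] [Module ℝ M] (f : F.Ext →ₗ[ℝ] F.Ext →ₗ[ℝ] M)
    (y : A) (h : f (omega F) (incl F y) = f (incl F y) (omega F)) :
    ∑ j, f (incl F y * incl F (F.basis j)) (incl F (F.dual j)) =
      ∑ j, f (incl F (F.basis j)) (incl F (F.dual j) * incl F y) := by
  have h1 := F.contract_adjoint (f.compl₁₂ (incl F) (incl F)) (T := LinearMap.mulLeft ℝ y)
    (T' := LinearMap.mulRight ℝ y) (fun a b => F.form_mul a y b)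
  simp only [LinearMap.compl₁₂_apply, LinearMap.mulLeft_apply, LinearMap.mulRight_apply] at h1
  simp only [incl_mul_incl, map_add, map_smul, LinearMap.add_apply, LinearMap.smul_apply,
    Finset.sum_add_distrib, h1]
  congr 1
  conv_lhs => enter [2, j]; rw [← map_smul, ← map_smul]
  conv_rhs => enter [2, j]; rw [← LinearMap.smul_apply, ← map_smul, ← map_smul]
  rw [← map_sum, ← map_sum, F.sum_form_basis, h]
  conv_lhs => rw [← F.sum_form_dual y]
  simp only [map_sum, LinearMap.sum_apply]

/-- The letter now stands between the two factors, and the graded symmetry of the inner product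
costs a sign. The hypothesis `h` again matches the two ω-terms, here `ω ⊗ ±y` and `y ⊗ ω`. -/
theorem slide_right {M : Type*} [AddCommGroup M] [Module ℝ M] (f : F.Ext →ₗ[ℝ] F.Ext →ₗ[ℝ] M)
    (y : A) (h : f (omega F) (incl F (signOp 𝒜 1 y)) = f (incl F y) (omega F)) :
    ∑ j, f (incl F (F.basis j) * incl F y) (incl F (F.dual j)) =
      ∑ j, f (incl F (F.basis j)) (incl F (signOp 𝒜 1 y) * incl F (F.dual j)) := by
  have h1 := F.contract_adjoint (f.compl₁₂ (incl F) (incl F)) (T := LinearMap.mulRight ℝ y)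
    (T' := LinearMap.mulLeft ℝ (signOp 𝒜 1 y)) (fun a b => by
      simp only [LinearMap.mulRight_apply, LinearMap.mulLeft_apply]
      rw [F.form_mul, F.form_comm, signOp_mul, F.form_mul, F.form_signOp, signOp_mul,
        signOp_signOp, CharTwo.add_self_eq_zero, signOp_zero])
  simp only [LinearMap.compl₁₂_apply, LinearMap.mulLeft_apply, LinearMap.mulRight_apply] at h1
  simp only [incl_mul_incl, map_add, map_smul, LinearMap.add_apply, LinearMap.smul_apply,
    Finset.sum_add_distrib, h1]
  congr 1
  conv_lhs => enter [2, j]; rw [F.form_comm, F.form_signOp, ← map_smul, ← map_smul]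
  conv_rhs => enter [2, j]; rw [F.form_comm, signOp_signOp, CharTwo.add_self_eq_zero, signOp_zero,
                ← LinearMap.smul_apply, ← map_smul, ← map_smul]
  rw [← map_sum, ← map_sum, F.sum_form_basis, h]
  conv_lhs => rw [← F.sum_form_dual y]
  simp only [map_sum, LinearMap.sum_apply]

theorem grade_contract {M : Type*} [AddCommGroup M] [Module ℝ M] (q : ZMod 2)
    (f : F.Ext →ₗ[ℝ] F.Ext →ₗ[ℝ] M) :
    ∑ j, f (incl F (signOp 𝒜 q (F.basis j))) (incl F (F.dual j)) =
      ∑ j, f (incl F (F.basis j)) (incl F (signOp 𝒜 q (F.dual j))) :=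
  F.contract_adjoint (f.compl₁₂ (incl F) (incl F)) (F.form_signOp q)

/-- The sum `∑ j, ± basis j * x * dual j` for `x` of degree `q`. -/
def casimirOf (F : DGFrobenius 𝒜) (q : ZMod 2) : F.Ext →ₗ[ℝ] F.Ext :=
  ∑ j, LinearMap.mulRight ℝ (incl F (signOp 𝒜 q (F.dual j))) ∘ₗ
    LinearMap.mulLeft ℝ (incl F (F.basis j))

theorem casimirOf_apply (q : ZMod 2) (x : F.Ext) :
    casimirOf F q x = ∑ j, incl F (F.basis j) * x * incl F (signOp 𝒜 q (F.dual j)) := by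
  simp [casimirOf]

/-- The operator `x ↦ ∑ j, ± basis j * x * dual j`. -/
def casimir (F : DGFrobenius 𝒜) : F.Ext →ₗ[ℝ] F.Ext :=
  (1 / 2 : ℝ) • (casimirOf F 0 ∘ₗ (LinearMap.id + grade F 1) +
    casimirOf F 1 ∘ₗ (LinearMap.id - grade F 1))

theorem IsHomog.casimir_eq {q : ZMod 2} {x : F.Ext} (hx : IsHomog q x) :
    casimir F x = ∑ j, incl F (F.basis j) * x * incl F (signOp 𝒜 q (F.dual j)) := by
  rw [← casimirOf_apply]
  simp only [casimir, LinearMap.smul_apply, LinearMap.add_apply, LinearMap.comp_apply,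
    LinearMap.sub_apply, LinearMap.id_apply, hx.grade_eq]
  rcases zmod_two_cases q with rfl | rfl
  · simp only [swapSign_zero_right, one_smul, sub_self, map_zero, map_add]
    module
  · simp only [show swapSign 1 1 = -1 by simp [swapSign], map_sub, map_add, map_smul]
    module

theorem IsHomog.casimir {q : ZMod 2} {x : F.Ext} (hx : IsHomog q x) :
    IsHomog q (casimir F x) := by
  rw [IsHomog, hx.casimir_eq, map_sum]
  simp only [grade_mul, grade_incl, signOp_signOp, add_comm (1 : ZMod 2)]
  simp only [← signOp_signOp]
  have := grade_contract 1 ((sandwich (grade F 1 x)).compl₂ (grade F (q + 1)))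
  simp only [LinearMap.compl₂_apply, sandwich_apply, grade_incl, ← signOp_signOp] at this
  rw [this]
  simp only [signOp_signOp, CharTwo.add_self_eq_zero, signOp_zero, add_assoc, add_zero, hx.grade_eq,
    mul_smul_comm, smul_mul_assoc, Finset.smul_sum]

/-- A letter to the left of `b_j` slides through the inverse inner product and reappears to the
right of `b^j`. The ω-terms vanish because they are enclosed by a letter of `A` on the other side of
`x`. -/
theorem IsHomog.isCentral_casimir {q : ZMod 2} {x : F.Ext} (hx : IsHomog q x) :
    IsCentral q (Ext.casimir F x) := by
  refine ⟨hx.casimir, fun a => ?_⟩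
  rw [hx.casimir_eq, Finset.mul_sum, Finset.sum_mul]
  have := slide_left ((sandwich x).compl₂ (grade F q)) a (by
    simp [grade_incl, omega_mul_mul_incl]
    ext <;> simp)
  simp only [LinearMap.compl₂_apply, sandwich_apply, grade_incl, grade_mul] at this
  simp only [← mul_assoc] at this ⊢
  exact this

/-- The letter next to `b_j` slides to the other end, next to `b^j`. Hence `casimir` of a word
depends, up to sign, on the cyclic word only, as it must for a boundary circle. -/
theorem casimir_incl_mul {i q : ZMod 2} {a : A} (ha : a ∈ 𝒜 i) {x : F.Ext} (hx : IsHomog q x) :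
    casimir F (incl F a * x) = swapSign i q • casimir F (x * incl F a) := by
  have ha' := isHomog_incl (F := F) ha
  rw [(ha'.mul hx).casimir_eq, (hx.mul ha').casimir_eq]
  have := slide_right ((sandwich x).compl₂ (grade F (i + q))) a (by
    simp [grade_incl, omega_mul_mul_incl]
    ext <;> simp)
  simp only [LinearMap.compl₂_apply, sandwich_apply, grade_incl, grade_mul] at this
  simp only [← mul_assoc] at this ⊢
  rw [this, Finset.smul_sum]
  refine Finset.sum_congr rfl fun j _ => ?_
  rw [signOp_of_mem 𝒜 _ ha, map_smul, signOp_of_mem 𝒜 _ ha, smul_smul, map_smul, mul_smul_comm,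
    smul_mul_assoc, add_comm q i]
  congr 1
  rcases zmod_two_cases i with rfl | rfl <;> rcases zmod_two_cases q with rfl | rfl <;>
    simp [swapSign, show (1 : ZMod 2) + 1 = 0 from rfl]

theorem IsCentral.mul_casimir {q i : ZMod 2} {x z : F.Ext} (hz : IsCentral q z) (hx : IsHomog i x)
    : casimir F (x * z) = casimir F x * z := by
  rw [(hx.mul hz.isHomog).casimir_eq, hx.casimir_eq, Finset.sum_mul]
  refine Finset.sum_congr rfl fun j _ => ?_
  rw [mul_assoc _ _ z, hz.comm, signOp_signOp, add_comm q i]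
  simp only [mul_assoc]

/-- The two letters that enclose `x` have equal parity, so their signs cancel and only that of `x`
remains. -/
theorem IsCentral.casimir_mul {q i : ZMod 2} {x z : F.Ext} (hz : IsCentral q z) (hx : IsWord F i x) :
    casimir F x * z = swapSign i q • (z * casimir F x) := by
  rw [hx.isHomog.casimir_eq, Finset.mul_sum, Finset.sum_mul, Finset.smul_sum]
  have := grade_contract q ((sandwich x).compl₂ (grade F (q + i)))
  simp only [LinearMap.compl₂_apply, sandwich_apply, grade_incl] at this
  have e : ∀ j, incl F (F.basis j) * x * incl F (signOp 𝒜 i (F.dual j)) * z = swapSign i q •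
      (z * (incl F (signOp 𝒜 q (F.basis j)) * x * incl F (signOp 𝒜 (q + i) (F.dual j)))) := by
    intro j
    rw [mul_assoc, hz.comm, signOp_signOp, ← mul_assoc, mul_assoc _ x z, hz.word_mul hx,
      mul_smul_comm, ← mul_assoc _ z x, hz.comm, smul_mul_assoc, mul_assoc, mul_assoc,
      swapSign_comm]
    simp only [mul_assoc]
  simp only [e, ← Finset.smul_sum, ← Finset.mul_sum, this, signOp_signOp]
  rw [add_comm q i, add_assoc, CharTwo.add_self_eq_zero, add_zero]

/-- The first block of a product of words can be exchanged with another one. -/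
theorem trace_mul_casimir_mul {q r s : ZMod 2} {x y z : F.Ext} (hx : IsWord F q x)
    (hy : IsWord F r y) (hz : IsCentral s z) : trace F (x * casimir F y * z) =
      swapSign q r * trace F (y * casimir F x * z) := by
  -- The case without `z`. For equal parities the trace of `x b_j y b^j` is rotated until `b_j`
  -- stands last; symmetry of the inverse inner product then exchanges `b_j` and `b^j`. For
  -- different parities both traces are odd and vanish.
  have key : ∀ {q r : ZMod 2} {x y : F.Ext}, IsHomog q x → IsHomog r y →
      trace F (x * casimir F y) = swapSign q r * trace F (y * casimir F x) := by
    intro q r x y hx hy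
    by_cases h : q = r
    · subst h
      rw [hy.casimir_eq, hx.casimir_eq, Finset.mul_sum, Finset.mul_sum, map_sum, map_sum]
      have e1 : ∀ j, trace F (x * (incl F (F.basis j) * y * incl F (signOp 𝒜 q (F.dual j)))) =
          trace F (y * grade F q (incl F (F.dual j)) * grade F 1 x *
            grade F 1 (incl F (F.basis j))) := by
        intro j
        rw [← mul_assoc, ← mul_assoc, mul_assoc _ y, Ext.trace_comm, grade_mul, grade_incl,
          grade_incl, ← mul_assoc]
      let B : F.Ext →ₗ[ℝ] F.Ext →ₗ[ℝ] ℝ :=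
        ((sandwich (grade F 1 x)).compl₁₂ (LinearMap.mulLeft ℝ y) (grade F 1)).compr₂ (trace F)
      have hB : ∀ u v, B u v = trace F (y * u * grade F 1 x * grade F 1 v) := fun u v => rfl
      have e2 := F.contract_symm ((B.flip.compl₂ (grade F q)).compl₁₂ (incl F) (incl F))
      have e3 := grade_contract (q + 1) B
      simp only [LinearMap.compl₁₂_apply, LinearMap.compl₂_apply, LinearMap.flip_apply, hB,
        grade_incl, signOp_signOp] at e2 e3
      simp only [e1, grade_incl]
      rw [e2, e3, Finset.mul_sum]
      refine Finset.sum_congr rfl fun j _ => ?_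
      rw [hx.grade_eq, show 1 + (q + 1) = q by
        rw [add_comm, add_assoc, CharTwo.add_self_eq_zero, add_zero]]
      simp only [mul_smul_comm, smul_mul_assoc, map_smul, smul_eq_mul, mul_assoc]
      congr 1
      rcases zmod_two_cases q with rfl | rfl <;> simp
    · have e : q + r = 1 := zmod_two_add_of_ne h
      have h1 := (hx.mul hy.casimir)
      have h2 := (hy.mul hx.casimir)
      rw [e] at h1
      rw [add_comm, e] at h2
      rw [h1.trace_eq_zero, h2.trace_eq_zero, mul_zero]
  -- The central factor is absorbed into the word `x` before the exchange and pulled out of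
  -- `casimir` afterwards.
  rw [mul_assoc, hz.casimir_mul hy, mul_smul_comm, map_smul, ← mul_assoc,
    key (hx.isHomog.mul hz.isHomog) hy.isHomog, hz.mul_casimir hx.isHomog, ← mul_assoc,
    smul_eq_mul, swapSign_add_left, swapSign_comm s r]
  linear_combination (swapSign q r * trace F (y * casimir F x * z)) * swapSign_mul_self r s

/-- The sum `∑ j k, ± basis j * basis k * dual j * dual k`. -/
def handle (F : DGFrobenius 𝒜) : F.Ext := ∑ j, incl F (F.basis j) * casimir F (incl F (F.dual j))

/-- Together with the vanishing of `casimir` on multiples of ω below, this removes the ω-terms when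
a letter slides into or out of `casimir`. -/
theorem omega_mul_casimir (x : F.Ext) : omega F * casimir F x = 0 := by
  have h : ∀ q y, omega F * casimirOf F q y = 0 := by
    intro q y
    rw [casimirOf_apply, Finset.mul_sum]
    refine Finset.sum_eq_zero fun j _ => ?_
    rw [mul_assoc, ← mul_assoc, omega_mul_incl, zero_mul]
  simp only [casimir, LinearMap.smul_apply, LinearMap.add_apply, LinearMap.comp_apply, mul_add, h,
    mul_smul_comm, add_zero, smul_zero]

theorem casimir_omega_mul (x : F.Ext) : casimir F (omega F * x) = 0 := by
  have h : omega F * x = x.unit • omega F := by ext <;> simp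
  have h0 : IsHomog 0 (omega F) := by ext <;> simp
  rw [h, map_smul, h0.casimir_eq]
  simp [incl_mul_omega]

/-- The letters of `y` leave `casimir` one by one: each slides from behind `b^j` to the front of
`b_j`. -/
theorem IsWord.mul_handle {i : ZMod 2} {y : F.Ext} (hy : IsWord F i y) :
    ∑ j, incl F (F.basis j) * casimir F (incl F (F.dual j) * y) = y * handle F := by
  induction hy with
  | one => simp [handle]
  | @cons i j a x ha hx ih =>
    have := slide_left ((LinearMap.mul ℝ F.Ext).compl₂ (casimir F ∘ₗ LinearMap.mulRight ℝ x)) a (by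
      simp [omega_mul_casimir, casimir_omega_mul])
    simp only [LinearMap.compl₂_apply, LinearMap.mul_apply', LinearMap.comp_apply,
      LinearMap.mulRight_apply, mul_assoc] at this
    rw [← this, ← Finset.mul_sum, ih, mul_assoc]

/-- With signs suppressed, `a H = ∑ b_j C(b^j a) = ∑ b_j C(a b^j) = ∑ b_j a C(b^j) = ∑ b_j C(b^j) a
= H a`. The letter enters `casimir` by `IsWord.mul_handle`, is rotated there, slides out in front of
it, and passes it because `casimir` is central. -/
theorem isCentral_handle : IsCentral 0 (handle F) := by
  constructor
  · rw [IsHomog, handle, map_sum, swapSign_zero_right, one_smul]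
    have h : ∀ b, grade F 1 (casimir F (incl F b)) = casimir F (incl F (signOp 𝒜 1 b)) := by
      intro b
      refine LinearMap.congr_homogeneous 𝒜 (grade F 1 ∘ₗ casimir F ∘ₗ incl F)
        (casimir F ∘ₗ incl F ∘ₗ signOp 𝒜 1) ?_ b
      intro i b hb
      simp only [LinearMap.comp_apply, signOp_of_mem 𝒜 _ hb, map_smul]
      exact (isHomog_incl hb).casimir
    have := grade_contract 1 (((LinearMap.mul ℝ F.Ext).compl₂ (casimir F ∘ₗ grade F 1)))
    simp only [LinearMap.compl₂_apply, LinearMap.mul_apply', LinearMap.comp_apply, grade_incl,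
      signOp_signOp, CharTwo.add_self_eq_zero, signOp_zero] at this
    simp only [grade_mul, h, grade_incl, this]
  · have key : ∀ i, ∀ a ∈ 𝒜 i, incl F a * handle F = handle F * incl F a := by
      intro i a ha
      have h1 : ∀ b, casimir F (incl F b * incl F a) =
          casimir F (incl F a * incl F (signOp 𝒜 i b)) := by
        intro b
        refine LinearMap.congr_homogeneous 𝒜 (casimir F ∘ₗ LinearMap.mulRight ℝ (incl F a) ∘ₗ incl F)
          (casimir F ∘ₗ LinearMap.mulLeft ℝ (incl F a) ∘ₗ incl F ∘ₗ signOp 𝒜 i) ?_ b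
        intro j b hb
        simp only [LinearMap.comp_apply, signOp_of_mem 𝒜 _ hb, map_smul, LinearMap.mulLeft_apply,
          LinearMap.mulRight_apply]
        rw [casimir_incl_mul hb (isHomog_incl ha), swapSign_comm]
      have h2 : ∀ b, incl F a * casimir F (incl F (signOp 𝒜 i b)) =
          casimir F (incl F b) * incl F a := by
        intro b
        refine LinearMap.congr_homogeneous 𝒜 (LinearMap.mulLeft ℝ (incl F a) ∘ₗ casimir F ∘ₗ incl F ∘ₗ
          signOp 𝒜 i) (LinearMap.mulRight ℝ (incl F a) ∘ₗ casimir F ∘ₗ incl F) ?_ b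
        intro j b hb
        simp only [LinearMap.comp_apply, signOp_of_mem 𝒜 _ hb, map_smul, LinearMap.mulLeft_apply,
          LinearMap.mulRight_apply]
        rw [(isHomog_incl hb).isCentral_casimir.comm, signOp_of_mem 𝒜 _ ha, map_smul, mul_smul_comm,
          smul_smul, swapSign_comm, swapSign_mul_self, one_smul]
      have hw : IsWord F (i + 0) (incl F a * 1) := IsWord.cons ha IsWord.one
      have h3 := hw.mul_handle
      simp only [mul_one, h1] at h3
      have h4 := slide_right ((LinearMap.mul ℝ F.Ext).compl₂ (casimir F ∘ₗ grade F i)) a (by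
        simp only [LinearMap.compl₂_apply, LinearMap.mul_apply', LinearMap.comp_apply,
          omega_mul_casimir]
        have h : grade F i (omega F) = omega F * 1 := by ext <;> simp
        rw [h, casimir_omega_mul, mul_zero])
      simp only [LinearMap.compl₂_apply, LinearMap.mul_apply', LinearMap.comp_apply, grade_mul,
        grade_incl, mul_assoc, h2] at h4
      rw [← h3, handle, Finset.sum_mul]
      simp only [mul_assoc, h4]
      refine Finset.sum_congr rfl fun j _ => ?_
      rw [signOp_of_mem 𝒜 _ ha, map_smul, signOp_of_mem 𝒜 _ ha, smul_smul]
      have : swapSign 1 i * swapSign i i = 1 := by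
        rcases zmod_two_cases i with rfl | rfl <;> simp
      rw [this, one_smul]
    intro a
    rw [signOp_zero]
    refine LinearMap.congr_homogeneous 𝒜 (LinearMap.mulRight ℝ (handle F) ∘ₗ incl F)
      (LinearMap.mulLeft ℝ (handle F) ∘ₗ incl F) ?_ a
    exact key

/-- This is the gluing of two boundary circles of one surface, with words `x` and `y`: the circles
become one and a handle appears. The central factor is moved to the left of `x`, and then
`IsWord.mul_handle` applies. -/
theorem sum_mul_casimir_mul {i k : ZMod 2} {x y : F.Ext} (hx : IsWord F i x) (hy : IsWord F k y) :
    ∑ j, incl F (F.basis j) * x * casimir F (incl F (signOp 𝒜 i (F.dual j)) * y) =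
      swapSign i k • (y * x * handle F) := by
  have h : ∀ b, x * casimir F (incl F (signOp 𝒜 i b) * y) =
      swapSign i k • (casimir F (incl F b * y) * x) := by
    intro b
    refine LinearMap.congr_homogeneous 𝒜 (LinearMap.mulLeft ℝ x ∘ₗ casimir F ∘ₗ
      LinearMap.mulRight ℝ y ∘ₗ incl F ∘ₗ signOp 𝒜 i) (swapSign i k • (LinearMap.mulRight ℝ x ∘ₗ
        casimir F ∘ₗ LinearMap.mulRight ℝ y ∘ₗ incl F)) ?_ b
    intro j b hb
    simp only [LinearMap.comp_apply, signOp_of_mem 𝒜 _ hb, map_smul, LinearMap.mulLeft_apply,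
      LinearMap.mulRight_apply, LinearMap.smul_apply, smul_mul_assoc]
    rw [((isHomog_incl hb).mul hy.isHomog).isCentral_casimir.word_mul hx, smul_smul,
      swapSign_add_right, ← mul_assoc, swapSign_mul_self, one_mul]
  simp only [mul_assoc, h, mul_smul_comm, ← Finset.smul_sum]
  simp only [← mul_assoc, ← Finset.sum_mul]
  rw [hy.mul_handle, mul_assoc, mul_assoc, isCentral_handle.word_mul hx, swapSign_zero_right,
    one_smul]

/-- The differential of the extension. -/
def diff (F : DGFrobenius 𝒜) : F.Ext →ₗ[ℝ] F.Ext where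
  toFun x := ⟨0, F.d x.el, 0⟩
  map_add' x y := by ext <;> simp
  map_smul' r x := by ext <;> simp

theorem diff_incl (a : A) : diff F (incl F a) = incl F (F.d a) := rfl

theorem diff_one : diff F 1 = 0 := by ext <;> simp [diff]

theorem trace_diff (x : F.Ext) : trace F (diff F x) = 0 := rfl

theorem d_mul_signOp (a b : A) : F.d (a * b) = F.d a * b + signOp 𝒜 1 a * F.d b := by
  refine LinearMap.congr_homogeneous 𝒜 (F.d ∘ₗ LinearMap.mulRight ℝ b)
    (LinearMap.mulRight ℝ b ∘ₗ F.d + LinearMap.mulRight ℝ (F.d b) ∘ₗ signOp 𝒜 1) ?_ a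
  intro i a ha
  simp [F.d_mul i a ha, neg_one_pow_val, signOp_of_mem 𝒜 _ ha]

/-- In the component of ω the rule says that `d` is skew-adjoint for the inner product. -/
theorem diff_mul (x y : F.Ext) : diff F (x * y) = diff F x * y + grade F 1 x * diff F y := by
  ext
  · simp [diff]
  · simp only [diff, LinearMap.coe_mk, AddHom.coe_mk, el_mul, map_add, map_smul, d_mul_signOp,
      el_add, el_grade, unit_grade]
    module
  · simp only [diff, LinearMap.coe_mk, AddHom.coe_mk, top_mul, top_add, el_grade, top_grade,
      unit_grade, F.form_d_right, signOp_signOp, CharTwo.add_self_eq_zero, signOp_zero, map_neg,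
      LinearMap.neg_apply]
    ring

theorem IsHomog.diff {q : ZMod 2} {x : F.Ext} (hx : IsHomog q x) :
    IsHomog (q + 1) (diff F x) := by
  have h := congrArg (Ext.diff F) hx
  have e : Ext.diff F (grade F 1 x) = - grade F 1 (Ext.diff F x) := by
    ext
    · simp [Ext.diff, grade]
    · simp [Ext.diff, grade, F.d_signOp, show swapSign 1 1 = -1 by simp [swapSign]]
    · simp [Ext.diff, grade]
  rw [e, map_smul] at h
  rw [IsHomog, swapSign_add_right, show swapSign 1 1 = -1 by simp [swapSign], mul_neg_one, neg_smul,
    ← h, neg_neg]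

/-- The inverse inner product is a cycle, since `d` is skew-adjoint in the graded sense. Hence
`casimir` commutes with `diff` and `handle` is closed. -/
theorem diff_contract {M : Type*} [AddCommGroup M] [Module ℝ M] (f : F.Ext →ₗ[ℝ] F.Ext →ₗ[ℝ] M) :
    ∑ j, f (incl F (F.d (F.basis j))) (incl F (F.dual j)) =
      -∑ j, f (incl F (F.basis j)) (incl F (F.d (signOp 𝒜 1 (F.dual j)))) := by
  have := F.contract_adjoint (f.compl₁₂ (incl F) (incl F)) (T' := -(F.d ∘ₗ signOp 𝒜 1))
    F.form_d_right
  simpa using this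

theorem IsHomog.diff_casimir {q : ZMod 2} {x : F.Ext} (hx : IsHomog q x) :
    Ext.diff F (Ext.casimir F x) = Ext.casimir F (Ext.diff F x) := by
  rw [hx.casimir_eq, hx.diff.casimir_eq, map_sum]
  simp only [diff_mul, diff_incl, grade_mul, grade_incl, add_mul, Finset.sum_add_distrib]
  have h1 := diff_contract ((sandwich x).compl₂ (grade F q))
  have h2 := grade_contract 1 (sandwich (Ext.diff F x) |>.compl₂ (grade F q))
  have h3 := grade_contract 1 (sandwich (grade F 1 x) |>.compl₂ (Ext.diff F ∘ₗ grade F q))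
  simp only [LinearMap.compl₂_apply, sandwich_apply, grade_incl, LinearMap.comp_apply,
    diff_incl, signOp_signOp] at h1 h2 h3
  rw [h1, h2, h3, add_right_comm, add_eq_right, neg_add_eq_zero]
  refine Finset.sum_congr rfl fun j _ => ?_
  rw [hx.grade_eq, F.d_signOp, F.d_signOp]
  simp only [map_smul, signOp_signOp, mul_smul_comm, smul_mul_assoc, smul_smul]
  congr 1
  rcases zmod_two_cases q with rfl | rfl <;> simp [swapSign, show (1 : ZMod 2) + 1 = 0 from rfl]

theorem diff_handle : diff F (handle F) = 0 := by
  rw [handle, map_sum]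
  have h : ∀ b, diff F (casimir F (incl F b)) = casimir F (incl F (F.d b)) := by
    intro b
    refine LinearMap.congr_homogeneous 𝒜 (diff F ∘ₗ casimir F ∘ₗ incl F)
      (casimir F ∘ₗ incl F ∘ₗ F.d) ?_ b
    intro i b hb
    exact (isHomog_incl hb).diff_casimir
  simp only [diff_mul, diff_incl, grade_incl, h, Finset.sum_add_distrib]
  have h1 := diff_contract ((LinearMap.mul ℝ F.Ext).compl₂ (casimir F))
  have h2 := grade_contract 1 ((LinearMap.mul ℝ F.Ext).compl₂ (casimir F ∘ₗ diff F))
  simp only [LinearMap.compl₂_apply, LinearMap.mul_apply', LinearMap.comp_apply, diff_incl] at h1 h2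
  rw [h1, h2, neg_add_cancel]

end DGFrobenius.Ext

end

/-! ### The trace of a list of boundary words: symmetry, multilinearity and closedness. -/

noncomputable section

namespace DGFrobenius.Ext

variable {A : Type*} [NonUnitalRing A] [Module ℝ A] [IsScalarTower ℝ A A] [SMulCommClass ℝ A A]
  {𝒜 : ZMod 2 → Submodule ℝ A} {F : DGFrobenius 𝒜} [DirectSum.Decomposition 𝒜]
  [SetLike.GradedMul 𝒜] [FiniteDimensional ℝ A] {I : Type}

theorem casimir_word_mul {q r : ZMod 2} {x y : F.Ext} (hx : IsWord F q x) (hy : IsHomog r y) :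
    casimir F (x * y) = swapSign q r • casimir F (y * x) := by
  induction hx generalizing r y with
  | one => simp
  | @cons i j a x ha hx ih =>
    rw [mul_assoc, casimir_incl_mul ha (hx.isHomog.mul hy), mul_assoc x,
      ih (hy.mul (isHomog_incl ha)), smul_smul, mul_assoc y]
    congr 1
    rw [swapSign_add_left, swapSign_add_right, swapSign_add_right, swapSign_comm j i]
    linear_combination (swapSign i r * swapSign j r) * swapSign_mul_self i j

theorem trace_word_mul {q r s : ZMod 2} {x y z : F.Ext} (hx : IsWord F q x) (hy : IsHomog r y)
    (hz : IsCentral s z) : trace F (x * y * z) = swapSign q r * trace F (y * x * z) := by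
  rw [mul_assoc, hx.isHomog.trace_comm (hy.mul hz.isHomog), mul_assoc y x z, hz.word_mul hx,
    mul_smul_comm, map_smul, smul_eq_mul, swapSign_add_right, mul_assoc,
    mul_assoc y]

/-- The product of the elements `a i` over a list. -/
def wordProd (F : DGFrobenius 𝒜) (w : List I) (a : I → A) : F.Ext :=
  (w.map fun i => incl F (a i)).prod

@[simp] theorem wordProd_nil (a : I → A) : wordProd F [] a = 1 := rfl

@[simp] theorem wordProd_cons (i : I) (w : List I) (a : I → A) :
    wordProd F (i :: w) a = incl F (a i) * wordProd F w a := by simp [wordProd]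

@[simp] theorem wordProd_append (v w : List I) (a : I → A) :
    wordProd F (v ++ w) a = wordProd F v a * wordProd F w a := by simp [wordProd]

/-- The product over the words `w` of the list of the images of their products under `casimir`. -/
def blockProd (F : DGFrobenius 𝒜) (ws : List (List I)) (a : I → A) : F.Ext :=
  (ws.map fun w => casimir F (wordProd F w a)).prod

@[simp] theorem blockProd_nil (a : I → A) : blockProd F [] a = 1 := rfl

@[simp] theorem blockProd_cons (w : List I) (ws : List (List I)) (a : I → A) :
    blockProd F (w :: ws) a = casimir F (wordProd F w a) * blockProd F ws a := by simp [blockProd]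

@[simp] theorem blockProd_append (vs ws : List (List I)) (a : I → A) :
    blockProd F (vs ++ ws) a = blockProd F vs a * blockProd F ws a := by simp [blockProd]

/-- The value of the surface of genus `g` whose boundary circles carry the words of the list. -/
def surfaceTrace (F : DGFrobenius 𝒜) : List (List I) → ℕ → (I → A) → ℝ
  | [], _, _ => 0
  | w :: ws, g, a => trace F (wordProd F w a * (blockProd F ws a * handle F ^ g))

theorem isWord_wordProd {p : I → ZMod 2} {a : I → A} (ha : ∀ i, a i ∈ 𝒜 (p i)) (w : List I) :
    IsWord F (wordParity p w) (wordProd F w a) := by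
  induction w with
  | nil => exact IsWord.one
  | cons i w ih => rw [wordProd_cons, wordParity_cons]; exact IsWord.cons (ha i) ih

theorem isCentral_blockProd {p : I → ZMod 2} {a : I → A} (ha : ∀ i, a i ∈ 𝒜 (p i))
    (ws : List (List I)) : IsCentral (wordParity p ws.flatten) (blockProd F ws a) := by
  induction ws with
  | nil => exact isCentral_one
  | cons w ws ih =>
    rw [blockProd_cons, List.flatten_cons, wordParity_append]
    exact (isWord_wordProd ha w).isHomog.isCentral_casimir.mul ih

theorem isCentral_blockProd_mul {p : I → ZMod 2} {a : I → A} (ha : ∀ i, a i ∈ 𝒜 (p i))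
    (ws : List (List I)) (g : ℕ) :
    IsCentral (wordParity p ws.flatten) (blockProd F ws a * handle F ^ g) := by
  simpa using (isCentral_blockProd ha ws).mul (isCentral_handle.pow g)

section Fintype

variable [Fintype I]

theorem blockProd_perm {p : I → ZMod 2} {a : I → A} (ha : ∀ i, a i ∈ 𝒜 (p i))
    {ws ws' : List (List I)} (h : ws.Perm ws') (hn : ws.flatten.Nodup) :
    blockProd F ws a = koszulSign p ws.flatten ws'.flatten • blockProd F ws' a := by
  induction h with
  | nil => simp [koszulSign_self]
  | cons w h ih =>
    rw [List.flatten_cons] at hn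
    rw [blockProd_cons, blockProd_cons, ih (List.nodup_append.1 hn).2.1, List.flatten_cons,
      List.flatten_cons, koszulSign_append_left p h.flatten hn, mul_smul_comm]
  | swap v w ws =>
    simp only [List.flatten_cons, ← List.append_assoc] at hn ⊢
    rw [koszulSign_swap_blocks p _ _ _ hn]
    simp only [blockProd_cons, ← mul_assoc]
    rw [(isWord_wordProd ha v).isHomog.isCentral_casimir.casimir_mul (isWord_wordProd ha w),
      smul_mul_assoc]
  | trans h1 h2 ih1 ih2 =>
    rw [ih1 hn, ih2 (h1.flatten.nodup_iff.1 hn), smul_smul, koszulSign_trans p h1.flatten h2.flatten]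

/-- Among the later words the blocks commute in the graded sense because they are central. The only
other generator exchanges the first word, which is not under `casimir`, with the second; this is
`trace_mul_casimir_mul`. -/
theorem surfaceTrace_perm {p : I → ZMod 2} {a : I → A} (ha : ∀ i, a i ∈ 𝒜 (p i)) (g : ℕ)
    {ws ws' : List (List I)} (h : ws.Perm ws') (hn : ws.flatten.Nodup) :
    surfaceTrace F ws g a = koszulSign p ws.flatten ws'.flatten * surfaceTrace F ws' g a := by
  induction h with
  | nil => simp [koszulSign_self]
  | cons w h ih =>
    rw [List.flatten_cons] at hn
    rw [surfaceTrace, surfaceTrace, blockProd_perm ha h (List.nodup_append.1 hn).2.1,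
      List.flatten_cons, List.flatten_cons, koszulSign_append_left p h.flatten hn, smul_mul_assoc,
      mul_smul_comm, map_smul, smul_eq_mul]
  | swap v w ws =>
    simp only [List.flatten_cons, ← List.append_assoc] at hn ⊢
    rw [koszulSign_swap_blocks p _ _ _ hn]
    simp only [surfaceTrace, blockProd_cons]
    rw [mul_assoc, ← mul_assoc, mul_assoc (casimir F (wordProd F w a)),
      ← mul_assoc (wordProd F v a)]
    exact trace_mul_casimir_mul (isWord_wordProd ha w) (isWord_wordProd ha v)
      (isCentral_blockProd_mul ha ws g)
  | trans h1 h2 ih1 ih2 =>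
    rw [ih1 hn, ih2 (h1.flatten.nodup_iff.1 hn), ← mul_assoc,
      koszulSign_trans p h1.flatten h2.flatten]

theorem _root_.List.IsRotated.exists_append {α : Type*} {v w : List α} (h : v ~r w) :
    ∃ x y, v = x ++ y ∧ w = y ++ x := by
  obtain ⟨n, rfl⟩ := h
  exact ⟨v.take (n % v.length), v.drop (n % v.length), (List.take_append_drop _ _).symm,
    List.rotate_eq_drop_append_take_mod⟩

theorem koszulSign_rotate (p : I → ZMod 2) {x y : List I} (hn : (x ++ y).Nodup) :
    koszulSign p (x ++ y) (y ++ x) = swapSign (wordParity p x) (wordParity p y) := by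
  simpa using koszulSign_swap_blocks p x y [] (by simpa using hn)

theorem _root_.List.Forall₂.flatten_perm {α : Type*} {ws ws' : List (List α)}
    (h : List.Forall₂ List.IsRotated ws ws') : ws.flatten.Perm ws'.flatten := by
  induction h with
  | nil => exact List.Perm.refl _
  | cons h _ ih => exact h.perm.append ih

theorem blockProd_rotate {p : I → ZMod 2} {a : I → A} (ha : ∀ i, a i ∈ 𝒜 (p i))
    {ws ws' : List (List I)} (h : List.Forall₂ List.IsRotated ws ws') (hn : ws.flatten.Nodup) :
    blockProd F ws a = koszulSign p ws.flatten ws'.flatten • blockProd F ws' a := by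
  induction h with
  | nil => simp [koszulSign_self]
  | cons h1 h2 ih =>
    rw [List.flatten_cons] at hn
    rw [List.flatten_cons, List.flatten_cons,
      koszulSign_append_append p h1.perm h2.flatten_perm hn]
    obtain ⟨x, y, rfl, rfl⟩ := h1.exists_append
    rw [koszulSign_rotate p (List.nodup_append.1 hn).1, blockProd_cons, blockProd_cons,
      ih (List.nodup_append.1 hn).2.1, wordProd_append, wordProd_append,
      casimir_word_mul (isWord_wordProd ha x) (isWord_wordProd ha y).isHomog, mul_smul_comm,
      smul_mul_assoc, smul_smul, mul_comm]

/-- The first word is rotated under the trace, the remaining factor being central; every other word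
is rotated inside its `casimir`. -/
theorem surfaceTrace_rotate {p : I → ZMod 2} {a : I → A} (ha : ∀ i, a i ∈ 𝒜 (p i)) (g : ℕ)
    {ws ws' : List (List I)} (h : List.Forall₂ List.IsRotated ws ws') (hn : ws.flatten.Nodup) :
    surfaceTrace F ws g a = koszulSign p ws.flatten ws'.flatten * surfaceTrace F ws' g a := by
  cases h with
  | nil => simp [koszulSign_self]
  | cons h1 h2 =>
    rw [List.flatten_cons] at hn
    rw [List.flatten_cons, List.flatten_cons,
      koszulSign_append_append p h1.perm h2.flatten_perm hn]
    obtain ⟨x, y, rfl, rfl⟩ := h1.exists_append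
    rw [koszulSign_rotate p (List.nodup_append.1 hn).1, surfaceTrace, surfaceTrace,
      blockProd_rotate ha h2 (List.nodup_append.1 hn).2.1, wordProd_append, wordProd_append,
      smul_mul_assoc, mul_smul_comm, map_smul, smul_eq_mul,
      trace_word_mul (isWord_wordProd ha x) (isWord_wordProd ha y).isHomog
        (isCentral_blockProd_mul ha _ g)]
    ring

/-- The value depends, up to the Koszul sign, only on the multiset of cyclic words, which is the
combinatorial datum of the boundary of a surface. -/
theorem surfaceTrace_cycles {p : I → ZMod 2} {a : I → A} (ha : ∀ i, a i ∈ 𝒜 (p i)) (g : ℕ)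
    {ws ws' : List (List I)}
    (h : (ws.map ((↑) : List I → Cycle I)).Perm (ws'.map ((↑) : List I → Cycle I)))
    (hn : ws.flatten.Nodup) : ws.flatten.Perm ws'.flatten ∧
    surfaceTrace F ws g a = koszulSign p ws.flatten ws'.flatten * surfaceTrace F ws' g a := by
  have h1 : List.Forall₂ (fun w c => ((w : List I) : Cycle I) = c) ws
      (ws.map ((↑) : List I → Cycle I)) := by
    rw [List.forall₂_map_right_iff]
    exact List.forall₂_same.2 fun _ _ => rfl
  have h2 : Relation.Comp (List.Forall₂ (fun w c => ((w : List I) : Cycle I) = c)) List.Perm ws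
      (ws'.map ((↑) : List I → Cycle I)) := ⟨_, h1, h⟩
  -- Passing to cycles and then permuting is replaced by permuting the words and then rotating each
  -- of them, so that the two preceding lemmas apply in turn.
  rw [List.forall₂_comp_perm_eq_perm_comp_forall₂] at h2
  obtain ⟨vs, h3, h4⟩ := h2
  rw [List.forall₂_map_right_iff] at h4
  have h5 : List.Forall₂ List.IsRotated vs ws' := h4.imp fun _ _ h => Cycle.coe_eq_coe.1 h
  have hn' := h3.flatten.nodup_iff.1 hn
  refine ⟨h3.flatten.trans h5.flatten_perm, ?_⟩
  rw [surfaceTrace_perm ha g h3 hn, surfaceTrace_rotate ha g h5 hn', ← mul_assoc,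
    koszulSign_trans p h3.flatten h5.flatten_perm]

/-- The function `f` of elements `a i` is multilinear in those with `i` in `L`, does not depend on
the others, has the degree of the product of the `a i` over `L`, and satisfies the Leibniz rule. -/
structure IsTensorOn (F : DGFrobenius 𝒜) (L : List I) (f : (I → A) → F.Ext) : Prop where
  homog : ∀ (p : I → ZMod 2) (a : I → A), (∀ i, a i ∈ 𝒜 (p i)) → IsHomog (wordParity p L) (f a)
  const : ∀ i ∉ L, ∀ a x, f (Function.update a i x) = f a
  add : ∀ i ∈ L, ∀ a x y, f (Function.update a i (x + y)) =
    f (Function.update a i x) + f (Function.update a i y)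
  smul : ∀ i ∈ L, ∀ a (r : ℝ) x, f (Function.update a i (r • x)) = r • f (Function.update a i x)
  leibniz : ∀ (p : I → ZMod 2) (a : I → A), (∀ i, a i ∈ 𝒜 (p i)) →
    diff F (f a) = (L.map fun i => prefixSign p L i • f (Function.update a i (F.d (a i)))).sum

theorem isTensorOn_const {z : F.Ext} (hz : IsHomog 0 z) (hd : diff F z = 0) :
    IsTensorOn F ([] : List I) fun _ => z where
  homog _ _ _ := hz
  const _ _ _ _ := rfl
  add _ h := absurd h List.not_mem_nil
  smul _ h := absurd h List.not_mem_nil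
  leibniz _ _ _ := hd

theorem isTensorOn_incl (i : I) : IsTensorOn F [i] fun a => incl F (a i) where
  homog p a ha := by simpa using isHomog_incl (ha i)
  const j hj a x := by
    rw [Function.update_of_ne (fun h => hj (by simp [h]))]
  add j hj a x y := by
    obtain rfl : j = i := by simpa using hj
    simp
  smul j hj a x y := by
    obtain rfl : j = i := by simpa using hj
    simp
  leibniz p a ha := by
    simp [diff_incl, prefixSign_cons p List.not_mem_nil]

/-- The sign with which the differential reaches the second factor is that of passing all letters of
`L`, in accordance with `prefixSign` for the concatenated list. -/
theorem IsTensorOn.mul {L K : List I} {f g : (I → A) → F.Ext} (hf : IsTensorOn F L f)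
    (hg : IsTensorOn F K g) (hn : (L ++ K).Nodup) : IsTensorOn F (L ++ K) fun a => f a * g a where
  homog p a ha := by
    rw [wordParity_append]
    exact (hf.homog p a ha).mul (hg.homog p a ha)
  const i hi a x := by
    rw [List.mem_append, not_or] at hi
    rw [hf.const i hi.1, hg.const i hi.2]
  add i hi a x y := by
    by_cases h : i ∈ L
    · have h' : i ∉ K := fun h' => List.disjoint_of_nodup_append hn h h'
      rw [hf.add i h, hg.const i h', hg.const i h', hg.const i h', add_mul]
    · have h' := (List.mem_append.1 hi).resolve_left h
      rw [hf.const i h, hf.const i h, hf.const i h, hg.add i h', mul_add]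
  smul i hi a x y := by
    by_cases h : i ∈ L
    · have h' : i ∉ K := fun h' => List.disjoint_of_nodup_append hn h h'
      rw [hf.smul i h, hg.const i h', hg.const i h', smul_mul_assoc]
    · have h' := (List.mem_append.1 hi).resolve_left h
      rw [hf.const i h, hf.const i h, hg.smul i h', mul_smul_comm]
  leibniz p a ha := by
    rw [diff_mul, hf.leibniz p a ha, hg.leibniz p a ha, (hf.homog p a ha).grade_eq,
      List.map_append, List.sum_append, ← List.sum_map_mul_right, ← List.sum_map_mul_left]
    congr 2
    · refine List.map_congr_left fun i hi => ?_
      rw [prefixSign_append_of_mem p hi,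
        hg.const i (fun h' => List.disjoint_of_nodup_append hn hi h'), smul_mul_assoc]
    · refine List.map_congr_left fun i hi => ?_
      have h' : i ∉ L := fun h' => List.disjoint_of_nodup_append hn h' hi
      rw [prefixSign_append_of_not_mem p hn h', hf.const i h', smul_mul_assoc, mul_smul_comm,
        smul_smul]

theorem IsTensorOn.casimir {L : List I} {f : (I → A) → F.Ext} (hf : IsTensorOn F L f) :
    IsTensorOn F L fun a => Ext.casimir F (f a) where
  homog p a ha := (hf.homog p a ha).casimir
  const i hi a x := by rw [hf.const i hi]
  add i hi a x y := by rw [hf.add i hi, map_add]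
  smul i hi a x y := by rw [hf.smul i hi, map_smul]
  leibniz p a ha := by
    rw [(hf.homog p a ha).diff_casimir, hf.leibniz p a ha, map_list_sum, List.map_map]
    congr 1
    refine List.map_congr_left fun i _ => ?_
    simp

theorem isTensorOn_wordProd {w : List I} (hn : w.Nodup) : IsTensorOn F w (wordProd F w) := by
  induction w with
  | nil => exact isTensorOn_const isHomog_one diff_one
  | cons i w ih =>
    have := (isTensorOn_incl (F := F) i).mul (ih (List.nodup_cons.1 hn).2) hn
    have e : (fun a : I → A => incl F (a i) * wordProd F w a) = wordProd F (i :: w) :=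
      funext fun a => (wordProd_cons i w a).symm
    rwa [e] at this

theorem isTensorOn_blockProd {ws : List (List I)} (hn : ws.flatten.Nodup) :
    IsTensorOn F ws.flatten (blockProd F ws) := by
  induction ws with
  | nil => exact isTensorOn_const isHomog_one diff_one
  | cons w ws ih =>
    rw [List.flatten_cons] at hn
    have := (isTensorOn_wordProd (F := F) (List.nodup_append.1 hn).1).casimir.mul
      (ih (List.nodup_append.1 hn).2.1) hn
    have e : (fun a : I → A => casimir F (wordProd F w a) * blockProd F ws a) =
        blockProd F (w :: ws) := funext fun a => (blockProd_cons w ws a).symm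
    rwa [e] at this

theorem diff_handle_pow (g : ℕ) : diff F (handle F ^ g) = 0 := by
  induction g with
  | zero => rw [pow_zero, diff_one]
  | succ g ih => rw [pow_succ, diff_mul, ih, diff_handle, zero_mul, mul_zero, add_zero]

theorem isTensorOn_surface {w : List I} {ws : List (List I)} (g : ℕ)
    (hn : (w :: ws).flatten.Nodup) : IsTensorOn F (w :: ws).flatten
      fun a => wordProd F w a * (blockProd F ws a * handle F ^ g) := by
  rw [List.flatten_cons] at hn ⊢
  have h := (isTensorOn_blockProd (F := F) (List.nodup_append.1 hn).2.1).mul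
    (isTensorOn_const (I := I) (isCentral_handle.pow g).isHomog (diff_handle_pow g))
    (by simpa using (List.nodup_append.1 hn).2.1)
  rw [List.append_nil] at h
  exact (isTensorOn_wordProd (List.nodup_append.1 hn).1).mul h hn

/-- `surfaceTrace` as a multilinear map. -/
def surfaceMap (F : DGFrobenius 𝒜) (ws : List (List I)) (g : ℕ) (hn : ws.flatten.Nodup)
    (hc : ∀ i, i ∈ ws.flatten) : MultilinearMap ℝ (fun _ : I => A) ℝ where
  toFun := surfaceTrace F ws g
  map_update_add' := by
    intro inst a i x y
    obtain rfl : inst = fun _ _ => Classical.propDecidable _ := Subsingleton.elim _ _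
    cases ws with
    | nil => simp [surfaceTrace]
    | cons w ws =>
      have := congrArg (trace F) ((isTensorOn_surface (F := F) g hn).add i (hc i) a x y)
      rw [map_add] at this
      exact this
  map_update_smul' := by
    intro inst a i r x
    obtain rfl : inst = fun _ _ => Classical.propDecidable _ := Subsingleton.elim _ _
    cases ws with
    | nil => simp [surfaceTrace]
    | cons w ws =>
      have := congrArg (trace F) ((isTensorOn_surface (F := F) g hn).smul i (hc i) a r x)
      rw [map_smul] at this
      exact this

theorem surfaceTrace_even {p : I → ZMod 2} {a : I → A} (ha : ∀ i, a i ∈ 𝒜 (p i))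
    {ws : List (List I)} (g : ℕ) (hn : ws.flatten.Nodup) (h : wordParity p ws.flatten ≠ 0) :
    surfaceTrace F ws g a = 0 := by
  cases ws with
  | nil => rfl
  | cons w ws =>
    have h1 := (isTensorOn_surface (F := F) g hn).homog p a ha
    rw [(zmod_two_cases _).resolve_left h] at h1
    exact h1.trace_eq_zero

/-- The Leibniz rule expands the differential of the product under the trace, and the trace of a
differential is zero. -/
theorem surfaceTrace_d {p : I → ZMod 2} {a : I → A} (ha : ∀ i, a i ∈ 𝒜 (p i))
    {ws : List (List I)} (g : ℕ) (hn : ws.flatten.Nodup) (hc : ∀ i, i ∈ ws.flatten) :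
    ∑ i, prefixSign p ws.flatten i * surfaceTrace F ws g (Function.update a i (F.d (a i))) = 0 := by
  cases ws with
  | nil => simp [surfaceTrace]
  | cons w ws =>
    have h1 := congrArg (trace F) ((isTensorOn_surface (F := F) g hn).leibniz p a ha)
    rw [trace_diff, map_list_sum, List.map_map] at h1
    have h2 : ∀ f : I → ℝ, ∑ i, f i = ((w :: ws).flatten.map f).sum := by
      intro f
      rw [← List.sum_toFinset f hn]
      refine Finset.sum_congr ?_ fun _ _ => rfl
      ext i; simpa using hc i
    rw [h2, h1]
    congr 1

end Fintype

end DGFrobenius.Ext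

end

noncomputable section

/-! ### Cycles of permutations as lists of words -/

section CycleList

variable {I : Type}

/-- The nonempty words of `ws` are the cycles of `σ`. -/
structure IsCycleList (σ : Perm I) (ws : List (List I)) : Prop where
  nodup : ws.flatten.Nodup
  complete : ∀ i, i ∈ ws.flatten
  chain : ∀ w ∈ ws, Cycle.Chain (fun x y => σ x = y) (w : Cycle I)

theorem List.IsChain.concat_imp {α : Type*} {r r' : α → α → Prop} {l : List α} {e e' : α}
    (h : List.IsChain r (l ++ [e])) (h1 : ∀ a ∈ l, ∀ b ∈ l, r a b → r' a b)
    (h2 : ∀ a ∈ l, r a e → r' a e') : List.IsChain r' (l ++ [e']) := by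
  induction l with
  | nil => simp
  | cons a l ih =>
    cases l with
    | nil =>
      simp only [List.cons_append, List.nil_append, List.isChain_cons_cons] at h ⊢
      exact ⟨h2 a (by simp) h.1, by simp⟩
    | cons b l =>
      simp only [List.cons_append, List.isChain_cons_cons] at h ⊢
      refine ⟨h1 a (by simp) b (by simp) h.1, ?_⟩
      exact ih h.2 (fun x hx y hy => h1 x (List.mem_cons_of_mem _ hx) y (List.mem_cons_of_mem _ hy))
        (fun x hx => h2 x (List.mem_cons_of_mem _ hx))

theorem chain_coe_cons_imp {r r' : I → I → Prop} {x : I} {t : List I} {e : I}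
    (h : List.IsChain r (x :: t ++ [e])) (h1 : ∀ a ∈ x :: t, ∀ b ∈ x :: t, r a b → r' a b)
    (h2 : ∀ a ∈ x :: t, r a e → r' a x) : Cycle.Chain r' ((x :: t : List I) : Cycle I) := by
  rw [Cycle.chain_coe_cons, ← List.cons_append]
  exact h.concat_imp h1 h2

theorem eq_of_isChain_of_isChain {f : I → I} {i : I} {u u' : List I} {x : I}
    (h : List.IsChain (fun a b => f a = b) (x :: (u ++ [i])))
    (h' : List.IsChain (fun a b => f a = b) (x :: (u' ++ [i]))) (hi : i ∉ u) (hi' : i ∉ u') :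
    u = u' := by
  induction u generalizing x u' with
  | nil =>
    cases u' with
    | nil => rfl
    | cons b u' =>
      simp only [List.nil_append, List.cons_append, List.isChain_cons_cons] at h h'
      exact absurd (by rw [← h.1, h'.1]; simp) hi'
  | cons b u ih =>
    cases u' with
    | nil =>
      simp only [List.nil_append, List.cons_append, List.isChain_cons_cons] at h h'
      exact absurd (by rw [← h'.1, h.1]; simp) hi
    | cons c u' =>
      simp only [List.cons_append, List.isChain_cons_cons] at h h'
      obtain rfl : b = c := h.1.symm.trans h'.1
      rw [ih h.2 h'.2 (fun hc => hi (List.mem_cons_of_mem _ hc))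
        (fun hc => hi' (List.mem_cons_of_mem _ hc))]

theorem List.exists_isRotated_cons {α : Type*} {w : List α} {x : α} (hx : x ∈ w) :
    ∃ u, w ~r (x :: u) := by
  obtain ⟨s, t, rfl⟩ := List.append_of_mem hx
  exact ⟨t ++ s, s.length, by rw [List.rotate_append_length_eq]; rfl⟩

theorem List.IsRotated.coe_eq {α : Type*} {v w : List α} (h : v ~r w) : (v : Cycle α) = w :=
  Cycle.coe_eq_coe.2 h

theorem chain_apply {f : I → I} {w : List I} (hw : Cycle.Chain (fun x y => f x = y) (w : Cycle I))
    {x : I} {u : List I} (h : w ~r (x :: u)) : List.IsChain (fun x y => f x = y) (x :: (u ++ [x])) := by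
  rw [h.coe_eq, Cycle.chain_coe_cons] at hw
  exact hw

theorem chain_apply_mem {f : I → I} {w : List I}
    (hw : Cycle.Chain (fun x y => f x = y) (w : Cycle I)) {x : I} (hx : x ∈ w) : f x ∈ w := by
  obtain ⟨u, hu⟩ := List.exists_isRotated_cons hx
  have h := chain_apply hw hu
  rw [hu.mem_iff]
  cases u with
  | nil =>
    simp only [List.nil_append, List.isChain_cons_cons] at h
    rw [h.1]; simp
  | cons b u =>
    simp only [List.cons_append, List.isChain_cons_cons] at h
    rw [h.1]; simp

theorem chain_sameCycle {σ : Perm I} {l : List I} {x : I}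
    (h : List.IsChain (fun x y => σ x = y) (x :: l)) {y : I} (hy : y ∈ l) : σ.SameCycle x y := by
  induction l generalizing x with
  | nil => simp at hy
  | cons b l ih =>
    rw [List.isChain_cons_cons] at h
    have h1 : σ.SameCycle x b := h.1 ▸ Perm.sameCycle_apply_right.2 (Perm.SameCycle.refl σ x)
    rcases List.mem_cons.1 hy with rfl | hy
    · exact h1
    · exact h1.trans (ih h.2 hy)

/-- Rotated to start at a common letter, both words follow the iterates of `f` until the first
return to it. -/
theorem chain_cycle_eq {f : I → I} {w w' : List I} (hn : w.Nodup) (hn' : w'.Nodup)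
    (hw : Cycle.Chain (fun x y => f x = y) (w : Cycle I))
    (hw' : Cycle.Chain (fun x y => f x = y) (w' : Cycle I)) {x : I} (hx : x ∈ w) (hx' : x ∈ w') :
    (w : Cycle I) = w' := by
  obtain ⟨u, hu⟩ := List.exists_isRotated_cons hx
  obtain ⟨u', hu'⟩ := List.exists_isRotated_cons hx'
  rw [hu.coe_eq, hu'.coe_eq, eq_of_isChain_of_isChain (chain_apply hw hu) (chain_apply hw' hu')
    (List.nodup_cons.1 (hu.nodup_iff.1 hn)).1 (List.nodup_cons.1 (hu'.nodup_iff.1 hn')).1]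

namespace IsCycleList

variable {σ : Perm I} {ws ws' : List (List I)}

theorem exists_mem (h : IsCycleList σ ws) (x : I) : ∃ w ∈ ws, x ∈ w :=
  List.mem_flatten.1 (h.complete x)

theorem nodup_of_mem (h : IsCycleList σ ws) {w : List I} (hw : w ∈ ws) : w.Nodup :=
  (List.nodup_flatten.1 h.nodup).1 w hw

theorem perm (h : IsCycleList σ ws) (hp : ws.Perm ws') : IsCycleList σ ws' :=
  ⟨hp.flatten.nodup_iff.1 h.nodup, fun i => hp.flatten.mem_iff.1 (h.complete i),
    fun w hw => h.chain w (hp.mem_iff.2 hw)⟩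

theorem rotate {w w' : List I} (h : IsCycleList σ (w :: ws)) (hw : w ~r w') :
    IsCycleList σ (w' :: ws) := by
  have hp : (w :: ws).flatten.Perm (w' :: ws).flatten := hw.perm.append_right _
  refine ⟨hp.nodup_iff.1 h.nodup, fun i => hp.mem_iff.1 (h.complete i), fun v hv => ?_⟩
  rcases List.mem_cons.1 hv with rfl | hv
  · rw [← hw.coe_eq]; exact h.chain w (by simp)
  · exact h.chain v (List.mem_cons_of_mem _ hv)

theorem mem_cycles_iff (h : IsCycleList σ ws) (h' : IsCycleList σ ws') (c : Cycle I)
    (hc : c ≠ Cycle.nil) (hm : c ∈ ws.map ((↑) : List I → Cycle I)) :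
    c ∈ ws'.map ((↑) : List I → Cycle I) := by
  obtain ⟨w, hw, rfl⟩ := List.mem_map.1 hm
  have : w ≠ [] := fun hn => hc (by rw [hn]; rfl)
  obtain ⟨x, hx⟩ := List.exists_mem_of_ne_nil w this
  obtain ⟨w', hw', hx'⟩ := h'.exists_mem x
  rw [chain_cycle_eq (h.nodup_of_mem hw) (h'.nodup_of_mem hw') (h.chain w hw) (h'.chain w' hw') hx hx']
  exact List.mem_map_of_mem hw'

theorem nodup_cycles (h : IsCycleList σ ws) :
    ((ws.map ((↑) : List I → Cycle I)).filter (· ≠ Cycle.nil)).Nodup := by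
  rw [List.filter_map]
  unfold List.Nodup
  rw [List.pairwise_map]
  have h1 := ((List.nodup_flatten.1 h.nodup).2.filter
    ((fun c : Cycle I => decide (c ≠ Cycle.nil)) ∘ ((↑) : List I → Cycle I)))
  refine List.Pairwise.imp_of_mem ?_ h1
  intro a b ha hb hab he
  have h2 : a ≠ [] := by
    rintro rfl
    simp at ha
  obtain ⟨x, hx⟩ := List.exists_mem_of_ne_nil a h2
  exact hab hx ((Cycle.coe_eq_coe.1 he).mem_iff.1 hx)

/-- The nonempty words are determined by `σ` as cycles and occur once each. The common length then
fixes the number of empty words, which stand for circles without intervals. -/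
theorem cycles_perm (h : IsCycleList σ ws) (h' : IsCycleList σ ws') (hl : ws.length = ws'.length) :
    (ws.map ((↑) : List I → Cycle I)).Perm (ws'.map ((↑) : List I → Cycle I)) := by
  set C := ws.map ((↑) : List I → Cycle I) with hC
  set C' := ws'.map ((↑) : List I → Cycle I) with hC'
  have h1 : (C.filter (· ≠ Cycle.nil)).Perm (C'.filter (· ≠ Cycle.nil)) := by
    rw [List.perm_ext_iff_of_nodup h.nodup_cycles h'.nodup_cycles]
    intro c
    simp only [List.mem_filter, decide_eq_true_eq]
    exact ⟨fun hc => ⟨mem_cycles_iff h h' c hc.2 hc.1, hc.2⟩,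
      fun hc => ⟨mem_cycles_iff h' h c hc.2 hc.1, hc.2⟩⟩
  have h2 : ∀ D : List (Cycle I), D.filter (fun c => !decide (c ≠ Cycle.nil)) =
      List.replicate (D.length - (D.filter (· ≠ Cycle.nil)).length) Cycle.nil := by
    intro D
    rw [List.eq_replicate_iff]
    constructor
    · have := List.length_eq_length_filter_add (l := D) (fun c => decide (c ≠ Cycle.nil))
      omega
    · intro b hb
      have := (List.mem_filter.1 hb).2
      simpa using this
  have h3 := List.filter_append_perm (fun c => decide (c ≠ Cycle.nil)) C
  have h4 := List.filter_append_perm (fun c => decide (c ≠ Cycle.nil)) C'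
  rw [h2] at h3 h4
  have hlen : C.length = C'.length := by simp [hC, hC', hl]
  rw [hlen, h1.length_eq] at h3
  exact h3.symm.trans ((h1.append_right _).trans h4)

theorem perm_eq {τ : Perm I} (h : IsCycleList σ ws) (h' : IsCycleList τ ws) : σ = τ := by
  ext x
  obtain ⟨w, hw, hx⟩ := h.exists_mem x
  obtain ⟨u, hu⟩ := List.exists_isRotated_cons hx
  have h1 := chain_apply (h.chain w hw) hu
  have h2 := chain_apply (h'.chain w hw) hu
  cases u with
  | nil =>
    simp only [List.nil_append, List.isChain_cons_cons] at h1 h2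
    rw [h1.1, h2.1]
  | cons b u =>
    simp only [List.cons_append, List.isChain_cons_cons] at h1 h2
    rw [h1.1, h2.1]

theorem sameCycle_of_mem (h : IsCycleList σ ws) {w : List I} (hw : w ∈ ws) {x y : I} (hx : x ∈ w)
    (hy : y ∈ w) : σ.SameCycle x y := by
  obtain ⟨u, hu⟩ := List.exists_isRotated_cons hx
  rcases List.mem_cons.1 (hu.mem_iff.1 hy) with rfl | hy'
  · exact Perm.SameCycle.refl _ _
  · exact chain_sameCycle (chain_apply (h.chain w hw) hu) (by simp [hy'])

theorem not_sameCycle (h : IsCycleList σ ws) {v w : List I} {vs : List (List I)}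
    (hws : ws = v :: w :: vs) {x y : I} (hx : x ∈ v) (hy : y ∈ w) : ¬ σ.SameCycle x y := by
  have hd := (List.nodup_flatten.1 h.nodup).2
  rw [hws, List.pairwise_cons] at hd
  have hv : v ∈ ws := by simp [hws]
  intro hs
  -- Membership in `v` is invariant under `σ`: the word that contains `x` also contains `σ x`, and
  -- different words are disjoint.
  have := sameCycle_of_step σ ⟨fun x y => x ∈ v ↔ y ∈ v, fun _ => Iff.rfl, fun h => h.symm,
    fun h h' => h.trans h'⟩ (fun x => by
      refine ⟨fun hσ => ?_, fun hx => chain_apply_mem (h.chain v hv) hx⟩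
      obtain ⟨w', hw', hxw⟩ := h.exists_mem x
      have h3 := chain_apply_mem (h.chain w' hw') hxw
      rw [hws] at hw'
      rcases List.mem_cons.1 hw' with rfl | hw'
      · exact hxw
      · exact absurd h3 (fun h3 => hd.1 w' hw' hσ h3)) hs
  exact hd.1 w (by simp) (this.1 hx) hy

theorem map {J : Type} (e : I ≃ J) (h : IsCycleList σ ws) :
    IsCycleList (e.permCongr σ) (ws.map (List.map e)) := by
  refine ⟨?_, fun j => ?_, ?_⟩
  · rw [← List.map_flatten]; exact h.nodup.map e.injective
  · rw [← List.map_flatten, List.mem_map]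
    exact ⟨e.symm j, h.complete _, by simp⟩
  · intro w hw
    obtain ⟨v, hv, rfl⟩ := List.mem_map.1 hw
    rw [← Cycle.map_coe, Cycle.chain_map]
    convert h.chain v hv using 3
    simp [Equiv.permCongr_apply]

theorem sum {J : Type} {τ : Perm J} {vs : List (List J)} (h : IsCycleList σ ws)
    (h' : IsCycleList τ vs) : IsCycleList (Perm.sumCongr σ τ)
      (ws.map (List.map Sum.inl) ++ vs.map (List.map Sum.inr)) := by
  refine ⟨?_, fun j => ?_, ?_⟩
  · rw [List.flatten_append, ← List.map_flatten, ← List.map_flatten, List.nodup_append]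
    refine ⟨h.nodup.map Sum.inl_injective, h'.nodup.map Sum.inr_injective, ?_⟩
    intro a ha b hb
    obtain ⟨x, -, rfl⟩ := List.mem_map.1 ha
    obtain ⟨y, -, rfl⟩ := List.mem_map.1 hb
    exact Sum.inl_ne_inr
  · rw [List.flatten_append, ← List.map_flatten, ← List.map_flatten, List.mem_append]
    rcases j with j | j
    · exact Or.inl (List.mem_map_of_mem (h.complete j))
    · exact Or.inr (List.mem_map_of_mem (h'.complete j))
  · intro w hw
    rcases List.mem_append.1 hw with hw | hw
    · obtain ⟨v, hv, rfl⟩ := List.mem_map.1 hw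
      rw [← Cycle.map_coe, Cycle.chain_map]
      convert h.chain v hv using 3
      simp
    · obtain ⟨v, hv, rfl⟩ := List.mem_map.1 hw
      rw [← Cycle.map_coe, Cycle.chain_map]
      convert h'.chain v hv using 3
      simp

end IsCycleList

/-- The orbits of `σ`, supplemented by `n` empty words for the boundary circles without intervals.
-/
theorem exists_isCycleList [Finite I] (σ : Perm I) (n : ℕ) :
    ∃ ws, IsCycleList σ ws ∧ ws.length = numCycles σ + n := by
  haveI := Fintype.ofFinite I
  let Q := Quotient (Perm.SameCycle.setoid σ)
  have hper : ∀ x, x ∈ Function.periodicPts σ := fun x =>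
    ⟨orderOf σ, orderOf_pos σ, by
      rw [Function.IsPeriodicPt, Function.IsFixedPt, ← Perm.coe_pow, pow_orderOf_eq_one]; rfl⟩
  have hw : ∀ q : Q, ∃ w : List I, (w : Cycle I) = Function.periodicOrbit σ q.out :=
    fun q => Quotient.exists_rep _
  choose w hw using hw
  have hmem : ∀ q x, x ∈ w q ↔ Quotient.mk _ x = q := by
    intro q x
    rw [← Cycle.mem_coe_iff, hw, Function.mem_periodicOrbit_iff (hper _)]
    constructor
    · rintro ⟨n, rfl⟩
      conv_rhs => rw [← Quotient.out_eq q]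
      apply Quotient.sound
      exact Perm.SameCycle.symm ⟨n, by rw [zpow_natCast, Perm.coe_pow]⟩
    · intro hq
      have : Quotient.mk (Perm.SameCycle.setoid σ) q.out = Quotient.mk _ x := by
        rw [hq, Quotient.out_eq]
      obtain ⟨n, -, hn⟩ := (show σ.SameCycle q.out x from Quotient.exact this).exists_pow_eq'
      exact ⟨n, by rw [← hn, Perm.coe_pow]⟩
  refine ⟨(Finset.univ : Finset Q).toList.map w ++ List.replicate n [], ⟨?_, ?_, ?_⟩, ?_⟩
  · rw [List.flatten_append, List.flatten_replicate_nil, List.append_nil, List.nodup_flatten]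
    constructor
    · intro l hl
      obtain ⟨q, -, rfl⟩ := List.mem_map.1 hl
      rw [← Cycle.nodup_coe_iff, hw]
      exact Function.nodup_periodicOrbit
    · rw [List.pairwise_map]
      refine List.Pairwise.imp ?_ (Finset.nodup_toList Finset.univ)
      intro q r hqr x hx hx'
      exact hqr (((hmem q x).1 hx).symm.trans ((hmem r x).1 hx'))
  · intro i
    rw [List.mem_flatten]
    exact ⟨w (Quotient.mk _ i), by simp, (hmem _ _).2 rfl⟩
  · intro v hv
    rcases List.mem_append.1 hv with hv | hv
    · obtain ⟨q, -, rfl⟩ := List.mem_map.1 hv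
      rw [hw, Function.periodicOrbit_chain' _ (hper _)]
      intro m
      rw [Function.iterate_succ_apply']
    · rw [List.eq_of_mem_replicate hv]
      exact Cycle.Chain.nil _
  · simp [numCycles, Q]

/-! ### Gluing -/

theorem List.exists_map_val {α : Type*} {P : α → Prop} (ws : List (List α))
    (h : ∀ w ∈ ws, ∀ x ∈ w, P x) : ∃ vs : List (List {x // P x}), vs.map (List.map Subtype.val) = ws := by
  have h1 : ∀ w : List α, (∀ x ∈ w, P x) → ∃ v : List {x // P x}, v.map Subtype.val = w :=
    fun w hw => ⟨w.attach.map fun x => ⟨x.1, hw x.1 x.2⟩, by simp⟩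
  induction ws with
  | nil => exact ⟨[], rfl⟩
  | cons w ws ih =>
    obtain ⟨v, hv⟩ := h1 w (h w (by simp))
    obtain ⟨vs, hvs⟩ := ih (fun w hw => h w (List.mem_cons_of_mem _ hw))
    exact ⟨v :: vs, by rw [List.map_cons, hv, hvs]⟩

/-- The successor of `x` after gluing. -/
def glueNext (σ : Perm I) (h h' : I) (x : I) : I :=
  if σ x = h then (if σ h' = h' then σ h else σ h')
  else if σ x = h' then (if σ h = h then σ h' else σ h) else σ x

/-- This lets the glued words be checked in the original alphabet, where `glueNext` is an explicit
function; by `gluePerm_val` it describes the glued permutation. -/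
theorem isCycleList_glue_aux {σ : Perm I} {h h' : I} (hne : h ≠ h') {ws us : List (List I)}
    (hp : (h :: h' :: us.flatten).Perm ws.flatten) (hσ : IsCycleList σ ws)
    {vs : List (List {x // x ≠ h ∧ x ≠ h'})} (hvs : vs.map (List.map Subtype.val) = us)
    (hc : ∀ w ∈ us, Cycle.Chain (fun x y => glueNext σ h h' x = y) (w : Cycle I)) :
    IsCycleList (gluePerm σ h h') vs := by
  have hf : vs.flatten.map Subtype.val = us.flatten := by rw [List.map_flatten, hvs]
  have hn := hp.nodup_iff.2 hσ.nodup
  refine ⟨?_, ?_, ?_⟩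
  · have : (vs.flatten.map Subtype.val).Nodup := by
      rw [hf]; exact (List.nodup_cons.1 (List.nodup_cons.1 hn).2).2
    exact this.of_map _
  · rintro ⟨x, hx, hx'⟩
    have h1 := hp.mem_iff.2 (hσ.complete x)
    simp only [List.mem_cons, hx, hx', false_or] at h1
    rw [← hf, List.mem_map] at h1
    obtain ⟨y, hy, rfl⟩ := h1
    exact hy
  · intro v hv
    have h1 := hc (v.map Subtype.val) (by rw [← hvs]; exact List.mem_map_of_mem hv)
    rw [← Cycle.map_coe, Cycle.chain_map] at h1
    convert h1 using 3 with x y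
    rw [Subtype.ext_iff, gluePerm_val σ hne]
    rfl

theorem glueNext_chain {σ : Perm I} {h h' : I} {w : List I}
    (hw : Cycle.Chain (fun x y => σ x = y) (w : Cycle I)) (h1 : h ∉ w) (h2 : h' ∉ w) :
    Cycle.Chain (fun x y => glueNext σ h h' x = y) (w : Cycle I) := by
  cases w with
  | nil => exact Cycle.Chain.nil _
  | cons x t =>
    have hw' := hw
    rw [Cycle.chain_coe_cons, ← List.cons_append] at hw
    have key : ∀ a ∈ x :: t, glueNext σ h h' a = σ a := by
      intro a ha
      have hm := chain_apply_mem hw' ha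
      have e1 : σ a ≠ h := fun hc => h1 (by rw [← hc]; exact hm)
      have e2 : σ a ≠ h' := fun hc => h2 (by rw [← hc]; exact hm)
      rw [glueNext, if_neg e1, if_neg e2]
    exact chain_coe_cons_imp hw (fun a ha b _ hab => (key a ha).trans hab)
      (fun a ha hab => (key a ha).trans hab)

/-- The circle `h u h' u'` is cut in two: the last letter of `u'` precedes `h` and is now followed
by the successor of `h'`, the first letter of `u'`; likewise `u` closes up. An empty `u` or `u'` is
retained as a circle without intervals. -/
theorem IsCycleList.glue_same {σ : Perm I} {h h' : I} {u u' : List I} {ws : List (List I)}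
    (hσ : IsCycleList σ ((h :: (u ++ h' :: u')) :: ws))
    {vs : List (List {x // x ≠ h ∧ x ≠ h'})} (hvs : vs.map (List.map Subtype.val) = u' :: u :: ws) :
    IsCycleList (gluePerm σ h h') vs := by
  have hn := hσ.nodup
  rw [List.flatten_cons, List.cons_append, List.nodup_cons] at hn
  have hne : h ≠ h' := fun hc => hn.1 (by simp [hc])
  have hp : (h :: h' :: (u' :: u :: ws).flatten).Perm ((h :: (u ++ h' :: u')) :: ws).flatten := by
    simp only [List.flatten_cons, List.cons_append, List.append_assoc]
    refine List.Perm.cons _ ?_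
    refine List.Perm.trans ?_ List.perm_middle.symm
    refine List.Perm.cons _ ?_
    rw [← List.append_assoc, ← List.append_assoc]
    exact List.perm_append_comm.append_right _
  refine isCycleList_glue_aux hne hp hσ hvs ?_
  have hn2 := hp.nodup_iff.2 hσ.nodup
  simp only [List.flatten_cons, List.nodup_cons, List.mem_cons, List.mem_append, not_or] at hn2
  obtain ⟨⟨-, h1, h2, h3⟩, ⟨h4, h5, h6⟩, -⟩ := hn2
  have hc := hσ.chain _ (List.mem_cons_self)
  rw [Cycle.chain_coe_cons, List.append_assoc, List.cons_append, ← List.cons_append,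
    List.isChain_split] at hc
  obtain ⟨c1, c2⟩ := hc
  intro w hw
  simp only [List.mem_cons] at hw
  rcases hw with rfl | rfl | hw
  · cases w with
    | nil => exact Cycle.Chain.nil _
    | cons x t =>
      rw [List.cons_append, List.isChain_cons_cons, ← List.cons_append] at c2
      have hx : σ h' ≠ h' := fun hc => h4 (by rw [← hc, c2.1]; simp)
      refine chain_coe_cons_imp c2.2 (fun a ha b hb hab => ?_) (fun a ha hab => ?_)
      · rw [glueNext, if_neg (fun hc => h1 (by rw [← hc, hab]; exact hb)),
          if_neg (fun hc => h4 (by rw [← hc, hab]; exact hb)), hab]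
      · rw [glueNext, if_pos hab, if_neg hx, c2.1]
  · cases w with
    | nil => exact Cycle.Chain.nil _
    | cons x t =>
      rw [List.cons_append, List.cons_append, List.isChain_cons_cons, ← List.cons_append] at c1
      have hx : σ h ≠ h := fun hc => h2 (by rw [← hc, c1.1]; simp)
      refine chain_coe_cons_imp c1.2 (fun a ha b hb hab => ?_) (fun a ha hab => ?_)
      · rw [glueNext, if_neg (fun hc => h2 (by rw [← hc, hab]; exact hb)),
          if_neg (fun hc => h5 (by rw [← hc, hab]; exact hb)), hab]
      · rw [glueNext, if_neg (fun hc => hne (hc.symm.trans hab)), if_pos hab, if_neg hx, c1.1]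
  · refine glueNext_chain (hσ.chain w (List.mem_cons_of_mem _ hw)) (fun hc => h3 ?_) (fun hc => h6 ?_)
    · exact List.mem_flatten.2 ⟨w, hw, hc⟩
    · exact List.mem_flatten.2 ⟨w, hw, hc⟩

/-- The last letter of `u` preceded `h` and is now followed by the first of `u'`, and vice versa, so
two circles are joined into `u' u`. -/
theorem IsCycleList.glue_diff {σ : Perm I} {h h' : I} {u u' : List I} {ws : List (List I)}
    (hσ : IsCycleList σ ((h :: u) :: (h' :: u') :: ws))
    {vs : List (List {x // x ≠ h ∧ x ≠ h'})} (hvs : vs.map (List.map Subtype.val) = (u' ++ u) :: ws) :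
    IsCycleList (gluePerm σ h h') vs := by
  have hn := hσ.nodup
  rw [List.flatten_cons, List.cons_append, List.nodup_cons] at hn
  have hne : h ≠ h' := fun hc => hn.1 (by simp [hc])
  have hp : (h :: h' :: ((u' ++ u) :: ws).flatten).Perm ((h :: u) :: (h' :: u') :: ws).flatten := by
    simp only [List.flatten_cons, List.cons_append]
    refine List.Perm.cons _ ?_
    refine List.Perm.trans ?_ List.perm_middle.symm
    refine List.Perm.cons _ ?_
    rw [← List.append_assoc]
    exact List.perm_append_comm.append_right _
  refine isCycleList_glue_aux hne hp hσ hvs ?_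
  have hn2 := hp.nodup_iff.2 hσ.nodup
  simp only [List.flatten_cons, List.nodup_cons, List.mem_cons, List.mem_append, not_or] at hn2
  obtain ⟨⟨-, ⟨h1, h2⟩, h3⟩, ⟨⟨h4, h5⟩, h6⟩, -⟩ := hn2
  have c1 := hσ.chain (h :: u) (by simp)
  have c2 := hσ.chain (h' :: u') (by simp)
  rw [Cycle.chain_coe_cons] at c1 c2
  have away : ∀ a b, b ≠ h → b ≠ h' → σ a = b → glueNext σ h h' a = b := by
    intro a b hb hb' hab
    rw [glueNext, if_neg (fun hc => hb (hab.symm.trans hc)),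
      if_neg (fun hc => hb' (hab.symm.trans hc)), hab]
  have e1 : ∀ {v : List I} {e e' : I}, h ∉ v → h' ∉ v →
      List.IsChain (fun x y => σ x = y) (v ++ [e]) → (∀ a, σ a = e → glueNext σ h h' a = e') →
      List.IsChain (fun x y => glueNext σ h h' x = y) (v ++ [e']) := by
    intro v e e' hv hv' hc he
    exact hc.concat_imp (fun a _ b hb hab => away a b (fun hc => hv (hc ▸ hb))
      (fun hc => hv' (hc ▸ hb)) hab) (fun a _ hab => he a hab)
  intro w hw
  simp only [List.mem_cons] at hw
  rcases hw with rfl | hw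
  · cases u' with
    | nil =>
      cases u with
      | nil => exact Cycle.Chain.nil _
      | cons x t =>
        rw [List.cons_append, List.isChain_cons_cons, ← List.cons_append] at c1
        simp only [List.nil_append, List.isChain_cons_cons] at c2
        rw [List.nil_append, Cycle.chain_coe_cons, ← List.cons_append]
        refine e1 h2 h5 c1.2 fun a ha => ?_
        rw [glueNext, if_pos ha, if_pos c2.1, c1.1]
    | cons x t =>
      rw [List.cons_append, List.isChain_cons_cons, ← List.cons_append] at c2
      have hx : σ h' ≠ h' := fun hc => h4 (by rw [← hc, c2.1]; simp)
      cases u with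
      | nil =>
        simp only [List.nil_append, List.isChain_cons_cons] at c1
        rw [List.append_nil, Cycle.chain_coe_cons, ← List.cons_append]
        refine e1 h1 h4 c2.2 fun a ha => ?_
        rw [glueNext, if_neg (fun hc => hne (hc.symm.trans ha)), if_pos ha, if_pos c1.1, c2.1]
      | cons y s =>
        rw [List.cons_append, List.isChain_cons_cons, ← List.cons_append] at c1
        have hy : σ h ≠ h := fun hc => h2 (by rw [← hc, c1.1]; simp)
        rw [List.cons_append, Cycle.chain_coe_cons, List.append_assoc, List.cons_append,
          ← List.cons_append, List.isChain_split]
        constructor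
        · refine e1 h1 h4 c2.2 fun a ha => ?_
          rw [glueNext, if_neg (fun hc => hne (hc.symm.trans ha)), if_pos ha, if_neg hy, c1.1]
        · rw [← List.cons_append]
          refine e1 h2 h5 c1.2 fun a ha => ?_
          rw [glueNext, if_pos ha, if_neg hx, c2.1]
  · refine glueNext_chain (hσ.chain w (by simp [hw])) (fun hc => h3 ?_) (fun hc => h6 ?_)
    · exact List.mem_flatten.2 ⟨w, hw, hc⟩
    · exact List.mem_flatten.2 ⟨w, hw, hc⟩

end CycleList

end

/-! ### Multilinear maps on homogeneous arguments. -/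

noncomputable section

section Homogeneous

variable {A : Type*} [NonUnitalRing A] [Module ℝ A] {𝒜 : ZMod 2 → Submodule ℝ A}
  [DirectSum.Decomposition 𝒜] {I : Type} [Fintype I]

variable (𝒜) in
theorem MultilinearMap.sum_hproj (f : MultilinearMap ℝ (fun _ : I => A) ℝ) (a : I → A) :
    ∑ p : I → ZMod 2, f (fun i => hproj 𝒜 (p i) (a i)) = f a := by
  rw [← MultilinearMap.map_sum f fun i q => hproj 𝒜 q (a i)]
  simp only [_root_.sum_hproj]

variable (𝒜) in
theorem MultilinearMap.congr_homogeneous (f g : MultilinearMap ℝ (fun _ : I => A) ℝ)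
    (h : ∀ (p : I → ZMod 2) (a : I → A), (∀ i, a i ∈ 𝒜 (p i)) → f a = g a) (a : I → A) :
    f a = g a := by
  rw [← f.sum_hproj 𝒜, ← g.sum_hproj 𝒜]
  exact Finset.sum_congr rfl fun p _ => h p _ fun i => hproj_mem 𝒜 _ _

variable (𝒜) in
/-- The multilinear map that on elements of parities `p` is `s p * f`. -/
def signedMap (s : (I → ZMod 2) → ℝ) (f : MultilinearMap ℝ (fun _ : I => A) ℝ) :
    MultilinearMap ℝ (fun _ : I => A) ℝ :=
  ∑ p : I → ZMod 2, s p • f.compLinearMap fun i => hproj 𝒜 (p i)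

theorem signedMap_apply (s : (I → ZMod 2) → ℝ) (f : MultilinearMap ℝ (fun _ : I => A) ℝ)
    (a : I → A) : signedMap 𝒜 s f a = ∑ p, s p * f fun i => hproj 𝒜 (p i) (a i) := by
  simp [signedMap, MultilinearMap.sum_apply]

theorem signedMap_of_mem (s : (I → ZMod 2) → ℝ) (f : MultilinearMap ℝ (fun _ : I => A) ℝ)
    {p : I → ZMod 2} {a : I → A} (ha : ∀ i, a i ∈ 𝒜 (p i)) : signedMap 𝒜 s f a = s p * f a := by
  rw [signedMap_apply, Finset.sum_eq_single p]
  · congr 2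
    funext i
    rw [hproj_of_mem 𝒜 (ha i), if_pos rfl]
  · intro q _ hq
    obtain ⟨i, hi⟩ := Function.ne_iff.1 hq
    rw [f.map_coord_zero i (by rw [hproj_of_mem 𝒜 (ha i), if_neg hi.symm]), mul_zero]
  · simp

/-- Since the inverse inner product is even, bilinear maps need only be compared on pairs of equal
parity. In the gluing proofs the two inserted elements may therefore be treated as homogeneous of a
common parity, although `basis j` and `dual j` are not homogeneous in general. -/
theorem DGFrobenius.contract_congr [FiniteDimensional ℝ A] (F : DGFrobenius 𝒜) {M : Type*}
    [AddCommGroup M] [Module ℝ M] (B C : A →ₗ[ℝ] A →ₗ[ℝ] M)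
    (h : ∀ q, ∀ x ∈ 𝒜 q, ∀ y ∈ 𝒜 q, B x y = C x y) :
    ∑ j, B (F.basis j) (F.dual j) = ∑ j, C (F.basis j) (F.dual j) := by
  have key : ∀ B : A →ₗ[ℝ] A →ₗ[ℝ] M, ∑ j, B (F.basis j) (F.dual j) =
      ∑ q, ∑ j, B (hproj 𝒜 q (F.basis j)) (hproj 𝒜 q (F.dual j)) := by
    intro B
    have h1 : ∀ j, B (F.basis j) (F.dual j) =
        ∑ q, ∑ r, B (hproj 𝒜 q (F.basis j)) (hproj 𝒜 r (F.dual j)) := by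
      intro j
      conv_lhs => rw [← sum_hproj (𝒜 := 𝒜) (F.basis j), ← sum_hproj (𝒜 := 𝒜) (F.dual j)]
      simp only [map_sum, LinearMap.sum_apply]
      exact Finset.sum_comm
    refine (Finset.sum_congr rfl fun j _ => h1 j).trans ?_
    rw [Finset.sum_comm]
    refine Finset.sum_congr rfl fun q _ => ?_
    rw [Finset.sum_comm, Finset.sum_eq_single q]
    · exact fun r _ hr => F.contract_hproj B hr.symm
    · simp
  rw [key B, key C]
  exact Finset.sum_congr rfl fun q _ => Finset.sum_congr rfl fun j _ =>
    h q _ (hproj_mem 𝒜 _ _) _ (hproj_mem 𝒜 _ _)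

/-- Inserting `x` and `y` at the places `h` and `h'`. -/
def insertTwo {α : Type*} (h h' : I) (a : {x // x ≠ h ∧ x ≠ h'} → α) (x y : α) : I → α :=
  fun z => if hz : z ≠ h ∧ z ≠ h' then a ⟨z, hz⟩ else if z = h then x else y

section insertTwo

variable {α : Type*} {h h' : I} (a : {x // x ≠ h ∧ x ≠ h'} → α) (x y : α)

@[simp] theorem insertTwo_left : insertTwo h h' a x y h = x := by simp [insertTwo]

theorem insertTwo_right (hne : h ≠ h') : insertTwo h h' a x y h' = y := by
  simp [insertTwo, hne.symm]

@[simp] theorem insertTwo_val (z : {x // x ≠ h ∧ x ≠ h'}) : insertTwo h h' a x y z = a z := by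
  have hz : (z : I) ≠ h ∧ (z : I) ≠ h' := z.2
  unfold insertTwo
  rw [dif_pos hz]

theorem insertTwo_eq_update_left (x₀ : α) :
    insertTwo h h' a x y = Function.update (insertTwo h h' a x₀ y) h x := by
  funext z
  by_cases hz : z = h
  · subst hz; simp
  · rw [Function.update_of_ne hz]; simp [insertTwo, hz]

theorem insertTwo_eq_update_right (hne : h ≠ h') (y₀ : α) :
    insertTwo h h' a x y = Function.update (insertTwo h h' a x y₀) h' y := by
  funext z
  by_cases hz : z = h'
  · subst hz; simp [insertTwo_right, hne]
  · rw [Function.update_of_ne hz]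
    by_cases hz' : z = h <;> simp [insertTwo, hz, hz']

theorem insertTwo_mem (hne : h ≠ h') {p : {x // x ≠ h ∧ x ≠ h'} → ZMod 2}
    {a : {x // x ≠ h ∧ x ≠ h'} → A} (ha : ∀ i, a i ∈ 𝒜 (p i)) {q r : ZMod 2} {x y : A}
    (hx : x ∈ 𝒜 q) (hy : y ∈ 𝒜 r) (i : I) : insertTwo h h' a x y i ∈ 𝒜 (insertTwo h h' p q r i) := by
  unfold insertTwo
  split_ifs with h1 h2
  · exact ha _
  · exact hx
  · exact hy

end insertTwo

/-- The bilinear map that results from fixing all arguments of a multilinear map except two. -/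
def MultilinearMap.bilin {h h' : I} (f : MultilinearMap ℝ (fun _ : I => A) ℝ) (hne : h ≠ h')
    (a : {x // x ≠ h ∧ x ≠ h'} → A) : A →ₗ[ℝ] A →ₗ[ℝ] ℝ :=
  LinearMap.mk₂ ℝ (fun x y => f (insertTwo h h' a x y))
    (fun x x' y => by
      rw [insertTwo_eq_update_left a (x + x') y 0, insertTwo_eq_update_left a x y 0,
        insertTwo_eq_update_left a x' y 0, f.map_update_add])
    (fun r x y => by
      rw [insertTwo_eq_update_left a (r • x) y 0, insertTwo_eq_update_left a x y 0,
        f.map_update_smul])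
    (fun x y y' => by
      rw [insertTwo_eq_update_right a x (y + y') hne 0, insertTwo_eq_update_right a x y hne 0,
        insertTwo_eq_update_right a x y' hne 0, f.map_update_add])
    (fun r x y => by
      rw [insertTwo_eq_update_right a x (r • y) hne 0, insertTwo_eq_update_right a x y hne 0,
        f.map_update_smul])

@[simp] theorem MultilinearMap.bilin_apply {h h' : I} (f : MultilinearMap ℝ (fun _ : I => A) ℝ)
    (hne : h ≠ h') (a : {x // x ≠ h ∧ x ≠ h'} → A) (x y : A) :
    f.bilin hne a x y = f (insertTwo h h' a x y) := rfl

end Homogeneous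

/-! ### Presentations of surfaces -/

theorem Enumeration.perm {I : Type} (L : Enumeration I) {l : List I} (hn : l.Nodup)
    (hc : ∀ i, i ∈ l) : L.list.Perm l :=
  (List.perm_ext_iff_of_nodup L.nodup hn).2 fun i => by simp [hc i, L.complete i]

theorem Enumeration.finite {I : Type} (L : Enumeration I) : Finite I :=
  @Finite.of_fintype I ⟨⟨L.list, L.nodup⟩, fun i => L.complete i⟩

theorem wordParity_eq_sum {I : Type} [Fintype I] (p : I → ZMod 2) {l : List I} (hn : l.Nodup)
    (hc : ∀ i, i ∈ l) : wordParity p l = ∑ i, p i := by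
  rw [wordParity, ← List.sum_toFinset p hn]
  refine Finset.sum_congr ?_ fun _ _ => rfl
  ext i; simpa using hc i

/-- The words of `ws` describe the boundary circles of the surface. -/
def Surface.IsPresentation {I : Type} (S : Surface I) (ws : List (List I)) : Prop :=
  IsCycleList S.cyc ws ∧ ws.length = numCycles S.cyc + S.free

namespace Surface.IsPresentation

variable {I J : Type} {S : Surface I} {T : Surface J} {ws : List (List I)} {vs : List (List J)}

theorem ne_nil (h : S.IsPresentation ws) : ws ≠ [] := fun hc => by
  have h1 := S.stable.1
  rw [← h.2, hc] at h1
  simp at h1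

theorem enum (h : S.IsPresentation ws) (L : Enumeration I) : L.list.Perm ws.flatten :=
  L.perm h.1.nodup h.1.complete

theorem perm (h : S.IsPresentation ws) {ws' : List (List I)} (hp : ws.Perm ws') :
    S.IsPresentation ws' := ⟨h.1.perm hp, by rw [← hp.length_eq, h.2]⟩

theorem rotate {w w' : List I} (h : S.IsPresentation (w :: ws)) (hw : w ~r w') :
    S.IsPresentation (w' :: ws) := ⟨h.1.rotate hw, by simpa using h.2⟩

theorem relabel (h : S.IsPresentation ws) (e : I ≃ J) :
    (S.relabel e).IsPresentation (ws.map (List.map e)) := by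
  refine ⟨h.1.map e, ?_⟩
  rw [List.length_map, h.2, Surface.relabel]
  congr 1
  exact numCycles_congr e _ _ fun x => by simp

theorem exists_cons (h : S.IsPresentation ws) (i : I) :
    ∃ u vs, S.IsPresentation ((i :: u) :: vs) := by
  obtain ⟨w, hw, hi⟩ := h.1.exists_mem i
  obtain ⟨u, hu⟩ := List.exists_isRotated_cons hi
  exact ⟨u, ws.erase w, (h.perm (List.perm_cons_erase hw)).rotate hu⟩

theorem exists_same (h : S.IsPresentation ws) {i j : I} (hne : i ≠ j) (hs : S.cyc.SameCycle i j) :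
    ∃ u u' vs, S.IsPresentation ((i :: (u ++ j :: u')) :: vs) := by
  obtain ⟨t, vs, ht⟩ := h.exists_cons i
  have hj : j ∈ t := by
    by_contra hj
    obtain ⟨w, hw, hjw⟩ := ht.1.exists_mem j
    rcases List.mem_cons.1 hw with rfl | hw
    · rcases List.mem_cons.1 hjw with rfl | hjw
      · exact hne rfl
      · exact hj hjw
    · have h1 := ht.perm ((List.perm_cons_erase hw).cons _)
      exact h1.1.not_sameCycle rfl List.mem_cons_self hjw hs
  obtain ⟨u, u', rfl⟩ := List.append_of_mem hj
  exact ⟨u, u', vs, ht⟩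

theorem exists_diff (h : S.IsPresentation ws) {i j : I} (hs : ¬ S.cyc.SameCycle i j) :
    ∃ u u' vs, S.IsPresentation ((i :: u) :: (j :: u') :: vs) := by
  obtain ⟨u, vs, hu⟩ := h.exists_cons i
  obtain ⟨w, hw, hj⟩ := hu.1.exists_mem j
  rcases List.mem_cons.1 hw with rfl | hw
  · exact absurd (hu.1.sameCycle_of_mem hw List.mem_cons_self hj) hs
  · obtain ⟨u', hu'⟩ := List.exists_isRotated_cons hj
    exact ⟨u, u', _, (((hu.perm ((List.perm_cons_erase hw).cons _)).perm
      (List.Perm.swap _ _ _)).rotate hu').perm (List.Perm.swap _ _ _)⟩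

/-- The word list grows by one, and so does the number of all circles: by `numCycles_glue`, the
cycles of the glued permutation and the new free circles together are the cycles after
multiplication with the transposition. -/
theorem selfGlue_same [Finite I] {h h' : I} (hne : h ≠ h') {u u' : List I}
    (hS : S.IsPresentation ((h :: (u ++ h' :: u')) :: ws))
    {vs : List (List {x // x ≠ h ∧ x ≠ h'})} (hvs : vs.map (List.map Subtype.val) = u' :: u :: ws) :
    (S.selfGlue h h' hne).IsPresentation vs ∧ (S.selfGlue h h' hne).genus = S.genus := by
  have hs : S.cyc.SameCycle h h' := hS.1.sameCycle_of_mem List.mem_cons_self (by simp) (by simp)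
  refine ⟨⟨hS.1.glue_same hvs, ?_⟩, if_pos hs⟩
  have h1 := congrArg List.length hvs
  have h2 := hS.2
  have h3 := numCycles_glue S.cyc hne
  rw [numCycles_mul_swap_of_same S.cyc hne hs] at h3
  simp only [List.length_map, List.length_cons] at h1 h2
  simp only [Surface.selfGlue]
  omega

theorem selfGlue_diff [Finite I] {h h' : I} (hne : h ≠ h') {u u' : List I}
    (hS : S.IsPresentation ((h :: u) :: (h' :: u') :: ws))
    {vs : List (List {x // x ≠ h ∧ x ≠ h'})} (hvs : vs.map (List.map Subtype.val) = (u' ++ u) :: ws) :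
    (S.selfGlue h h' hne).IsPresentation vs ∧ (S.selfGlue h h' hne).genus = S.genus + 1 := by
  have hs : ¬ S.cyc.SameCycle h h' := hS.1.not_sameCycle rfl List.mem_cons_self List.mem_cons_self
  refine ⟨⟨hS.1.glue_diff hvs, ?_⟩, if_neg hs⟩
  have h1 := congrArg List.length hvs
  have h2 := hS.2
  have h3 := numCycles_glue S.cyc hne
  have h4 := numCycles_mul_swap_of_not S.cyc hs
  simp only [List.length_map, List.length_cons] at h1 h2
  simp only [Surface.selfGlue]
  omega

/-- In the disjoint union the two intervals lie on different circles, so this is an instance of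
`glue_diff`. The result is rotated so that the letters of the first surface come first. -/
theorem join [Finite I] [Finite J] {h : I} {h' : J} {u : List I} {u' : List J}
    (hS : S.IsPresentation ((u ++ [h]) :: ws)) (hT : T.IsPresentation ((h' :: u') :: vs))
    {ts : List (List {x : I ⊕ J // x ≠ Sum.inl h ∧ x ≠ Sum.inr h'})}
    (hts : ts.map (List.map Subtype.val) = (u.map Sum.inl ++ u'.map Sum.inr) ::
      (ws.map (List.map Sum.inl) ++ vs.map (List.map Sum.inr))) :
    (S.join T h h').IsPresentation ts := by
  obtain ⟨t, ts, rfl⟩ : ∃ t ts', ts = t :: ts' := by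
    cases ts with
    | nil => simp at hts
    | cons t ts => exact ⟨t, ts, rfl⟩
  rw [List.map_cons, List.cons.injEq] at hts
  obtain ⟨h1, h2⟩ := hts
  obtain ⟨t1, t2, rfl, e1, e2⟩ := List.map_eq_append_iff.1 h1
  have hr : (u ++ [h]) ~r (h :: u) := List.isRotated_concat h u
  have h3 := (hS.rotate hr).1.sum hT.1
  have h4 : IsCycleList (Perm.sumCongr S.cyc T.cyc) ((Sum.inl h :: u.map Sum.inl) ::
      (Sum.inr h' :: u'.map Sum.inr) :: (ws.map (List.map Sum.inl) ++ vs.map (List.map Sum.inr))) := by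
    refine h3.perm ?_
    simp only [List.map_cons, List.cons_append]
    exact List.perm_middle.cons _
  have h5 := h4.glue_diff (vs := (t2 ++ t1) :: ts) (by simp [e1, e2, h2])
  refine ⟨h5.rotate List.isRotated_append, ?_⟩
  have h6 := congrArg List.length h2
  have h7 := hS.2
  have h8 := hT.2
  have h9 := numCycles_glue (Perm.sumCongr S.cyc T.cyc) (h := Sum.inl h) (h' := Sum.inr h')
    Sum.inl_ne_inr
  have h10 := numCycles_mul_swap_of_not _ (h4.not_sameCycle rfl List.mem_cons_self List.mem_cons_self)
  have h11 := numCycles_sumCongr S.cyc T.cyc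
  simp only [List.length_map, List.length_cons, List.length_append] at h6 h7 h8
  simp only [Surface.join, List.length_cons]
  omega

end Surface.IsPresentation

theorem Surface.exists_isPresentation {I : Type} [Finite I] (S : Surface I) :
    ∃ ws, S.IsPresentation ws := exists_isCycleList S.cyc S.free

/-- Surfaces with a common presentation and the same genus are equal. -/
theorem Surface.eq_of_isPresentation {I : Type} {S T : Surface I} {ws : List (List I)}
    (hS : S.IsPresentation ws) (hT : T.IsPresentation ws) (hg : S.genus = T.genus) : S = T := by
  have h1 := hS.1.perm_eq hT.1
  refine Surface.ext h1 hg ?_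
  have h2 := hS.2
  rw [hT.2, h1] at h2
  omega

end

/-! ### The tensor of a surface and its basic properties. -/

noncomputable section

namespace DGFrobenius.Ext

variable {A : Type*} [NonUnitalRing A] [Module ℝ A] [IsScalarTower ℝ A A] [SMulCommClass ℝ A A]
  {𝒜 : ZMod 2 → Submodule ℝ A} {F : DGFrobenius 𝒜} [DirectSum.Decomposition 𝒜]
  [SetLike.GradedMul 𝒜] [FiniteDimensional ℝ A] {I J : Type}

theorem wordProd_map (e : I → J) (w : List I) (a : J → A) :
    wordProd F (w.map e) a = wordProd F w fun i => a (e i) := by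
  simp [wordProd, Function.comp_def]

theorem blockProd_map (e : I → J) (ws : List (List I)) (a : J → A) :
    blockProd F (ws.map (List.map e)) a = blockProd F ws fun i => a (e i) := by
  simp [blockProd, Function.comp_def, wordProd_map]

theorem surfaceTrace_map (e : I → J) (ws : List (List I)) (g : ℕ) (a : J → A) :
    surfaceTrace F (ws.map (List.map e)) g a = surfaceTrace F ws g fun i => a (e i) := by
  cases ws with
  | nil => rfl
  | cons w ws => rw [List.map_cons, surfaceTrace, surfaceTrace, wordProd_map, blockProd_map]

theorem wordProd_congr {w : List I} {a b : I → A} (h : ∀ i ∈ w, a i = b i) :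
    wordProd F w a = wordProd F w b := by
  rw [wordProd, wordProd, List.map_congr_left fun i hi => by rw [h i hi]]

theorem blockProd_congr {ws : List (List I)} {a b : I → A} (h : ∀ i ∈ ws.flatten, a i = b i) :
    blockProd F ws a = blockProd F ws b := by
  rw [blockProd, blockProd, List.map_congr_left fun w hw => by
    rw [wordProd_congr fun i hi => h i (List.mem_flatten.2 ⟨w, hw, hi⟩)]]

theorem unit_casimir (x : F.Ext) : (casimir F x).unit = 0 := by
  have h : ∀ q y, (casimirOf F q y).unit = 0 := by
    intro q y
    rw [casimirOf_apply]
    have : ∀ (s : Finset (Fin (Module.finrank ℝ A))) (f : Fin (Module.finrank ℝ A) → F.Ext),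
        (∀ j, (f j).unit = 0) → (∑ j ∈ s, f j).unit = 0 := by
      intro s f hf
      induction s using Finset.induction_on with
      | empty => simp
      | insert j s hj ih => rw [Finset.sum_insert hj, unit_add, hf, ih, add_zero]
    exact this _ _ fun j => by simp
  simp [casimir, h, sub_eq_add_neg]

theorem unit_handle : (handle F).unit = 0 := by
  rw [handle]
  refine Finset.sum_induction _ (fun x : F.Ext => x.unit = 0) (fun x y hx hy => ?_) rfl
    fun j _ => by simp
  rw [unit_add, hx, hy, add_zero]

/-- The unit component is multiplicative and vanishes on letters, on values of `casimir` and on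
`handle`. For a surface with one interval removed from its first word, the hypothesis is supplied by
stability. -/
theorem unit_word_mul_block {w : List I} {ws : List (List I)} {g : ℕ}
    (h : w ≠ [] ∨ ws ≠ [] ∨ g ≠ 0) (a : I → A) :
    (wordProd F w a * (blockProd F ws a * handle F ^ g)).unit = 0 := by
  rcases h with h | h | h
  · obtain ⟨i, w, rfl⟩ := List.exists_cons_of_ne_nil h
    simp
  · obtain ⟨v, ws, rfl⟩ := List.exists_cons_of_ne_nil h
    simp [unit_casimir]
  · obtain ⟨g, rfl⟩ := Nat.exists_eq_succ_of_ne_zero h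
    simp [pow_succ, unit_handle]

/-- Both sides equal the inner product of the `A`-components. A unit component of `x` or `y` would
contribute on the right but not on the left. -/
theorem sum_trace_mul_trace {x y : F.Ext} (hx : x.unit = 0) (hy : y.unit = 0) :
    ∑ j, trace F (x * incl F (F.basis j)) * trace F (incl F (F.dual j) * y) = trace F (x * y) := by
  have h1 := congrArg (fun b => F.form b y.el) (F.sum_form_basis x.el)
  simp only [map_sum, map_smul, LinearMap.sum_apply, LinearMap.smul_apply, smul_eq_mul] at h1
  simp [trace_apply, hx, hy, h1]

theorem blockProd_comm_handle {p : I → ZMod 2} {a : I → A} (ha : ∀ i, a i ∈ 𝒜 (p i))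
    (ws : List (List I)) : blockProd F ws a * handle F = handle F * blockProd F ws a := by
  induction ws with
  | nil => simp
  | cons w ws ih =>
    have h1 := isCentral_handle.casimir_mul (isWord_wordProd (F := F) ha w)
    rw [swapSign_zero_right, one_smul] at h1
    rw [blockProd_cons, mul_assoc, ih, ← mul_assoc, h1, mul_assoc]

theorem blockProd_comm_handle_pow {p : I → ZMod 2} {a : I → A} (ha : ∀ i, a i ∈ 𝒜 (p i))
    (ws : List (List I)) (g : ℕ) :
    blockProd F ws a * handle F ^ g = handle F ^ g * blockProd F ws a :=
  (Commute.pow_right (blockProd_comm_handle ha ws) g : _)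

/-- The tensor assigned to a surface. -/
def surfaceValue (F : DGFrobenius 𝒜) (S : Surface I) (L : Enumeration I) :
    MultilinearMap ℝ (fun _ : I => A) ℝ :=
  haveI := L.finite
  haveI := Fintype.ofFinite I
  have h := S.exists_isPresentation.choose_spec
  signedMap 𝒜 (fun p => koszulSign p L.list S.exists_isPresentation.choose.flatten)
    (surfaceMap F _ S.genus h.1.nodup h.1.complete)

/-- The presentation chosen in the definition has the same cyclic words as `ws`, so
`surfaceTrace_cycles` compares the traces; the sign it produces is absorbed by `koszulSign_trans`.
-/
theorem surfaceValue_eq [inst : Fintype I] {S : Surface I} {ws : List (List I)}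
    (h : S.IsPresentation ws)
    (L : Enumeration I) {p : I → ZMod 2} {a : I → A} (ha : ∀ i, a i ∈ 𝒜 (p i)) :
    surfaceValue F S L a = koszulSign p L.list ws.flatten * surfaceTrace F ws S.genus a := by
  haveI := L.finite
  obtain rfl : inst = Fintype.ofFinite I := Subsingleton.elim _ _
  letI := Fintype.ofFinite I
  have hc := S.exists_isPresentation.choose_spec
  obtain ⟨h1, h2⟩ := surfaceTrace_cycles (F := F) ha S.genus (hc.1.cycles_perm h.1
    (hc.2.trans h.2.symm)) hc.1.nodup
  rw [surfaceValue, signedMap_of_mem _ _ ha]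
  change _ * surfaceTrace F _ _ _ = _
  rw [h2, ← mul_assoc, koszulSign_trans p (hc.enum L) h1]

variable [Fintype I] [Fintype J]

theorem surfaceValue_relabel (e : I ≃ J) (S : Surface I) (L : Enumeration I) (L' : Enumeration J)
    (hL : L'.list = L.list.map e) (a : J → A) :
    surfaceValue F (S.relabel e) L' a = surfaceValue F S L fun i => a (e i) := by
  refine MultilinearMap.congr_homogeneous 𝒜 _ ((surfaceValue F S L).domDomCongr e) ?_ a
  intro p a ha
  obtain ⟨ws, hws⟩ := S.exists_isPresentation
  rw [surfaceValue_eq (hws.relabel e) L' ha, MultilinearMap.domDomCongr_apply,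
    surfaceValue_eq hws L fun i => ha (e i), surfaceTrace_map, hL, ← List.map_flatten,
    koszulSign_map e e.injective p (hws.enum L) L.nodup]
  rfl

theorem surfaceValue_reorder (S : Surface I) (L L' : Enumeration I) {p : I → ZMod 2} {a : I → A}
    (ha : ∀ i, a i ∈ 𝒜 (p i)) :
    surfaceValue F S L' a = koszulSign p L.list L'.list * surfaceValue F S L a := by
  obtain ⟨ws, hws⟩ := S.exists_isPresentation
  rw [surfaceValue_eq hws L ha, surfaceValue_eq hws L' ha, ← mul_assoc, koszulSign_comm p L.list,
    koszulSign_trans p (L'.perm L.nodup L.complete) (hws.enum L)]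

theorem surfaceValue_even (S : Surface I) (L : Enumeration I) {p : I → ZMod 2} {a : I → A}
    (ha : ∀ i, a i ∈ 𝒜 (p i)) (hp : ∑ i, p i ≠ 0) : surfaceValue F S L a = 0 := by
  obtain ⟨ws, hws⟩ := S.exists_isPresentation
  rw [surfaceValue_eq hws L ha, surfaceTrace_even ha S.genus hws.1.nodup, mul_zero]
  rwa [wordParity_eq_sum p hws.1.nodup hws.1.complete]

theorem update_d_mem {p : I → ZMod 2} {a : I → A} (ha : ∀ i, a i ∈ 𝒜 (p i)) (i j : I) :
    Function.update a i (F.d (a i)) j ∈ 𝒜 (Function.update p i (p i + 1) j) := by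
  by_cases h : j = i
  · subst h; simpa using F.d_mem _ _ (ha j)
  · simpa [h] using ha j

theorem surfaceValue_d (S : Surface I) (L : Enumeration I) {p : I → ZMod 2} {a : I → A}
    (ha : ∀ i, a i ∈ 𝒜 (p i)) :
    ∑ i, prefixSign p L.list i * surfaceValue F S L (Function.update a i (F.d (a i))) = 0 := by
  obtain ⟨ws, hws⟩ := S.exists_isPresentation
  have h := surfaceTrace_d (F := F) ha S.genus hws.1.nodup hws.1.complete
  rw [← mul_zero (koszulSign p L.list ws.flatten), ← h, Finset.mul_sum]
  refine Finset.sum_congr rfl fun i _ => ?_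
  rw [surfaceValue_eq hws L (update_d_mem ha i), ← mul_assoc,
    prefixSign_mul_koszulSign p (hws.enum L) L.nodup, mul_assoc]

end DGFrobenius.Ext

end

/-! ### Gluing two intervals of one surface. -/

noncomputable section

theorem wordParity_map {I J : Type} (e : I → J) (p : J → ZMod 2) (L : List I) :
    wordParity p (L.map e) = wordParity (fun i => p (e i)) L := by
  simp [wordParity, Function.comp_def]

/-- Apart from the reordering of the remaining letters, the only sign is that of carrying `h'`
across the word `v` that separates it from `h`. -/
theorem koszulSign_insertTwo {I : Type} [Fintype I] {h h' : I} (hne : h ≠ h')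
    (p : {x // x ≠ h ∧ x ≠ h'} → ZMod 2) (q q' : ZMod 2) {L v r : List {x // x ≠ h ∧ x ≠ h'}}
    (hL : L.Perm (v ++ r)) (hn : L.Nodup) :
    koszulSign (insertTwo h h' p q q') (h :: h' :: L.map Subtype.val)
      (h :: (v.map Subtype.val ++ h' :: r.map Subtype.val)) =
    swapSign q' (wordParity p v) * koszulSign p L (v ++ r) := by
  have hh : ∀ l : List {x // x ≠ h ∧ x ≠ h'}, h ∉ l.map Subtype.val := fun l hl => by
    obtain ⟨x, -, hx⟩ := List.mem_map.1 hl
    exact x.2.1 hx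
  have hh' : ∀ l : List {x // x ≠ h ∧ x ≠ h'}, h' ∉ l.map Subtype.val := fun l hl => by
    obtain ⟨x, -, hx⟩ := List.mem_map.1 hl
    exact x.2.2 hx
  have hn' : (v ++ r).Nodup := hL.nodup_iff.1 hn
  have e1 : (h' :: L.map Subtype.val).Perm (h' :: (v.map Subtype.val ++ r.map Subtype.val)) := by
    rw [← List.map_append]
    exact (hL.map _).cons _
  have e2 : (h' :: (v.map Subtype.val ++ r.map Subtype.val)).Perm
      (v.map Subtype.val ++ h' :: r.map Subtype.val) := List.perm_middle.symm
  rw [koszulSign_cons _ (e1.trans e2) (by simpa [hne] using hh L), ← koszulSign_trans _ e1 e2,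
    ← List.map_append, koszulSign_cons _ (hL.map _) (hh' L),
    koszulSign_map _ Subtype.val_injective _ hL hn, List.map_append, ← List.cons_append,
    koszulSign_move _ _ _ _ (by
      rw [List.cons_append, ← List.map_append]
      exact List.nodup_cons.2 ⟨hh' _, hn'.map Subtype.val_injective⟩),
    insertTwo_right _ _ _ hne, wordParity_map, mul_comm]
  simp only [insertTwo_val]

theorem exists_lift_words {I : Type} {h h' : I} {u u' : List I} {us : List (List I)}
    (hn : (h :: (u ++ h' :: (u' ++ us.flatten))).Nodup) :
    ∃ (v v' : List {x // x ≠ h ∧ x ≠ h'}) (rs : List (List {x // x ≠ h ∧ x ≠ h'})),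
      v.map Subtype.val = u ∧ v'.map Subtype.val = u' ∧ rs.map (List.map Subtype.val) = us := by
  obtain ⟨vs, hvs⟩ := List.exists_map_val (P := fun x => x ≠ h ∧ x ≠ h') (u' :: u :: us) (by
    intro w hw x hx
    have hx' : x ∈ (u' :: u :: us).flatten := List.mem_flatten.2 ⟨w, hw, hx⟩
    simp only [List.flatten_cons, List.mem_append] at hx'
    constructor
    · rintro rfl
      exact (List.nodup_cons.1 hn).1 (by simp only [List.mem_append, List.mem_cons]; tauto)
    · rintro rfl
      have h2 := List.perm_middle.nodup_iff.1 (List.nodup_cons.1 hn).2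
      exact (List.nodup_cons.1 h2).1 (by simp only [List.mem_append]; tauto))
  obtain ⟨v', vs, rfl⟩ := List.exists_cons_of_ne_nil (l := vs) (by rintro rfl; simp at hvs)
  obtain ⟨v, rs, rfl⟩ := List.exists_cons_of_ne_nil (l := vs) (by rintro rfl; simp at hvs)
  simp only [List.map_cons, List.cons.injEq] at hvs
  exact ⟨v, v', rs, hvs.2.1, hvs.1, hvs.2.2⟩

namespace DGFrobenius.Ext

variable {A : Type*} [NonUnitalRing A] [Module ℝ A] [IsScalarTower ℝ A A] [SMulCommClass ℝ A A]
  {𝒜 : ZMod 2 → Submodule ℝ A} {F : DGFrobenius 𝒜} [DirectSum.Decomposition 𝒜]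
  [SetLike.GradedMul 𝒜] [FiniteDimensional ℝ A] {I J : Type} [Fintype I] [Fintype J]

/-- The sign of carrying `y` across `v` is written as `signOp` on `y`. The right-hand side is then
linear in `x` and `y` without reference to their degree and has the sign that occurs in `casimir`.
-/
theorem surfaceValue_insertTwo {S : Surface I} {ws : List (List I)} (hS : S.IsPresentation ws)
    {h h' : I} (hne : h ≠ h') (L : Enumeration {x // x ≠ h ∧ x ≠ h'}) (L' : Enumeration I)
    (hL : L'.list = h :: h' :: L.list.map Subtype.val) {p : {x // x ≠ h ∧ x ≠ h'} → ZMod 2}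
    {a : {x // x ≠ h ∧ x ≠ h'} → A} (ha : ∀ i, a i ∈ 𝒜 (p i)) {v r : List {x // x ≠ h ∧ x ≠ h'}}
    (hv : ws.flatten = h :: (v.map Subtype.val ++ h' :: r.map Subtype.val))
    (hr : L.list.Perm (v ++ r)) {q : ZMod 2} {x y : A} (hx : x ∈ 𝒜 q) (hy : y ∈ 𝒜 q) :
    surfaceValue F S L' (insertTwo h h' a x y) = koszulSign p L.list (v ++ r) *
      surfaceTrace F ws S.genus (insertTwo h h' a x (signOp 𝒜 (wordParity p v) y)) := by
  have e : surfaceTrace F ws S.genus (insertTwo h h' a x (signOp 𝒜 (wordParity p v) y)) =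
      swapSign (wordParity p v) q * surfaceTrace F ws S.genus (insertTwo h h' a x y) := by
    rw [signOp_of_mem 𝒜 _ hy]
    have := ((surfaceMap F ws S.genus hS.1.nodup hS.1.complete).bilin hne a x).map_smul
      (swapSign (wordParity p v) q) y
    exact this
  rw [surfaceValue_eq hS L' (insertTwo_mem hne ha hx hy), hL, hv,
    koszulSign_insertTwo hne p q q hr L.nodup, e, swapSign_comm]
  ring

/-- The first circle carries `h v h' v'`. Contraction replaces `b_j v b^j` by `casimir` of `v`,
which is the contribution of a separate circle with word `v`, while `v'` stays under the trace. -/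
theorem surfaceValue_selfGlue_same {S : Surface I} {h h' : I} (hne : h ≠ h')
    (hs : S.cyc.SameCycle h h') (L : Enumeration {x // x ≠ h ∧ x ≠ h'}) (L' : Enumeration I)
    (hL : L'.list = h :: h' :: L.list.map Subtype.val) {p : {x // x ≠ h ∧ x ≠ h'} → ZMod 2}
    {a : {x // x ≠ h ∧ x ≠ h'} → A} (ha : ∀ i, a i ∈ 𝒜 (p i)) :
    surfaceValue F (S.selfGlue h h' hne) L a =
      ∑ j, surfaceValue F S L' (insertTwo h h' a (F.basis j) (F.dual j)) := by
  obtain ⟨_, h0⟩ := S.exists_isPresentation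
  obtain ⟨u, u', us, hS⟩ := h0.exists_same hne hs
  have hn := hS.1.nodup
  simp only [List.flatten_cons, List.cons_append, List.append_assoc] at hn
  obtain ⟨v, v', rs, rfl, rfl, rfl⟩ := exists_lift_words hn
  obtain ⟨hP, hg⟩ := hS.selfGlue_same hne (vs := v' :: v :: rs) (by simp)
  have hLp := hP.enum L
  rw [List.flatten_cons, List.flatten_cons] at hLp
  have hsw : (v' ++ (v ++ rs.flatten)).Perm (v ++ (v' ++ rs.flatten)) := by
    rw [← List.append_assoc, ← List.append_assoc]
    exact List.perm_append_comm.append_right _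
  have hn2 : (v' ++ v ++ rs.flatten).Nodup := by
    rw [List.append_assoc]; exact hP.1.nodup
  have hV := isWord_wordProd (F := F) ha v
  set K := koszulSign p L.list (v ++ (v' ++ rs.flatten)) with hK
  set Z := blockProd F rs a * handle F ^ S.genus with hZ
  have key := F.contract_congr ((surfaceValue F S L').bilin hne a)
    (K • ((sandwich (wordProd F v a)).compl₁₂ (incl F) (incl F ∘ₗ signOp 𝒜 (wordParity p v))).compr₂
      (trace F ∘ₗ LinearMap.mulRight ℝ (wordProd F v' a * Z))) (by
    intro q x hx y hy
    rw [MultilinearMap.bilin_apply, surfaceValue_insertTwo hS hne L L' hL ha (v := v)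
      (r := v' ++ rs.flatten) (by
        simp only [List.flatten_cons, List.map_append, List.map_flatten, List.cons_append,
          List.append_assoc]) (hLp.trans hsw) hx hy]
    simp only [LinearMap.smul_apply, smul_eq_mul, LinearMap.compr₂_apply, LinearMap.compl₁₂_apply,
      LinearMap.comp_apply, sandwich_apply, LinearMap.mulRight_apply, surfaceTrace, wordProd_cons,
      wordProd_append, wordProd_map, blockProd_map, insertTwo_val, insertTwo_left,
      insertTwo_right _ _ _ hne, hZ, mul_assoc]
    rfl)
  simp only [MultilinearMap.bilin_apply] at key
  rw [key, surfaceValue_eq hP L ha, hg]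
  simp only [LinearMap.smul_apply, smul_eq_mul, LinearMap.compr₂_apply, LinearMap.compl₁₂_apply,
      LinearMap.comp_apply, sandwich_apply, LinearMap.mulRight_apply]
  -- The central element is moved behind `v'`; the sign agrees with that of exchanging the blocks
  -- `v` and `v'` in the order of the letters.
  rw [← Finset.mul_sum, ← map_sum, ← Finset.sum_mul, ← hV.isHomog.casimir_eq, surfaceTrace,
    blockProd_cons, mul_assoc (Ext.casimir F _), ← mul_assoc (wordProd F v' a),
    hV.isHomog.isCentral_casimir.word_mul (isWord_wordProd ha v'), smul_mul_assoc, map_smul,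
    smul_eq_mul, ← mul_assoc, ← hZ, mul_assoc (Ext.casimir F _), List.flatten_cons,
    List.flatten_cons, hK, ← koszulSign_trans p hLp hsw, ← List.append_assoc v',
    ← List.append_assoc v, koszulSign_swap_blocks p _ _ _ hn2]

/-- The glued circles `h v` and `h' v'` contribute `b_j v C(b^j v')`, which sums up to `± v' v H` by
`sum_mul_casimir_mul`: one circle less, one handle more. -/
theorem surfaceValue_selfGlue_diff {S : Surface I} {h h' : I} (hne : h ≠ h')
    (hs : ¬ S.cyc.SameCycle h h') (L : Enumeration {x // x ≠ h ∧ x ≠ h'}) (L' : Enumeration I)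
    (hL : L'.list = h :: h' :: L.list.map Subtype.val) {p : {x // x ≠ h ∧ x ≠ h'} → ZMod 2}
    {a : {x // x ≠ h ∧ x ≠ h'} → A} (ha : ∀ i, a i ∈ 𝒜 (p i)) :
    surfaceValue F (S.selfGlue h h' hne) L a =
      ∑ j, surfaceValue F S L' (insertTwo h h' a (F.basis j) (F.dual j)) := by
  obtain ⟨_, h0⟩ := S.exists_isPresentation
  obtain ⟨u, u', us, hS⟩ := h0.exists_diff hs
  have hn := hS.1.nodup
  simp only [List.flatten_cons, List.cons_append, List.append_assoc] at hn
  obtain ⟨v, v', rs, rfl, rfl, rfl⟩ := exists_lift_words hn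
  obtain ⟨hP, hg⟩ := hS.selfGlue_diff hne (vs := (v' ++ v) :: rs) (by simp)
  have hLp := hP.enum L
  rw [List.flatten_cons, List.append_assoc] at hLp
  have hsw : (v' ++ (v ++ rs.flatten)).Perm (v ++ (v' ++ rs.flatten)) := by
    rw [← List.append_assoc, ← List.append_assoc]
    exact List.perm_append_comm.append_right _
  have hn2 : (v' ++ v ++ rs.flatten).Nodup := hP.1.nodup
  have hV := isWord_wordProd (F := F) ha v
  set K := koszulSign p L.list (v ++ (v' ++ rs.flatten)) with hK
  set Z := blockProd F rs a * handle F ^ S.genus with hZ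
  have key := F.contract_congr ((surfaceValue F S L').bilin hne a)
    (K • ((sandwich (wordProd F v a)).compl₁₂ (incl F) (Ext.casimir F ∘ₗ
      LinearMap.mulRight ℝ (wordProd F v' a) ∘ₗ incl F ∘ₗ signOp 𝒜 (wordParity p v))).compr₂
      (trace F ∘ₗ LinearMap.mulRight ℝ Z)) (by
    intro q x hx y hy
    rw [MultilinearMap.bilin_apply, surfaceValue_insertTwo hS hne L L' hL ha (v := v)
      (r := v' ++ rs.flatten) (by
        simp only [List.flatten_cons, List.map_append, List.map_flatten, List.cons_append,
          List.append_assoc]) (hLp.trans hsw) hx hy]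
    simp only [LinearMap.smul_apply, smul_eq_mul, LinearMap.compr₂_apply, LinearMap.compl₁₂_apply,
      LinearMap.comp_apply, sandwich_apply, LinearMap.mulRight_apply, surfaceTrace, wordProd_cons,
      blockProd_cons, wordProd_map, blockProd_map, insertTwo_val, insertTwo_left,
      insertTwo_right _ _ _ hne, hZ, mul_assoc]
    rfl)
  simp only [MultilinearMap.bilin_apply] at key
  rw [key, surfaceValue_eq hP L ha, hg]
  simp only [LinearMap.smul_apply, smul_eq_mul, LinearMap.compr₂_apply, LinearMap.compl₁₂_apply,
      LinearMap.comp_apply, sandwich_apply, LinearMap.mulRight_apply]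
  rw [← Finset.mul_sum, ← map_sum, ← Finset.sum_mul, sum_mul_casimir_mul hV (isWord_wordProd ha v'),
    surfaceTrace, pow_succ', ← mul_assoc (blockProd F rs a), blockProd_comm_handle ha,
    mul_assoc (handle F), ← hZ, wordProd_append, smul_mul_assoc, map_smul,
    smul_eq_mul, ← mul_assoc, List.flatten_cons, List.append_assoc,
    hK, ← koszulSign_trans p hLp hsw, ← List.append_assoc v',
    ← List.append_assoc v, koszulSign_swap_blocks p _ _ _ hn2, swapSign_comm (wordParity p v)]
  simp only [mul_assoc]
  rw [← mul_assoc (swapSign _ _), swapSign_mul_self, one_mul]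

theorem surfaceValue_selfGlue (S : Surface I) {h h' : I} (hne : h ≠ h')
    (L : Enumeration {x // x ≠ h ∧ x ≠ h'}) (L' : Enumeration I)
    (hL : L'.list = h :: h' :: L.list.map Subtype.val) (a : {x // x ≠ h ∧ x ≠ h'} → A) :
    surfaceValue F (S.selfGlue h h' hne) L a =
      ∑ j, surfaceValue F S L' (insertTwo h h' a (F.basis j) (F.dual j)) := by
  have e := MultilinearMap.congr_homogeneous 𝒜 (surfaceValue F (S.selfGlue h h' hne) L)
    (∑ j, (surfaceValue F S L').domDomRestrict (fun x => x ≠ h ∧ x ≠ h')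
      (fun x => if (x : I) = h then F.basis j else F.dual j)) (fun p a ha => by
    rw [MultilinearMap.sum_apply]
    by_cases hs : S.cyc.SameCycle h h'
    · exact surfaceValue_selfGlue_same hne hs L L' hL ha
    · exact surfaceValue_selfGlue_diff hne hs L L' hL ha) a
  rw [MultilinearMap.sum_apply] at e
  exact e

end DGFrobenius.Ext

end

/-! ### Gluing two surfaces; the existence of the theory. -/

noncomputable section

theorem wordParity_congr {I : Type} {p q : I → ZMod 2} {l : List I} (h : ∀ i ∈ l, p i = q i) :
    wordParity p l = wordParity q l := by
  rw [wordParity, wordParity, List.map_congr_left h]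

theorem Surface.IsPresentation.card_eq {I : Type} [Fintype I] {S : Surface I} {ws : List (List I)}
    (h : S.IsPresentation ws) : Nat.card I = ws.flatten.length := by
  rw [Nat.card_eq_fintype_card, ← List.toFinset_card_of_nodup h.1.nodup, ← Finset.card_univ]
  congr 1
  ext i
  simpa using h.1.complete i

/-- A stable surface is not a disk with one interval. -/
theorem Surface.IsPresentation.nontrivial {I : Type} [Fintype I] {S : Surface I} {i : I}
    {w u : List I} {ws : List (List I)} (h : S.IsPresentation (w :: ws)) (hw : w.Perm (i :: u)) :
    u ≠ [] ∨ ws ≠ [] ∨ S.genus ≠ 0 := by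
  by_contra hc
  push Not at hc
  obtain ⟨rfl, rfl, hg⟩ := hc
  have h1 := S.stable.2
  have h2 := h.2
  have h3 := h.card_eq
  have h4 := hw.length_eq
  rw [List.flatten_cons, List.flatten_nil, List.append_nil, h4] at h3
  simp only [List.length_cons, List.length_nil] at h2 h3
  omega

theorem update_eq_of_mem {I β : Type*} {h : I} {l : List I} (hh : h ∉ l) (b : I → β) (x : β) {i : I}
    (hi : i ∈ l) : Function.update b h x i = b i :=
  Function.update_of_ne (fun hc => hh (by rwa [← hc])) _ _

theorem mem_update {A I : Type*} [AddCommGroup A] [Module ℝ A] {𝒜 : ZMod 2 → Submodule ℝ A}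
    {p : I → ZMod 2} {b : I → A} (hb : ∀ i, b i ∈ 𝒜 (p i)) {q : ZMod 2} {x : A} (hx : x ∈ 𝒜 q)
    (h i : I) : Function.update b h x i ∈ 𝒜 (Function.update p h q i) := by
  by_cases hi : i = h
  · subst hi; simpa using hx
  · simpa [hi] using hb i

namespace DGFrobenius.Ext

variable {A : Type*} [NonUnitalRing A] [Module ℝ A] [IsScalarTower ℝ A A] [SMulCommClass ℝ A A]
  {𝒜 : ZMod 2 → Submodule ℝ A} {F : DGFrobenius 𝒜} [DirectSum.Decomposition 𝒜]
  [SetLike.GradedMul 𝒜] [FiniteDimensional ℝ A] {I J : Type} [Fintype I] [Fintype J]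

/-- The element at `h` is carried past the central blocks to the end of the product. The sign of
this cancels against the Koszul sign of placing `h` last among the factors. -/
theorem surfaceValue_last {S : Surface I} {h : I} {u : List I} {us : List (List I)}
    (hS : S.IsPresentation ((u ++ [h]) :: us)) (L : Enumeration I) {l : List I}
    (hL : L.list = l ++ [h]) {p : I → ZMod 2} {b : I → A} (hb : ∀ i, b i ∈ 𝒜 (p i)) (x : A) :
    surfaceValue F S L (Function.update b h x) = koszulSign p l (u ++ us.flatten) *
      trace F (wordProd F u b * (blockProd F us b * handle F ^ S.genus) * incl F x) := by
  have hn := hS.1.nodup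
  have hp := hS.enum L
  have e1 : (u ++ us.flatten ++ [h]).Perm (u ++ [h] ++ us.flatten) := by
    rw [List.append_assoc, List.append_assoc]
    exact List.perm_append_comm.append_left _
  rw [List.flatten_cons] at hn hp
  rw [hL] at hp
  have hn2 := e1.symm.nodup_iff.1 hn
  have hhn : h ∉ u ++ us.flatten := fun hc =>
    (List.disjoint_of_nodup_append hn2) hc (by simp)
  have hl : l.Perm (u ++ us.flatten) :=
    (List.perm_append_right_iff [h]).1 (hp.trans e1.symm)
  revert x
  refine LinearMap.congr_homogeneous 𝒜 ((surfaceValue F S L).toLinearMap b h)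
    (koszulSign p l (u ++ us.flatten) • trace F ∘ₗ LinearMap.mulLeft ℝ _ ∘ₗ incl F) ?_
  intro q x hx
  have hz := isCentral_blockProd_mul (F := F) hb us S.genus
  rw [MultilinearMap.toLinearMap_apply, surfaceValue_eq hS L (mem_update hb hx h), hL,
    List.flatten_cons, ← koszulSign_trans _ (hp.trans e1.symm) e1,
    koszulSign_append _ hl (hL ▸ L.nodup), koszulSign_congr (q := p) hl
      (fun i hi => update_eq_of_mem hhn p q (hl.mem_iff.1 hi)), List.append_assoc, List.append_assoc,
    koszulSign_append_left _ List.perm_append_comm (by rwa [← List.append_assoc]),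
    koszulSign_comm _ (us.flatten ++ [h])]
  have e2 := koszulSign_swap_blocks (Function.update p h q) [h] us.flatten []
    (by
      rw [List.append_assoc] at hn
      rw [List.append_nil]
      exact (List.nodup_append.1 hn).2.1)
  rw [List.append_nil, List.append_nil] at e2
  rw [e2, wordParity_congr (fun i hi => update_eq_of_mem hhn p q (List.mem_append_right _ hi)), surfaceTrace,
    wordProd_append, wordProd_congr (fun i hi => update_eq_of_mem hhn b x (List.mem_append_left _ hi)),
    blockProd_congr (fun i hi => update_eq_of_mem hhn b x (List.mem_append_right _ hi))]
  simp only [LinearMap.smul_apply, LinearMap.comp_apply, LinearMap.mulLeft_apply, wordProd_cons,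
    wordProd_nil, mul_one, Function.update_self, smul_eq_mul, wordParity_cons, wordParity_nil,
    add_zero]
  rw [mul_assoc (wordProd F u b), hz.comm, signOp_of_mem 𝒜 _ hx, map_smul, mul_smul_comm,
    mul_smul_comm, map_smul, smul_eq_mul, swapSign_comm q]
  simp only [mul_assoc]
  rw [← mul_assoc (swapSign _ _), swapSign_mul_self, one_mul]

theorem surfaceValue_first {S : Surface I} {h : I} {u : List I} {us : List (List I)}
    (hS : S.IsPresentation ((h :: u) :: us)) (L : Enumeration I) {l : List I}
    (hL : L.list = h :: l) {p : I → ZMod 2} {b : I → A} (hb : ∀ i, b i ∈ 𝒜 (p i)) (x : A) :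
    surfaceValue F S L (Function.update b h x) = koszulSign p l (u ++ us.flatten) *
      trace F (incl F x * (wordProd F u b * (blockProd F us b * handle F ^ S.genus))) := by
  have hn := hS.1.nodup
  have hp := hS.enum L
  rw [List.flatten_cons, List.cons_append] at hn hp
  rw [hL] at hp
  have hhn := (List.nodup_cons.1 hn).1
  have hl : l.Perm (u ++ us.flatten) := (List.perm_cons h).1 hp
  revert x
  refine LinearMap.congr_homogeneous 𝒜 ((surfaceValue F S L).toLinearMap b h)
    (koszulSign p l (u ++ us.flatten) • trace F ∘ₗ LinearMap.mulRight ℝ _ ∘ₗ incl F) ?_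
  intro q x hx
  rw [MultilinearMap.toLinearMap_apply, surfaceValue_eq hS L (mem_update hb hx h), hL,
    List.flatten_cons, List.cons_append, koszulSign_cons _ hl (fun hc => hhn (hl.mem_iff.1 hc)),
    koszulSign_congr (q := p) hl (fun i hi => update_eq_of_mem hhn p q (hl.mem_iff.1 hi)), surfaceTrace,
    wordProd_cons, wordProd_congr (fun i hi => update_eq_of_mem hhn b x (List.mem_append_left _ hi)),
    blockProd_congr (fun i hi => update_eq_of_mem hhn b x (List.mem_append_right _ hi)), Function.update_self,
    mul_assoc]
  rfl

/-- With `h` last in the first trace and `h'` first in the second one, `sum_trace_mul_trace`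
contracts them to a single trace. The factors are then regrouped into one word, the remaining blocks
and the total power of `handle`. -/
theorem surfaceValue_join_of_mem (S : Surface I) (T : Surface J) (h : I) (h' : J)
    {l : List I} {l' : List J} (L : Enumeration I) (L' : Enumeration J)
    (K : Enumeration {x : I ⊕ J // x ≠ Sum.inl h ∧ x ≠ Sum.inr h'})
    (hL : L.list = l ++ [h]) (hL' : L'.list = h' :: l')
    (hK : K.list.map Subtype.val = l.map Sum.inl ++ l'.map Sum.inr)
    {p : I ⊕ J → ZMod 2} {b : I ⊕ J → A} (hb : ∀ i, b i ∈ 𝒜 (p i)) :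
    surfaceValue F (S.join T h h') K (fun i => b i) =
      ∑ j, surfaceValue F S L (Function.update (fun i => b (Sum.inl i)) h (F.basis j)) *
        surfaceValue F T L' (Function.update (fun i => b (Sum.inr i)) h' (F.dual j)) := by
  obtain ⟨_, h1⟩ := S.exists_isPresentation
  obtain ⟨u, us, hS⟩ := h1.exists_cons h
  replace hS := hS.rotate (List.isRotated_concat h u).symm
  obtain ⟨_, h1⟩ := T.exists_isPresentation
  obtain ⟨u', us', hT⟩ := h1.exists_cons h'
  have hn := hS.1.nodup
  have hn' := hT.1.nodup
  rw [List.flatten_cons, List.append_assoc] at hn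
  have hn2 := List.perm_middle.nodup_iff.1 hn
  rw [List.flatten_cons, List.cons_append] at hn'
  have hl : l.Perm (u ++ us.flatten) := by
    have := hS.enum L
    rw [hL, List.flatten_cons, List.append_assoc] at this
    exact (List.perm_cons h).1 ((List.perm_append_singleton h l).symm.trans
      (this.trans List.perm_middle))
  have hl' : l'.Perm (u' ++ us'.flatten) := by
    have := hT.enum L'
    rw [hL', List.flatten_cons, List.cons_append] at this
    exact (List.perm_cons h').1 this
  obtain ⟨ts, hts⟩ := List.exists_map_val (P := fun x : I ⊕ J => x ≠ Sum.inl h ∧ x ≠ Sum.inr h')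
    ((u.map Sum.inl ++ u'.map Sum.inr) ::
      (us.map (List.map Sum.inl) ++ us'.map (List.map Sum.inr))) (by
    intro w hw x hx
    have hx' := List.mem_flatten.2 ⟨w, hw, hx⟩
    simp only [List.flatten_cons, List.flatten_append, ← List.map_flatten, List.mem_append,
      List.mem_map] at hx'
    constructor
    · rintro rfl
      refine (List.nodup_cons.1 hn2).1 ?_
      simpa using hx'
    · rintro rfl
      refine (List.nodup_cons.1 hn').1 ?_
      simpa using hx')
  have hP := hS.join hT hts
  have hKp := (hP.enum K).map Subtype.val
  have hflat : ts.flatten.map Subtype.val = (u.map Sum.inl ++ u'.map Sum.inr) ++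
      (us.flatten.map Sum.inl ++ us'.flatten.map Sum.inr) := by
    rw [List.map_flatten, hts]
    simp only [List.flatten_cons, List.flatten_append, List.map_flatten]
  have hbr := isCentral_blockProd_mul (F := F) (fun i => hb (Sum.inl i)) us S.genus
  have hu' := isWord_wordProd (F := F) (fun i => hb (Sum.inr i)) u'
  simp only [surfaceValue_last hS L hL fun i => hb (Sum.inl i),
    surfaceValue_first hT L' hL' fun i => hb (Sum.inr i)]
  set U := wordProd F u fun i => b (Sum.inl i)
  set U' := wordProd F u' fun i => b (Sum.inr i)
  set R := blockProd F us fun i => b (Sum.inl i)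
  set R' := blockProd F us' fun i => b (Sum.inr i) with hR'
  set k := koszulSign (fun i => p (Sum.inl i)) l (u ++ us.flatten)
  set k' := koszulSign (fun i => p (Sum.inr i)) l' (u' ++ us'.flatten)
  have e1 : ∀ j, k * trace F (U * (R * handle F ^ S.genus) * incl F (F.basis j)) *
      (k' * trace F (incl F (F.dual j) * (U' * (R' * handle F ^ T.genus)))) = (k * k') *
      (trace F (U * (R * handle F ^ S.genus) * incl F (F.basis j)) *
        trace F (incl F (F.dual j) * (U' * (R' * handle F ^ T.genus)))) := fun j => by ring
  rw [Finset.sum_congr rfl fun j _ => e1 j, ← Finset.mul_sum, sum_trace_mul_trace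
    (unit_word_mul_block (hS.nontrivial (List.perm_append_singleton h u)) _)
    (unit_word_mul_block (hT.nontrivial (List.Perm.refl _)) _)]
  have hp2 : ∀ i : {x : I ⊕ J // x ≠ Sum.inl h ∧ x ≠ Sum.inr h'}, b i ∈ 𝒜 (p i) := fun i => hb i
  rw [surfaceValue_eq (p := fun i => p i) hP K hp2, ← surfaceTrace_map Subtype.val ts _ b, hts,
    surfaceTrace, wordProd_append, blockProd_append, wordProd_map, wordProd_map, blockProd_map,
    blockProd_map]
  -- The word `U'` has to be carried across the central blocks of the first surface.
  have e2 : U * U' * (R * R' * handle F ^ (S.join T h h').genus) =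
      swapSign (wordParity (fun i => p (Sum.inr i)) u')
        (wordParity (fun i => p (Sum.inl i)) us.flatten) •
      (U * (R * handle F ^ S.genus) * (U' * (R' * handle F ^ T.genus))) := by
    have e3 : R * R' * handle F ^ (S.join T h h').genus =
        (R * handle F ^ S.genus) * (R' * handle F ^ T.genus) := by
      have h4 : R' * handle F ^ S.genus = handle F ^ S.genus * R' :=
        blockProd_comm_handle_pow (fun i => hb (Sum.inr i)) us' _
      rw [show (S.join T h h').genus = S.genus + T.genus from rfl, pow_add, mul_assoc R,
        ← mul_assoc R', h4]
      simp only [mul_assoc]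
    rw [e3, mul_assoc U, ← mul_assoc U', hbr.word_mul hu', smul_mul_assoc, mul_smul_comm]
    simp only [mul_assoc]
  -- The same sign arises from the orders: the first presentation lists `us` before `u'`, the glued
  -- one lists it after `u'`. Hence the two signs cancel.
  have e5 : koszulSign (fun i : {x : I ⊕ J // x ≠ Sum.inl h ∧ x ≠ Sum.inr h'} => p i) K.list
      ts.flatten = k * k' * swapSign (wordParity (fun i => p (Sum.inr i)) u')
        (wordParity (fun i => p (Sum.inl i)) us.flatten) := by
    rw [← koszulSign_map Subtype.val Subtype.val_injective p (hP.enum K) K.nodup, hK, hflat]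
    have e6 : (l.map (Sum.inl : I → I ⊕ J) ++ l'.map Sum.inr).Perm
        ((u ++ us.flatten).map Sum.inl ++ (u' ++ us'.flatten).map Sum.inr) :=
      (hl.map _).append (hl'.map _)
    have hN : (l.map (Sum.inl : I → I ⊕ J) ++ l'.map Sum.inr).Nodup := by
      rw [← hK]; exact K.nodup.map Subtype.val_injective
    have e7 : ((u ++ us.flatten).map (Sum.inl : I → I ⊕ J) ++
        (u' ++ us'.flatten).map Sum.inr).Perm ((u.map Sum.inl ++ u'.map Sum.inr) ++
      (us.flatten.map Sum.inl ++ us'.flatten.map Sum.inr)) := by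
      rw [List.map_append, List.map_append, List.append_assoc, List.append_assoc]
      refine List.Perm.append_left _ ?_
      rw [← List.append_assoc, ← List.append_assoc]
      exact List.perm_append_comm.append_right _
    rw [← koszulSign_trans p e6 e7, koszulSign_append_append p (hl.map _) (hl'.map _) hN,
      koszulSign_map _ Sum.inl_injective p hl (List.Nodup.of_append_left (hL ▸ L.nodup)),
      koszulSign_map _ Sum.inr_injective p hl' (List.nodup_cons.1 (hL' ▸ L'.nodup)).2]
    have hN2 := e6.nodup_iff.1 hN
    rw [List.map_append, List.map_append, List.append_assoc] at hN2
    have hN3 := (List.nodup_append.1 hN2).2.1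
    rw [← List.append_assoc] at hN3
    rw [List.map_append, List.map_append, List.append_assoc, List.append_assoc,
      koszulSign_append_left p _ hN2, ← List.append_assoc, ← List.append_assoc,
      koszulSign_swap_blocks p _ _ _ hN3, wordParity_map, wordParity_map, swapSign_comm]
    rw [← List.append_assoc, ← List.append_assoc]
    exact List.perm_append_comm.append_right _
  rw [e2, map_smul, smul_eq_mul, e5]
  simp only [mul_assoc]
  rw [← mul_assoc (swapSign _ _), swapSign_mul_self, one_mul]

theorem surfaceValue_join (S : Surface I) (T : Surface J) (h : I) (h' : J)
    {l : List I} {l' : List J} (L : Enumeration I) (L' : Enumeration J)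
    (K : Enumeration {x : I ⊕ J // x ≠ Sum.inl h ∧ x ≠ Sum.inr h'})
    (hL : L.list = l ++ [h]) (hL' : L'.list = h' :: l')
    (hK : K.list.map Subtype.val = l.map Sum.inl ++ l'.map Sum.inr)
    (a : {x : I ⊕ J // x ≠ Sum.inl h ∧ x ≠ Sum.inr h'} → A) :
    surfaceValue F (S.join T h h') K a =
      ∑ j, surfaceValue F S L (fun x =>
          if hx : x = h then F.basis j
          else a ⟨Sum.inl x, fun hc => hx (Sum.inl_injective hc), Sum.inl_ne_inr⟩) *
        surfaceValue F T L' (fun x =>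
          if hx : x = h' then F.dual j
          else a ⟨Sum.inr x, Sum.inr_ne_inl, fun hc => hx (Sum.inr_injective hc)⟩) := by
  let f (x : {x : I ⊕ J // ¬ (x ≠ Sum.inl h ∧ x ≠ Sum.inr h')})
      (j : Fin (Module.finrank ℝ A)) : A :=
    Sum.elim (fun _ => F.basis j) (fun _ => F.dual j) x.1
  have e := MultilinearMap.congr_homogeneous 𝒜 (surfaceValue F (S.join T h h') K)
    (∑ j, MultilinearMap.domDomRestrict ((LinearMap.mul' ℝ ℝ).compMultilinearMap
      ((surfaceValue F S L).domCoprod (surfaceValue F T L')))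
      (fun x => x ≠ Sum.inl h ∧ x ≠ Sum.inr h') (fun x => f x j)) (fun p a ha => ?_) a
  · rw [e, MultilinearMap.sum_apply]
    refine Finset.sum_congr rfl fun j _ => ?_
    simp only [MultilinearMap.domDomRestrict_apply, LinearMap.compMultilinearMap_apply,
      MultilinearMap.domCoprod_apply, LinearMap.mul'_apply]
    congr 2
    · funext x
      by_cases hx : x = h
      · subst hx; simp [f]
      · simp [hx]
    · funext x
      by_cases hx : x = h'
      · subst hx; simp [f]
      · simp [hx]
  -- The previous lemma wants values at all places; zero, which is homogeneous of parity zero, is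
  -- put at the two glued ones, where it is overwritten.
  · let b : I ⊕ J → A := fun x => if hx : x ≠ Sum.inl h ∧ x ≠ Sum.inr h' then a ⟨x, hx⟩ else 0
    let q : I ⊕ J → ZMod 2 := fun x => if hx : x ≠ Sum.inl h ∧ x ≠ Sum.inr h' then p ⟨x, hx⟩ else 0
    have hb : ∀ i, b i ∈ 𝒜 (q i) := fun i => by
      simp only [b, q]
      split_ifs with hi
      · exact ha _
      · exact Submodule.zero_mem _
    have hab : (fun i : {x : I ⊕ J // x ≠ Sum.inl h ∧ x ≠ Sum.inr h'} => b i) = a := by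
      funext i
      have hi := i.2
      simp only [b]
      rw [dif_pos hi]
    have key := surfaceValue_join_of_mem (F := F) S T h h' L L' K hL hL' hK hb
    rw [hab] at key
    rw [key, MultilinearMap.sum_apply]
    refine Finset.sum_congr rfl fun j _ => ?_
    simp only [MultilinearMap.domDomRestrict_apply, LinearMap.compMultilinearMap_apply,
      MultilinearMap.domCoprod_apply, LinearMap.mul'_apply]
    congr 2
    · funext x
      by_cases hx : x = h
      · subst hx; simp [f]
      · simp [hx, b]
    · funext x
      by_cases hx : x = h'
      · subst hx; simp [f]
      · simp [hx, b]

/-- The open topological field theory with values in `A`. -/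
def theory (F : DGFrobenius 𝒜) : OpenTFT F where
  val S L := surfaceValue F S L
  val_relabel e S L L' hL a := surfaceValue_relabel e S L L' hL a
  val_reorder S L L' _ _ ha := surfaceValue_reorder S L L' ha
  val_even S L _ _ ha hp := surfaceValue_even S L ha hp
  val_d S L _ _ ha := surfaceValue_d S L ha
  val_selfGlue S _ _ hne L L' hL a := surfaceValue_selfGlue S hne L L' hL a
  val_join S T h h' _ _ L L' K hL hL' hK a := surfaceValue_join S T h h' L L' K hL hL' hK a

end DGFrobenius.Ext

end

/-! ### Uniqueness of the theory and its values on disks. -/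

noncomputable section

section CycleList

variable {I J : Type}

theorem chain_formPerm {w : List I} (hw : w.Nodup) :
    Cycle.Chain (fun x y => w.formPerm x = y) (w : Cycle I) := by
  cases w with
  | nil => exact Cycle.Chain.nil _
  | cons x t =>
    rw [Cycle.chain_coe_cons, List.isChain_iff_getElem]
    intro i hi
    simp only [List.length_cons, List.length_append, List.length_nil] at hi
    have hlt : i < (x :: t).length := by simp only [List.length_cons]; omega
    have e1 : (x :: (t ++ [x]))[i] = (x :: t)[i] := by
      simp only [← List.cons_append]
      rw [List.getElem_append_left hlt]
    rw [e1, List.formPerm_apply_getElem _ hw i hlt]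
    rcases Nat.lt_or_ge (i + 1) (x :: t).length with h | h
    · simp only [Nat.mod_eq_of_lt h, ← List.cons_append]
      rw [List.getElem_append_left h]
    · have : i + 1 = (x :: t).length := by omega
      simp only [this, Nat.mod_self, ← List.cons_append]
      simp

theorem formPerm_three (inst : DecidableEq (Fin 3)) :
    @List.formPerm _ inst [(0 : Fin 3), 1, 2] = finRotate 3 := by
  obtain rfl : inst = fun _ _ => Classical.propDecidable _ := Subsingleton.elim _ _
  have h := chain_formPerm (w := [(0 : Fin 3), 1, 2]) (by decide)
  rw [Cycle.chain_coe_cons] at h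
  simp only [List.cons_append, List.nil_append, List.isChain_cons_cons, List.isChain_singleton,
    and_true] at h
  refine Equiv.ext fun x => ?_
  fin_cases x
  · exact h.1
  · exact h.2.1
  · exact h.2.2

theorem prod_formPerm_apply_of_notMem {ws : List (List I)} {x : I} (hx : x ∉ ws.flatten) :
    (ws.map List.formPerm).prod x = x := by
  induction ws with
  | nil => rfl
  | cons w ws ih =>
    rw [List.flatten_cons, List.mem_append, not_or] at hx
    rw [List.map_cons, List.prod_cons, Perm.mul_apply, ih hx.2, List.formPerm_apply_of_notMem hx.1]

theorem prod_formPerm_apply_of_mem {ws : List (List I)} (hn : ws.flatten.Nodup) {w : List I}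
    (hw : w ∈ ws) {x : I} (hx : x ∈ w) : (ws.map List.formPerm).prod x = w.formPerm x := by
  induction ws with
  | nil => simp at hw
  | cons v ws ih =>
    rw [List.flatten_cons] at hn
    have hd := List.disjoint_of_nodup_append hn
    rw [List.map_cons, List.prod_cons, Perm.mul_apply]
    rcases List.mem_cons.1 hw with rfl | hw
    · rw [prod_formPerm_apply_of_notMem (hd hx)]
    · rw [ih (List.nodup_append.1 hn).2.1 hw, List.formPerm_apply_of_notMem]
      intro hc
      exact hd hc (List.mem_flatten.2 ⟨w, hw, List.formPerm_apply_mem_of_mem hx⟩)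

theorem isCycleList_prod_formPerm {ws : List (List I)} (hn : ws.flatten.Nodup)
    (hc : ∀ i, i ∈ ws.flatten) : IsCycleList (ws.map List.formPerm).prod ws where
  nodup := hn
  complete := hc
  chain w hw := by
    have h := chain_formPerm ((List.nodup_flatten.1 hn).1 w hw)
    cases w with
    | nil => exact Cycle.Chain.nil _
    | cons x t =>
      rw [Cycle.chain_coe_cons, ← List.cons_append] at h
      exact chain_coe_cons_imp h
        (fun a ha b _ hab => (prod_formPerm_apply_of_mem hn hw ha).trans hab)
        (fun a ha hab => (prod_formPerm_apply_of_mem hn hw ha).trans hab)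

theorem IsCycleList.numCycles_le {σ : Perm I} {ws : List (List I)} (h : IsCycleList σ ws) :
    numCycles σ ≤ ws.length := by
  choose w hw hm using h.exists_mem
  let f : Quotient (Perm.SameCycle.setoid σ) → {w // w ∈ ws.toFinset} :=
    fun q => ⟨w q.out, List.mem_toFinset.2 (hw _)⟩
  have hf : Function.Injective f := by
    intro q r hqr
    have e : w q.out = w r.out := congrArg Subtype.val hqr
    rw [← Quotient.out_eq q, ← Quotient.out_eq r]
    exact Quotient.sound (h.sameCycle_of_mem (hw q.out) (hm _) (e ▸ hm r.out))
  have h1 := Nat.card_le_card_of_injective f hf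
  have h2 : Nat.card {w // w ∈ ws.toFinset} = ws.toFinset.card :=
    Nat.card_eq_fintype_card.trans (Fintype.card_coe _)
  exact h1.trans (h2.le.trans (List.toFinset_card_le ws))

/-- The permutation is the product of the cycles given by the words. The number of free circles is a
truncated difference, which is exact by `IsCycleList.numCycles_le`. -/
theorem Surface.exists_of_words [Fintype I] {ws : List (List I)} (g : ℕ) (hn : ws.flatten.Nodup)
    (hc : ∀ i, i ∈ ws.flatten) (h0 : 0 < ws.length)
    (h4 : 4 < 4 * g + 2 * ws.length + Nat.card I) :
    ∃ S : Surface I, S.IsPresentation ws ∧ S.genus = g := by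
  obtain ⟨σ, h⟩ : ∃ σ, IsCycleList σ ws := ⟨_, isCycleList_prod_formPerm hn hc⟩
  have h1 := h.numCycles_le
  refine ⟨⟨σ, g, ws.length - numCycles σ, ?_, ?_⟩, ⟨h, ?_⟩, rfl⟩
  · omega
  · omega
  · simp only
    omega

theorem exists_equiv_map_eq {L : List I} {L' : List J} (hL : L.Nodup) (hc : ∀ i, i ∈ L)
    (hL' : L'.Nodup) (hc' : ∀ i, i ∈ L') (hl : L.length = L'.length) :
    ∃ e : I ≃ J, L.map e = L' := by
  refine ⟨(hL.getEquivOfForallMemList L hc).symm.trans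
    ((finCongr hl).trans (hL'.getEquivOfForallMemList L' hc')), ?_⟩
  refine List.ext_getElem (by simpa using hl) fun i h1 h2 => ?_
  have h1' : i < L.length := by simpa using h1
  have e1 : (hL.getEquivOfForallMemList L hc).symm L[i] = ⟨i, h1'⟩ := by
    rw [Equiv.symm_apply_eq]; rfl
  simp only [List.getElem_map, Equiv.trans_apply, e1]
  rfl

theorem map_map_eq_of_flatten {ws : List (List I)} {ws' : List (List J)} {e : I → J}
    (h : ws.flatten.map e = ws'.flatten) (hs : ws.map List.length = ws'.map List.length) :
    ws.map (List.map e) = ws' := by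
  induction ws generalizing ws' with
  | nil =>
    cases ws' with
    | nil => rfl
    | cons => simp at hs
  | cons w ws ih =>
    cases ws' with
    | nil => simp at hs
    | cons w' ws' =>
      simp only [List.map_cons, List.cons.injEq] at hs
      rw [List.flatten_cons, List.flatten_cons, List.map_append] at h
      obtain ⟨h1, h2⟩ := List.append_inj h (by simpa using hs.1)
      rw [List.map_cons, h1, ih h2 hs.2]

end CycleList

variable {A : Type*} [NonUnitalRing A] [Module ℝ A] [FiniteDimensional ℝ A]
  {𝒜 : ZMod 2 → Submodule ℝ A} {F : DGFrobenius 𝒜} [DirectSum.Decomposition 𝒜]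

/-- Transport of an enumeration along a bijection. -/
def Enumeration.map {I J : Type} (L : Enumeration I) (e : I ≃ J) : Enumeration J where
  list := L.list.map e
  nodup := L.nodup.map e.injective
  complete j := List.mem_map.2 ⟨e.symm j, L.complete _, by simp⟩

/-- Any duplicate-free list extended by the elements not on it. -/
theorem Enumeration.exists_append {I : Type} [Fintype I] {l : List I} (hl : l.Nodup) :
    ∃ (L : Enumeration I) (m : List I), L.list = m ++ l ∧ m.Nodup := by
  have hm : ((Finset.univ : Finset I).filter (· ∉ l)).toList.Nodup := Finset.nodup_toList _
  refine ⟨⟨((Finset.univ : Finset I).filter (· ∉ l)).toList ++ l, ?_, ?_⟩, _, rfl, hm⟩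
  · refine List.nodup_append.2 ⟨hm, hl, ?_⟩
    rintro x hx y hy rfl
    simp at hx
    exact hx hy
  · intro i
    by_cases h : i ∈ l <;> simp [h]

theorem Enumeration.exists_subtype {I : Type} {P : I → Prop} {l : List I} (hl : l.Nodup)
    (h : ∀ x, x ∈ l ↔ P x) : ∃ K : Enumeration {x // P x}, K.list.map Subtype.val = l := by
  obtain ⟨vs, hvs⟩ := List.exists_map_val (P := P) [l] (by
    intro w hw x hx
    obtain rfl : w = l := by simpa using hw
    exact (h x).1 hx)
  obtain ⟨v, vs, rfl⟩ := List.exists_cons_of_ne_nil (l := vs) (by rintro rfl; simp at hvs)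
  simp only [List.map_cons, List.cons.injEq] at hvs
  refine ⟨⟨v, ?_, ?_⟩, hvs.1⟩
  · exact List.Nodup.of_map Subtype.val (hvs.1.symm ▸ hl)
  · rintro ⟨x, hx⟩
    have := (h x).2 hx
    rw [← hvs.1, List.mem_map] at this
    obtain ⟨y, hy, rfl⟩ := this
    exact hy

theorem Enumeration.nonempty (I : Type) [Fintype I] : Nonempty (Enumeration I) :=
  ⟨⟨Finset.univ.toList, Finset.nodup_toList _, fun i => by simp⟩⟩

namespace OpenTFT

/-- Two theories have the same value on a surface. -/
def Agree (t t' : OpenTFT F) {I : Type} (S : Surface I) : Prop :=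
  ∀ L : Enumeration I, t.val S L = t'.val S L

variable {t t' : OpenTFT F} {I J : Type} [Fintype I] [Fintype J]

/-- The tensors for different orders are related by Koszul signs that do not depend on the theory.
-/
theorem agree_of_exists {S : Surface I} (L : Enumeration I) (h : t.val S L = t'.val S L) :
    Agree t t' S := by
  intro L'
  ext a
  refine MultilinearMap.congr_homogeneous 𝒜 _ _ (fun p a ha => ?_) a
  rw [t.val_reorder S L L' p a ha, t'.val_reorder S L L' p a ha, h]

theorem Agree.relabel {S : Surface I} (h : Agree t t' S) (e : I ≃ J) :
    Agree t t' (S.relabel e) := by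
  obtain ⟨L⟩ := Enumeration.nonempty I
  refine agree_of_exists (L.map e) ?_
  ext a
  rw [t.val_relabel e S L (L.map e) rfl, t'.val_relabel e S L (L.map e) rfl, h L]

theorem Agree.selfGlue {S : Surface I} (h : Agree t t' S) {x y : I} (hne : x ≠ y) :
    Agree t t' (S.selfGlue x y hne) := by
  intro K
  ext a
  have hx : ∀ z ∈ K.list.map Subtype.val, z ≠ x ∧ z ≠ y := by
    intro z hz
    obtain ⟨w, -, rfl⟩ := List.mem_map.1 hz
    exact w.2
  let L : Enumeration I := ⟨x :: y :: K.list.map Subtype.val, by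
      refine List.nodup_cons.2 ⟨?_, List.nodup_cons.2
        ⟨fun hc => (hx y hc).2 rfl, K.nodup.map Subtype.val_injective⟩⟩
      rw [List.mem_cons, not_or]
      exact ⟨hne, fun hc => (hx x hc).1 rfl⟩, by
      intro i
      by_cases hi : i ≠ x ∧ i ≠ y
      · refine List.mem_cons_of_mem _ (List.mem_cons_of_mem _ ?_)
        exact List.mem_map.2 ⟨⟨i, hi⟩, K.complete _, rfl⟩
      · rw [List.mem_cons, List.mem_cons]
        tauto⟩
  rw [t.val_selfGlue S x y hne K L rfl, t'.val_selfGlue S x y hne K L rfl, h L]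

theorem Agree.join {S : Surface I} {T : Surface J} (hS : Agree t t' S) (hT : Agree t t' T) (x : I)
    (y : J) : Agree t t' (S.join T x y) := by
  obtain ⟨L, l, hL, -⟩ := Enumeration.exists_append (List.nodup_singleton x)
  obtain ⟨M, m, hM, -⟩ := Enumeration.exists_append (List.nodup_singleton y)
  have hM' := List.nodup_append.1 (hM ▸ M.nodup)
  have hL' := List.nodup_append.1 (hL ▸ L.nodup)
  let M' : Enumeration J := ⟨y :: m, (List.perm_append_singleton y m).nodup_iff.1 (hM ▸ M.nodup),
    fun i => (List.perm_append_singleton y m).mem_iff.1 (hM ▸ M.complete i)⟩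
  obtain ⟨K, hK⟩ := Enumeration.exists_subtype (l := l.map Sum.inl ++ m.map Sum.inr)
    (P := fun z : I ⊕ J => z ≠ Sum.inl x ∧ z ≠ Sum.inr y) (by
      refine List.nodup_append.2 ⟨hL'.1.map Sum.inl_injective, hM'.1.map Sum.inr_injective, ?_⟩
      simp) (by
      have hl : ∀ i, i ∈ l ↔ i ≠ x := fun i => by
        have h1 := L.complete i
        rw [hL] at h1
        constructor
        · rintro hi rfl
          exact hL'.2.2 i hi i (by simp) rfl
        · intro hi
          simpa [hi] using h1
      have hm : ∀ i, i ∈ m ↔ i ≠ y := fun i => by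
        have h1 := M.complete i
        rw [hM] at h1
        constructor
        · rintro hi rfl
          exact hM'.2.2 i hi i (by simp) rfl
        · intro hi
          simpa [hi] using h1
      rintro (z | z) <;> simp [hl, hm])
  refine agree_of_exists K ?_
  ext a
  rw [t.val_join S T x y l m L M' K hL rfl hK, t'.val_join S T x y l m L M' K hL rfl hK, hS L,
    hT M']

/-- Up to relabelling, a surface is determined by its genus and the lengths of its boundary words.
-/
theorem Agree.of_shape {S : Surface I} {T : Surface J} (h : Agree t t' S) {ws : List (List I)}
    {vs : List (List J)} (hS : S.IsPresentation ws) (hT : T.IsPresentation vs)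
    (hs : ws.map List.length = vs.map List.length) (hg : S.genus = T.genus) : Agree t t' T := by
  obtain ⟨e, he⟩ := exists_equiv_map_eq hS.1.nodup hS.1.complete hT.1.nodup hT.1.complete
    (by rw [List.length_flatten, List.length_flatten, hs])
  have h1 := hS.relabel e
  rw [map_map_eq_of_flatten he hs] at h1
  rw [← Surface.eq_of_isPresentation h1 hT hg]
  exact h.relabel e

/-- A disk with `n + 4` intervals results from gluing the disk with three intervals to a disk with
`n + 3`. -/
theorem agree_disk (ht : t.IsDeterminedBy) (ht' : t'.IsDeterminedBy) (n : ℕ) :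
    ∀ {I : Type} [Fintype I] {T : Surface I} {w : List I}, T.IsPresentation [w] → T.genus = 0 →
      w.length = n + 3 → Agree t t' T := by
  have e3 : [[(0 : Fin 3), 1, 2]].flatten.Nodup := by decide
  obtain ⟨D, hD, hD0⟩ := Surface.exists_of_words (ws := [[(0 : Fin 3), 1, 2]]) 0 e3 (by decide)
    (by simp) (by simp)
  have hDp : D.cyc = finRotate 3 := by
    rw [hD.1.perm_eq (isCycleList_prod_formPerm e3 (by decide)), List.map_singleton,
      List.prod_singleton]
    exact formPerm_three _
  have hDn : numCycles D.cyc + D.free = 1 := hD.2.symm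
  have hDa : Agree t t' D := by
    have hd : D.IsDisk := by
      have := numCycles_pos D.cyc 0
      exact ⟨hD0, by omega, by omega⟩
    refine agree_of_exists ⟨[0, 1, 2], by decide, by decide⟩ ?_
    ext a
    rw [ht D _ hd hDp rfl, ht' D _ hd hDp rfl]
  induction n with
  | zero =>
    intro I _ T w hT hg hw
    exact hDa.of_shape hD hT (by simp [hw]) (hD0.trans hg.symm)
  | succ n ih =>
    intro I _ T w hT hg hw
    have e2 : [List.finRange (n + 3)].flatten.Nodup := by simpa using List.nodup_finRange _
    obtain ⟨E, hE, hE0⟩ := Surface.exists_of_words (ws := [List.finRange (n + 3)]) 0 e2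
      (by simp) (by simp) (by simp; omega)
    have hEa : Agree t t' E := ih hE hE0 (by simp)
    have hE' := hE
    rw [List.finRange_succ] at hE'
    obtain ⟨vs, hvs⟩ := List.exists_map_val
      (P := fun z : Fin 3 ⊕ Fin (n + 3) => z ≠ Sum.inl 2 ∧ z ≠ Sum.inr 0)
      [[(0 : Fin 3), 1].map Sum.inl ++ ((List.finRange (n + 2)).map Fin.succ).map Sum.inr] (by
        intro w hw x hx
        obtain rfl := List.mem_singleton.1 hw
        rw [List.mem_append, List.mem_map, List.mem_map] at hx
        rcases hx with ⟨y, hy, rfl⟩ | ⟨y, hy, rfl⟩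
        · refine ⟨fun hc => ?_, Sum.inl_ne_inr⟩
          rw [Sum.inl.injEq] at hc
          subst hc
          exact absurd hy (by decide)
        · refine ⟨Sum.inr_ne_inl, fun hc => ?_⟩
          rw [Sum.inr.injEq] at hc
          subst hc
          obtain ⟨z, -, hz⟩ := List.mem_map.1 hy
          exact Fin.succ_ne_zero z hz)
    have hJ := Surface.IsPresentation.join (u := [0, 1]) hD hE' (ts := vs) (by simpa using hvs)
    refine (hDa.join hEa 2 0).of_shape hJ hT ?_ ?_
    · have h1 := congrArg (List.map List.length) hvs
      rw [List.map_map] at h1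
      have h2 : (List.length ∘ List.map Subtype.val :
        List {z : Fin 3 ⊕ Fin (n + 3) // z ≠ Sum.inl 2 ∧ z ≠ Sum.inr 0} → ℕ) = List.length := by
        funext l; simp
      rw [h2] at h1
      rw [h1]
      simp [hw]
    · rw [hg]
      show D.genus + E.genus = 0
      rw [hD0, hE0]

/-- A surface that is not a disk is obtained by self-gluing from one with smaller `2 * genus +
number of circles` and two more intervals. Stability survives the cut, because the quantity `4 *
genus + 2 * circles + intervals` in its definition is unchanged. -/
theorem agree_of_isDeterminedBy (ht : t.IsDeterminedBy) (ht' : t'.IsDeterminedBy) (m : ℕ) :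
    ∀ {I : Type} [Fintype I] {T : Surface I} {ws : List (List I)}, T.IsPresentation ws →
      2 * T.genus + ws.length ≤ m → Agree t t' T := by
  induction m with
  | zero =>
    intro I _ T ws hT hm
    exact absurd (List.length_eq_zero_iff.1 (by omega)) hT.ne_nil
  | succ m ih =>
    intro I _ T ws hT hm
    have hst := T.stable.2
    rw [← hT.2] at hst
    have hne : (Sum.inr true : I ⊕ Bool) ≠ Sum.inr false := by simp
    have hcard : Nat.card (I ⊕ Bool) = Nat.card I + 2 := by simp
    have hlen : ∀ {h h' : I ⊕ Bool} {vs : List (List {x : I ⊕ Bool // x ≠ h ∧ x ≠ h'})}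
        {us : List (List I)}, vs.map (List.map Subtype.val) = us.map (List.map Sum.inl) →
        vs.map List.length = us.map List.length := by
      intro h h' vs us hvs
      have h1 := congrArg (List.map List.length) hvs
      simpa [List.map_map, Function.comp_def] using h1
    obtain ⟨w, us, rfl⟩ := List.exists_cons_of_ne_nil hT.ne_nil
    have hlift : ∀ us : List (List I), ∃ vs : List (List {x : I ⊕ Bool //
        x ≠ Sum.inr true ∧ x ≠ Sum.inr false}),
        vs.map (List.map Subtype.val) = us.map (List.map Sum.inl) := fun us =>
      List.exists_map_val _ (by
        intro w hw x hx
        obtain ⟨v, -, rfl⟩ := List.mem_map.1 hw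
        obtain ⟨y, -, rfl⟩ := List.mem_map.1 hx
        exact ⟨Sum.inl_ne_inr, Sum.inl_ne_inr⟩)
    have hn := hT.1.nodup
    have hc := hT.1.complete
    cases us with
    | nil =>
      rcases Nat.eq_zero_or_pos T.genus with hg | hg
      · have h3 := hT.card_eq
        simp only [List.flatten_cons, List.flatten_nil, List.append_nil] at h3
        simp only [List.length_cons, List.length_nil] at hst
        -- With genus zero and one circle, stability means at least three intervals, so the
        -- subtraction is exact.
        exact agree_disk ht ht' (w.length - 3) hT hg (by omega)
      -- One circle and positive genus: a handle is cut, which lowers the genus by one and adds a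
      -- circle carrying only the new interval.
      · obtain ⟨S, hS, hSg⟩ := Surface.exists_of_words (I := I ⊕ Bool)
          (ws := [[Sum.inr true], Sum.inr false :: w.map Sum.inl]) (T.genus - 1)
          (by
            have : (w.map (Sum.inl : I → I ⊕ Bool)).Nodup :=
              List.Nodup.map Sum.inl_injective (by simpa using hn)
            simpa using this)
          (by rintro (i | b)
              · simpa using hc i
              · cases b <;> simp) (by simp) (by
            rw [hcard]
            simp only [List.length_cons, List.length_nil] at hst ⊢
            omega)
        have hSa := ih hS (by
          simp only [List.length_cons, List.length_nil] at hm ⊢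
          omega)
        obtain ⟨vs, hvs⟩ := hlift [w]
        have hG := hS.selfGlue_diff hne (vs := vs) (by simpa using hvs)
        exact (hSa.selfGlue hne).of_shape hG.1 hT (hlen hvs) (by rw [hG.2]; omega)
    | cons w' us =>
      have hperm : (Sum.inr true :: Sum.inr false :: (w :: w' :: us).flatten.map Sum.inl).Perm
          (((Sum.inr true : I ⊕ Bool) :: (w'.map Sum.inl ++ Sum.inr false :: w.map Sum.inl)) ::
            us.map (List.map Sum.inl)).flatten := by
        simp only [List.flatten_cons, List.cons_append, List.map_append, List.map_flatten,
          List.append_assoc]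
        refine List.Perm.cons _ (List.Perm.trans (List.Perm.cons _ ?_) List.perm_middle.symm)
        rw [← List.append_assoc, ← List.append_assoc]
        exact List.perm_append_comm.append_right _
      -- At least two circles: they are merged into one, separated by the two new intervals, and
      -- gluing these cuts it apart again.
      obtain ⟨S, hS, hSg⟩ := Surface.exists_of_words (I := I ⊕ Bool)
        (ws := (Sum.inr true :: (w'.map Sum.inl ++ Sum.inr false :: w.map Sum.inl)) ::
            us.map (List.map Sum.inl)) T.genus
        (hperm.nodup_iff.1 (by
          have : ((w :: w' :: us).flatten.map (Sum.inl : I → I ⊕ Bool)).Nodup :=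
            hn.map Sum.inl_injective
          refine List.nodup_cons.2 ⟨?_, List.nodup_cons.2 ⟨?_, this⟩⟩ <;> simp))
        (fun i => hperm.mem_iff.1 (by
          rcases i with i | b
          · exact List.mem_cons_of_mem _ (List.mem_cons_of_mem _ (List.mem_map_of_mem (hc i)))
          · cases b <;> simp)) (by simp) (by
          rw [hcard]
          simp only [List.length_cons, List.length_map] at hst ⊢
          omega)
      have hSa := ih hS (by
        simp only [List.length_cons, List.length_map] at hm ⊢
        omega)
      obtain ⟨vs, hvs⟩ := hlift (w :: w' :: us)
      have hG := hS.selfGlue_same hne (vs := vs) (by simpa using hvs)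
      exact (hSa.selfGlue hne).of_shape hG.1 hT (hlen hvs) (by rw [hG.2]; omega)

theorem eq_of_isDeterminedBy (ht : t.IsDeterminedBy) (ht' : t'.IsDeterminedBy) : t = t' := by
  ext I S L : 4
  haveI := L.finite
  haveI := Fintype.ofFinite I
  obtain ⟨ws, hws⟩ := S.exists_isPresentation
  exact agree_of_isDeterminedBy ht ht' _ hws le_rfl L

end OpenTFT

namespace DGFrobenius.Ext

variable [IsScalarTower ℝ A A] [SMulCommClass ℝ A A] [SetLike.GradedMul 𝒜]

/-- A disk has a single word and no handles, so its value is the trace of that word, with no sign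
since the word is the given order. -/
theorem theory_diskValues : (theory F).DiskValues := by
  intro I _ S L hS hL a
  have hP : S.IsPresentation [L.list] := by
    refine ⟨⟨by simpa using L.nodup, by simpa using L.complete, ?_⟩, ?_⟩
    · intro w hw
      rw [List.mem_singleton.1 hw, ← hL]
      exact chain_formPerm L.nodup
    · rw [hS.2.2, hS.2.1]; rfl
  have e : surfaceValue F S L a = surfaceMap F [L.list] 0 hP.1.nodup hP.1.complete a := by
    refine MultilinearMap.congr_homogeneous 𝒜 _ _ (fun p a ha => ?_) a
    rw [surfaceValue_eq hP L ha, hS.1]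
    simp only [List.flatten_cons, List.flatten_nil, List.append_nil, koszulSign_self, one_mul]
    rfl
  -- Stability excludes disks with fewer than three intervals, for which `cyclicProduct` may take
  -- its default value.
  have hlen : 2 < L.list.length := by
    have h1 := S.stable.2
    have h2 := hP.card_eq
    rw [hS.1, hS.2.1, hS.2.2] at h1
    simp only [List.flatten_cons, List.flatten_nil, List.append_nil] at h2
    omega
  have h1 : (theory F).val S L a = trace F (wordProd F L.list a * (1 * 1)) := e
  rw [h1, mul_one, mul_one]
  rcases hl : L.list with _ | ⟨i, _ | ⟨j, l⟩⟩
  · simp [hl] at hlen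
  · simp [hl] at hlen
  · rw [List.map_cons, List.map_cons, cyclicProduct_eq, wordProd]
    simp [Function.comp_def]

theorem theory_isDeterminedBy : (theory F).IsDeterminedBy := by
  intro S L hS hc hL a
  rw [theory_diskValues S L hS (by rw [hL, hc]; exact formPerm_three _), hL]
  simp [cyclicProduct]

end DGFrobenius.Ext

end

/-! ### The heat operator. -/

noncomputable section

section Heat

variable {A : Type*} [NonUnitalRing A] [Module ℝ A] [FiniteDimensional ℝ A]
  {𝒜 : ZMod 2 → Submodule ℝ A} {F : DGFrobenius 𝒜}

/-- All positive powers of `M` are `M`, so the exponential series is `exp t` times `M`, except for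
its constant term. -/
theorem Matrix.exp_smul_of_isIdempotentElem {n : Type*} [Fintype n] [DecidableEq n]
    {M : Matrix n n ℝ} (hM : M * M = M) (t : ℝ) :
    NormedSpace.exp (t • M) = 1 - M + Real.exp t • M := by
  have hpow : ∀ k : ℕ, M ^ (k + 1) = M := by
    intro k
    induction k with
    | zero => simp
    | succ k ih => rw [pow_succ, ih, hM]
  have h1 : HasSum (fun k : ℕ => ((k.factorial : ℝ)⁻¹ * t ^ k) • M) (Real.exp t • M) := by
    have h := NormedSpace.expSeries_div_hasSum_exp (𝔸 := ℝ) t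
    rw [← Real.exp_eq_exp_ℝ] at h
    have h2 := h.smul_const M
    refine h2.congr_fun ?_
    intro k
    rw [div_eq_inv_mul]
  -- Corrects the constant term, which is `1` in the exponential series but `M` in `h1`.
  have h2 : HasSum (fun k : ℕ => if k = 0 then 1 - M else 0) (1 - M) := hasSum_ite_eq 0 _
  have h3 := h2.add h1
  rw [NormedSpace.exp_eq_tsum ℝ]
  refine HasSum.tsum_eq ?_
  refine h3.congr_fun ?_
  intro k
  rcases k with _ | k
  · simp
  · rw [smul_pow, hpow, smul_smul]
    simp

namespace HodgeDecomposition

variable (D : HodgeDecomposition F)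

theorem laplacian_apply (a : A) : D.laplacian a = a - D.π a := D.homotopy a

/-- The Laplacian is `1 - π` by the homotopy relation and hence idempotent. -/
theorem heat_apply (t : ℝ) (a : A) : D.heat t a = D.π a + Real.exp (-t) • (a - D.π a) := by
  have hM : LinearMap.toMatrix F.basis F.basis D.laplacian *
      LinearMap.toMatrix F.basis F.basis D.laplacian =
      LinearMap.toMatrix F.basis F.basis D.laplacian := by
    rw [← LinearMap.toMatrix_comp]
    congr 1
    ext a
    simp [laplacian_apply, D.π_π]
  rw [heat, Matrix.exp_smul_of_isIdempotentElem hM, map_add, map_sub, map_smul,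
    Matrix.toLin_toMatrix, Matrix.toLin_one]
  simp [laplacian_apply]

theorem tendsto_heat (φ : A →ₗ[ℝ] ℝ) (a : A) :
    Filter.Tendsto (fun t => φ (D.heat t a)) Filter.atTop (nhds (φ (D.π a))) := by
  have h1 : Filter.Tendsto (fun t : ℝ => φ (D.π a) + Real.exp (-t) * φ (a - D.π a)) Filter.atTop
      (nhds (φ (D.π a) + 0 * φ (a - D.π a))) :=
    tendsto_const_nhds.add ((Real.tendsto_exp_neg_atTop_nhds_zero).mul_const _)
  rw [zero_mul, add_zero] at h1
  refine h1.congr fun t => ?_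
  rw [heat_apply, map_add, map_smul, smul_eq_mul]

end HodgeDecomposition

end Heat

/-! ### Koszul signs of lists composed of blocks, and the half-edge orders of a graph. -/

section Koszul

variable {I V : Type} [Fintype I] [Fintype V]

theorem List.Nodup.of_flatMap_cons {f : V → List I} {v : V} {L : List V}
    (h : ((v :: L).flatMap f).Nodup) : (L.flatMap f).Nodup := by
  rw [List.flatMap_cons] at h
  exact (List.nodup_append.1 h).2.1

/-- Blocks are permuted like single elements with the total parity of the block. For vertices these
parities may be taken to be even, for edges they are the degrees of the operators. -/
theorem koszulSign_flatMap_perm (p : I → ZMod 2) (f : V → List I) {L L' : List V} (h : L.Perm L')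
    (hn : (L.flatMap f).Nodup) (hL : L.Nodup) : koszulSign p (L.flatMap f) (L'.flatMap f) =
      koszulSign (fun v => wordParity p (f v)) L L' := by
  induction h with
  | nil => simp [koszulSign_self]
  | cons v h ih =>
    have hv := List.nodup_cons.1 hL
    rw [koszulSign_cons _ h hv.1, ← ih hn.of_flatMap_cons hv.2]
    exact koszulSign_append_left p (h.flatMap_right f) hn
  | swap v w L =>
    have hv := List.nodup_cons.1 hL
    rw [koszulSign_swap _ _ (fun hc => hv.1 (by simp [hc]))]
    simp only [List.flatMap_cons, ← List.append_assoc] at hn ⊢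
    exact koszulSign_swap_blocks p _ _ _ hn
  | trans h1 h2 ih1 ih2 =>
    have hn' := (h1.flatMap_right f).nodup_iff.1 hn
    rw [← koszulSign_trans p (h1.flatMap_right f) (h2.flatMap_right f), ih1 hn hL,
      ih2 hn' (h1.nodup_iff.1 hL), koszulSign_trans _ h1 h2]

theorem List.Perm.flatMap_congr' {f f' : V → List I} (L : List V) (h : ∀ v, (f v).Perm (f' v)) :
    (L.flatMap f).Perm (L.flatMap f') := by
  induction L with
  | nil => exact List.Perm.refl _
  | cons v L ih => rw [List.flatMap_cons, List.flatMap_cons]; exact (h v).append ih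

theorem koszulSign_flatMap_congr (p : I → ZMod 2) {f f' : V → List I} {L : List V}
    (h : ∀ v, (f v).Perm (f' v)) (hn : (L.flatMap f).Nodup) :
    koszulSign p (L.flatMap f) (L.flatMap f') = (L.map fun v => koszulSign p (f v) (f' v)).prod := by
  induction L with
  | nil => simp [koszulSign_self]
  | cons v L ih =>
    rw [List.map_cons, List.prod_cons, ← ih hn.of_flatMap_cons, List.flatMap_cons,
      List.flatMap_cons]
    exact koszulSign_append_append p (h v) (List.Perm.flatMap_congr' L h) hn

theorem prefixSign_flatMap (p : I → ZMod 2) {f : V → List I} {L : List V}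
    (hn : (L.flatMap f).Nodup) (hL : L.Nodup) {v : V} (hv : v ∈ L) {i : I} (hi : i ∈ f v) :
    prefixSign p (L.flatMap f) i =
      prefixSign (fun v => wordParity p (f v)) L v * prefixSign p (f v) i := by
  induction L with
  | nil => simp at hv
  | cons w L ih =>
    rw [List.flatMap_cons] at hn ⊢
    rw [List.nodup_cons] at hL
    have hd := List.disjoint_of_nodup_append hn
    rw [prefixSign_cons _ hL.1]
    rcases List.mem_cons.1 hv with rfl | hv
    · rw [if_pos rfl, one_mul, prefixSign_append_of_mem p hi]
    · have hi' : i ∉ f w := fun hc => hd hc (List.mem_flatMap.2 ⟨v, hv, hi⟩)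
      rw [if_neg (fun hc : v = w => hL.1 (hc ▸ hv)), prefixSign_append_of_not_mem p hn hi',
        ih (List.nodup_append.1 hn).2.1 hL.2 hv, mul_assoc]

theorem Enumeration.prod_eq (L : Enumeration V) (f : V → ℝ) : (L.list.map f).prod = ∏ v, f v := by
  rw [← List.prod_toFinset f L.nodup]
  refine Finset.prod_congr ?_ fun _ _ => rfl
  ext v
  simpa using L.complete v

end Koszul

namespace StableRibbonGraph.Choices

variable {γ : StableRibbonGraph} (c : γ.Choices)

theorem mem_vertexOrder (h : γ.H) : h ∈ c.vertexOrder :=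
  List.mem_flatMap.2 ⟨γ.vert h, c.verts.complete _,
    List.mem_map.2 ⟨⟨h, rfl⟩, (c.legs _).complete _, rfl⟩⟩

theorem nodup_vertexOrder : c.vertexOrder.Nodup := by
  refine List.nodup_flatMap.2 ⟨fun v _ => (c.legs v).nodup.map Subtype.val_injective, ?_⟩
  refine c.verts.nodup.imp fun {v w} hvw => ?_
  intro x hx hy
  obtain ⟨x, -, rfl⟩ := List.mem_map.1 hx
  obtain ⟨y, -, hy⟩ := List.mem_map.1 hy
  exact hvw (by rw [← x.2, ← y.2, hy])

theorem fst_ne_flip (e : γ.E) : c.fst e ≠ γ.flip (c.fst e) := (γ.flip_ne _).symm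

theorem edge_flip_fst (e : γ.E) : γ.edge (γ.flip (c.fst e)) = e := by
  rw [γ.edge_flip, c.edge_fst]

theorem eq_fst_or (h : γ.H) : h = c.fst (γ.edge h) ∨ h = γ.flip (c.fst (γ.edge h)) :=
  (γ.edge_eq_iff _ _).1 (c.edge_fst _)

theorem mem_edgeOrder (h : γ.H) : h ∈ c.edgeOrder :=
  List.mem_flatMap.2 ⟨γ.edge h, c.edges.complete _, by simpa using c.eq_fst_or h⟩

theorem nodup_edgeOrder : c.edgeOrder.Nodup := by
  refine List.nodup_flatMap.2 ⟨fun e _ => by simpa using c.fst_ne_flip e, ?_⟩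
  refine c.edges.nodup.imp fun {e e'} he => ?_
  have key : ∀ e x, x ∈ [c.fst e, γ.flip (c.fst e)] → γ.edge x = e := by
    intro e x hx
    simp only [List.mem_cons, List.not_mem_nil, or_false] at hx
    rcases hx with rfl | rfl
    · exact c.edge_fst e
    · exact c.edge_flip_fst e
  intro x hx hy
  exact he ((key e x hx).symm.trans (key e' x hy))

theorem edgeOrder_perm : c.edgeOrder.Perm c.vertexOrder :=
  (List.perm_ext_iff_of_nodup c.nodup_edgeOrder c.nodup_vertexOrder).2 fun h => by
    simp [c.mem_edgeOrder, c.mem_vertexOrder]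

end StableRibbonGraph.Choices

end

/-! ### The vertex tensors evaluated on the edge tensors. -/

noncomputable section

theorem insertTwo_map {I : Type} {α β : Type*} {h h' : I} (hne : h ≠ h') (g : I → α → β)
    (a : {x // x ≠ h ∧ x ≠ h'} → α) (x y : α) :
    (fun i => g i (insertTwo h h' a x y i)) =
      insertTwo h h' (fun i => g i (a i)) (g h x) (g h' y) := by
  funext i
  unfold insertTwo
  split_ifs with h1 h2
  · rfl
  · rw [h2]
  · have : i = h' := by tauto
    rw [this]

theorem insertTwo_self {I : Type} {α : Type*} {h h' : I} (a : I → α) :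
    insertTwo h h' (fun x => a x) (a h) (a h') = a := by
  funext i
  unfold insertTwo
  split_ifs with h1 h2
  · rfl
  · rw [h2]
  · have : i = h' := by tauto
    rw [this]

/-- The summation over all assignments is organised as a sum over the index of one edge for fixed
indices of the others, so that identities for the inverse inner product can be used at one edge at a
time. -/
theorem Fintype.sum_congr_update {E N M : Type*} [Fintype E] [Fintype N] [AddCommMonoid M]
    {F G : (E → N) → M} (e : E)
    (h : ∀ m, ∑ j, F (Function.update m e j) = ∑ j, G (Function.update m e j)) :
    ∑ m, F m = ∑ m, G m := by
  have key : ∀ F : (E → N) → M, ∑ m, F m =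
      ∑ m : {x // x ≠ e} → N, ∑ j, F ((Equiv.piSplitAt e fun _ => N).symm (j, m)) := by
    intro F
    rw [← (Equiv.piSplitAt e fun _ => N).symm.sum_comp, Fintype.sum_prod_type, Finset.sum_comm]
  rw [key F, key G]
  refine Finset.sum_congr rfl fun m _ => ?_
  rcases isEmpty_or_nonempty N with hN | ⟨⟨j₀⟩⟩
  · simp
  · have h1 : ∀ j, (Equiv.piSplitAt e fun _ => N).symm (j, m) =
        Function.update ((Equiv.piSplitAt e fun _ => N).symm (j₀, m)) e j := by
      intro j
      funext x
      by_cases hx : x = e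
      · subst hx; simp [Equiv.piSplitAt]
      · simp [Equiv.piSplitAt, hx]
    refine (Finset.sum_congr rfl fun j _ => congrArg F (h1 j)).trans ((h _).trans ?_)
    exact Finset.sum_congr rfl fun j _ => (congrArg G (h1 j)).symm

namespace StableRibbonGraph.Choices

variable {A : Type*} [NonUnitalRing A] [Module ℝ A] [FiniteDimensional ℝ A]
  {𝒜 : ZMod 2 → Submodule ℝ A} {F : DGFrobenius 𝒜} [DirectSum.Decomposition 𝒜]
  {γ : StableRibbonGraph} (c : γ.Choices)

theorem val_update_of_vert_ne (t : OpenTFT F) (a : γ.H → A) {h : γ.H} {v : γ.V}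
    (hv : γ.vert h ≠ v) (x : A) :
    t.val (γ.surface v) (c.legs v) (fun i => Function.update a h x i.1) =
      t.val (γ.surface v) (c.legs v) (fun i => a i.1) := by
  congr 1
  funext i
  rw [Function.update_of_ne]
  rintro rfl
  exact hv i.2

theorem update_comp_val (a : γ.H → A) (h : γ.H) (x : A) :
    (fun i : {i // γ.vert i = γ.vert h} => Function.update a h x i.1) =
      Function.update (fun i => a i.1) ⟨h, rfl⟩ x := by
  funext i
  by_cases hi : i = ⟨h, rfl⟩
  · subst hi; simp
  · rw [Function.update_of_ne hi, Function.update_of_ne]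
    exact fun hc => hi (Subtype.ext hc)

/-- The tensor product over the vertices. -/
def vertexMap (t : OpenTFT F) : MultilinearMap ℝ (fun _ : γ.H => A) ℝ where
  toFun a := ∏ v, t.val (γ.surface v) (c.legs v) (fun h => a h.1)
  map_update_add' := by
    intro inst a h x y
    obtain rfl : inst = fun _ _ => Classical.propDecidable _ := Subsingleton.elim _ _
    simp only [← Finset.mul_prod_erase Finset.univ _ (Finset.mem_univ (γ.vert h))]
    rw [update_comp_val, update_comp_val, update_comp_val, MultilinearMap.map_update_add, add_mul]
    congr 2 <;>
    · refine Finset.prod_congr rfl fun v hv => ?_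
      rw [val_update_of_vert_ne _ _ _ (Finset.ne_of_mem_erase hv).symm,
        val_update_of_vert_ne _ _ _ (Finset.ne_of_mem_erase hv).symm]
  map_update_smul' := by
    intro inst a h r x
    obtain rfl : inst = fun _ _ => Classical.propDecidable _ := Subsingleton.elim _ _
    simp only [← Finset.mul_prod_erase Finset.univ _ (Finset.mem_univ (γ.vert h))]
    rw [update_comp_val, update_comp_val, MultilinearMap.map_update_smul, smul_eq_mul, smul_eq_mul,
      mul_assoc]
    congr 2
    refine Finset.prod_congr rfl fun v hv => ?_
    rw [val_update_of_vert_ne _ _ _ (Finset.ne_of_mem_erase hv).symm,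
      val_update_of_vert_ne _ _ _ (Finset.ne_of_mem_erase hv).symm]

theorem vertexMap_apply (t : OpenTFT F) (a : γ.H → A) : c.vertexMap t a =
    ∏ v, t.val (γ.surface v) (c.legs v) (fun h => a h.1) := rfl

/-- The tensor product over the vertices, as a function of elements in the order `edgeOrder`. -/
def tensorMap (t : OpenTFT F) : MultilinearMap ℝ (fun _ : γ.H => A) ℝ :=
  signedMap 𝒜 (fun p => koszulSign p c.edgeOrder c.vertexOrder) (c.vertexMap t)

theorem tensor_eq (t : OpenTFT F) (a : γ.H → A) :
    c.tensor (𝒜 := 𝒜) (fun v => t.val (γ.surface v) (c.legs v)) a = c.tensorMap t a := by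
  rw [tensorMap, signedMap_apply]
  rfl

theorem tensorMap_of_mem (t : OpenTFT F) {p : γ.H → ZMod 2} {a : γ.H → A}
    (ha : ∀ h, a h ∈ 𝒜 (p h)) : c.tensorMap t a =
      koszulSign p c.edgeOrder c.vertexOrder * c.vertexMap t a := signedMap_of_mem _ _ ha

/-- The product over the edges of the tensors `∑ j, Φ e (basis j) ⊗ dual j` is the sum of the
tensors `edgeVec Φ m`. -/
def edgeVec (F : DGFrobenius 𝒜) (Φ : γ.E → A →ₗ[ℝ] A)
    (m : γ.E → Fin (Module.finrank ℝ A)) (h : γ.H) : A :=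
  if h = c.fst (γ.edge h) then Φ (γ.edge h) (F.basis (m (γ.edge h))) else F.dual (m (γ.edge h))

theorem edgeVec_fst (Φ : γ.E → A →ₗ[ℝ] A) (m : γ.E → Fin (Module.finrank ℝ A)) (e : γ.E) :
    c.edgeVec F Φ m (c.fst e) = Φ e (F.basis (m e)) := by
  rw [edgeVec, c.edge_fst, if_pos rfl]

theorem edgeVec_flip (Φ : γ.E → A →ₗ[ℝ] A) (m : γ.E → Fin (Module.finrank ℝ A)) (e : γ.E) :
    c.edgeVec F Φ m (γ.flip (c.fst e)) = F.dual (m e) := by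
  rw [edgeVec, c.edge_flip_fst, if_neg (c.fst_ne_flip e).symm]

theorem edgeVec_congr {Φ Φ' : γ.E → A →ₗ[ℝ] A} {m m' : γ.E → Fin (Module.finrank ℝ A)} {h : γ.H}
    (h1 : Φ (γ.edge h) = Φ' (γ.edge h)) (h2 : m (γ.edge h) = m' (γ.edge h)) :
    c.edgeVec F Φ m h = c.edgeVec F Φ' m' h := by
  rw [edgeVec, edgeVec, h1, h2]

theorem edge_ne_of_ne (e : γ.E) {x : γ.H} (h1 : x ≠ c.fst e) (h2 : x ≠ γ.flip (c.fst e)) :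
    γ.edge x ≠ e := by
  have := (γ.edge_ne_iff (c.fst e) x).2 ⟨h1, h2⟩
  rwa [c.edge_fst] at this

theorem edgeVec_update (Φ : γ.E → A →ₗ[ℝ] A) (m : γ.E → Fin (Module.finrank ℝ A)) (e : γ.E)
    (T : A →ₗ[ℝ] A) (j : Fin (Module.finrank ℝ A)) :
    c.edgeVec F (Function.update Φ e T) (Function.update m e j) =
    insertTwo (c.fst e) (γ.flip (c.fst e)) (fun x => c.edgeVec F Φ m x) (T (F.basis j))
      (F.dual j) := by
  rw [← insertTwo_self (h := c.fst e) (h' := γ.flip (c.fst e)) (c.edgeVec F _ _), edgeVec_fst,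
    edgeVec_flip, Function.update_self, Function.update_self]
  congr 1
  funext x
  have := c.edge_ne_of_ne e x.2.1 x.2.2
  exact c.edgeVec_congr (Function.update_of_ne this _ _) (Function.update_of_ne this _ _)

/-- The evaluation of a multilinear map on the product over the edges of the tensors
`∑ j, Φ e (basis j) ⊗ dual j`. -/
def edgeSum (F : DGFrobenius 𝒜) (T : MultilinearMap ℝ (fun _ : γ.H => A) ℝ) :
    MultilinearMap ℝ (fun _ : γ.E => A →ₗ[ℝ] A) ℝ where
  toFun Φ := ∑ m, T (c.edgeVec F Φ m)
  map_update_add' := by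
    intro inst Φ e f g
    obtain rfl : inst = fun _ _ => Classical.propDecidable _ := Subsingleton.elim _ _
    rw [← Finset.sum_add_distrib]
    refine Finset.sum_congr rfl fun m _ => ?_
    have h := fun f => c.edgeVec_update (F := F) Φ m e f (m e)
    simp only [Function.update_eq_self] at h
    rw [h, h, h, LinearMap.add_apply]
    exact LinearMap.congr_fun ((T.bilin (c.fst_ne_flip e) _).map_add (f (F.basis (m e)))
      (g (F.basis (m e)))) (F.dual (m e))
  map_update_smul' := by
    intro inst Φ e r f
    obtain rfl : inst = fun _ _ => Classical.propDecidable _ := Subsingleton.elim _ _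
    rw [Finset.smul_sum]
    refine Finset.sum_congr rfl fun m _ => ?_
    have h := fun f => c.edgeVec_update (F := F) Φ m e f (m e)
    simp only [Function.update_eq_self] at h
    rw [h, h, LinearMap.smul_apply]
    exact LinearMap.congr_fun ((T.bilin (c.fst_ne_flip e) _).map_smul r
      (f (F.basis (m e)))) (F.dual (m e))

theorem edgeSum_apply (T : MultilinearMap ℝ (fun _ : γ.H => A) ℝ) (Φ : γ.E → A →ₗ[ℝ] A) :
    c.edgeSum F T Φ = ∑ m, T (c.edgeVec F Φ m) := rfl

theorem edgeSum_congr_edge (e : γ.E) {T T' : MultilinearMap ℝ (fun _ : γ.H => A) ℝ}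
    (Φ : γ.E → A →ₗ[ℝ] A) (f g : A →ₗ[ℝ] A)
    (h : ∀ a, ∑ j, T (insertTwo (c.fst e) (γ.flip (c.fst e)) a (f (F.basis j)) (F.dual j)) =
      ∑ j, T' (insertTwo (c.fst e) (γ.flip (c.fst e)) a (g (F.basis j)) (F.dual j))) :
    c.edgeSum F T (Function.update Φ e f) = c.edgeSum F T' (Function.update Φ e g) := by
  rw [edgeSum_apply, edgeSum_apply]
  refine Fintype.sum_congr_update e fun m => ?_
  simp only [edgeVec_update]
  exact h _

theorem hproj_comm_degree {δ : ZMod 2} {f : A →ₗ[ℝ] A} (hf : ∀ i, ∀ a ∈ 𝒜 i, f a ∈ 𝒜 (i + δ))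
    (q : ZMod 2) (a : A) : hproj 𝒜 (q + δ) (f a) = f (hproj 𝒜 q a) := by
  refine LinearMap.congr_homogeneous 𝒜 (hproj 𝒜 (q + δ) ∘ₗ f) (f ∘ₗ hproj 𝒜 q) (fun i a ha => ?_) a
  rw [LinearMap.comp_apply, LinearMap.comp_apply, hproj_of_mem 𝒜 (hf i a ha), hproj_of_mem 𝒜 ha]
  by_cases h : i = q
  · simp [h]
  · simp [h]

/-- The tensor of the edge `e` has total parity `δ e`, since the inverse inner product is even.
Decomposing all arguments into homogeneous parts, only assignments of parities with this property
contribute, even though the basis is not homogeneous. -/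
theorem edgeSum_congr {δ : γ.E → ZMod 2} {Φ : γ.E → A →ₗ[ℝ] A}
    (hΦ : ∀ e i, ∀ a ∈ 𝒜 i, Φ e a ∈ 𝒜 (i + δ e)) {T T' : MultilinearMap ℝ (fun _ : γ.H => A) ℝ}
    (h : ∀ (p : γ.H → ZMod 2) (a : γ.H → A), (∀ h, a h ∈ 𝒜 (p h)) →
      (∀ e, p (c.fst e) + p (γ.flip (c.fst e)) = δ e) → T a = T' a) :
    c.edgeSum F T Φ = c.edgeSum F T' Φ := by
  have key : ∀ p : γ.H → ZMod 2, c.edgeSum F (T.compLinearMap fun h => hproj 𝒜 (p h)) Φ =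
      c.edgeSum F (T'.compLinearMap fun h => hproj 𝒜 (p h)) Φ := by
    intro p
    by_cases hp : ∀ e, p (c.fst e) + p (γ.flip (c.fst e)) = δ e
    · rw [edgeSum_apply, edgeSum_apply]
      exact Finset.sum_congr rfl fun m _ => h p _ (fun i => hproj_mem 𝒜 _ _) hp
    · push Not at hp
      obtain ⟨e, he⟩ := hp
      have hzero : ∀ (T : MultilinearMap ℝ (fun _ : γ.H => A) ℝ)
          (a : {x // x ≠ c.fst e ∧ x ≠ γ.flip (c.fst e)} → A),
          ∑ j, (T.compLinearMap fun h => hproj 𝒜 (p h)) (insertTwo (c.fst e) (γ.flip (c.fst e)) a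
            (Φ e (F.basis j)) (F.dual j)) = 0 := by
        intro T a
        have h1 := F.contract_hproj ((T.bilin (c.fst_ne_flip e)
          fun i => hproj 𝒜 (p i) (a i)) ∘ₗ Φ e) (q := p (c.fst e) + δ e)
          (r := p (γ.flip (c.fst e))) (fun hc => he (by
            rw [← hc, ← add_assoc, CharTwo.add_self_eq_zero, zero_add]))
        rw [← h1]
        refine Finset.sum_congr rfl fun j _ => ?_
        rw [MultilinearMap.compLinearMap_apply, insertTwo_map (c.fst_ne_flip e)
          (fun i => hproj 𝒜 (p i)), LinearMap.comp_apply, ← hproj_comm_degree (hΦ e), add_assoc,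
          CharTwo.add_self_eq_zero, add_zero]
        rfl
      have := c.edgeSum_congr_edge e Φ (Φ e) (Φ e) (fun a => (hzero T a).trans (hzero T' a).symm)
      rwa [Function.update_eq_self] at this
  have hsum : ∀ T : MultilinearMap ℝ (fun _ : γ.H => A) ℝ, c.edgeSum F T Φ =
      ∑ p : γ.H → ZMod 2, c.edgeSum F (T.compLinearMap fun h => hproj 𝒜 (p h)) Φ := by
    intro T
    simp only [edgeSum_apply]
    rw [Finset.sum_comm]
    refine Finset.sum_congr rfl fun m _ => ?_
    rw [← T.sum_hproj 𝒜]
    rfl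
  rw [hsum T, hsum T']
  exact Finset.sum_congr rfl fun p _ => key p

/-- The value of the tensor product over the vertices on the product over the edges. -/
def coef (t : OpenTFT F) : MultilinearMap ℝ (fun _ : γ.E => A →ₗ[ℝ] A) ℝ :=
  c.edgeSum F (c.tensorMap t)

end StableRibbonGraph.Choices

end

/-! ### Dependence on the orders of vertices, half-edges and edges and on the ends of the edges. -/

noncomputable section

/-- Operators of degree `δ` that are self-adjoint in the graded sense. -/
structure DGFrobenius.IsEdgeOp {A : Type*} [NonUnitalRing A] [Module ℝ A]
    {𝒜 : ZMod 2 → Submodule ℝ A} [DirectSum.Decomposition 𝒜] (F : DGFrobenius 𝒜) (δ : ZMod 2)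
    (f : A →ₗ[ℝ] A) : Prop where
  mem : ∀ i, ∀ a ∈ 𝒜 i, f a ∈ 𝒜 (i + δ)
  form : ∀ a b, F.form a (f b) = F.form (f (signOp 𝒜 δ a)) b

theorem koszulSign_of_even {I : Type} [Fintype I] {p : I → ZMod 2} {L L' : List I}
    (h : ∀ i, p i = 0) : koszulSign p L L' = 1 := by
  simp [koszulSign, h]

section

variable {A : Type*} [NonUnitalRing A] [Module ℝ A] [FiniteDimensional ℝ A]
  {𝒜 : ZMod 2 → Submodule ℝ A} {F : DGFrobenius 𝒜} [DirectSum.Decomposition 𝒜]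

namespace DGFrobenius.IsEdgeOp

theorem id : F.IsEdgeOp 0 LinearMap.id := ⟨fun i a ha => by simpa using ha, fun a b => by simp⟩

theorem π (D : HodgeDecomposition F) : F.IsEdgeOp 0 D.π :=
  ⟨fun i a ha => by simpa using D.π_mem i a ha, fun a b => by simp [D.form_π]⟩

theorem s (D : HodgeDecomposition F) : F.IsEdgeOp 1 D.s := by
  refine ⟨D.s_mem, fun a b => ?_⟩
  refine LinearMap.congr_homogeneous 𝒜 (F.form.flip (D.s b))
    (F.form.flip b ∘ₗ D.s ∘ₗ signOp 𝒜 1) (fun i a ha => ?_) a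
  simp only [LinearMap.flip_apply, LinearMap.comp_apply]
  rw [signOp_of_mem 𝒜 _ ha, map_smul, map_smul]
  change F.form a (D.s b) = swapSign 1 i • F.form (D.s a) b
  rw [D.form_s i a ha, neg_one_pow_val, smul_eq_mul, ← mul_assoc, swapSign_mul_self, one_mul]

theorem add {δ : ZMod 2} {f g : A →ₗ[ℝ] A} (hf : F.IsEdgeOp δ f) (hg : F.IsEdgeOp δ g) :
    F.IsEdgeOp δ (f + g) :=
  ⟨fun i a ha => Submodule.add_mem _ (hf.mem i a ha) (hg.mem i a ha), fun a b => by
    simp [hf.form, hg.form]⟩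

theorem smul {δ : ZMod 2} {f : A →ₗ[ℝ] A} (hf : F.IsEdgeOp δ f) (r : ℝ) :
    F.IsEdgeOp δ (r • f) :=
  ⟨fun i a ha => Submodule.smul_mem _ r (hf.mem i a ha), fun a b => by simp [hf.form]⟩

theorem neg {δ : ZMod 2} {f : A →ₗ[ℝ] A} (hf : F.IsEdgeOp δ f) : F.IsEdgeOp δ (-f) := by
  rw [← neg_one_smul ℝ]; exact hf.smul _

theorem sub {δ : ZMod 2} {f g : A →ₗ[ℝ] A} (hf : F.IsEdgeOp δ f) (hg : F.IsEdgeOp δ g) :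
    F.IsEdgeOp δ (f - g) := by
  rw [sub_eq_add_neg]; exact hf.add hg.neg

/-- Exchanging the two ends of an edge. -/
theorem contract_swap {δ : ZMod 2} {f : A →ₗ[ℝ] A} (hf : F.IsEdgeOp δ f)
    {B B' : A →ₗ[ℝ] A →ₗ[ℝ] ℝ}
    (h : ∀ q r, ∀ x ∈ 𝒜 q, ∀ y ∈ 𝒜 r, B' x y = swapSign q r * B x y) :
    ∑ j, B' (F.dual j) (f (F.basis j)) = ∑ j, B (f (F.basis j)) (F.dual j) := by
  have h1 := F.contract_adjoint B (T := f) (T' := f ∘ₗ signOp 𝒜 δ) hf.form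
  have h2 := F.contract_symm (B.compl₂ (f ∘ₗ signOp 𝒜 δ))
  simp only [LinearMap.compl₂_apply] at h2
  rw [h1, h2]
  -- For letters of common parity `q` the signs match: the exchange gives `(-1)^(q (q + δ))`,
  -- adjointness `(-1)^(δ q)` and transposition of the inverse inner product `(-1)^q`.
  refine F.contract_congr (B'.compl₂ f).flip
    (B.compl₂ ((f ∘ₗ signOp 𝒜 δ) ∘ₗ signOp 𝒜 1)).flip fun q x hx y hy => ?_
  simp only [LinearMap.flip_apply, LinearMap.compl₂_apply, LinearMap.comp_apply]
  rw [h q (q + δ) y hy _ (hf.mem q x hx), signOp_of_mem 𝒜 1 hx, map_smul,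
    signOp_of_mem 𝒜 δ hx, map_smul, map_smul, map_smul, map_smul, smul_eq_mul, smul_eq_mul,
    swapSign_add_right, swapSign_comm q δ, mul_assoc]
  congr 1
  rcases zmod_two_cases q with rfl | rfl <;> simp

end DGFrobenius.IsEdgeOp

/-- A sign relation between multilinear maps on homogeneous elements that depends on the parities
at two places only. -/
theorem MultilinearMap.insertTwo_congr {I : Type} [Fintype I] {h h' : I} (hne : h ≠ h')
    {T T' : MultilinearMap ℝ (fun _ : I => A) ℝ} {q r : ZMod 2} {x y : A} (hx : x ∈ 𝒜 q)
    (hy : y ∈ 𝒜 r) {s : ℝ} (hT : ∀ (p : I → ZMod 2) (a : I → A), (∀ i, a i ∈ 𝒜 (p i)) →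
      p h = q → p h' = r → T' a = s * T a) (a : {z // z ≠ h ∧ z ≠ h'} → A) :
    T' (insertTwo h h' a x y) = s * T (insertTwo h h' a x y) := by
  refine MultilinearMap.congr_homogeneous 𝒜
    (T'.domDomRestrict (fun z => z ≠ h ∧ z ≠ h') (fun z => if (z : I) = h then x else y))
    (s • T.domDomRestrict (fun z => z ≠ h ∧ z ≠ h') (fun z => if (z : I) = h then x else y))
    (fun p a ha => ?_) a
  exact hT (insertTwo h h' p q r) _ (insertTwo_mem hne ha hx hy) (by simp)
    (insertTwo_right _ _ _ hne)

namespace StableRibbonGraph.Choices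

variable {γ : StableRibbonGraph} (c c' : γ.Choices)

theorem sum_legs (p : γ.H → ZMod 2) (v : γ.V) :
    wordParity p ((c.legs v).list.map Subtype.val) = ∑ h : {h // γ.vert h = v}, p h := by
  rw [wordParity_map, wordParity_eq_sum _ (c.legs v).nodup (c.legs v).complete]

theorem legs_perm (v : γ.V) : (c.legs v).list.Perm (c'.legs v).list :=
  (c.legs v).perm (c'.legs v).nodup (c'.legs v).complete

/-- If some vertex receives arguments of odd total parity, both sides vanish because vertex tensors
are even. Otherwise permuting the vertices costs no sign, and reordering the half-edges at each
vertex is governed by `val_reorder`. -/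
theorem koszulSign_vertexOrder (t : OpenTFT F) {p : γ.H → ZMod 2} {a : γ.H → A}
    (ha : ∀ h, a h ∈ 𝒜 (p h)) : koszulSign p c'.vertexOrder c.vertexOrder * c.vertexMap t a =
      c'.vertexMap t a := by
  by_cases hp : ∀ v, ∑ h : {h // γ.vert h = v}, p h = 0
  · have h1 : c'.vertexOrder.Perm (c'.verts.list.flatMap fun v => (c.legs v).list.map Subtype.val) :=
      List.Perm.flatMap_congr' _ fun v => (legs_perm c' c v).map _
    have h2 : (c'.verts.list.flatMap fun v => (c.legs v).list.map Subtype.val).Perm c.vertexOrder :=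
      (c'.verts.perm c.verts.nodup c.verts.complete).flatMap_right _
    rw [← koszulSign_trans p h1 h2, vertexOrder, vertexOrder, koszulSign_flatMap_congr p
      (fun v => (legs_perm c' c v).map _) c'.nodup_vertexOrder, koszulSign_flatMap_perm p _
      (c'.verts.perm c.verts.nodup c.verts.complete) (h1.nodup_iff.1 c'.nodup_vertexOrder)
      c'.verts.nodup, koszulSign_of_even (fun v => (c.sum_legs p v).trans (hp v)), mul_one,
      Enumeration.prod_eq, vertexMap_apply, vertexMap_apply, ← Finset.prod_mul_distrib]
    refine Finset.prod_congr rfl fun v _ => ?_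
    rw [t.val_reorder (γ.surface v) (c.legs v) (c'.legs v) (fun h => p h) _ fun h => ha h,
      koszulSign_map _ Subtype.val_injective p (legs_perm c' c v) (c'.legs v).nodup,
      koszulSign_comm]
  · push Not at hp
    obtain ⟨v, hv⟩ := hp
    rw [vertexMap_apply, vertexMap_apply, Finset.prod_eq_zero (Finset.mem_univ v)
      (t.val_even (γ.surface v) (c.legs v) (fun h => p h) _ (fun h => ha h) hv),
      Finset.prod_eq_zero (Finset.mem_univ v)
      (t.val_even (γ.surface v) (c'.legs v) (fun h => p h) _ (fun h => ha h) hv), mul_zero]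

/-- The two half-edges of `e` form a block of parity `δ e`, so reordering the edges costs the Koszul
sign for `δ`. -/
theorem coef_eq_of_fst (t : OpenTFT F) {δ : γ.E → ZMod 2} {Φ : γ.E → A →ₗ[ℝ] A}
    (hΦ : ∀ e, F.IsEdgeOp (δ e) (Φ e)) (hf : c.fst = c'.fst) :
    c.coef t Φ = koszulSign δ c.edges.list c'.edges.list * c'.coef t Φ := by
  have h1 : c'.coef t Φ = c.edgeSum F (c'.tensorMap t) Φ := by
    rw [coef, edgeSum_apply, edgeSum_apply]
    refine Finset.sum_congr rfl fun m _ => congrArg _ ?_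
    funext h
    rw [edgeVec, edgeVec, hf]
  rw [h1]
  refine c.edgeSum_congr (fun e => (hΦ e).mem) (T' := koszulSign δ c.edges.list c'.edges.list •
    c'.tensorMap t) (fun p a ha hp => ?_) |>.trans ?_
  · have e1 : c.edgeOrder.Perm c'.edgeOrder :=
      (List.perm_ext_iff_of_nodup c.nodup_edgeOrder c'.nodup_edgeOrder).2 fun h => by
        simp [mem_edgeOrder]
    have e2 : koszulSign p c.edgeOrder c'.edgeOrder =
        koszulSign δ c.edges.list c'.edges.list := by
      have hn := c.nodup_edgeOrder
      have := koszulSign_flatMap_perm p _ (c.edges.perm c'.edges.nodup c'.edges.complete) hn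
        c.edges.nodup
      simp only [wordParity_cons, wordParity_nil, add_zero, hp] at this
      rw [← this, edgeOrder, edgeOrder, hf]
    rw [MultilinearMap.smul_apply, smul_eq_mul, tensorMap_of_mem c t ha, tensorMap_of_mem c' t ha,
      ← e2, ← koszulSign_trans p e1 (e1.symm.trans c.edgeOrder_perm),
      ← koszulSign_trans p c'.edgeOrder_perm (c'.edgeOrder_perm.symm.trans
        (e1.symm.trans c.edgeOrder_perm)), mul_assoc, mul_assoc, koszulSign_vertexOrder c c' t ha]
  · rw [edgeSum_apply, edgeSum_apply, Finset.mul_sum]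
    rfl

/-- The choices with the two ends of an edge exchanged. -/
def flipEdge (e : γ.E) : γ.Choices :=
  { c with
    fst := Function.update c.fst e (γ.flip (c.fst e))
    edge_fst := fun e' => by
      by_cases h : e' = e
      · subst h; simpa using c.edge_flip_fst e'
      · simpa [h] using c.edge_fst e' }

theorem tensorMap_flipEdge (t : OpenTFT F) (e : γ.E) {p : γ.H → ZMod 2} {a : γ.H → A}
    (ha : ∀ h, a h ∈ 𝒜 (p h)) : (c.flipEdge e).tensorMap t a =
      swapSign (p (c.fst e)) (p (γ.flip (c.fst e))) * c.tensorMap t a := by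
  have hfst : (c.flipEdge e).fst e = γ.flip (c.fst e) := by simp [flipEdge]
  have hfst' : ∀ e', e' ≠ e → (c.flipEdge e).fst e' = c.fst e' := fun e' h => by
    simp [flipEdge, h]
  have hperm : ∀ e', [(c.flipEdge e).fst e', γ.flip ((c.flipEdge e).fst e')].Perm
      [c.fst e', γ.flip (c.fst e')] := by
    intro e'
    by_cases h : e' = e
    · subst h
      rw [hfst, γ.flip_flip]
      exact List.Perm.swap _ _ _
    · rw [hfst' e' h]
  have e1 : koszulSign p (c.flipEdge e).edgeOrder c.edgeOrder =
      swapSign (p (c.fst e)) (p (γ.flip (c.fst e))) := by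
    have h1 := koszulSign_flatMap_congr p (L := c.edges.list) hperm
      (c.flipEdge e).nodup_edgeOrder
    rw [Enumeration.prod_eq, Finset.prod_eq_single e] at h1
    · rw [edgeOrder, edgeOrder]
      refine h1.trans ?_
      rw [hfst, γ.flip_flip, koszulSign_swap p [] (c.fst_ne_flip e).symm, swapSign_comm]
    · intro e' _ h
      rw [hfst' e' h, koszulSign_self]
    · simp
  have e2 : (c.flipEdge e).edgeOrder.Perm c.edgeOrder :=
    List.Perm.flatMap_congr' c.edges.list hperm
  rw [tensorMap_of_mem _ t ha, tensorMap_of_mem _ t ha, ← mul_assoc, ← e1,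
    koszulSign_trans p e2 c.edgeOrder_perm]
  rfl

/-- The Koszul sign of exchanging the two half-edges is compensated by the graded symmetry of the
edge tensor, `IsEdgeOp.contract_swap`. -/
theorem coef_flipEdge (t : OpenTFT F) (e : γ.E) {δ : γ.E → ZMod 2} {Φ : γ.E → A →ₗ[ℝ] A}
    (hΦ : ∀ e, F.IsEdgeOp (δ e) (Φ e)) : (c.flipEdge e).coef t Φ = c.coef t Φ := by
  rw [coef, coef, edgeSum_apply, edgeSum_apply]
  refine Fintype.sum_congr_update e fun m => ?_
  have h1 : ∀ j, c.edgeVec F Φ (Function.update m e j) = insertTwo (c.fst e) (γ.flip (c.fst e))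
      (fun x => c.edgeVec F Φ m x) (Φ e (F.basis j)) (F.dual j) := by
    intro j
    rw [← edgeVec_update, Function.update_eq_self]
  have hfst : (c.flipEdge e).fst e = γ.flip (c.fst e) := by simp [flipEdge]
  have h2 : ∀ j, (c.flipEdge e).edgeVec F Φ (Function.update m e j) =
      insertTwo (c.fst e) (γ.flip (c.fst e))
        (fun x => c.edgeVec F Φ m x) (F.dual j) (Φ e (F.basis j)) := by
    intro j
    rw [← insertTwo_self (h := c.fst e) (h' := γ.flip (c.fst e)) ((c.flipEdge e).edgeVec F _ _)]
    have h3 := (c.flipEdge e).edgeVec_flip (F := F) Φ (Function.update m e j) e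
    have h4 := (c.flipEdge e).edgeVec_fst (F := F) Φ (Function.update m e j) e
    rw [hfst, γ.flip_flip] at h3
    rw [hfst] at h4
    rw [h3, h4, Function.update_self]
    congr 1
    funext x
    have := c.edge_ne_of_ne e x.2.1 x.2.2
    rw [edgeVec, edgeVec, Function.update_of_ne this]
    congr 2
    simp [flipEdge, this]
  simp only [h1, h2]
  exact (hΦ e).contract_swap (B' := ((c.flipEdge e).tensorMap t).bilin (c.fst_ne_flip e)
    fun x => c.edgeVec F Φ m x) (B := (c.tensorMap t).bilin (c.fst_ne_flip e)
    fun x => c.edgeVec F Φ m x) fun q r x hx y hy =>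
    MultilinearMap.insertTwo_congr (c.fst_ne_flip e) hx hy (fun p a ha hq hr => by
      rw [tensorMap_flipEdge c t e ha, hq, hr]) _

/-- The effect of the choices on the value. -/
theorem coef_eq (t : OpenTFT F) {δ : γ.E → ZMod 2} {Φ : γ.E → A →ₗ[ℝ] A}
    (hΦ : ∀ e, F.IsEdgeOp (δ e) (Φ e)) :
    c.coef t Φ = koszulSign δ c.edges.list c'.edges.list * c'.coef t Φ := by
  -- The first ends are made to agree with those of `c'` one edge at a time; every flip leaves the
  -- value unchanged.
  have key : ∀ S : Finset γ.E, ∃ b : γ.Choices, b.edges = c.edges ∧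
      (∀ e ∈ S, b.fst e = c'.fst e) ∧ b.coef t Φ = c.coef t Φ := by
    intro S
    induction S using Finset.induction_on with
    | empty => exact ⟨c, rfl, by simp, rfl⟩
    | insert e S he ih =>
      obtain ⟨b, h1, h2, h3⟩ := ih
      by_cases hb : b.fst e = c'.fst e
      · refine ⟨b, h1, fun e' he' => ?_, h3⟩
        rcases Finset.mem_insert.1 he' with rfl | he'
        · exact hb
        · exact h2 e' he'
      · refine ⟨b.flipEdge e, h1, fun e' he' => ?_, by rw [coef_flipEdge b t e hΦ, h3]⟩
        have hb' : c'.fst e = γ.flip (b.fst e) := by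
          have := b.eq_fst_or (c'.fst e)
          rw [c'.edge_fst] at this
          exact this.resolve_left (Ne.symm hb)
        rcases Finset.mem_insert.1 he' with rfl | he'
        · simp [flipEdge, hb']
        · have : e' ≠ e := fun hc => he (hc ▸ he')
          simp [flipEdge, this, h2 e' he']
  obtain ⟨b, h1, h2, h3⟩ := key Finset.univ
  rw [← h3, coef_eq_of_fst b c' t hΦ (funext fun e => h2 e (Finset.mem_univ e)), h1]

end StableRibbonGraph.Choices

end

end

/-! ### The Stokes relation for the value of a graph. -/

noncomputable section

theorem prefixSign_map {I J : Type} [Fintype I] [Fintype J] {e : I → J}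
    (he : Function.Injective e) (p : J → ZMod 2) {L : List I} (hn : L.Nodup) {i : I} (hi : i ∈ L) :
    prefixSign p (L.map e) (e i) = prefixSign (fun i => p (e i)) L i := by
  induction L with
  | nil => simp at hi
  | cons x L ih =>
    rw [List.nodup_cons] at hn
    have hx : e x ∉ L.map e := fun hc => by
      obtain ⟨y, hy, hxy⟩ := List.mem_map.1 hc
      exact hn.1 (he hxy ▸ hy)
    rw [List.map_cons, prefixSign_cons _ hx, prefixSign_cons _ hn.1]
    by_cases h : i = x
    · rw [if_pos h, if_pos (congrArg e h)]
    · rw [if_neg h, if_neg (fun hc => h (he hc)), ih hn.2 ((List.mem_cons.1 hi).resolve_left h)]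

theorem List.Nodup.sum_map_eq {I : Type} [Fintype I] {L : List I} (hn : L.Nodup)
    (hc : ∀ i, i ∈ L) (f : I → ℝ) : (L.map f).sum = ∑ i, f i := by
  rw [← List.sum_toFinset f hn]
  refine Finset.sum_congr ?_ fun _ _ => rfl
  ext i; simpa using hc i

namespace StableRibbonGraph.Choices

variable {A : Type*} [NonUnitalRing A] [Module ℝ A] [FiniteDimensional ℝ A]
  {𝒜 : ZMod 2 → Submodule ℝ A} {F : DGFrobenius 𝒜} [DirectSum.Decomposition 𝒜]
  {γ : StableRibbonGraph} (c : γ.Choices)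

theorem update_d_mem' {p : γ.H → ZMod 2} {a : γ.H → A} (ha : ∀ h, a h ∈ 𝒜 (p h)) (h i : γ.H) :
    Function.update a h (F.d (a h)) i ∈ 𝒜 (Function.update p h (p h + 1) i) :=
  mem_update ha (F.d_mem _ _ (ha h)) h i

/-- The sum splits by vertices. At a vertex the prefix sign factors into that of the preceding
vertices, which is common to all its half-edges, and the one in the closedness relation of the
vertex tensor. -/
theorem sum_vertexMap_d (t : OpenTFT F) {p : γ.H → ZMod 2} {a : γ.H → A}
    (ha : ∀ h, a h ∈ 𝒜 (p h)) :
    ∑ h, prefixSign p c.vertexOrder h * c.vertexMap t (Function.update a h (F.d (a h))) = 0 := by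
  rw [← (Equiv.sigmaFiberEquiv γ.vert).sum_comp, Fintype.sum_sigma]
  refine Finset.sum_eq_zero fun v _ => ?_
  have h1 : ∀ h : {h // γ.vert h = v}, prefixSign p c.vertexOrder h.1 *
      c.vertexMap t (Function.update a h.1 (F.d (a h.1))) =
      (prefixSign (fun v => wordParity p ((c.legs v).list.map Subtype.val)) c.verts.list v *
        ∏ w ∈ Finset.univ.erase v, t.val (γ.surface w) (c.legs w) (fun h => a h.1)) *
      (prefixSign (fun h : {h // γ.vert h = v} => p h.1) (c.legs v).list h *
        t.val (γ.surface v) (c.legs v)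
          (Function.update (fun h => a h.1) h (F.d (a h.1)))) := by
    rintro ⟨h, rfl⟩
    have e1 : prefixSign p c.vertexOrder h = prefixSign (fun v => wordParity p
        ((c.legs v).list.map Subtype.val)) c.verts.list (γ.vert h) * prefixSign p
        ((c.legs (γ.vert h)).list.map Subtype.val) h :=
      prefixSign_flatMap p c.nodup_vertexOrder c.verts.nodup (c.verts.complete _)
        (List.mem_map.2 ⟨⟨h, rfl⟩, (c.legs _).complete _, rfl⟩)
    have e2 := prefixSign_map Subtype.val_injective p (c.legs (γ.vert h)).nodup
      (i := ⟨h, rfl⟩) ((c.legs _).complete _)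
    have e3 : c.vertexMap t (Function.update a h (F.d (a h))) = t.val (γ.surface (γ.vert h))
        (c.legs (γ.vert h)) (Function.update (fun h => a h.1) ⟨h, rfl⟩ (F.d (a h))) *
        ∏ w ∈ Finset.univ.erase (γ.vert h), t.val (γ.surface w) (c.legs w) (fun h => a h.1) := by
      rw [vertexMap_apply, ← Finset.mul_prod_erase Finset.univ _ (Finset.mem_univ (γ.vert h)),
        update_comp_val]
      congr 1
      refine Finset.prod_congr rfl fun w hw => ?_
      rw [val_update_of_vert_ne c t a (Finset.ne_of_mem_erase hw).symm]
    rw [e1, e2, e3]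
    ring
  refine (Finset.sum_congr rfl fun h _ => h1 h).trans ?_
  rw [← Finset.mul_sum]
  convert mul_zero _
  convert t.val_d (γ.surface v) (c.legs v) (fun h => p h.1) (fun h => a h.1) fun h => ha h.1

theorem sum_tensorMap_d (t : OpenTFT F) {p : γ.H → ZMod 2} {a : γ.H → A}
    (ha : ∀ h, a h ∈ 𝒜 (p h)) :
    ∑ h, prefixSign p c.edgeOrder h * c.tensorMap t (Function.update a h (F.d (a h))) = 0 := by
  have h1 := congrArg (koszulSign p c.edgeOrder c.vertexOrder * ·) (c.sum_vertexMap_d t ha)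
  simp only [mul_zero, Finset.mul_sum] at h1
  rw [← h1]
  refine Finset.sum_congr rfl fun h _ => ?_
  rw [tensorMap_of_mem c t (update_d_mem' ha h), ← mul_assoc,
    prefixSign_mul_koszulSign p c.edgeOrder_perm c.nodup_edgeOrder, mul_assoc]

theorem sum_halfEdges (f : γ.H → ℝ) : ∑ h, f h = ∑ e, (f (c.fst e) + f (γ.flip (c.fst e))) := by
  rw [← c.nodup_edgeOrder.sum_map_eq c.mem_edgeOrder f,
    ← c.edges.nodup.sum_map_eq c.edges.complete fun e => f (c.fst e) + f (γ.flip (c.fst e)),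
    edgeOrder]
  induction c.edges.list with
  | nil => rfl
  | cons e L ih =>
    rw [List.flatMap_cons, List.map_append, List.sum_append, ih]
    simp

theorem prefixSign_edgeOrder {δ : γ.E → ZMod 2} {p : γ.H → ZMod 2}
    (hp : ∀ e, p (c.fst e) + p (γ.flip (c.fst e)) = δ e) (e : γ.E) :
    prefixSign p c.edgeOrder (c.fst e) = prefixSign δ c.edges.list e ∧
    prefixSign p c.edgeOrder (γ.flip (c.fst e)) =
      prefixSign δ c.edges.list e * swapSign 1 (p (c.fst e)) := by
  have h1 : (fun e => wordParity p [c.fst e, γ.flip (c.fst e)]) = δ := by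
    funext e
    simpa using hp e
  have h2 := fun {x} hx => prefixSign_flatMap p c.nodup_edgeOrder c.edges.nodup
    (c.edges.complete e) (i := x) hx
  rw [h1] at h2
  have hne := c.fst_ne_flip e
  constructor
  · rw [edgeOrder, h2 (by simp), prefixSign_cons _ (by simpa using hne), if_pos rfl, mul_one]
  · rw [edgeOrder, h2 (by simp), prefixSign_cons _ (by simpa using hne), if_neg hne.symm,
      prefixSign_cons _ (by simp), if_pos rfl, mul_one]

/-- The restriction of a multilinear map along an operator in one argument. -/
def _root_.MultilinearMap.compAt {I : Type} (T : MultilinearMap ℝ (fun _ : I => A) ℝ) (i : I)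
    (f : A →ₗ[ℝ] A) : MultilinearMap ℝ (fun _ : I => A) ℝ :=
  T.compLinearMap (Function.update (fun _ => LinearMap.id) i f)

theorem _root_.MultilinearMap.compAt_apply {I : Type} (T : MultilinearMap ℝ (fun _ : I => A) ℝ)
    (i : I) (f : A →ₗ[ℝ] A) (a : I → A) : T.compAt i f a = T (Function.update a i (f (a i))) := by
  rw [MultilinearMap.compAt, MultilinearMap.compLinearMap_apply]
  congr 1
  funext j
  by_cases h : j = i
  · subst h; simp
  · simp [h]

theorem edgeSum_compAt_fst (T : MultilinearMap ℝ (fun _ : γ.H => A) ℝ) (Φ : γ.E → A →ₗ[ℝ] A)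
    (e : γ.E) (f : A →ₗ[ℝ] A) : c.edgeSum F (T.compAt (c.fst e) f) Φ =
      c.edgeSum F T (Function.update Φ e (f ∘ₗ Φ e)) := by
  conv_lhs => rw [← Function.update_eq_self e Φ]
  refine c.edgeSum_congr_edge e Φ _ _ fun a => Finset.sum_congr rfl fun j _ => ?_
  rw [MultilinearMap.compAt_apply, insertTwo_left, ← insertTwo_eq_update_left]
  rfl

/-- The differential at the second end is moved to the first end through the inverse inner product
and then stands to the right of the edge operator. -/
theorem edgeSum_compAt_flip (T : MultilinearMap ℝ (fun _ : γ.H => A) ℝ) (Φ : γ.E → A →ₗ[ℝ] A)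
    (e : γ.E) : c.edgeSum F (T.compAt (γ.flip (c.fst e)) (F.d ∘ₗ signOp 𝒜 1)) Φ =
      -c.edgeSum F T (Function.update Φ e (Φ e ∘ₗ F.d)) := by
  rw [← neg_one_smul ℝ, ← MultilinearMap.map_update_smul]
  conv_lhs => rw [← Function.update_eq_self e Φ]
  refine c.edgeSum_congr_edge e Φ _ _ fun a => ?_
  have h1 := F.contract_adjoint ((T.bilin (c.fst_ne_flip e) a) ∘ₗ Φ e) (T := F.d)
    (T' := -(F.d ∘ₗ signOp 𝒜 1)) fun x y => by
      rw [F.form_d_right]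
      simp
  simp only [LinearMap.comp_apply, LinearMap.neg_apply, map_neg, Finset.sum_neg_distrib] at h1
  have h2 := neg_eq_iff_eq_neg.2 h1
  rw [← Finset.sum_neg_distrib] at h2
  refine Eq.trans ?_ (h2.symm.trans ?_)
  · refine Finset.sum_congr rfl fun j _ => ?_
    rw [MultilinearMap.compAt_apply, insertTwo_right _ _ _ (c.fst_ne_flip e),
      ← insertTwo_eq_update_right _ _ _ (c.fst_ne_flip e)]
    rfl
  · refine Finset.sum_congr rfl fun j _ => ?_
    rw [neg_one_smul, ← MultilinearMap.bilin_apply T (c.fst_ne_flip e), LinearMap.neg_apply, map_neg]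
    rfl

theorem edgeSum_map_sum {ι : Type} [Fintype ι] (s : ι → ℝ)
    (T : ι → MultilinearMap ℝ (fun _ : γ.H => A) ℝ) (Φ : γ.E → A →ₗ[ℝ] A) :
    c.edgeSum F (∑ i, s i • T i) Φ = ∑ i, s i * c.edgeSum F (T i) Φ := by
  simp only [edgeSum_apply, MultilinearMap.sum_apply, MultilinearMap.smul_apply, smul_eq_mul,
    Finset.mul_sum]
  rw [Finset.sum_comm]

/-- Applying `d` to all half-edges in turn gives zero by closedness of the vertex tensors. At each
edge the two ends contribute `d Φ` and `∓ Φ d`, which together form the graded commutator of `d`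
with the edge operator. -/
theorem stokes (t : OpenTFT F) {δ : γ.E → ZMod 2} {Φ : γ.E → A →ₗ[ℝ] A}
    (hΦ : ∀ e i, ∀ a ∈ 𝒜 i, Φ e a ∈ 𝒜 (i + δ e)) :
    ∑ e, prefixSign δ c.edges.list e * c.coef t (Function.update Φ e
      (F.d ∘ₗ Φ e - swapSign 1 (δ e) • (Φ e ∘ₗ F.d))) = 0 := by
  set T := c.tensorMap t with hT
  let G (i : γ.E ⊕ γ.E) : MultilinearMap ℝ (fun _ : γ.H => A) ℝ := Sum.elim
    (fun e => T.compAt (c.fst e) F.d)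
    (fun e => T.compAt (γ.flip (c.fst e)) (F.d ∘ₗ signOp 𝒜 1)) i
  let s (i : γ.E ⊕ γ.E) : ℝ := Sum.elim (fun e => prefixSign δ c.edges.list e)
    (fun e => prefixSign δ c.edges.list e * swapSign 1 (δ e)) i
  -- At the second end the sign of passing the first one is rewritten as the sign of the edge degree
  -- times that of the second end, which is the `signOp` in `G`. This uses that the two parities add
  -- up to `δ e`.
  have h0 : c.edgeSum F (∑ i, s i • G i) Φ = c.edgeSum F 0 Φ := by
    refine c.edgeSum_congr hΦ fun p a ha hp => ?_
    have h1 := c.sum_tensorMap_d t ha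
    rw [c.sum_halfEdges] at h1
    rw [MultilinearMap.sum_apply, Fintype.sum_sum_type, ← Finset.sum_add_distrib,
      MultilinearMap.zero_apply, ← h1]
    refine Finset.sum_congr rfl fun e _ => ?_
    obtain ⟨e1, e2⟩ := c.prefixSign_edgeOrder hp e
    simp only [MultilinearMap.smul_apply, smul_eq_mul, G, s, Sum.elim_inl, Sum.elim_inr,
      MultilinearMap.compAt_apply, LinearMap.comp_apply]
    rw [e1, e2, signOp_of_mem 𝒜 1 (ha _), map_smul, MultilinearMap.map_update_smul, smul_eq_mul,
      ← hp e, swapSign_add_right]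
    linear_combination (prefixSign δ c.edges.list e * swapSign 1 (p (c.fst e)) *
      T (Function.update a (γ.flip (c.fst e)) (F.d (a (γ.flip (c.fst e)))))) *
      swapSign_mul_self 1 (p (γ.flip (c.fst e)))
  rw [edgeSum_map_sum, Fintype.sum_sum_type, ← Finset.sum_add_distrib] at h0
  have h2 : c.edgeSum F 0 Φ = 0 := by simp [edgeSum_apply]
  rw [h2] at h0
  rw [← h0]
  refine Finset.sum_congr rfl fun e _ => ?_
  simp only [G, s, Sum.elim_inl, Sum.elim_inr]
  rw [edgeSum_compAt_fst, edgeSum_compAt_flip, MultilinearMap.map_update_sub,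
    MultilinearMap.map_update_smul, coef, smul_eq_mul]
  ring

end StableRibbonGraph.Choices

end

/-! ### Transport along isomorphisms of graphs. -/

noncomputable section

variable {A : Type*} [NonUnitalRing A] [Module ℝ A] [FiniteDimensional ℝ A]
  {𝒜 : ZMod 2 → Submodule ℝ A} {F : DGFrobenius 𝒜} [DirectSum.Decomposition 𝒜]

namespace StableRibbonGraph

variable {γ γ' : StableRibbonGraph}

/-- Isomorphisms are only required to respect the partition into edges; the partner of a half-edge
is the other element of its edge. -/
theorem Iso.flip_eq (f : Iso γ γ') (h : γ.H) : γ'.flip (f.onH h) = f.onH (γ.flip h) := by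
  have h1 : γ'.edge (f.onH h) = γ'.edge (f.onH (γ.flip h)) := by
    rw [f.edge_eq, f.edge_eq, γ.edge_flip]
  rcases (γ'.edge_eq_iff _ _).1 h1 with h2 | h2
  · exact absurd (f.onH.injective h2) (γ.flip_ne h)
  · exact h2.symm

/-- The bijection between the half-edges at corresponding vertices. -/
def Iso.fiber (f : Iso γ γ') (v : γ'.V) :
    {h // γ.vert h = f.onV.symm v} ≃ {h // γ'.vert h = v} :=
  f.onH.subtypeEquiv fun h => by rw [f.vert_eq, Equiv.eq_symm_apply]

theorem Iso.surface_eq (f : Iso γ γ') (v : γ'.V) :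
    γ'.surface v = (γ.surface (f.onV.symm v)).relabel (f.fiber v) := by
  refine Surface.ext ?_ ?_ ?_
  · ext h
    obtain ⟨h, rfl⟩ := (f.fiber v).surjective h
    simp only [Surface.relabel, surface, Equiv.permCongr_apply, Equiv.symm_apply_apply]
    exact f.cyc_eq h
  · exact (congrArg γ'.genus (f.onV.apply_symm_apply v).symm).trans (f.genus_eq _)
  · exact (congrArg γ'.free (f.onV.apply_symm_apply v).symm).trans (f.free_eq _)

namespace Choices

variable (c : γ.Choices) (f : Iso γ γ')

/-- The transport of choices along an isomorphism. -/
def map : γ'.Choices where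
  verts := c.verts.map f.onV
  legs v := (c.legs (f.onV.symm v)).map (f.fiber v)
  edges := c.edges.map f.onE
  fst e := f.onH (c.fst (f.onE.symm e))
  edge_fst e := by rw [f.edge_eq, c.edge_fst, Equiv.apply_symm_apply]

theorem map_edgeOrder : (c.map f).edgeOrder = c.edgeOrder.map f.onH := by
  simp only [edgeOrder, map, Enumeration.map, List.flatMap_map, List.map_flatMap,
    Equiv.symm_apply_apply, List.map_cons, List.map_nil, f.flip_eq]

theorem map_vertexOrder : (c.map f).vertexOrder = c.vertexOrder.map f.onH := by
  have h1 : ∀ v, ((c.map f).legs v).list.map Subtype.val =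
      ((c.legs (f.onV.symm v)).list.map Subtype.val).map f.onH := fun v => by
    simp only [map, Enumeration.map, List.map_map]
    rfl
  rw [vertexOrder, vertexOrder, List.flatMap_congr fun v _ => h1 v]
  simp only [map, Enumeration.map, List.flatMap_map, List.map_flatMap]
  exact List.flatMap_congr fun v _ => by rw [Equiv.symm_apply_apply]

theorem map_vertexMap (t : OpenTFT F) (a : γ'.H → A) :
    (c.map f).vertexMap t a = c.vertexMap t (fun h => a (f.onH h)) := by
  rw [vertexMap_apply, vertexMap_apply, ← f.onV.symm.prod_comp]
  refine Finset.prod_congr rfl fun v _ => ?_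
  rw [f.surface_eq]
  exact t.val_relabel (f.fiber v) _ (c.legs (f.onV.symm v)) _ rfl _

theorem map_tensorMap (t : OpenTFT F) (a : γ'.H → A) :
    (c.map f).tensorMap t a = c.tensorMap t (fun h => a (f.onH h)) := by
  rw [tensorMap, tensorMap, signedMap_apply, signedMap_apply,
    ← (f.onH.symm.arrowCongr (Equiv.refl (ZMod 2))).sum_comp]
  refine Finset.sum_congr rfl fun p _ => ?_
  rw [map_vertexMap, map_edgeOrder, map_vertexOrder,
    koszulSign_map _ f.onH.injective _ c.edgeOrder_perm c.nodup_edgeOrder]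
  rfl

theorem map_coef (t : OpenTFT F) (Φ : γ'.E → A →ₗ[ℝ] A) :
    (c.map f).coef t Φ = c.coef t (fun e => Φ (f.onE e)) := by
  rw [coef, coef, edgeSum_apply, edgeSum_apply,
    ← (f.onE.arrowCongr (Equiv.refl (Fin (Module.finrank ℝ A)))).sum_comp]
  refine Finset.sum_congr rfl fun m _ => ?_
  rw [map_tensorMap]
  congr 1
  funext h
  simp only [edgeVec, map, f.edge_eq, Equiv.symm_apply_apply, Equiv.arrowCongr_apply,
    Function.comp_apply, Equiv.refl_apply, f.onH.injective.eq_iff]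

end Choices

end StableRibbonGraph

end

/-! ### Vertex tensors of a contracted graph. -/

noncomputable section

variable {A : Type*} [NonUnitalRing A] [Module ℝ A] [FiniteDimensional ℝ A]
  {𝒜 : ZMod 2 → Submodule ℝ A} {F : DGFrobenius 𝒜} [DirectSum.Decomposition 𝒜]

theorem OpenTFT.val_of_equiv (t : OpenTFT F) {I J : Type} [Fintype I] [Fintype J] (e : I ≃ J)
    {S : Surface I} {T : Surface J} (hc : ∀ x, T.cyc (e x) = e (S.cyc x))
    (hg : T.genus = S.genus) (hf : T.free = S.free) {L : Enumeration I} {L' : Enumeration J}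
    (hL : L'.list = L.list.map e) (a : J → A) : t.val T L' a = t.val S L (fun i => a (e i)) := by
  have : T = S.relabel e := by
    refine Surface.ext ?_ hg hf
    ext x
    obtain ⟨x, rfl⟩ := e.surjective x
    simp [Surface.relabel, Equiv.permCongr_apply, hc]
  rw [this]
  exact t.val_relabel e S L L' hL a

theorem Enumeration.exists_of_injective {I J : Type} {f : J → I} (hf : Function.Injective f)
    {l : List I} (hl : l.Nodup) (h : ∀ x, x ∈ l ↔ x ∈ Set.range f) :
    ∃ K : Enumeration J, K.list.map f = l := by
  have : l ∈ Set.range (List.map f) := by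
    rw [Set.range_list_map]
    exact fun x hx => (h x).1 hx
  obtain ⟨k, rfl⟩ := this
  refine ⟨⟨k, hl.of_map f, fun j => ?_⟩, rfl⟩
  obtain ⟨i, hi, hij⟩ := List.mem_map.1 ((h (f j)).2 ⟨j, rfl⟩)
  rwa [← hf hij]

/-- A duplicate-free list followed by the elements not on it. -/
theorem Enumeration.exists_prepend {I : Type} [Fintype I] {l : List I} (hl : l.Nodup) :
    ∃ (L : Enumeration I) (m : List I), L.list = l ++ m := by
  obtain ⟨L, m, h, -⟩ := Enumeration.exists_append hl
  have hp : (l ++ m).Perm L.list := h ▸ List.perm_append_comm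
  exact ⟨⟨l ++ m, hp.nodup_iff.2 L.nodup, fun i => hp.mem_iff.2 (L.complete i)⟩, m, rfl⟩

namespace StableRibbonGraph

variable {γ : StableRibbonGraph} (h : γ.H)

theorem contract_vert_away {w : (γ.contract h).V} (hw : w.1 ≠ γ.vert h)
    (x : (γ.contract h).H) : (γ.contract h).vert x = w ↔ γ.vert x.1 = w.1 := by
  have h2 : w.1 ≠ γ.vert (γ.flip h) := w.2.resolve_left hw
  refine (γ.contractVert_eq_iff h _ _).trans ?_
  split_ifs with hx
  · rw [hx]
    exact iff_of_false hw.symm h2.symm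
  · rfl

theorem contract_vert_merged {w : (γ.contract h).V} (hw : w.1 = γ.vert h)
    (x : (γ.contract h).H) : (γ.contract h).vert x = w ↔
      γ.vert x.1 = γ.vert h ∨ γ.vert x.1 = γ.vert (γ.flip h) := by
  refine (γ.contractVert_eq_iff h _ _).trans ?_
  rw [hw]
  split_ifs with hx
  · simp [hx]
  · simp [hx]

theorem contract_cyc_val (x : (γ.contract h).H) {y : γ.H} (hy : x.1 = y) :
    ((γ.contract h).cyc x).1 =
      if γ.cyc y = h then (if γ.cyc (γ.flip h) = γ.flip h then γ.cyc h else γ.cyc (γ.flip h))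
      else if γ.cyc y = γ.flip h then (if γ.cyc h = h then γ.cyc (γ.flip h) else γ.cyc h)
      else γ.cyc y := by
  subst hy
  exact gluePerm_val γ.cyc (γ.flip_ne h).symm x

/-- The boundary walk at a vertex that the edge does not meet never reaches either end of the edge,
so its surface is unchanged. -/
theorem val_contract_away (t : OpenTFT F) {w : (γ.contract h).V} (hw : w.1 ≠ γ.vert h)
    {L : Enumeration {x : (γ.contract h).H // (γ.contract h).vert x = w}}
    {K : Enumeration {x : γ.H // γ.vert x = w.1}}
    (hL : L.list.map (fun x => x.1.1) = K.list.map Subtype.val) (a : γ.H → A) :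
    t.val ((γ.contract h).surface w) L (fun x => a x.1.1) =
      t.val (γ.surface w.1) K (fun x => a x.1) := by
  have h2 : w.1 ≠ γ.vert (γ.flip h) := w.2.resolve_left hw
  let e : {x : γ.H // γ.vert x = w.1} ≃
      {x : (γ.contract h).H // (γ.contract h).vert x = w} :=
    { toFun x := ⟨⟨x.1, fun hc => hw (by rw [← x.2, hc]), fun hc => h2 (by rw [← x.2, hc])⟩,
        (contract_vert_away h hw _).2 x.2⟩
      invFun x := ⟨x.1.1, (contract_vert_away h hw _).1 x.2⟩
      left_inv x := rfl
      right_inv x := rfl }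
  refine t.val_of_equiv e (fun x => ?_) (if_neg hw) (if_neg hw) ?_ _
  · have hx := x.2
    have a1 : γ.cyc x.1 ≠ h := fun hc => hw (by rw [← hx, ← γ.vert_cyc, hc])
    have a2 : γ.cyc x.1 ≠ γ.flip h := fun hc => h2 (by rw [← hx, ← γ.vert_cyc, hc])
    apply Subtype.ext
    apply Subtype.ext
    refine (contract_cyc_val h (e x).1 (y := x.1) rfl).trans ?_
    rw [if_neg a1, if_neg a2]
    rfl
  · refine (List.map_injective_iff (f := fun x :
      {x : (γ.contract h).H // (γ.contract h).vert x = w} => x.1.1)).2 (fun x y hxy => ?_) ?_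
    · exact Subtype.ext (Subtype.ext hxy)
    · rw [hL, List.map_map]
      rfl

/-- The surface at the vertex of the loop is the self-gluing of the original one, up to the
identification `e` of half-edges. The order in `hL` is the one required by `val_selfGlue`. -/
theorem val_contract_loop (t : OpenTFT F) (hl : γ.IsLoop h) {w : (γ.contract h).V}
    (hw : w.1 = γ.vert h)
    {L : Enumeration {x : (γ.contract h).H // (γ.contract h).vert x = w}}
    {K : Enumeration {x : γ.H // γ.vert x = γ.vert h}}
    (hL : K.list.map Subtype.val = h :: γ.flip h :: L.list.map (fun x => x.1.1))
    (a : {x // x ≠ h ∧ x ≠ γ.flip h} → A) :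
    t.val ((γ.contract h).surface w) L (fun x => a x.1) =
      ∑ j, t.val (γ.surface (γ.vert h)) K
        (fun x => insertTwo h (γ.flip h) a (F.basis j) (F.dual j) x.1) := by
  have hne := (γ.flip_ne h).symm
  set b : {x // γ.vert x = γ.vert h} := ⟨h, rfl⟩ with hb
  set b' : {x // γ.vert x = γ.vert h} := ⟨γ.flip h, hl.symm⟩ with hb'
  have hbb : b ≠ b' := fun hc => hne (congrArg Subtype.val hc)
  have hP : ∀ x : (γ.contract h).H, (γ.contract h).vert x = w ↔ γ.vert x.1 = γ.vert h := fun x => by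
    rw [contract_vert_merged h hw, ← show γ.vert h = γ.vert (γ.flip h) from hl, or_self]
  let e : {x : {x // γ.vert x = γ.vert h} // x ≠ b ∧ x ≠ b'} ≃
      {x : (γ.contract h).H // (γ.contract h).vert x = w} :=
    { toFun := fun x => ⟨⟨x.1.1, fun hc => x.2.1 (Subtype.ext hc),
        fun hc => x.2.2 (Subtype.ext hc)⟩, (hP _).2 x.1.2⟩
      invFun := fun x => ⟨⟨x.1.1, (hP _).1 x.2⟩,
        fun hc => x.1.2.1 (congrArg Subtype.val hc), fun hc => x.1.2.2 (congrArg Subtype.val hc)⟩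
      left_inv := fun x => rfl
      right_inv := fun x => rfl }
  have e1 : (γ.surface (γ.vert h)).cyc.SameCycle b b' ↔ γ.cyc.SameCycle h (γ.flip h) :=
    Perm.sameCycle_subtypePerm (h := fun x => by rw [γ.vert_cyc])
  have e2 : glueFree (γ.surface (γ.vert h)).cyc b b' = glueFree γ.cyc h (γ.flip h) := by
    simp [glueFree, surface, b, b', Subtype.ext_iff]
  have key := t.val_of_equiv e (S := (γ.surface (γ.vert h)).selfGlue b b' hbb)
    (T := (γ.contract h).surface w) (L := L.map e.symm) (L' := L) ?_ ?_ ?_ ?_ (fun x => a x.1)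
  · rw [key, t.val_selfGlue (γ.surface (γ.vert h)) b b' hbb _ K]
    · refine Finset.sum_congr rfl fun j _ => ?_
      congr 1
      funext x
      by_cases hx : x ≠ b ∧ x ≠ b'
      · rw [dif_pos hx]
        exact (insertTwo_val a (F.basis j) (F.dual j) (e ⟨x, hx⟩).1).symm
      · rw [dif_neg hx]
        by_cases hxb : x = b
        · rw [hxb, if_pos rfl]
          simp [b]
        · have : x = b' := by tauto
          rw [this, if_neg hbb.symm]
          exact (insertTwo_right a (F.basis j) (F.dual j) hne).symm
    · refine List.map_injective_iff.2 Subtype.val_injective ?_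
      rw [hL]
      simp only [Enumeration.map, List.map_cons, List.map_map]
      rfl
  · rintro x
    apply Subtype.ext
    apply Subtype.ext
    refine (contract_cyc_val h (e x).1 (y := x.1.1) rfl).trans ?_
    change _ = (gluePerm (γ.surface (γ.vert h)).cyc b b' x).1.1
    rw [gluePerm_val _ hbb]
    simp only [surface, Perm.subtypePerm_apply, Subtype.ext_iff, b, b']
    split_ifs <;> rfl
  · change (if w.1 = γ.vert h then _ else _) =
      ((γ.surface (γ.vert h)).selfGlue b b' hbb).genus
    rw [if_pos hw, if_pos hl]
    by_cases hs : γ.cyc.SameCycle h (γ.flip h)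
    · rw [if_pos hs]
      exact (if_pos (e1.2 hs)).symm
    · rw [if_neg hs]
      exact (if_neg fun hc => hs (e1.1 hc)).symm
  · change (if w.1 = γ.vert h then _ else _) = _ + glueFree _ _ _
    rw [if_pos hw, if_pos hl, e2]
    rfl
  · simp [Enumeration.map]

/-- The merged surface is the gluing of the surfaces at the two ends, up to the identification `e`.
The orders are those of `val_join`: `h` last on one side, its partner first on the other. -/
theorem val_contract_join (t : OpenTFT F) (hl : ¬ γ.IsLoop h) {w : (γ.contract h).V}
    (hw : w.1 = γ.vert h)
    {L : Enumeration {x : (γ.contract h).H // (γ.contract h).vert x = w}}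
    {K : Enumeration {x : γ.H // γ.vert x = γ.vert h}}
    {K' : Enumeration {x : γ.H // γ.vert x = γ.vert (γ.flip h)}}
    {l : List {x : γ.H // γ.vert x = γ.vert h}}
    {l' : List {x : γ.H // γ.vert x = γ.vert (γ.flip h)}}
    (hK : K.list = l ++ [⟨h, rfl⟩]) (hK' : K'.list = ⟨γ.flip h, rfl⟩ :: l')
    (hL : L.list.map (fun x => x.1.1) = l.map Subtype.val ++ l'.map Subtype.val)
    (a : {x // x ≠ h ∧ x ≠ γ.flip h} → A) :
    t.val ((γ.contract h).surface w) L (fun x => a x.1) =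
      ∑ j, t.val (γ.surface (γ.vert h)) K
          (fun x => insertTwo h (γ.flip h) a (F.basis j) (F.dual j) x.1) *
        t.val (γ.surface (γ.vert (γ.flip h))) K'
          (fun x => insertTwo h (γ.flip h) a (F.basis j) (F.dual j) x.1) := by
  have hne := (γ.flip_ne h).symm
  set b : {x // γ.vert x = γ.vert h} := ⟨h, rfl⟩ with hb
  set b' : {x // γ.vert x = γ.vert (γ.flip h)} := ⟨γ.flip h, rfl⟩ with hb'
  have hout : ∀ x, γ.vert x = γ.vert h → γ.vert x ≠ γ.vert (γ.flip h) := fun x h1 h2 =>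
    hl (h1.symm.trans h2)
  have hinj : Function.Injective (Sum.elim Subtype.val Subtype.val :
      {x // γ.vert x = γ.vert h} ⊕ {x // γ.vert x = γ.vert (γ.flip h)} → γ.H) := by
    rintro (x | x) (y | y) hxy
    · exact congrArg Sum.inl (Subtype.ext hxy)
    · exact absurd y.2 (hout _ ((show x.1 = y.1 from hxy) ▸ x.2))
    · exact absurd x.2 (hout _ ((show x.1 = y.1 from hxy) ▸ y.2))
    · exact congrArg Sum.inr (Subtype.ext hxy)
  let f : {x : {x // γ.vert x = γ.vert h} ⊕ {x // γ.vert x = γ.vert (γ.flip h)} //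
      x ≠ Sum.inl b ∧ x ≠ Sum.inr b'} →
      {x : (γ.contract h).H // (γ.contract h).vert x = w} := fun x =>
    ⟨⟨Sum.elim Subtype.val Subtype.val x.1, fun hc => x.2.1 (hinj hc), fun hc => x.2.2 (hinj hc)⟩,
      (contract_vert_merged h hw _).2 (by
        rcases x with ⟨x | x, hx⟩
        · exact Or.inl x.2
        · exact Or.inr x.2)⟩
  have hf : Function.Bijective f := by
    constructor
    · intro x y hxy
      exact Subtype.ext (hinj (congrArg (fun x => x.1.1) hxy))
    · rintro ⟨⟨x, hx⟩, hx'⟩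
      rcases (contract_vert_merged h hw _).1 hx' with h3 | h3
      · exact ⟨⟨Sum.inl ⟨x, h3⟩, fun hc => hx.1 (congrArg Subtype.val (Sum.inl_injective hc)),
          Sum.inl_ne_inr⟩, rfl⟩
      · exact ⟨⟨Sum.inr ⟨x, h3⟩, Sum.inr_ne_inl,
          fun hc => hx.2 (congrArg Subtype.val (Sum.inr_injective hc))⟩, rfl⟩
  let e := Equiv.ofBijective f hf
  have e2 : glueFree (Perm.sumCongr (γ.surface (γ.vert h)).cyc (γ.surface (γ.vert (γ.flip h))).cyc)
      (Sum.inl b) (Sum.inr b') = glueFree γ.cyc h (γ.flip h) := by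
    have a1 : γ.cyc h ≠ γ.flip h := fun hc => hl (by rw [IsLoop, ← hc, γ.vert_cyc])
    have a2 : γ.cyc (γ.flip h) ≠ h := fun hc => hl (by
      have := γ.vert_cyc (γ.flip h); rw [hc] at this; exact this)
    simp [glueFree, surface, b, b', Subtype.ext_iff, a1, a2]
  have key := t.val_of_equiv e
    (S := (γ.surface (γ.vert h)).join (γ.surface (γ.vert (γ.flip h))) b b')
    (T := (γ.contract h).surface w) (L := L.map e.symm) (L' := L) ?_ ?_ ?_ ?_ (fun x => a x.1)
  · rw [key, t.val_join _ _ b b' l l' K K' _ hK hK']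
    · refine Finset.sum_congr rfl fun j _ => ?_
      congr 2
      · funext x
        by_cases hx : x = b
        · rw [dif_pos hx, hx]
          simp [b]
        · rw [dif_neg hx]
          exact (insertTwo_val a (F.basis j) (F.dual j) (e ⟨Sum.inl x,
            fun hc => hx (Sum.inl_injective hc), Sum.inl_ne_inr⟩).1).symm
      · funext x
        by_cases hx : x = b'
        · rw [dif_pos hx, hx]
          exact (insertTwo_right a (F.basis j) (F.dual j) hne).symm
        · rw [dif_neg hx]
          exact (insertTwo_val a (F.basis j) (F.dual j) (e ⟨Sum.inr x, Sum.inr_ne_inl,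
            fun hc => hx (Sum.inr_injective hc)⟩).1).symm
    · refine List.map_injective_iff.2 hinj ?_
      simp only [List.map_append, List.map_map]
      refine Eq.trans ?_ hL
      simp only [Enumeration.map, List.map_map]
      refine List.map_congr_left fun x _ => ?_
      exact congrArg (fun x => x.1.1) (e.apply_symm_apply x)
  · rintro ⟨x, hx⟩
    apply Subtype.ext
    apply Subtype.ext
    refine (contract_cyc_val h (f ⟨x, hx⟩).1
      (y := Sum.elim Subtype.val Subtype.val x) rfl).trans ?_
    change _ = Sum.elim Subtype.val Subtype.val
      (gluePerm (Perm.sumCongr (γ.surface (γ.vert h)).cyc (γ.surface (γ.vert (γ.flip h))).cyc)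
        (Sum.inl b) (Sum.inr b') ⟨x, hx⟩).1
    rw [gluePerm_val _ Sum.inl_ne_inr]
    rcases x with x | x
    · have b1 : γ.cyc x.1 ≠ γ.flip h := fun hc => hout _ x.2 (by rw [← hc, γ.vert_cyc])
      simp only [b, b', surface, Perm.sumCongr_apply, Sum.map_inl, Sum.map_inr, Sum.elim_inl,
        Sum.inl.injEq, Sum.inr.injEq, reduceCtorEq, if_false, Subtype.ext_iff,
        Perm.subtypePerm_apply, b1]
      split_ifs <;> simp
    · have b1 : γ.cyc x.1 ≠ h := fun hc => hout h rfl (by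
        have := γ.vert_cyc x.1; rw [hc] at this; exact this.trans x.2)
      simp only [b, b', surface, Perm.sumCongr_apply, Sum.map_inl, Sum.map_inr, Sum.elim_inr,
        Sum.inl.injEq, Sum.inr.injEq, reduceCtorEq, if_false, Subtype.ext_iff,
        Perm.subtypePerm_apply, b1]
      by_cases k1 : γ.cyc x.1 = γ.flip h <;> by_cases k2 : γ.cyc h = h <;> simp [k1, k2]
  · change (if w.1 = γ.vert h then _ else _) = _
    rw [if_pos hw, if_neg hl]
    rfl
  · change (if w.1 = γ.vert h then _ else _) = _ + _ + glueFree _ _ _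
    rw [if_pos hw, if_neg hl, e2]
    rfl
  · simp [Enumeration.map]

end StableRibbonGraph

end

/-! ### Orders of half-edges adapted to a contraction. -/

noncomputable section

variable {A : Type*} [NonUnitalRing A] [Module ℝ A] [FiniteDimensional ℝ A]
  {𝒜 : ZMod 2 → Submodule ℝ A} {F : DGFrobenius 𝒜} [DirectSum.Decomposition 𝒜]

namespace StableRibbonGraph

variable {γ : StableRibbonGraph} {h : γ.H}

/-- Choices with given orders of the vertices and of the half-edges at them. -/
def Choices.ofOrders (verts : Enumeration γ.V) (legs : ∀ v, Enumeration {h // γ.vert h = v}) :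
    γ.Choices where
  verts := verts
  legs := legs
  edges := (Enumeration.nonempty γ.E).some
  fst e := (γ.edge_surjective e).choose
  edge_fst e := (γ.edge_surjective e).choose_spec

theorem nonempty_choices (γ : StableRibbonGraph) : Nonempty γ.Choices :=
  ⟨Choices.ofOrders (Enumeration.nonempty _).some fun _ => (Enumeration.nonempty _).some⟩

section

variable (h)

/-- The half-edges of a contraction as half-edges of the graph. -/
def halfEdgeVal : (γ.contract h).H → γ.H := Subtype.val

/-- The vertices of a contraction as vertices of the graph. -/
def vertVal : (γ.contract h).V → γ.V := Subtype.val

/-- The edges of a contraction as edges of the graph. -/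
def edgeVal : (γ.contract h).E → γ.E := Subtype.val

theorem halfEdgeVal_injective : Function.Injective (halfEdgeVal h) := Subtype.val_injective

theorem vertVal_injective : Function.Injective (vertVal h) := Subtype.val_injective

theorem edgeVal_injective : Function.Injective (edgeVal h) := Subtype.val_injective

/-- Inserting elements at the two half-edges of the contracted edge. -/
def insertEdge {α : Type*} (a : (γ.contract h).H → α) (x y : α) : γ.H → α :=
  insertTwo h (γ.flip h) a x y

@[simp] theorem insertEdge_val {α : Type*} (a : (γ.contract h).H → α) (x y : α)
    (z : (γ.contract h).H) : insertEdge h a x y (halfEdgeVal h z) = a z :=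
  insertTwo_val a x y z

end

/-- The list `L₀` orders the half-edges that remain at the merged vertex; at every other vertex the
order of the original graph is kept. -/
theorem exists_contract_legs (legs : ∀ v, Enumeration {x // γ.vert x = v}) (L₀ : List γ.H)
    (hn : L₀.Nodup) (hL₀ : ∀ x, x ∈ L₀ ↔ (x ≠ h ∧ x ≠ γ.flip h) ∧
      (γ.vert x = γ.vert h ∨ γ.vert x = γ.vert (γ.flip h))) (w : (γ.contract h).V) :
    ∃ K : Enumeration {x : (γ.contract h).H // (γ.contract h).vert x = w},
      K.list.map (fun x => halfEdgeVal h x.1) =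
        if vertVal h w = γ.vert h then L₀ else (legs (vertVal h w)).list.map Subtype.val := by
  refine Enumeration.exists_of_injective (fun x y hxy => Subtype.ext (Subtype.ext hxy)) ?_
    fun x => ?_
  · split_ifs
    · exact hn
    · exact (legs w.1).nodup.map Subtype.val_injective
  · split_ifs with hw
    · rw [hL₀]
      constructor
      · rintro ⟨h1, h2⟩
        exact ⟨⟨⟨x, h1⟩, (contract_vert_merged h hw _).2 h2⟩, rfl⟩
      · rintro ⟨y, rfl⟩
        exact ⟨y.1.2, (contract_vert_merged h hw _).1 y.2⟩
    · have h2 : vertVal h w ≠ γ.vert (γ.flip h) := w.2.resolve_left hw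
      constructor
      · intro hx
        obtain ⟨y, -, rfl⟩ := List.mem_map.1 hx
        exact ⟨⟨⟨y.1, fun hc => hw (by rw [← y.2, hc]), fun hc => h2 (by rw [← y.2, hc])⟩,
          (contract_vert_away h hw _).2 y.2⟩, rfl⟩
      · rintro ⟨y, rfl⟩
        exact List.mem_map.2 ⟨⟨y.1.1, (contract_vert_away h hw _).1 y.2⟩,
          (legs w.1).complete _, rfl⟩

/-- The vertices of a contraction that are not affected by it. -/
theorem contract_vertices (t : OpenTFT F) (legs' : ∀ v, Enumeration {x // γ.vert x = v})
    {verts : Enumeration (γ.contract h).V} {rest : List γ.V}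
    (hv : verts.list.map (vertVal h) = γ.vert h :: rest)
    {legs : ∀ w, Enumeration {x // (γ.contract h).vert x = w}} {L₀ : List γ.H}
    (hlegs : ∀ w, (legs w).list.map (fun x => halfEdgeVal h x.1) =
      if vertVal h w = γ.vert h then L₀ else (legs' (vertVal h w)).list.map Subtype.val) :
    ∃ (w₀ : (γ.contract h).V) (R : ((γ.contract h).H → A) → ℝ), vertVal h w₀ = γ.vert h ∧
      (verts.list.flatMap fun w => (legs w).list.map Subtype.val).map (halfEdgeVal h) =
        L₀ ++ rest.flatMap (fun v => (legs' v).list.map Subtype.val) ∧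
      (∀ a, ∏ w, t.val ((γ.contract h).surface w) (legs w) (fun x => a x.1) =
        t.val ((γ.contract h).surface w₀) (legs w₀) (fun x => a x.1) * R a) ∧
      ∀ a (a' : γ.H → A), (∀ x, a' (halfEdgeVal h x) = a x) →
        (rest.map fun v => t.val (γ.surface v) (legs' v) fun x => a' x.1).prod = R a := by
  have hn : (γ.vert h :: rest).Nodup := hv ▸ verts.nodup.map (vertVal_injective h)
  obtain ⟨w₀, rest₀, hl⟩ := List.exists_cons_of_ne_nil (l := verts.list) (by
    intro hc; rw [hc] at hv; exact List.cons_ne_nil _ _ hv.symm)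
  rw [hl] at hv
  obtain ⟨hw₀, rfl⟩ : vertVal h w₀ = γ.vert h ∧ rest₀.map (vertVal h) = rest := List.cons.inj hv
  have hne : ∀ w ∈ rest₀, vertVal h w ≠ γ.vert h := fun w hw hc =>
    (List.nodup_cons.1 hn).1 (by simpa [hc] using List.mem_map_of_mem (f := vertVal h) hw)
  refine ⟨w₀, fun a => (rest₀.map fun w => t.val ((γ.contract h).surface w) (legs w)
    (fun x => a x.1)).prod, hw₀, ?_, fun a => ?_, fun a a' ha => ?_⟩
  · rw [hl, List.map_flatMap, List.flatMap_cons]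
    simp only [List.map_map]
    congr 1
    · exact (hlegs w₀).trans (if_pos hw₀)
    · rw [List.flatMap_map]
      exact List.flatMap_congr fun w hw => (hlegs w).trans (if_neg (hne w hw))
  · rw [← verts.prod_eq, hl, List.map_cons, List.prod_cons]
  · rw [List.map_map]
    congr 1
    refine List.map_congr_left fun w hw => Eq.symm (Eq.trans ?_ (val_contract_away h t (hne w hw)
      ((hlegs w).trans (if_neg (hne w hw))) a'))
    exact congrArg _ (funext fun x => (ha x.1).symm)

variable (h)

/-- Orders of the vertices and half-edges that are adapted to the contraction of an edge. -/
theorem exists_contract_orders (t : OpenTFT F) :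
    ∃ (verts : Enumeration (γ.contract h).V)
      (legs : ∀ w, Enumeration {x // (γ.contract h).vert x = w})
      (verts' : Enumeration γ.V) (legs' : ∀ v, Enumeration {x // γ.vert x = v}),
      (∀ p : γ.H → ZMod 2, p h = p (γ.flip h) →
        koszulSign p (h :: γ.flip h ::
          (verts.list.flatMap fun w => (legs w).list.map Subtype.val).map (halfEdgeVal h))
          (verts'.list.flatMap fun v => (legs' v).list.map Subtype.val) = 1) ∧
      ∀ a : (γ.contract h).H → A,
        ∑ j, ∏ v, t.val (γ.surface v) (legs' v)
          (fun x => insertEdge h a (F.basis j) (F.dual j) x.1) =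
        ∏ w, t.val ((γ.contract h).surface w) (legs w) (fun x => a x.1) := by
  have hne := (γ.flip_ne h).symm
  -- For a loop, its vertex is put first and the two ends first among the half-edges there. The two
  -- orders compared by the sign are then identical.
  by_cases hl : γ.IsLoop h
  · have hl' : γ.vert h = γ.vert (γ.flip h) := hl
    obtain ⟨verts', rest, hv'⟩ := Enumeration.exists_prepend (List.nodup_singleton (γ.vert h))
    replace hv' : verts'.list = γ.vert h :: rest := hv'
    obtain ⟨verts, hv⟩ : ∃ K : Enumeration (γ.contract h).V,
        K.list.map (vertVal h) = γ.vert h :: rest := by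
      refine Enumeration.exists_of_injective (vertVal_injective h) (hv' ▸ verts'.nodup) fun x => ?_
      refine iff_of_true (by have := verts'.complete x; rwa [hv'] at this) ⟨⟨x, ?_⟩, rfl⟩
      rw [← hl']
      exact em _
    have h1 : ∀ v, ∃ K : Enumeration {x // γ.vert x = v}, ∃ L₀ : List γ.H, v = γ.vert h →
        K.list.map Subtype.val = h :: γ.flip h :: L₀ := by
      intro v
      by_cases hv : v = γ.vert h
      · subst hv
        obtain ⟨K, m, hK⟩ := Enumeration.exists_prepend (I := {x // γ.vert x = γ.vert h})
          (l := [⟨h, rfl⟩, ⟨γ.flip h, hl'.symm⟩]) (by simpa using hne)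
        exact ⟨K, m.map Subtype.val, fun _ => by rw [hK]; rfl⟩
      · exact ⟨(Enumeration.nonempty _).some, [], fun hc => absurd hc hv⟩
    choose legs' L hL using h1
    have hn : (h :: γ.flip h :: L (γ.vert h)).Nodup :=
      hL _ rfl ▸ (legs' _).nodup.map Subtype.val_injective
    rw [List.nodup_cons, List.nodup_cons, List.mem_cons, not_or] at hn
    choose legs hlegs using exists_contract_legs (h := h) legs' (L (γ.vert h)) hn.2.2 (fun x => by
      have hm : x ∈ h :: γ.flip h :: L (γ.vert h) ↔ γ.vert x = γ.vert h := by
        rw [← hL _ rfl, List.mem_map]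
        constructor
        · rintro ⟨y, -, rfl⟩; exact y.2
        · intro hx; exact ⟨⟨x, hx⟩, (legs' _).complete _, rfl⟩
      rw [← hl', or_self, ← hm, List.mem_cons, List.mem_cons]
      constructor
      · intro hx
        exact ⟨⟨fun hc => hn.1.2 (hc ▸ hx), fun hc => hn.2.1 (hc ▸ hx)⟩, Or.inr (Or.inr hx)⟩
      · rintro ⟨⟨h1, h2⟩, h3⟩
        exact (h3.resolve_left h1).resolve_left h2)
    obtain ⟨w₀, R, hw₀, h3, h4, h6⟩ := contract_vertices t legs' hv hlegs
    refine ⟨verts, legs, verts', legs', fun p _ => ?_, fun a => ?_⟩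
    · rw [h3, hv', List.flatMap_cons, hL _ rfl]
      exact koszulSign_self _ _
    · have h5 := val_contract_loop h t hl hw₀ (L := legs w₀) (K := legs' (γ.vert h))
        ((hL _ rfl).trans (congrArg (fun l => h :: γ.flip h :: l)
          ((hlegs w₀).trans (if_pos hw₀)).symm)) a
      refine Eq.trans ?_ ((congrArg (· * R a) h5).symm.trans ?_)
      · rw [Finset.sum_mul]
        refine Finset.sum_congr rfl fun j _ => ?_
        rw [← verts'.prod_eq, hv', List.map_cons, List.prod_cons,
          h6 a _ fun x => insertEdge_val h a (F.basis j) (F.dual j) x]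
        rfl
      · exact (h4 a).symm
  -- For an edge with different end vertices these come first, with `h` at the end of the one and
  -- its partner at the beginning of the other, so that the two ends are adjacent.
  · obtain ⟨verts', rest, hv'⟩ := Enumeration.exists_prepend
      (l := [γ.vert h, γ.vert (γ.flip h)]) (by simpa using show γ.vert h ≠ γ.vert (γ.flip h) from hl)
    replace hv' : verts'.list = γ.vert h :: γ.vert (γ.flip h) :: rest := hv'
    have hvn := verts'.nodup
    rw [hv', List.nodup_cons, List.nodup_cons, List.mem_cons, not_or] at hvn
    obtain ⟨verts, hv⟩ : ∃ K : Enumeration (γ.contract h).V,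
        K.list.map (vertVal h) = γ.vert h :: rest := by
      refine Enumeration.exists_of_injective (vertVal_injective h)
        (List.nodup_cons.2 ⟨hvn.1.2, hvn.2.2⟩) fun x => ?_
      have hx := verts'.complete x
      rw [hv', List.mem_cons, List.mem_cons] at hx
      rw [List.mem_cons]
      constructor
      · rintro (rfl | h1)
        · exact ⟨⟨_, Or.inl rfl⟩, rfl⟩
        · exact ⟨⟨x, Or.inr fun hc => hvn.2.1 (hc ▸ h1)⟩, rfl⟩
      · rintro ⟨w, rfl⟩
        rcases w.2 with h1 | h1
        · exact Or.inl h1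
        · exact hx.imp_right fun h2 => h2.resolve_left h1
    have h1 : ∀ v, ∃ K : Enumeration {x // γ.vert x = v}, ∃ l : List {x // γ.vert x = v},
        (∀ e : γ.vert h = v, K.list = l ++ [⟨h, e⟩]) ∧
        (∀ e : γ.vert (γ.flip h) = v, K.list = ⟨γ.flip h, e⟩ :: l) := by
      intro v
      by_cases hv : γ.vert h = v
      · obtain ⟨K, m, hK, -⟩ := Enumeration.exists_append (I := {x // γ.vert x = v})
          (l := [⟨h, hv⟩]) (List.nodup_singleton _)
        exact ⟨K, m, fun _ => hK, fun hc => absurd (hv.trans hc.symm) hl⟩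
      by_cases hv' : γ.vert (γ.flip h) = v
      · obtain ⟨K, m, hK⟩ := Enumeration.exists_prepend (I := {x // γ.vert x = v})
          (l := [⟨γ.flip h, hv'⟩]) (List.nodup_singleton _)
        exact ⟨K, m, fun hc => absurd hc hv, fun _ => hK⟩
      · exact ⟨(Enumeration.nonempty _).some, [], fun hc => absurd hc hv, fun hc => absurd hc hv'⟩
    choose legs' L hL hL' using h1
    replace hL := hL _ rfl
    replace hL' := hL' _ rfl
    set l := L (γ.vert h) with hldef
    set l' := L (γ.vert (γ.flip h)) with hldef'
    have hm : ∀ x, x ∈ (l.map Subtype.val ++ [h]) ↔ γ.vert x = γ.vert h := fun x => by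
      have : l.map Subtype.val ++ [h] = (legs' (γ.vert h)).list.map Subtype.val := by
        rw [hL, List.map_append]; rfl
      rw [this, List.mem_map]
      constructor
      · rintro ⟨y, -, rfl⟩; exact y.2
      · intro hx; exact ⟨⟨x, hx⟩, (legs' _).complete _, rfl⟩
    have hm' : ∀ x, x ∈ γ.flip h :: l'.map Subtype.val ↔ γ.vert x = γ.vert (γ.flip h) := fun x => by
      have : γ.flip h :: l'.map Subtype.val = (legs' (γ.vert (γ.flip h))).list.map Subtype.val := by
        rw [hL', List.map_cons]
      rw [this, List.mem_map]
      constructor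
      · rintro ⟨y, -, rfl⟩; exact y.2
      · intro hx; exact ⟨⟨x, hx⟩, (legs' _).complete _, rfl⟩
    have hn1 : (l.map Subtype.val ++ [h]).Nodup := by
      have := (legs' (γ.vert h)).nodup.map Subtype.val_injective
      rwa [hL, List.map_append] at this
    have hn2 : (γ.flip h :: l'.map Subtype.val).Nodup := by
      have := (legs' (γ.vert (γ.flip h))).nodup.map Subtype.val_injective
      rwa [hL', List.map_cons] at this
    rw [List.nodup_append] at hn1
    rw [List.nodup_cons] at hn2
    have hdisj : ∀ x ∈ l.map Subtype.val, ∀ y ∈ l'.map Subtype.val, x ≠ y := by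
      rintro x hx y hy rfl
      exact hl (((hm x).1 (List.mem_append_left _ hx)).symm.trans
        ((hm' x).1 (List.mem_cons_of_mem _ hy)))
    choose legs hlegs using exists_contract_legs (h := h) legs'
      (l.map Subtype.val ++ l'.map Subtype.val)
      (List.nodup_append.2 ⟨hn1.1, hn2.2, hdisj⟩) (fun x => by
      rw [← hm, ← hm', List.mem_append, List.mem_append, List.mem_singleton, List.mem_cons]
      constructor
      · rintro (hx | hx)
        · refine ⟨⟨fun hc => hn1.2.2 _ hx _ (List.mem_singleton_self h) hc, fun hc => hl ?_⟩,
            Or.inl (Or.inl hx)⟩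
          have := (hm x).1 (List.mem_append_left _ hx)
          rw [hc] at this
          exact this.symm
        · refine ⟨⟨fun hc => hl ?_, fun hc => hn2.1 (hc ▸ hx)⟩, Or.inr (Or.inr hx)⟩
          have := (hm' x).1 (List.mem_cons_of_mem _ hx)
          rwa [hc] at this
      · rintro ⟨⟨h1, h2⟩, (h3 | h3) | h3 | h3⟩
        · exact Or.inl h3
        · exact absurd h3 h1
        · exact absurd h3 h2
        · exact Or.inr h3)
    obtain ⟨w₀, R, hw₀, h3, h4, h6⟩ := contract_vertices t legs' hv hlegs
    refine ⟨verts, legs, verts', legs', fun p hp => ?_, fun a => ?_⟩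
    · rw [h3, hv', List.flatMap_cons, List.flatMap_cons, hL, hL', List.map_append, List.map_cons]
      set R' := rest.flatMap fun v => (legs' v).list.map Subtype.val with hR'
      have hnd := (Choices.ofOrders verts' legs').nodup_vertexOrder
      have e1 : (Choices.ofOrders verts' legs').vertexOrder =
          l.map Subtype.val ++ [h, γ.flip h] ++ (l'.map Subtype.val ++ R') := by
        change verts'.list.flatMap _ = _
        rw [hv', List.flatMap_cons, List.flatMap_cons]
        simp [Choices.ofOrders, hL, hL', hR']
      rw [e1] at hnd
      -- The two ends have equal parity and thus form an even block, which passes the half-edges in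
      -- front of it without a sign.
      have := koszulSign_swap_blocks p [h, γ.flip h] (l.map Subtype.val) (l'.map Subtype.val ++ R')
        ((List.perm_append_comm.append_right _).nodup_iff.1 hnd)
      rw [show wordParity p [h, γ.flip h] = 0 by simp [hp, CharTwo.add_self_eq_zero],
        swapSign_zero_left] at this
      simpa using this
    · have h5 := val_contract_join h t hl hw₀ (L := legs w₀) hL hL'
        ((hlegs w₀).trans (if_pos hw₀)) a
      refine Eq.trans ?_ ((congrArg (· * R a) h5).symm.trans (h4 a).symm)
      rw [Finset.sum_mul]
      refine Finset.sum_congr rfl fun j _ => ?_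
      rw [← verts'.prod_eq, hv', List.map_cons, List.prod_cons, List.map_cons, List.prod_cons,
        h6 a _ fun x => insertEdge_val h a (F.basis j) (F.dual j) x, mul_assoc]
      rfl

end StableRibbonGraph

end

/-! ### Contraction of an edge with the identity operator. -/

noncomputable section

variable {A : Type*} [NonUnitalRing A] [Module ℝ A] [FiniteDimensional ℝ A]
  {𝒜 : ZMod 2 → Submodule ℝ A} {F : DGFrobenius 𝒜} [DirectSum.Decomposition 𝒜]

theorem Fintype.sum_instance_irrel {X M : Type*} [AddCommMonoid M] (i j : Fintype X) (f : X → M) :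
    @Finset.sum X M _ (@Finset.univ X i) f = @Finset.sum X M _ (@Finset.univ X j) f := by
  rw [Subsingleton.elim i j]

namespace StableRibbonGraph.Choices

variable {γ : StableRibbonGraph} {h : γ.H}

/-- The contraction identity `hV` for the vertex tensors is carried over to the order by edges. By
evenness only inserted pairs of equal parity matter, and for these `hS` says that no additional sign
arises. -/
theorem sum_tensorMap_insertEdge (t : OpenTFT F) {c : (γ.contract h).Choices} {c' : γ.Choices}
    (hE : c'.edgeOrder = h :: γ.flip h :: c.edgeOrder.map (halfEdgeVal h))
    (hS : ∀ p : γ.H → ZMod 2, p h = p (γ.flip h) →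
      koszulSign p (h :: γ.flip h :: c.vertexOrder.map (halfEdgeVal h)) c'.vertexOrder = 1)
    (hV : ∀ a, ∑ j, c'.vertexMap t (insertEdge h a (F.basis j) (F.dual j)) = c.vertexMap t a)
    (a : (γ.contract h).H → A) :
    ∑ j, c'.tensorMap t (insertEdge h a (F.basis j) (F.dual j)) = c.tensorMap t a := by
  have hne := (γ.flip_ne h).symm
  let G : MultilinearMap ℝ (fun _ : (γ.contract h).H => A) ℝ :=
    ∑ j, (c'.tensorMap t).domDomRestrict (fun z => z ≠ h ∧ z ≠ γ.flip h)
      (fun z => if (z : γ.H) = h then F.basis j else F.dual j)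
  have hG : ∀ a, G a = ∑ j, c'.tensorMap t (insertEdge h a (F.basis j) (F.dual j)) := fun a =>
    MultilinearMap.sum_apply _ _ _
  rw [← hG]
  refine MultilinearMap.congr_homogeneous 𝒜 G (c.tensorMap t) (fun q a ha => ?_) a
  rw [hG, tensorMap_of_mem c t ha, ← hV, Finset.mul_sum]
  set K := koszulSign q c.edgeOrder c.vertexOrder with hK
  refine F.contract_congr ((c'.tensorMap t).bilin hne a) (K • (c'.vertexMap t).bilin hne a)
    fun r x hx y hy => ?_
  change c'.tensorMap t (insertEdge h a x y) = K * c'.vertexMap t (insertEdge h a x y)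
  have hmem : ∀ i, insertEdge h a x y i ∈ 𝒜 (insertEdge h q r r i) :=
    insertTwo_mem hne ha hx hy
  rw [tensorMap_of_mem c' t hmem]
  congr 1
  set p := insertEdge h q r r with hp
  have hph : p h = p (γ.flip h) := (insertTwo_left _ _ _).trans (insertTwo_right _ _ _ hne).symm
  have h1 := hS p hph
  have hn := c'.nodup_edgeOrder
  rw [hE, List.nodup_cons, List.nodup_cons, List.mem_cons, not_or] at hn
  have hperm := c.edgeOrder_perm.map (halfEdgeVal h)
  have h2 : (h :: γ.flip h :: c.edgeOrder.map (halfEdgeVal h)).Perm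
      (h :: γ.flip h :: c.vertexOrder.map (halfEdgeVal h)) := (hperm.cons _).cons _
  have h3 := koszulSign_trans p h2 (h2.symm.trans (hE ▸ c'.edgeOrder_perm))
  rw [h1, mul_one, koszulSign_cons p (hperm.cons _) (by simpa using hn.1),
    koszulSign_cons p hperm hn.2.1, koszulSign_map _ (halfEdgeVal_injective h) p c.edgeOrder_perm
      c.nodup_edgeOrder] at h3
  rw [hE, ← h3, hK]
  congr 1
  funext i
  exact insertEdge_val h q r r i

/-- An edge with the operator `id` may be contracted. -/
theorem exists_contract (t : OpenTFT F) (h : γ.H) :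
    ∃ (c : (γ.contract h).Choices) (c' : γ.Choices),
      c'.edges.list = γ.edge h :: c.edges.list.map (edgeVal h) ∧
      ∀ Φ : γ.E → A →ₗ[ℝ] A, Φ (γ.edge h) = LinearMap.id →
        c'.coef t Φ = c.coef t (fun e => Φ (edgeVal h e)) := by
  obtain ⟨verts, legs, verts', legs', hS, hV⟩ := exists_contract_orders h t
  -- The contracted edge is placed first, so that removing it does not affect the signs of the other
  -- edges.
  obtain ⟨edges', m, hm⟩ := Enumeration.exists_prepend (List.nodup_singleton (γ.edge h))
  replace hm : edges'.list = γ.edge h :: m := hm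
  have hmn := edges'.nodup
  rw [hm, List.nodup_cons] at hmn
  obtain ⟨edges, hedges⟩ : ∃ K : Enumeration (γ.contract h).E, K.list.map (edgeVal h) = m := by
    refine Enumeration.exists_of_injective (edgeVal_injective h) hmn.2 fun x => ?_
    constructor
    · intro hx
      exact ⟨⟨x, fun hc => hmn.1 (hc ▸ hx)⟩, rfl⟩
    · rintro ⟨y, rfl⟩
      have := edges'.complete (edgeVal h y)
      rw [hm, List.mem_cons] at this
      exact this.resolve_left y.2
  let c : (γ.contract h).Choices :=
    { verts := verts
      legs := legs
      edges := edges
      fst := fun e => ((γ.contract h).edge_surjective e).choose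
      edge_fst := fun e => ((γ.contract h).edge_surjective e).choose_spec }
  let c' : γ.Choices :=
    { verts := verts'
      legs := legs'
      edges := edges'
      fst := fun e => if he : e = γ.edge h then h else halfEdgeVal h (c.fst ⟨e, he⟩)
      edge_fst := fun e => by
        split_ifs with he
        · exact he.symm
        · exact congrArg (edgeVal h) (c.edge_fst ⟨e, he⟩) }
  have f1 : c'.fst (γ.edge h) = h := dif_pos rfl
  have f2 : ∀ e, c'.fst (edgeVal h e) = halfEdgeVal h (c.fst e) := fun e => dif_neg e.2
  have hE : c'.edgeOrder = h :: γ.flip h :: c.edgeOrder.map (halfEdgeVal h) := by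
    rw [edgeOrder, show c'.edges.list = γ.edge h :: edges.list.map (edgeVal h) from
      hm.trans (by rw [hedges]), List.flatMap_cons, f1, List.flatMap_map, edgeOrder,
      List.map_flatMap]
    simp only [f2]
    rfl
  have hT := sum_tensorMap_insertEdge t (c := c) (c' := c') hE hS hV
  refine ⟨c, c', hm.trans (by rw [← hedges]), fun Φ hΦ => ?_⟩
  rw [coef, coef, edgeSum_apply, edgeSum_apply]
  -- With the identity on the contracted edge, the product of edge tensors of `γ` is that of the
  -- contraction with the inverse inner product inserted.
  have hv : ∀ (m : (γ.contract h).E → Fin (Module.finrank ℝ A)) (j : Fin (Module.finrank ℝ A)),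
      c'.edgeVec F Φ ((Equiv.piSplitAt (γ.edge h) fun _ => Fin (Module.finrank ℝ A)).symm (j, m)) =
      insertEdge h (c.edgeVec F (fun e => Φ (edgeVal h e)) m) (F.basis j) (F.dual j) := by
    intro m j
    set M := (Equiv.piSplitAt (γ.edge h) fun _ => Fin (Module.finrank ℝ A)).symm (j, m) with hM
    have m1 : M (γ.edge h) = j := by simp [hM, Equiv.piSplitAt]
    have m2 : ∀ e, M (edgeVal h e) = m e := fun e => by
      have : edgeVal h e ≠ γ.edge h := e.2
      simp [hM, Equiv.piSplitAt, this]
      rfl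
    have g1 := c'.edgeVec_fst (F := F) Φ M (γ.edge h)
    have g2 := c'.edgeVec_flip (F := F) Φ M (γ.edge h)
    rw [f1, m1] at g1 g2
    rw [hΦ] at g1
    rw [← insertTwo_self (h := h) (h' := γ.flip h) (c'.edgeVec F Φ M), g1, g2]
    have key : ∀ x : (γ.contract h).H, c'.edgeVec F Φ M (halfEdgeVal h x) =
        c.edgeVec F (fun e => Φ (edgeVal h e)) m x := fun x => by
      have k1 : γ.edge (halfEdgeVal h x) = edgeVal h ((γ.contract h).edge x) := rfl
      simp only [edgeVec, k1, f2, m2, (halfEdgeVal_injective h).eq_iff]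
    exact congrArg (fun a => insertTwo h (γ.flip h) a (F.basis j) (F.dual j)) (funext key)
  rw [← (Equiv.piSplitAt (γ.edge h) fun _ => Fin (Module.finrank ℝ A)).symm.sum_comp,
    Fintype.sum_prod_type, Finset.sum_comm]
  refine (Fintype.sum_instance_irrel _ _ _).trans (Finset.sum_congr rfl fun m _ => ?_)
  refine Eq.trans (Finset.sum_congr rfl fun j _ => ?_) (hT _)
  exact congrArg _ (hv m j)

end StableRibbonGraph.Choices

end

/-! ### Increasing sequences of edges and alternating forms. -/

noncomputable section

/-- The function on `I` that is `1` on `S` and `0` elsewhere. -/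
def parityOn {I : Type} (S : Set I) (i : I) : ZMod 2 := if i ∈ S then 1 else 0

theorem parityOn_eq_one {I : Type} {S : Set I} {i : I} : parityOn S i = 1 ↔ i ∈ S := by
  simp [parityOn]

/-- When the odd elements are the entries of `g`, the Koszul sign counts the inversions of the
permutation that sorts `g` for the new order. -/
theorem koszulSign_parityOn {I : Type} [Fintype I] {L L' : List I} {k : ℕ} {g : Fin k → I}
    (hg : StrictMono fun i => L.idxOf (g i)) {σ : Perm (Fin k)}
    (hσ : StrictMono fun i => L'.idxOf (g (σ i))) :
    koszulSign (parityOn (Set.range g)) L L' = ((Perm.sign σ : ℤ) : ℝ) := by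
  have hinj : Function.Injective g := fun i j h => hg.injective (congrArg L.idxOf h)
  have h1 : ∀ i j, L'.idxOf (g i) < L'.idxOf (g j) ↔ σ⁻¹ i < σ⁻¹ j := fun i j => by
    have := hσ.lt_iff_lt (a := σ⁻¹ i) (b := σ⁻¹ j)
    simpa using this
  have h2 : koszulSign (parityOn (Set.range g)) L L' =
      ∏ j, ∏ i, if i < j ∧ σ⁻¹ j < σ⁻¹ i then (-1 : ℝ) else 1 := by
    rw [koszulSign, Finset.prod_comm]
    refine (Fintype.prod_of_injective g hinj _ _ (fun y hy => ?_) fun j => ?_).symm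
    · refine Finset.prod_eq_one fun x _ => if_neg ?_
      rintro ⟨-, -, -, h⟩
      exact hy (parityOn_eq_one.1 h)
    · refine Fintype.prod_of_injective g hinj _ _ (fun x hx => if_neg ?_) fun i => ?_
      · rintro ⟨-, -, h, -⟩
        exact hx (parityOn_eq_one.1 h)
      · refine if_congr ?_ rfl rfl
        rw [h1, ← hg.lt_iff_lt (a := i) (b := j)]
        simp [parityOn_eq_one]
  rw [h2, ← Perm.sign_inv, Perm.sign_eq_prod_prod_Iio]
  push_cast
  refine Finset.prod_congr rfl fun j _ => ?_
  rw [← Finset.prod_filter_mul_prod_filter_not Finset.univ (· < j)]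
  rw [Finset.prod_eq_one (s := Finset.univ.filter fun x => ¬ x < j), mul_one]
  · have : Finset.univ.filter (· < j) = Finset.Iio j := by ext; simp
    rw [this]
    refine Finset.prod_congr rfl fun i hi => ?_
    have hi' := Finset.mem_Iio.1 hi
    have hne : σ⁻¹ i ≠ σ⁻¹ j := fun h => hi'.ne (σ⁻¹.injective h)
    rcases lt_or_gt_of_ne hne with h | h
    · rw [if_neg fun hc => hc.2.not_gt h, if_pos h]
      simp
    · rw [if_pos ⟨hi', h⟩, if_neg h.not_gt]
      simp
  · intro i hi
    exact if_neg fun h => (Finset.mem_filter.1 hi).2 h.1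

section Forms

variable {B : Type} [Fintype B] (r : B → ℕ)

/-- The wedge product of coordinate functions. -/
def coordForm {k : ℕ} (f : Fin k → B) : (B → ℝ) [⋀^Fin k]→L[ℝ] ℝ :=
  ContinuousMultilinearMap.alternatization
    ((ContinuousMultilinearMap.mkPiAlgebra ℝ (Fin k) ℝ).compContinuousLinearMap
      fun i => ContinuousLinearMap.proj (R := ℝ) (φ := fun _ : B => ℝ) (f i))

/-- The standard basis vector of `b`. -/
def coordVec (b : B) : B → ℝ := Pi.single b 1

/-- A permutation `σ` contributes only if `f = g ∘ σ`; increasing sequences with the same range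
coincide, and then `σ` is the identity. -/
theorem coordForm_apply {k : ℕ} {f g : Fin k → B} (hf : StrictMono (r ∘ f))
    (hg : StrictMono (r ∘ g)) :
    coordForm f (fun i => coordVec (g i)) = if f = g then 1 else 0 := by
  have h0 : coordForm f (fun i => coordVec (g i)) =
      ∑ σ : Perm (Fin k), Perm.sign σ • ∏ i, (if f i = g (σ i) then (1 : ℝ) else 0) := by
    rw [coordForm, ContinuousMultilinearMap.alternatization_apply_apply]
    refine Finset.sum_congr rfl fun σ _ => ?_
    simp [coordVec, Pi.single_apply]
  have h1 : ∀ σ : Perm (Fin k), (∏ i, (if f i = g (σ i) then (1 : ℝ) else 0)) ≠ 0 →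
      f = g ∧ σ = 1 := by
    intro σ hσ
    have h2 : ∀ i, f i = g (σ i) := by
      intro i
      by_contra h
      exact hσ (Finset.prod_eq_zero (Finset.mem_univ i) (if_neg h))
    have h3 : r ∘ f = r ∘ g := (hf.range_inj hg).1 (by
      rw [show r ∘ f = (r ∘ g) ∘ σ from funext fun i => congrArg r (h2 i), σ.surjective.range_comp])
    have h4 : σ = 1 := by
      ext i
      have : r (g (σ i)) = r (g i) := (congrArg r (h2 i)).symm.trans (congrFun h3 i)
      exact congrArg Fin.val (hg.injective this)
    refine ⟨funext fun i => ?_, h4⟩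
    rw [h2 i, h4]
    rfl
  rw [h0]
  split_ifs with h
  · subst h
    rw [Finset.sum_eq_single 1]
    · simp
    · intro σ _ hσ
      by_contra hc
      exact hσ (h1 σ fun h => hc (by rw [h, smul_zero])).2
    · simp
  · refine Finset.sum_eq_zero fun σ _ => ?_
    by_contra hc
    exact h (h1 σ fun h => hc (by rw [h, smul_zero])).1

/-- Alternating forms are determined by their values on increasing sequences of basis vectors. -/
theorem alternating_ext (hr : Function.Injective r) {k : ℕ} {η ζ : (B → ℝ) [⋀^Fin k]→L[ℝ] ℝ}
    (h : ∀ g : Fin k → B, StrictMono (r ∘ g) →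
      η (fun i => coordVec (g i)) = ζ (fun i => coordVec (g i))) : η = ζ := by
  apply ContinuousAlternatingMap.toAlternatingMap_injective
  refine Module.Basis.ext_alternating (Pi.basisFun ℝ B) fun v hv => ?_
  have e : ∀ i, Pi.basisFun ℝ B (v i) = coordVec (v i) := fun i => by
    rw [Pi.basisFun_apply]; rfl
  simp only [e]
  -- An injective sequence of basis vectors is sorted by rank; this changes both forms by the same
  -- sign.
  have hs : StrictMono (r ∘ (v ∘ Tuple.sort (r ∘ v))) := by
    refine Monotone.strictMono_of_injective (Tuple.monotone_sort (r ∘ v)) ?_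
    exact hr.comp (hv.comp (Equiv.injective _))
  have h1 := h _ hs
  have h2 : ∀ θ : (B → ℝ) [⋀^Fin k]→L[ℝ] ℝ,
      θ (fun i => coordVec ((v ∘ Tuple.sort (r ∘ v)) i)) =
        Perm.sign (Tuple.sort (r ∘ v)) • θ.toAlternatingMap (fun i => coordVec (v i)) := fun θ =>
    θ.toAlternatingMap.map_perm (fun i => coordVec (v i)) (Tuple.sort (r ∘ v))
  rw [h2, h2] at h1
  exact smul_left_cancel _ h1

theorem coordVec_perm {k : ℕ} (η : (B → ℝ) [⋀^Fin k]→L[ℝ] ℝ) (g : Fin k → B) (σ : Perm (Fin k)) :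
    η (fun i => coordVec (g (σ i))) = ((Perm.sign σ : ℤ) : ℝ) * η (fun i => coordVec (g i)) := by
  have := η.toAlternatingMap.map_perm (fun i => coordVec (g i)) σ
  rw [Units.smul_def, zsmul_eq_mul] at this
  exact this

end Forms

end

/-! ### The differential form of a graph and its independence of the choices. -/

noncomputable section

variable {A : Type*} [NonUnitalRing A] [Module ℝ A] [FiniteDimensional ℝ A]
  {𝒜 : ZMod 2 → Submodule ℝ A} {F : DGFrobenius 𝒜} [DirectSum.Decomposition 𝒜]

namespace StableRibbonGraph

variable {γ : StableRibbonGraph} (D : HodgeDecomposition F) (u v : ℝ → ℝ)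

/-- The operators on the edges: `v s` for the edges in `S`, `π + u (1 - π)` for the other black
edges, and `π` for the white edges. -/
def edgeOp (S : Set γ.E) (x : γ.EdgeSpace) (e : γ.E) : A →ₗ[ℝ] A :=
  if hw : e ∈ γ.white then D.π
  else if e ∈ S then v (x ⟨e, hw⟩) • D.s
  else D.π + u (x ⟨e, hw⟩) • (LinearMap.id - D.π)

/-- The edges in a sequence of black edges. -/
def edgeSet {k : ℕ} (f : Fin k → γ.BlackEdge) : Set γ.E := Set.range fun i => (f i).1

theorem edgeSet_black {k : ℕ} {f : Fin k → γ.BlackEdge} {e : γ.E} (he : e ∈ edgeSet f) :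
    e ∉ γ.white := by
  obtain ⟨i, rfl⟩ := he
  exact (f i).2

theorem isEdgeOp_edgeOp {k : ℕ} (f : Fin k → γ.BlackEdge) (x : γ.EdgeSpace) (e : γ.E) :
    F.IsEdgeOp (parityOn (edgeSet f) e) (edgeOp D u v (edgeSet f) x e) := by
  rw [edgeOp, parityOn]
  split_ifs with h1 h2 h2
  · exact absurd h2 (edgeSet_black h1)
  · exact (DGFrobenius.IsEdgeOp.s D).smul _
  · exact DGFrobenius.IsEdgeOp.π D
  · exact (DGFrobenius.IsEdgeOp.π D).add
      ((DGFrobenius.IsEdgeOp.id.sub (DGFrobenius.IsEdgeOp.π D)).smul _)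

namespace Choices

variable (c c' : γ.Choices) (t : OpenTFT F)

/-- The position of a black edge in the chosen order. -/
def rank (b : γ.BlackEdge) : ℕ := c.edges.list.idxOf b.1

theorem rank_injective : Function.Injective c.rank := fun b _ h =>
  Subtype.ext ((List.idxOf_inj (c.edges.complete b.1)).1 h)

/-- The form obtained from the operators `edgeOp`. -/
def valueForm : γ.Form := fun k x =>
  ∑ f : Fin k → γ.BlackEdge, if StrictMono (c.rank ∘ f) then
    ((-1 : ℝ) ^ (k * (k - 1) / 2) * c.coef t (edgeOp D u v (edgeSet f) x)) • coordForm f else 0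

theorem valueForm_apply {k : ℕ} (x : γ.EdgeSpace) {g : Fin k → γ.BlackEdge}
    (hg : StrictMono (c.rank ∘ g)) : c.valueForm D u v t k x (fun i => coordVec (g i)) =
      (-1 : ℝ) ^ (k * (k - 1) / 2) * c.coef t (edgeOp D u v (edgeSet g) x) := by
  rw [valueForm, ContinuousAlternatingMap.sum_apply, Finset.sum_eq_single g]
  · rw [if_pos hg, ContinuousAlternatingMap.smul_apply, coordForm_apply c.rank hg hg, if_pos rfl,
      smul_eq_mul, mul_one]
  · intro f _ hf
    split_ifs with h
    · rw [ContinuousAlternatingMap.smul_apply, coordForm_apply c.rank h hg, if_neg hf, smul_zero]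
    · rfl
  · simp

theorem ext_form {k : ℕ} {η ζ : γ.EdgeSpace [⋀^Fin k]→L[ℝ] ℝ}
    (h : ∀ g : Fin k → γ.BlackEdge, StrictMono (c.rank ∘ g) →
      η (fun i => coordVec (g i)) = ζ (fun i => coordVec (g i))) : η = ζ :=
  alternating_ext c.rank c.rank_injective h

/-- The form does not depend on the choices. -/
theorem valueForm_eq : c.valueForm D u v t = c'.valueForm D u v t := by
  funext k x
  refine c.ext_form fun g hg => ?_
  have hinj : Function.Injective g := fun i j h => hg.injective (congrArg c.rank h)
  set σ := Tuple.sort (c'.rank ∘ g) with hσ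
  have hs : StrictMono (c'.rank ∘ (g ∘ σ)) :=
    Monotone.strictMono_of_injective (Tuple.monotone_sort (c'.rank ∘ g))
      (c'.rank_injective.comp (hinj.comp (Equiv.injective _)))
  have e1 := coordVec_perm (c'.valueForm D u v t k x) g σ
  have e2 := c'.valueForm_apply D u v t x hs
  have e3 : edgeSet (g ∘ σ) = edgeSet g := σ.surjective.range_comp fun i => (g i).1
  have e4 := c.coef_eq c' t (isEdgeOp_edgeOp D u v g x)
  -- The odd edge operators are those containing `s`. Reordering them costs the sign of `σ`, as does
  -- reordering the corresponding differentials, so the two signs cancel.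
  have e5 : koszulSign (parityOn (edgeSet g)) c.edges.list c'.edges.list =
    ((Perm.sign σ : ℤ) : ℝ) := koszulSign_parityOn (g := fun i => (g i).1) hg hs
  have e6 : ((Perm.sign σ : ℤ) : ℝ) * ((Perm.sign σ : ℤ) : ℝ) = 1 := by
    rw [← e5, koszulSign_mul_self]
  rw [e3] at e2
  rw [c.valueForm_apply D u v t x hg, e4, e5]
  have e7 := e1.symm.trans e2
  linear_combination (c'.valueForm D u v t k x fun i => coordVec (g i)) * e6 -
    ((Perm.sign σ : ℤ) : ℝ) * e7

/-- Here `heat_apply` enters: the heat operator is `π + exp (-l) (1 - π)`, and composing it with `s`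
leaves `exp (-l) s` because `s π = 0`. In lengths both coefficient functions are thus `exp (-l)`;
separate functions `u` and `v` are kept for the coordinates on the cube. -/
theorem form_eq : c.form D (fun v => t.val (γ.surface v) (c.legs v)) =
    c.valueForm D (fun l => Real.exp (-l)) (fun l => Real.exp (-l)) t := by
  funext k l
  rw [form, valueForm]
  refine Finset.sum_congr rfl fun f _ => ?_
  refine if_congr ⟨fun h i j hij => h i j hij, fun h i j hij => h hij⟩ ?_ rfl
  congr 2
  rw [coef, edgeSum_apply]
  refine Finset.sum_congr rfl fun m _ => ?_
  rw [← tensor_eq]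
  congr 1
  funext h
  rw [edgeVec]
  refine if_congr Iff.rfl ?_ rfl
  rw [edgeOp]
  split_ifs with h1 h2 h3 h3
  · rfl
  · simp [D.heat_apply, D.s_π]
  · exact absurd h2 h3
  · exact absurd h3 h2
  · simp [D.heat_apply]

end Choices

end StableRibbonGraph

end

/-! ### Pull-back along isomorphisms, zero-sections and ∞-sections. -/

noncomputable section

theorem List.idxOf_map_of_injective {I J : Type} {f : I → J} (hf : Function.Injective f)
    (L : List I) (x : I) : (L.map f).idxOf (f x) = L.idxOf x := by
  induction L with
  | nil => rfl
  | cons y L ih =>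
    rw [List.map_cons, List.idxOf_cons, List.idxOf_cons, ih]
    by_cases h : y = x
    · rw [h]; simp
    · have : f y ≠ f x := fun hc => h (hf hc)
      rw [beq_eq_false_iff_ne.2 h, beq_eq_false_iff_ne.2 this]

section

variable {B B' : Type} [Fintype B] [Fintype B']

/-- The three maps along which forms are pulled back have coordinate functions or constants as
components, so that their derivatives send basis vectors to basis vectors. -/
theorem fderiv_coordVec {P : (B → ℝ) → B' → ℝ} {b : B} {b' : B'}
    (hP : ∀ x, (∃ y, (∀ l, P l x = l y) ∧ (y = b ↔ x = b')) ∨ ((∃ κ, ∀ l, P l x = κ) ∧ x ≠ b'))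
    (l : B → ℝ) : fderiv ℝ P l (coordVec b) = coordVec b' := by
  have h1 : ∀ x, ∃ φ : (B → ℝ) →L[ℝ] ℝ, HasFDerivAt (fun l => P l x) φ l ∧
      φ (coordVec b) = coordVec b' x := by
    intro x
    rcases hP x with ⟨y, h1, h2⟩ | ⟨⟨κ, h1⟩, h2⟩
    · refine ⟨ContinuousLinearMap.proj (R := ℝ) (φ := fun _ : B => ℝ) y, ?_, ?_⟩
      · rw [show (fun l => P l x) = fun l => l y from funext h1]
        exact (ContinuousLinearMap.proj (R := ℝ) (φ := fun _ : B => ℝ) y).hasFDerivAt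
      · simp [coordVec, Pi.single_apply, h2]
    · refine ⟨0, ?_, by simp [coordVec, h2]⟩
      rw [show (fun l => P l x) = fun _ => κ from funext h1]
      exact hasFDerivAt_const _ _
  choose φ h1 h2 using h1
  rw [(hasFDerivAt_pi.2 h1).fderiv]
  exact funext h2

theorem pullbackForm_coordVec {k : ℕ} {P : (B → ℝ) → B' → ℝ} {ι : B → B'} {l : B → ℝ}
    (hP : ∀ b, fderiv ℝ P l (coordVec b) = coordVec (ι b))
    (η : (B' → ℝ) → (B' → ℝ) [⋀^Fin k]→L[ℝ] ℝ) (g : Fin k → B) :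
    pullbackForm P η l (fun i => coordVec (g i)) = η (P l) (fun i => coordVec (ι (g i))) := by
  rw [pullbackForm, ContinuousAlternatingMap.compContinuousLinearMap_apply]
  congr 1
  funext i
  exact hP _

end

variable {A : Type*} [NonUnitalRing A] [Module ℝ A] [FiniteDimensional ℝ A]
  {𝒜 : ZMod 2 → Submodule ℝ A} {F : DGFrobenius 𝒜} [DirectSum.Decomposition 𝒜]

namespace StableRibbonGraph

variable {γ γ' : StableRibbonGraph} (D : HodgeDecomposition F) (u v : ℝ → ℝ) (t : OpenTFT F)

theorem edgeOp_white (S : Set γ.E) (x : γ.EdgeSpace) {e : γ.E} (hw : e ∈ γ.white) :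
    edgeOp D u v S x e = D.π := dif_pos hw

theorem edgeOp_black (S : Set γ.E) (x : γ.EdgeSpace) {e : γ.E} (hw : e ∉ γ.white) :
    edgeOp D u v S x e = if e ∈ S then v (x ⟨e, hw⟩) • D.s
      else D.π + u (x ⟨e, hw⟩) • (LinearMap.id - D.π) := dif_neg hw

theorem pullback_iso (f : Iso γ γ') (c : γ.Choices) (k : ℕ) (l : γ'.EdgeSpace) :
    pullbackForm f.pull (c.valueForm D u v t k) l = (c.map f).valueForm D u v t k l := by
  let ι (b : γ'.BlackEdge) : γ.BlackEdge := ⟨f.onE.symm b.1, fun hc => b.2 (by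
    have := (f.white_iff _).2 hc
    rwa [Equiv.apply_symm_apply] at this)⟩
  have h1 : ∀ b, fderiv ℝ f.pull l (coordVec b) = coordVec (ι b) := fun b => by
    refine fderiv_coordVec (fun (x : γ.BlackEdge) => Or.inl ⟨⟨f.onE x.1, fun hc => x.2
      ((f.white_iff x.1).1 hc)⟩, fun l => rfl, ?_⟩) l
    exact Subtype.ext_iff.trans ((Equiv.eq_symm_apply f.onE).symm.trans
      (Subtype.ext_iff (a1 := x) (a2 := ι b)).symm)
  have h2 : ∀ b, c.rank (ι b) = (c.map f).rank b := fun b => by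
    have := List.idxOf_map_of_injective f.onE.injective c.edges.list (f.onE.symm b.1)
    rw [Equiv.apply_symm_apply] at this
    exact this.symm
  refine (c.map f).ext_form fun g hg => ?_
  have hg' : StrictMono (c.rank ∘ (ι ∘ g)) := by
    rwa [show c.rank ∘ (ι ∘ g) = (c.map f).rank ∘ g from funext fun i => h2 (g i)]
  have h3 := c.valueForm_apply D u v t (f.pull l) hg'
  rw [pullbackForm_coordVec h1, (c.map f).valueForm_apply D u v t l hg, c.map_coef]
  refine h3.trans ?_
  congr 2
  funext e
  have h4 : e ∈ edgeSet (ι ∘ g) ↔ f.onE e ∈ edgeSet g := by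
    refine exists_congr fun i => ?_
    exact (Equiv.symm_apply_eq f.onE)
  simp only [edgeOp, h4, f.white_iff]
  rfl

/-- On the zero-section the operator of the edge is `π + (1 - π) = id`, and no term with its
differential survives, so `hc` contracts it. As the edge comes first, the ranks of all others are
shifted by one and increasing sequences remain increasing. -/
theorem pullback_zeroSection (hu : u 0 = 1) (h : γ.H) (hb : γ.edge h ∉ γ.white)
    {c : (γ.contract h).Choices} {c' : γ.Choices}
    (hl : c'.edges.list = γ.edge h :: c.edges.list.map (edgeVal h))
    (hc : ∀ Φ : γ.E → A →ₗ[ℝ] A, Φ (γ.edge h) = LinearMap.id →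
        c'.coef t Φ = c.coef t (fun e => Φ (edgeVal h e))) (k : ℕ)
    (l : (γ.contract h).EdgeSpace) :
    pullbackForm (γ.zeroSection h) (c'.valueForm D u v t k) l = c.valueForm D u v t k l := by
  let ι (b : (γ.contract h).BlackEdge) : γ.BlackEdge := ⟨edgeVal h b.1, b.2⟩
  have h1 : ∀ b, fderiv ℝ (γ.zeroSection h) l (coordVec b) = coordVec (ι b) := fun b => by
    refine fderiv_coordVec (fun x => ?_) l
    by_cases he : x.1 = γ.edge h
    · refine Or.inr ⟨⟨0, fun l => dif_pos he⟩, ?_⟩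
      rintro rfl
      exact b.1.2 he
    · refine Or.inl ⟨⟨⟨x.1, he⟩, x.2⟩, fun l => dif_neg he, ?_, ?_⟩
      · rintro rfl; rfl
      · rintro rfl; rfl
  have h2 : ∀ b, c'.rank (ι b) = c.rank b + 1 := fun b => by
    refine (congrArg (List.idxOf (edgeVal h b.1)) hl).trans ?_
    have hne : γ.edge h ≠ edgeVal h b.1 := Ne.symm b.1.2
    rw [List.idxOf_cons_ne _ hne, List.idxOf_map_of_injective (edgeVal_injective h)]
    rfl
  refine c.ext_form fun g hg => ?_
  have hg' : StrictMono (c'.rank ∘ (ι ∘ g)) := fun i j hij => by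
    have := hg hij
    simp only [Function.comp_apply, h2] at this ⊢
    omega
  have h3 := c'.valueForm_apply D u v t (γ.zeroSection h l) hg'
  rw [pullbackForm_coordVec h1, c.valueForm_apply D u v t l hg]
  refine h3.trans ?_
  have h5 : γ.edge h ∉ edgeSet (ι ∘ g) := by
    rintro ⟨i, hi⟩
    exact (g i).1.2 hi
  rw [hc]
  · congr 2
    funext e
    have h4 : edgeVal h e ∈ edgeSet (ι ∘ g) ↔ e ∈ edgeSet g :=
      exists_congr fun i => (edgeVal_injective h).eq_iff
    have h6 : edgeVal h e ∈ γ.white ↔ e ∈ (γ.contract h).white := Iff.rfl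
    have h7 : ∀ hw, γ.zeroSection h l ⟨edgeVal h e, hw⟩ = l ⟨e, hw⟩ := fun hw => dif_neg e.2
    simp only [edgeOp, h4, h6, h7]
  · have h8 : γ.zeroSection h l ⟨γ.edge h, hb⟩ = 0 := dif_pos rfl
    rw [edgeOp, dif_neg hb, if_neg h5, h8, hu, one_smul, add_sub_cancel]

/-- The choices for a graph as choices for the graph with an edge made white. -/
def Choices.whiten (c : γ.Choices) (e : γ.E) : (γ.whiten e).Choices where
  verts := c.verts
  legs := c.legs
  edges := c.edges
  fst := c.fst
  edge_fst := c.edge_fst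

theorem Choices.whiten_coef (c : γ.Choices) (e : γ.E) (Φ : γ.E → A →ₗ[ℝ] A) :
    (c.whiten e).coef t Φ = c.coef t Φ := rfl

/-- At `x = 1` the operator of the edge reduces to `π`, which is the operator prescribed for a white
edge, and no term with its differential survives. -/
theorem pullback_inftySection (hu : u 1 = 0) (e : γ.E) (he : e ∉ γ.white)
    (c : γ.Choices) (k : ℕ) (l : (γ.whiten e).EdgeSpace) :
    pullbackForm (γ.inftySection e) (c.valueForm D u v t k) l =
      (c.whiten e).valueForm D u v t k l := by
  let ι (b : (γ.whiten e).BlackEdge) : γ.BlackEdge := ⟨b.1, fun hc => b.2 (Or.inr hc)⟩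
  have hne : ∀ b : (γ.whiten e).BlackEdge, b.1 ≠ e := fun b hc => b.2 (Or.inl hc)
  have h1 : ∀ b, fderiv ℝ (γ.inftySection e) l (coordVec b) = coordVec (ι b) := fun b => by
    refine fderiv_coordVec (fun x => ?_) l
    by_cases he : x.1 = e
    · refine Or.inr ⟨⟨1, fun l => dif_pos he⟩, ?_⟩
      rintro rfl
      exact hne b he
    · refine Or.inl ⟨⟨x.1, fun hc => hc.elim he x.2⟩, fun l => dif_neg he, ?_, ?_⟩
      · rintro rfl; rfl
      · rintro rfl; rfl
  refine (c.whiten e).ext_form fun g hg => ?_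
  have hg' : StrictMono (c.rank ∘ (ι ∘ g)) := hg
  have h3 := c.valueForm_apply D u v t (γ.inftySection e l) hg'
  rw [pullbackForm_coordVec h1, (c.whiten e).valueForm_apply D u v t l hg]
  refine h3.trans ?_
  refine congrArg (_ * ·) ((congrArg (c.coef t) (funext fun e' => ?_)).trans
    (c.whiten_coef t e _).symm)
  by_cases hw : e' ∈ γ.white
  · exact (edgeOp_white D u v _ _ hw).trans (edgeOp_white (γ := γ.whiten e) D u v _ _ (Or.inr hw)).symm
  · by_cases hee : e' = e
    · have h6 : e' ∉ edgeSet (ι ∘ g) := by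
        rintro ⟨i, hi⟩
        exact hne _ (hi.trans hee)
      have h7 : γ.inftySection e l ⟨e', hw⟩ = 1 := dif_pos hee
      refine Eq.trans ?_ (edgeOp_white (γ := γ.whiten e) D u v _ _ (Or.inl hee)).symm
      rw [edgeOp_black D u v _ _ hw, if_neg h6, h7, hu, zero_smul, add_zero]
    · have h8 : e' ∉ (γ.whiten e).white := fun hc => hc.elim hee hw
      have h7 : γ.inftySection e l ⟨e', hw⟩ = l ⟨e', h8⟩ := dif_neg hee
      refine Eq.trans ?_ (edgeOp_black D u v _ _ h8).symm
      rw [edgeOp_black D u v _ _ hw, h7]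
      rfl

end StableRibbonGraph

end

/-! ### Smoothness and closedness. -/

noncomputable section

theorem prefixSign_parityOn {I : Type} [Fintype I] {L : List I} {k : ℕ} {g : Fin k → I}
    (hg : StrictMono fun i => L.idxOf (g i)) (i : Fin k) :
    prefixSign (parityOn (Set.range g)) L (g i) = (-1 : ℝ) ^ i.val := by
  have hinj : Function.Injective g := fun i j h => hg.injective (congrArg L.idxOf h)
  have h1 : prefixSign (parityOn (Set.range g)) L (g i) =
      ∏ j : Fin k, if j < i then (-1 : ℝ) else 1 := by
    refine (Finset.prod_of_injOn g hinj.injOn (fun _ _ => Finset.mem_coe.2 (Finset.mem_univ _))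
      (fun e _ he => ?_) fun j _ => ?_).symm
    · rw [if_neg]
      rw [parityOn_eq_one]
      exact fun hc => he (by simpa using hc.2)
    · refine if_congr ?_ rfl rfl
      rw [parityOn_eq_one]
      exact ⟨fun h => ⟨hg h, j, rfl⟩, fun h => hg.lt_iff_lt.1 h.1⟩
  rw [h1, Finset.prod_ite, Finset.prod_const, Finset.prod_const_one, mul_one]
  congr 1
  rw [show Finset.univ.filter (· < i) = Finset.Iio i by ext; simp, Fin.card_Iio]

variable {A : Type*} [NonUnitalRing A] [Module ℝ A] [FiniteDimensional ℝ A]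
  {𝒜 : ZMod 2 → Submodule ℝ A} {F : DGFrobenius 𝒜} [DirectSum.Decomposition 𝒜]

namespace StableRibbonGraph

variable {γ : StableRibbonGraph} (D : HodgeDecomposition F) {u v : ℝ → ℝ} (t : OpenTFT F)

theorem edgeOp_val (S : Set γ.E) (x : γ.EdgeSpace) (b : γ.BlackEdge) :
    edgeOp D u v S x b.1 = if b.1 ∈ S then v (x b) • D.s
      else D.π + u (x b) • (LinearMap.id - D.π) := edgeOp_black D u v S x b.2

namespace Choices

variable (c : γ.Choices)

/-- All edge operators are combinations of the fixed operators `π`, `1 - π` and `s` with smooth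
coefficients, and `coef` is multilinear. -/
theorem contDiff_coef_edgeOp (hu : ContDiff ℝ ∞ u) (hv : ContDiff ℝ ∞ v) (S : Set γ.E) :
    ContDiff ℝ ∞ fun x => c.coef t (edgeOp D u v S x) := by
  have h1 : ∀ e : γ.E, ∃ a : Fin 3 → γ.EdgeSpace → ℝ, (∀ i, ContDiff ℝ ∞ (a i)) ∧
      ∀ x, edgeOp D u v S x e =
        ∑ i, a i x • (![D.π, LinearMap.id - D.π, D.s] : Fin 3 → A →ₗ[ℝ] A) i := by
    intro e
    by_cases hw : e ∈ γ.white
    · refine ⟨![fun _ => 1, fun _ => 0, fun _ => 0], fun i => ?_, fun x => ?_⟩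
      · fin_cases i <;> exact contDiff_const
      · simp [edgeOp_white D u v S x hw, Fin.sum_univ_three]
    · have h2 : ContDiff ℝ ∞ fun x : γ.EdgeSpace => x ⟨e, hw⟩ := contDiff_apply ℝ ℝ _
      by_cases hS : e ∈ S
      · refine ⟨![fun _ => 0, fun _ => 0, fun x => v (x ⟨e, hw⟩)], fun i => ?_, fun x => ?_⟩
        · fin_cases i
          exacts [contDiff_const, contDiff_const, hv.comp h2]
        · simp [edgeOp_black D u v S x hw, hS, Fin.sum_univ_three]
      · refine ⟨![fun _ => 1, fun x => u (x ⟨e, hw⟩), fun _ => 0], fun i => ?_, fun x => ?_⟩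
        · fin_cases i
          exacts [contDiff_const, hu.comp h2, contDiff_const]
        · simp [edgeOp_black D u v S x hw, hS, Fin.sum_univ_three]
  choose a h1 h2 using h1
  have h3 : ∀ x, c.coef t (edgeOp D u v S x) = ∑ r : γ.E → Fin 3, (∏ e, a e (r e) x) *
      c.coef t fun e => (![D.π, LinearMap.id - D.π, D.s] : Fin 3 → A →ₗ[ℝ] A) (r e) := fun x => by
    rw [show edgeOp D u v S x = _ from funext fun e => h2 e x, MultilinearMap.map_sum]
    refine Finset.sum_congr rfl fun r _ => ?_
    exact (c.coef t).map_smul_univ (fun e => a e (r e) x) _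
  simp only [h3]
  exact ContDiff.sum fun r _ => (contDiff_prod fun e _ => h1 e _).mul contDiff_const

theorem contDiff_valueForm (hu : ContDiff ℝ ∞ u) (hv : ContDiff ℝ ∞ v) (k : ℕ) :
    ContDiff ℝ ∞ (c.valueForm D u v t k) := by
  refine ContDiff.sum fun f _ => ?_
  split_ifs
  · exact (contDiff_const.mul (c.contDiff_coef_edgeOp D t hu hv _)).smul contDiff_const
  · exact contDiff_const

/-- Moving in the direction of `b` changes only the operator of the edge `b`, which is `π + u (1 -
π)` as `b` is not in `S`; its derivative is `-v (1 - π)` by `huv`. -/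
theorem fderiv_coef_edgeOp (hu : ContDiff ℝ ∞ u) (hv : ContDiff ℝ ∞ v)
    (huv : ∀ r, HasDerivAt u (-v r) r) (S : Set γ.E) (x : γ.EdgeSpace) {b : γ.BlackEdge}
    (hb : b.1 ∉ S) :
    fderiv ℝ (fun x => c.coef t (edgeOp D u v S x)) x (coordVec b) =
      -(v (x b) * c.coef t (Function.update (edgeOp D u v S x) b.1 (LinearMap.id - D.π))) := by
  set Φ := edgeOp D u v S x with hΦ
  have h1 : ∀ r : ℝ, edgeOp D u v S (x + r • coordVec b) =
      Function.update Φ b.1 (D.π + u (x b + r) • (LinearMap.id - D.π)) := fun r => by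
    funext e
    by_cases he : e = b.1
    · subst he
      rw [Function.update_self, edgeOp_black D u v _ _ b.2, if_neg hb]
      congr 3
      change x b + r * coordVec b b = _
      rw [coordVec, Pi.single_eq_same, mul_one]
    · rw [Function.update_of_ne he, hΦ]
      by_cases hw : e ∈ γ.white
      · rw [edgeOp_white D u v _ _ hw, edgeOp_white D u v _ _ hw]
      · obtain ⟨b', rfl⟩ : ∃ b' : γ.BlackEdge, b'.1 = e := ⟨⟨e, hw⟩, rfl⟩
        have h2 : (x + r • coordVec b) b' = x b' := by
          change x b' + r * coordVec b b' = _
          have hne : b' ≠ b := fun hc => he (by rw [hc])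
          rw [show coordVec b b' = 0 from Pi.single_eq_of_ne hne _, mul_zero, add_zero]
        rw [edgeOp_val, edgeOp_val, h2]
  have h2 : HasDerivAt (fun r : ℝ => c.coef t (edgeOp D u v S (x + r • coordVec b)))
      (-v (x b) * c.coef t (Function.update Φ b.1 (LinearMap.id - D.π))) 0 := by
    simp only [h1, MultilinearMap.map_update_add, MultilinearMap.map_update_smul, smul_eq_mul]
    refine HasDerivAt.const_add _ (HasDerivAt.mul_const ?_ _)
    have h3 : HasDerivAt u (-v (x b)) (x b + 0) := by
      rw [add_zero]
      exact huv _
    exact h3.comp_const_add (x b) 0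
  have h4 : HasDerivAt (fun r : ℝ => x + r • coordVec b) (coordVec b) 0 := by
    simpa using ((hasDerivAt_id (0 : ℝ)).smul_const (coordVec b)).const_add x
  have h5 : DifferentiableAt ℝ (fun x => c.coef t (edgeOp D u v S x)) (x + (0 : ℝ) • coordVec b) :=
    ((c.contDiff_coef_edgeOp D t hu hv S).differentiable (by simp)) _
  have h6 := HasDerivAt.unique (HasFDerivAt.comp_hasDerivAt (l :=
    fun x => c.coef t (edgeOp D u v S x)) (0 : ℝ) h5.hasFDerivAt h4) h2
  rw [zero_smul, add_zero] at h6
  rw [h6, neg_mul]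

/-- On an increasing sequence `g`, the exterior derivative is the alternating sum of the derivatives
along `g i` of the coefficients with `g i` omitted. Up to a common factor these are the terms of
`stokes` for the operators in which all entries of `g` carry `s`, since `[d, v s] = v (1 - π)` is
minus the derivative of `π + u (1 - π)`. -/
theorem extDeriv_valueForm (hu : ContDiff ℝ ∞ u) (hv : ContDiff ℝ ∞ v)
    (huv : ∀ r, HasDerivAt u (-v r) r) (k : ℕ) (x : γ.EdgeSpace) :
    extDeriv (c.valueForm D u v t k) x = 0 := by
  refine c.ext_form fun g hg => ?_
  set S := edgeSet g with hS
  set Φ := edgeOp D u v S x with hΦ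
  have hinj : Function.Injective g := fun i j h => hg.injective (congrArg c.rank h)
  have h1 : ∀ i, fderiv ℝ (fun y => c.valueForm D u v t k y
      (i.removeNth fun j => coordVec (g j))) x (coordVec (g i)) =
      (-1 : ℝ) ^ (k * (k - 1) / 2) *
        -(v (x (g i)) * c.coef t (Function.update Φ (g i).1 (LinearMap.id - D.π))) := by
    intro i
    have h2 : StrictMono (c.rank ∘ (g ∘ i.succAbove)) := hg.comp (Fin.strictMono_succAbove i)
    have h3 : (g i).1 ∉ edgeSet (g ∘ i.succAbove) := by
      rintro ⟨j, hj⟩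
      exact i.succAbove_ne j (hinj (Subtype.ext hj))
    have h4 : ∀ y, c.valueForm D u v t k y (i.removeNth fun j => coordVec (g j)) =
        (-1 : ℝ) ^ (k * (k - 1) / 2) * c.coef t (edgeOp D u v (edgeSet (g ∘ i.succAbove)) y) :=
      fun y => c.valueForm_apply D u v t y h2
    have h5 : DifferentiableAt ℝ
        (fun y => c.coef t (edgeOp D u v (edgeSet (g ∘ i.succAbove)) y)) x :=
      ((c.contDiff_coef_edgeOp D t hu hv _).differentiable (by simp)) _
    rw [funext h4, fderiv_const_mul h5, ContinuousLinearMap.smul_apply,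
      c.fderiv_coef_edgeOp D t hu hv huv _ x h3, smul_eq_mul]
    refine congrArg (fun Ψ => _ * -(_ * c.coef t Ψ)) (funext fun e => ?_)
    by_cases he : e = (g i).1
    · subst he
      rw [Function.update_self, Function.update_self]
    · rw [Function.update_of_ne he, Function.update_of_ne he, hΦ]
      have h6 : e ∈ edgeSet (g ∘ i.succAbove) ↔ e ∈ S := by
        constructor
        · rintro ⟨j, hj⟩
          exact ⟨_, hj⟩
        · rintro ⟨j, hj⟩
          have : j ≠ i := by
            rintro rfl
            exact he hj.symm
          obtain ⟨j', rfl⟩ := Fin.exists_succAbove_eq this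
          exact ⟨j', hj⟩
      simp only [edgeOp, h6]
  have h7 := c.stokes t (fun e i a ha => (isEdgeOp_edgeOp D u v g x e).mem i a ha)
  have h8 : ∑ i, (-1 : ℝ) ^ i.val *
      (v (x (g i)) * c.coef t (Function.update Φ (g i).1 (LinearMap.id - D.π))) = 0 := by
    refine Eq.trans ?_ h7
    -- Edges outside `S` do not contribute, because `d` commutes with `π` and with `π + u (1 - π)`.
    -- On `S` the prefix sign counts the odd edges before `g i`, which gives `(-1)^i`.
    refine Finset.sum_of_injOn (fun i => (g i).1) (Subtype.val_injective.comp hinj).injOn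
      (fun _ _ => Finset.mem_coe.2 (Finset.mem_univ _)) (fun e _ he => ?_) fun i _ => ?_
    · have h9 : e ∉ S := by simpa [hS, edgeSet] using he
      have h10 : parityOn S e = 0 := if_neg h9
      have h11 : F.d ∘ₗ edgeOp D u v S x e - swapSign 1 (parityOn S e) •
          (edgeOp D u v S x e ∘ₗ F.d) = 0 := by
        rw [h10]
        by_cases hw : e ∈ γ.white
        · rw [edgeOp_white D u v _ _ hw]
          ext a
          simp [D.d_π, D.π_d]
        · rw [edgeOp_black D u v _ _ hw, if_neg h9]
          ext a
          simp [D.d_π, D.π_d, swapSign]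
      rw [h11, MultilinearMap.map_update_zero, mul_zero]
    · have h9 : (g i).1 ∈ S := ⟨i, rfl⟩
      have h10 : parityOn S (g i).1 = 1 := if_pos h9
      have h11 : F.d ∘ₗ edgeOp D u v S x (g i).1 - swapSign 1 (parityOn S (g i).1) •
          (edgeOp D u v S x (g i).1 ∘ₗ F.d) = v (x (g i)) • (LinearMap.id - D.π) := by
        rw [h10, edgeOp_black D u v _ _ (g i).2, if_pos h9]
        ext a
        simp [swapSign, ← D.homotopy, smul_add]
        rfl
      rw [h11, MultilinearMap.map_update_smul]
      congr 1
      exact (prefixSign_parityOn (g := fun i => (g i).1) hg i).symm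
  rw [extDeriv_apply ((c.contDiff_valueForm D t hu hv k).differentiable (by simp) x)]
  refine Eq.trans ?_ (mul_eq_zero_of_right (-(-1 : ℝ) ^ (k * (k - 1) / 2)) h8)
  rw [Finset.mul_sum]
  refine Finset.sum_congr rfl fun i _ => ?_
  rw [h1]
  simp only [zsmul_eq_mul, smul_eq_mul]
  push_cast
  ring

/-- The form is smooth and closed on the whole coordinate space; unique differentiability identifies
the derivative within `s` with the full one. -/
theorem extDerivWithin_valueForm (hu : ContDiff ℝ ∞ u) (hv : ContDiff ℝ ∞ v)
    (huv : ∀ r, HasDerivAt u (-v r) r) (k : ℕ) {s : Set γ.EdgeSpace} {x : γ.EdgeSpace}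
    (hs : UniqueDiffWithinAt ℝ s x) : extDerivWithin (c.valueForm D u v t k) s x = 0 := by
  rw [← c.extDeriv_valueForm D t hu hv huv k x, extDerivWithin, extDeriv,
    fderivWithin_eq_fderiv hs ((c.contDiff_valueForm D t hu hv k).differentiable (by simp) x)]

end Choices

end StableRibbonGraph

end

/-! ### The coordinate on the cube, the domains, and the families of forms. -/

noncomputable section

/-- The function `exp (-l)` of the length `l = 1 / (1 - x) - 1`, extended by zero. -/
def cubeExp (x : ℝ) : ℝ := Real.exp 1 * expNegInvGlue (1 - x)

/-- Since `l = 1 / (1 - x) - 1`, the function `exp (-l)` is `e` times `exp (-1 / (1 - x))`, the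
standard smooth function that is flat at `x = 1`. -/
theorem contDiff_cubeExp : ContDiff ℝ ∞ cubeExp :=
  contDiff_const.mul (expNegInvGlue.contDiff.comp (contDiff_const.sub contDiff_id))

theorem cubeExp_zero : cubeExp 0 = 1 := by
  simp [cubeExp, expNegInvGlue, ← Real.exp_add]

theorem cubeExp_one : cubeExp 1 = 0 := by
  simp [cubeExp]

theorem cubeExp_of_lt {x : ℝ} (hx : x < 1) : cubeExp x = Real.exp (-(1 / (1 - x) - 1)) := by
  rw [cubeExp, expNegInvGlue, if_neg (by linarith), ← Real.exp_add]
  congr 1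
  rw [one_div]
  ring

theorem hasDerivAt_length {x : ℝ} (hx : x < 1) :
    HasDerivAt (fun x : ℝ => 1 / (1 - x) - 1) (1 / (1 - x) ^ 2) x := by
  have h1 : HasDerivAt (fun x : ℝ => 1 - x) (-1) x := (hasDerivAt_id x).const_sub 1
  have h2 := (h1.fun_inv (by linarith : (1 : ℝ) - x ≠ 0)).sub_const 1
  simpa [one_div] using h2

/-- This is `exp (-l) dl` in the coordinate `x`. Taking `v = -u'` on the cube keeps the relation
needed for closedness and is smooth up to `x = 1`. -/
theorem deriv_cubeExp {x : ℝ} (hx : x < 1) :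
    -deriv cubeExp x = 1 / (1 - x) ^ 2 * Real.exp (-(1 / (1 - x) - 1)) := by
  have h1 : cubeExp =ᶠ[nhds x] fun x => Real.exp (-(1 / (1 - x) - 1)) := by
    filter_upwards [gt_mem_nhds hx] with y hy using cubeExp_of_lt hy
  rw [h1.deriv_eq, ((hasDerivAt_length hx).fun_neg.exp).deriv]
  ring

theorem contDiff_deriv_cubeExp : ContDiff ℝ ∞ fun x => -deriv cubeExp x :=
  (contDiff_infty_iff_deriv.1 contDiff_cubeExp).2.neg

theorem hasDerivAt_cubeExp (x : ℝ) : HasDerivAt cubeExp (-(-deriv cubeExp x)) x := by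
  rw [neg_neg]
  exact (contDiff_cubeExp.differentiable (by simp) x).hasDerivAt

theorem hasDerivAt_exp_neg (x : ℝ) :
    HasDerivAt (fun l => Real.exp (-l)) (-Real.exp (-x)) x := by
  simpa using (hasDerivAt_id x).fun_neg.exp

theorem contDiff_exp_neg : ContDiff ℝ ∞ fun l : ℝ => Real.exp (-l) :=
  Real.contDiff_exp.comp contDiff_neg

namespace StableRibbonGraph

variable {γ : StableRibbonGraph}

theorem uniqueDiffWithinAt_halfDom {l : γ.EdgeSpace} (hl : l ∈ γ.halfDom) :
    UniqueDiffWithinAt ℝ γ.halfDom l := by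
  have h : UniqueDiffWithinAt ℝ (Set.pi Set.univ fun _ : γ.BlackEdge => Set.Ici (0 : ℝ)) l :=
    UniqueDiffWithinAt.univ_pi fun e => uniqueDiffOn_Ici 0 _ (hl e)
  exact h.mono fun l' h' e => h' e (Set.mem_univ e)

theorem uniqueDiffWithinAt_cube {x : γ.EdgeSpace} (hx : x ∈ γ.cube) :
    UniqueDiffWithinAt ℝ γ.cube x := by
  have h : UniqueDiffWithinAt ℝ (Set.pi Set.univ fun _ : γ.BlackEdge => Set.Icc (0 : ℝ) 1) x :=
    UniqueDiffWithinAt.univ_pi fun e => uniqueDiffOn_Icc_zero_one _ (hx e)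
  exact h.mono fun l' h' e => h' e (Set.mem_univ e)

/-- Increasing the lengths can only remove edges from the zero-length subgraph, and a subgraph of a
forest is a forest. Hence the domain contains an orthant at each of its points, which gives unique
differentiability. -/
theorem openDom_upward {l l' : γ.EdgeSpace} (hl : l ∈ γ.openDom) (h : ∀ e, l e ≤ l' e) :
    l' ∈ γ.openDom := by
  have h0 : ∀ e, l' e = 0 → l e = 0 := fun e he =>
    le_antisymm ((h e).trans he.le) (hl.1 e)
  refine ⟨fun e => (hl.1 e).trans (h e), fun x hb hx hc => hl.2 x hb (h0 _ hx)
    (Relation.ReflTransGen.mono ?_ _ _ hc)⟩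
  rintro a b ⟨y, h1, h2, ⟨hy, h3⟩, h4⟩
  exact ⟨y, h1, h2, ⟨hy, h0 _ h3⟩, h4⟩

theorem uniqueDiffWithinAt_openDom {l : γ.EdgeSpace} (hl : l ∈ γ.openDom) :
    UniqueDiffWithinAt ℝ γ.openDom l := by
  have h : UniqueDiffWithinAt ℝ (Set.pi Set.univ fun e : γ.BlackEdge => Set.Ici (l e)) l :=
    UniqueDiffWithinAt.univ_pi fun e => uniqueDiffOn_Ici _ _ Set.self_mem_Ici
  exact h.mono fun l' h' => openDom_upward hl fun e => h' e (Set.mem_univ e)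

theorem fderiv_lengths {x : γ.EdgeSpace} (hx : ∀ b, x b < 1) (b : γ.BlackEdge) :
    fderiv ℝ γ.lengths x (coordVec b) = (1 / (1 - x b) ^ 2) • coordVec b := by
  have h1 : ∀ b', HasFDerivAt (fun x : γ.EdgeSpace => γ.lengths x b')
      ((1 / (1 - x b') ^ 2) • ContinuousLinearMap.proj (R := ℝ) (φ := fun _ : γ.BlackEdge => ℝ) b')
      x := fun b' =>
    HasDerivAt.comp_hasFDerivAt (h₂ := fun r : ℝ => 1 / (1 - r) - 1) x (hasDerivAt_length (hx b'))
      (ContinuousLinearMap.proj (R := ℝ) (φ := fun _ : γ.BlackEdge => ℝ) b').hasFDerivAt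
  rw [(hasFDerivAt_pi.2 h1).fderiv]
  funext b'
  change 1 / (1 - x b') ^ 2 * coordVec b b' = 1 / (1 - x b) ^ 2 * coordVec b b'
  by_cases hb : b' = b
  · rw [hb]
  · rw [show coordVec b b' = 0 from Pi.single_eq_of_ne hb _, mul_zero, mul_zero]

variable {A : Type*} [NonUnitalRing A] [Module ℝ A] [FiniteDimensional ℝ A]
  {𝒜 : ZMod 2 → Submodule ℝ A} {F : DGFrobenius 𝒜} [DirectSum.Decomposition 𝒜]
  (D : HodgeDecomposition F) (t : OpenTFT F)

/-- The derivative of the lengths is diagonal. Each differential contributes `1 / (1 - x)^2`, which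
turns the coefficient `exp (-l)` of `s` into `-u'(x)`; the other operators are only re-expressed in
`x`. -/
theorem pullback_lengths (c : γ.Choices) (k : ℕ) {x : γ.EdgeSpace} (hx : ∀ b, x b < 1) :
    pullbackForm γ.lengths
      (c.valueForm D (fun l => Real.exp (-l)) (fun l => Real.exp (-l)) t k) x =
      c.valueForm D cubeExp (fun x => -deriv cubeExp x) t k x := by
  refine c.ext_form fun g hg => ?_
  have hinj : Function.Injective fun i => (g i).1 := fun i j h =>
    hg.injective (congrArg c.rank (Subtype.ext h))
  -- The Jacobian factors, assigned to the edges carrying `s`, so that multilinearity of `coef`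
  -- collects them into the same product as multilinearity of the form does.
  let w (e : γ.E) : ℝ := if he : e ∈ edgeSet g then 1 / (1 - x ⟨e, edgeSet_black he⟩) ^ 2 else 1
  have h1 : ∀ i, w (g i).1 = 1 / (1 - x (g i)) ^ 2 := fun i => dif_pos ⟨i, rfl⟩
  have h2 : ∏ e, w e = ∏ i, 1 / (1 - x (g i)) ^ 2 := by
    refine (Finset.prod_of_injOn (fun i => (g i).1) hinj.injOn
      (fun _ _ => Finset.mem_coe.2 (Finset.mem_univ _)) (fun e _ he => ?_)
      fun i _ => (h1 i).symm).symm
    exact dif_neg fun hc => he (by simpa [edgeSet] using hc)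
  have h3 : edgeOp D cubeExp (fun x => -deriv cubeExp x) (edgeSet g) x = fun e => w e •
      edgeOp D (fun l => Real.exp (-l)) (fun l => Real.exp (-l)) (edgeSet g) (γ.lengths x) e := by
    funext e
    by_cases hw : e ∈ γ.white
    · have h4 : w e = 1 := dif_neg fun hc => edgeSet_black hc hw
      rw [edgeOp_white _ _ _ _ _ hw, edgeOp_white _ _ _ _ _ hw, h4, one_smul]
    · obtain ⟨b, rfl⟩ : ∃ b : γ.BlackEdge, b.1 = e := ⟨⟨e, hw⟩, rfl⟩
      rw [edgeOp_val, edgeOp_val]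
      by_cases hS : b.1 ∈ edgeSet g
      · have h4 : w b.1 = 1 / (1 - x b) ^ 2 := dif_pos hS
        rw [if_pos hS, if_pos hS, h4, smul_smul, deriv_cubeExp (hx b)]
        rfl
      · have h4 : w b.1 = 1 := dif_neg hS
        rw [if_neg hS, if_neg hS, h4, one_smul, cubeExp_of_lt (hx b)]
        rfl
  rw [pullbackForm, ContinuousAlternatingMap.compContinuousLinearMap_apply,
    show (fderiv ℝ γ.lengths x) ∘ (fun i => coordVec (g i)) =
      fun i => (1 / (1 - x (g i)) ^ 2) • coordVec (g i) from funext fun i => fderiv_lengths hx _,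
    c.valueForm_apply D _ _ t x hg, h3, (c.coef t).map_smul_univ, h2]
  have h5 := (c.valueForm D (fun l => Real.exp (-l)) (fun l => Real.exp (-l)) t k
    (γ.lengths x)).toMultilinearMap.map_smul_univ (fun i => 1 / (1 - x (g i)) ^ 2)
    (fun i => coordVec (g i))
  refine h5.trans ?_
  refine (congrArg (_ • ·) (c.valueForm_apply D _ _ t (γ.lengths x) hg)).trans ?_
  simp only [smul_eq_mul]
  ring

/-- The form `valueForm` for an arbitrary choice of orders. -/
def canonicalForm (u v : ℝ → ℝ) : FormFamily := fun γ =>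
  (nonempty_choices γ).some.valueForm D u v t

variable {u v : ℝ → ℝ}

theorem canonicalForm_eq (c : γ.Choices) : canonicalForm D t u v γ = c.valueForm D u v t :=
  Choices.valueForm_eq D u v _ c t

theorem isOrbiCellular_canonicalForm (hu : ContDiff ℝ ∞ u) (hv : ContDiff ℝ ∞ v) (hu0 : u 0 = 1)
    (cell : StableRibbonGraph → Prop) (dom : ∀ γ : StableRibbonGraph, Set γ.EdgeSpace)
    (shrink : ∀ γ : StableRibbonGraph, γ.H → Prop) :
    IsOrbiCellular cell dom shrink (canonicalForm D t u v) where
  smooth γ _ k := (Choices.contDiff_valueForm D t _ hu hv k).contDiffOn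
  invariant γ γ' _ f k l _ := by
    obtain ⟨c⟩ := nonempty_choices γ
    rw [canonicalForm_eq D t c, canonicalForm_eq D t (c.map f)]
    exact pullback_iso D u v t f c k l
  contract γ _ h hb _ k l _ := by
    obtain ⟨c, c', hl, hc⟩ := Choices.exists_contract t h
    rw [canonicalForm_eq D t c, canonicalForm_eq D t c']
    exact pullback_zeroSection D u v t hu0 h hb hl hc k l

theorem isClosedOn_canonicalForm (hu : ContDiff ℝ ∞ u) (hv : ContDiff ℝ ∞ v)
    (huv : ∀ r, HasDerivAt u (-v r) r) (cell : StableRibbonGraph → Prop)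
    {dom : ∀ γ : StableRibbonGraph, Set γ.EdgeSpace}
    (hdom : ∀ γ, ∀ l ∈ dom γ, UniqueDiffWithinAt ℝ (dom γ) l) :
    IsClosedOn cell dom (canonicalForm D t u v) := fun γ _ k l hl =>
  Choices.extDerivWithin_valueForm D t _ hu hv huv k (hdom γ l hl)

end StableRibbonGraph

end

/-! ### The theorem. -/

noncomputable section

open StableRibbonGraph

theorem mainTheorem1 {A : Type*} [NonUnitalRing A] [Module ℝ A] [IsScalarTower ℝ A A]
    [SMulCommClass ℝ A A] [FiniteDimensional ℝ A] (𝒜 : ZMod 2 → Submodule ℝ A)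
    [DirectSum.Decomposition 𝒜] [SetLike.GradedMul 𝒜] (F : DGFrobenius 𝒜)
    (D : HodgeDecomposition F) :
    ∃ t : OpenTFT F, t.IsDeterminedBy ∧ (∀ t' : OpenTFT F, t'.IsDeterminedBy → t' = t) ∧
      t.DiskValues ∧
      (∀ (φ : A →ₗ[ℝ] ℝ) (a : A),
        Filter.Tendsto (fun τ => φ (D.heat τ a)) Filter.atTop (nhds (φ (D.π a)))) ∧
      ∀ g n : ℕ, ∃ ηM ηL ηI : FormFamily,
        (IsOrbiCellularM g n ηM ∧ IsClosedM g n ηM ∧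
          ∀ γ : StableRibbonGraph, γ.IsRibbon → γ.IsOfType g n → ∀ c : γ.Choices, c.IsCyclic →
            ∀ k, ∀ l ∈ γ.openDom, ηM γ k l =
              c.form D (fun v a => F.cyclicProduct ((c.legs v).list.map a)) k l) ∧
        (IsOrbiCellularL g n ηL ∧ IsClosedL g n ηL ∧ ExtendsM g n ηL ηM ∧
          ∀ γ : StableRibbonGraph, γ.AllBlack → γ.IsOfType g n → ∀ c : γ.Choices,
            ∀ k, ∀ l ∈ γ.halfDom, ηL γ k l =
              c.form D (fun v => t.val (γ.surface v) (c.legs v)) k l) ∧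
        (IsOrbiCellularLInfty g n ηI ∧ IsClosedLInfty g n ηI ∧ ExtendsL g n ηI ηL ∧
          ∀ γ : StableRibbonGraph, γ.IsOfType g n → ∀ c : γ.Choices,
            ∀ k, ∀ x ∈ γ.finiteCube, ηI γ k x =
              pullbackForm γ.lengths (c.form D (fun v => t.val (γ.surface v) (c.legs v)) k) x) := by
  refine ⟨DGFrobenius.Ext.theory F, DGFrobenius.Ext.theory_isDeterminedBy,
    fun t' ht' => OpenTFT.eq_of_isDeterminedBy ht' DGFrobenius.Ext.theory_isDeterminedBy,
    DGFrobenius.Ext.theory_diskValues, D.tendsto_heat, fun g n => ?_⟩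
  set t := DGFrobenius.Ext.theory F with ht
  let η := canonicalForm D t (fun l => Real.exp (-l)) (fun l => Real.exp (-l))
  have hη : ∀ cell dom shrink, IsOrbiCellular cell dom shrink η :=
    isOrbiCellular_canonicalForm D t contDiff_exp_neg contDiff_exp_neg (by simp)
  have hform : ∀ {γ : StableRibbonGraph} (c : γ.Choices),
      η γ = c.form D (fun v => t.val (γ.surface v) (c.legs v)) := fun c =>
    (canonicalForm_eq D t c).trans (c.form_eq D t).symm
  -- One family serves for the decorated moduli space and for `L_{g,n}`, so the first extension
  -- property holds by definition. The family on the cubes is its transform under the change of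
  -- coordinate, extended to infinite lengths.
  refine ⟨η, η, canonicalForm D t cubeExp fun x => -deriv cubeExp x,
    ⟨hη _ _ _, isClosedOn_canonicalForm D t contDiff_exp_neg contDiff_exp_neg hasDerivAt_exp_neg _
      fun γ l => uniqueDiffWithinAt_openDom, fun γ hγ _ c hc k l _ => ?_⟩,
    ⟨hη _ _ _, isClosedOn_canonicalForm D t contDiff_exp_neg contDiff_exp_neg hasDerivAt_exp_neg _
      fun γ l => uniqueDiffWithinAt_halfDom, fun γ _ _ k l _ => rfl,
      fun γ _ _ c k l _ => by rw [hform c]⟩,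
    ⟨⟨isOrbiCellular_canonicalForm D t contDiff_cubeExp contDiff_deriv_cubeExp cubeExp_zero _ _ _,
      fun γ _ e he k x _ => ?_⟩,
      isClosedOn_canonicalForm D t contDiff_cubeExp contDiff_deriv_cubeExp hasDerivAt_cubeExp _
      fun γ l => uniqueDiffWithinAt_cube, fun γ _ _ k x hx => ?_, fun γ _ c k x hx => ?_⟩⟩
  -- On an ordinary ribbon graph every vertex surface is a disk, and for cyclic orders the theory
  -- has the values of `DiskValues` there.
  · rw [hform c]
    congr 2
    funext v a
    exact DGFrobenius.Ext.theory_diskValues _ _ (hγ.2 v) (by convert hc v) a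
  · obtain ⟨c⟩ := nonempty_choices γ
    rw [canonicalForm_eq D t c, canonicalForm_eq D t (c.whiten e)]
    exact pullback_inftySection D _ _ t cubeExp_one e he c k x
  · exact (pullback_lengths D t _ k fun b => (hx b).2).symm
  · rw [← hform c, canonicalForm_eq D t c]
    exact (pullback_lengths D t c k fun b => (hx b).2).symm.trans
      (by rw [← canonicalForm_eq D t c])

end
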